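/- All digraphs are finite, without multiple edges, and may have loops; $N^+(v)$ and $N^-(v)$ are the sets of out- and in-neighbours of $v$ (containing $v$ if $v$ has a loop). For a set $A$ of vertices of a digraph $G$ let $\bar A=V(G)\setminus A$ and let $\mathrm{bimim}_G(A)$ be the sum of the maximum sizes of an induced matching in the bipartite digraphs $G[A\to\bar A]$ and $G[\bar A\to A]$ formed by the edges from $A$ to $\bar A$ and from $\bar A$ to $A$, respectively. A branch decomposition $(T,f)$ of $G$ is a tree $T$ with at least two nodes, all of whose internal nodes have degree $3$, with a bijection $f$ from $V(G)$ to the leaves of $T$. Each edge $e$ of $T$ yields a cut $(A_e,\overline{A_e})$ of $G$, according to the two components of $T-e$; the bi-mim-width $w$ of $(T,f)$ is $\max_e \mathrm{bimim}_G(A_e)$. For $d\in\mathbb N$, two sets $X,Y\subseteq A$ are $d$-bi-neighbourhood equivalent over $A$ if $\min\{d,|N^-(u)\cap X|\}=\min\{d,|N^-(u)\cap Y|\}$ and $\min\{d,|N^+(u)\cap X|\}=\min\{d,|N^+(u)\cap Y|\}$ for all $u\in\bar A$; $\mathrm{nec}_d(T,f)$ denotes the maximum number of equivalence classes over $A$,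 where $A$ ranges over both sides of the cuts given by the edges of $T$. The $d$-value of a finite or co-finite set $\mu\subseteq\mathbb N$ is $d(\mu)=1+\min\{\max\mu,\max(\mathbb N\setminus\mu)\}$ (the maximum of an infinite set being $\infty$), with $d(\mathbb N)=d(\emptyset)=0$. Running times are numbers of steps of a uniform-cost random access machine (natural numbers, addition, truncated subtraction, indirect addressing, comparisons), the digraph and the tree being given by adjacency matrices and $f$ by a list of leaves. **(1) Directed LCVS problems.** Let $\sigma^+,\sigma^-,\rho^+,\rho^-\subseteq\mathbb N$ be finite or co-finite and let $d$ be the maximum of their $d$-values. A set $S\subseteq V(G)$ is a $(\sigma^+,\sigma^-,\rho^+,\rho^-)$-set if $|N^+(v)\cap S|\in\sigma^+$ and $|N^-(v)\cap S|\in\sigma^-$ for all $v\in S$, and $|N^+(v)\cap S|\in\rho^+$ and $|N^-(v)\cap S|\in\rho^-$ for all $v\in V(G)\setminus S$. For minimization as well as for maximization there is an algorithm that, given a digraph $G$ on $n$ vertices and a branch decomposition $(T,f)$ of $G$, of bi-mim-width $w$, computes a $(\sigma^+,\sigma^-,\rho^+,\rho^-)$-set of optimum size, or reports that there is no such set, in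 time $O(\mathrm{nec}_d(T,f)^3\cdot n^3\log n)$; moreover in time $O(\mathrm{nec}_d(T,f)^3\cdot n^2)$ if $n\le \mathrm{nec}_d(T,f)$, and in time $O(n^{3dw+2})$ if $w\ge 1$. **(2) Directed LCVP problems.** Let $q\ge 1$ and let $D_q$ be a $q\times q$ matrix whose entries $D_q[i,j]=(\mu^+_{i,j},\mu^-_{i,j})$ are pairs of finite or co-finite subsets of $\mathbb N$, and let $d$ be the maximum of their $d$-values. A $D_q$-partition of $G$ is a partition $(X_1,\dots,X_q)$ of $V(G)$, with possibly empty parts, such that $|N^+(v)\cap X_j|\in\mu^+_{i,j}$ and $|N^-(v)\cap X_j|\in\mu^-_{i,j}$ for all $i,j$ and all $v\in X_i$. There is an algorithm that, given a digraph $G$ on $n$ vertices and a branch decomposition $(T,f)$ of $G$, of bi-mim-width $w$, decides whether $G$ has a $D_q$-partition, in time $O(\mathrm{nec}_d(T,f)^{3q}\cdot q\cdot n^3\log n)$, and moreover in time $O(\mathrm{nec}_d(T,f)^{3q}\cdot q\cdot n^2)$ if $n\le\mathrm{nec}_d(T,f)$, and in any case in time $O(q\cdot n^{3qdw+2})$.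 The constants in (1) depend only on $\sigma^+,\sigma^-,\rho^+,\rho^-$, those in (2) only on $d$. -/

import Mathlib

/-! ### Digraphs: neighbourhoods, induced matchings, cut functions -/

/-- The set of out-neighbours of `v` (it contains `v` if `v` has a loop). -/
def outNbr {V : Type*} (G : Digraph V) (v : V) : Set V := {u | G.Adj v u}

/-- The set of in-neighbours of `v` (it contains `v` if `v` has a loop). -/
def inNbr {V : Type*} (G : Digraph V) (v : V) : Set V := {u | G.Adj u v}

/-- The digraph `G[A → B]` that keeps exactly the edges of `G` from `A` to `B`.
(Vertices outside `A ∪ B` stay as isolated vertices.) -/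
def edgesFromTo {V : Type*} (G : Digraph V) (A B : Set V) : Digraph V where
  Adj a b := a ∈ A ∧ b ∈ B ∧ G.Adj a b

/-- Two edges (ordered pairs of vertices) share an endpoint. -/
def Meets {V : Type*} (e f : V × V) : Prop :=
  e.1 = f.1 ∨ e.1 = f.2 ∨ e.2 = f.1 ∨ e.2 = f.2

/-- `M` is an induced matching of the digraph `H`: a set of edges, no two of which share an
endpoint, such that no edge of `H` meets two distinct members of `M`. -/
def IsInducedMatching {V : Type*} (H : Digraph V) (M : Set (V × V)) : Prop :=
  (∀ e ∈ M, H.Adj e.1 e.2) ∧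
  (∀ e ∈ M, ∀ f ∈ M, e ≠ f → ¬ Meets e f) ∧
  (∀ g : V × V, H.Adj g.1 g.2 → ∀ e ∈ M, ∀ f ∈ M, e ≠ f → ¬ (Meets g e ∧ Meets g f))

/-- The maximum size of an induced matching (of a finite digraph). -/
noncomputable def inducedMatchingNumber {V : Type*} (H : Digraph V) : ℕ :=
  sSup {k | ∃ M : Set (V × V), IsInducedMatching H M ∧ M.ncard = k}

/-- The cut function `bimim_G(A) = mim⁺_G(A) + mim⁻_G(A)`. -/
noncomputable def bimim {V : Type*} (G : Digraph V) (A : Set V) : ℕ :=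
  inducedMatchingNumber (edgesFromTo G A Aᶜ) + inducedMatchingNumber (edgesFromTo G Aᶜ A)

/-! ### Branch decompositions -/

/-- `x` is a leaf of the tree `T`. -/
def IsLeaf {N : Type*} (T : SimpleGraph N) (x : N) : Prop := (T.neighborSet x).ncard = 1

/-- A branch decomposition of a (di)graph with vertex set `V`: a subcubic tree `tree` on the node
set `N` (at least two nodes, every internal node of degree 3), together with a bijection `leaf`
from `V` to the leaves of the tree. -/
structure BranchDecomposition (V N : Type*) where
  tree : SimpleGraph N
  isTree : tree.IsTree
  nontrivial : Nontrivial N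
  subcubic : ∀ x, ¬ IsLeaf tree x → (tree.neighborSet x).ncard = 3
  leaf : V → N
  leaf_injective : Function.Injective leaf
  leaf_range : Set.range leaf = {x | IsLeaf tree x}

/-- For an edge `xy` of the tree: the vertices mapped to leaves in the component of `tree - xy`
that contains `x`. The other side of the same cut is `B.side y x`. -/
def BranchDecomposition.side {V N : Type*} (B : BranchDecomposition V N) (x y : N) : Set V :=
  {v | (B.tree.deleteEdges {s(x, y)}).Reachable x (B.leaf v)}

/-- The bi-mim-width of a branch decomposition. -/
noncomputable def BranchDecomposition.bimimWidth {V N : Type*} (B : BranchDecomposition V N)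
    (G : Digraph V) : ℕ :=
  sSup {k | ∃ x y, B.tree.Adj x y ∧ bimim G (B.side x y) = k}

/-! ### `d`-bi-neighbourhood equivalence -/

/-- `d`-bi-neighbourhood equivalence of subsets of `A`. -/
def biNbrEquiv {V : Type*} (G : Digraph V) (d : ℕ) (A : Set V) : Setoid {X : Set V // X ⊆ A} where
  r X Y := ∀ u ∉ A,
    min d (inNbr G u ∩ X.1).ncard = min d (inNbr G u ∩ Y.1).ncard ∧
    min d (outNbr G u ∩ X.1).ncard = min d (outNbr G u ∩ Y.1).ncard
  iseqv :=
    { refl := fun _ _ _ => ⟨rfl, rfl⟩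
      symm := fun h u hu => ⟨(h u hu).1.symm, (h u hu).2.symm⟩
      trans := fun h h' u hu =>
        ⟨(h u hu).1.trans (h' u hu).1, (h u hu).2.trans (h' u hu).2⟩ }

/-- The number of `d`-bi-neighbourhood equivalence classes over `A`. -/
noncomputable def nec {V : Type*} (G : Digraph V) (d : ℕ) (A : Set V) : ℕ :=
  Nat.card (Quotient (biNbrEquiv G d A))

/-- The maximum number of `d`-bi-neighbourhood equivalence classes over both sides of all the cuts
given by the edges of the tree. Rooting the tree by subdividing an edge, these are all the sets
`V_t` and their complements for the nodes `t` other than the root; the root only adds the sets `V`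
and `∅`, for which there is exactly one class. -/
noncomputable def BranchDecomposition.nec {V N : Type*} (B : BranchDecomposition V N)
    (G : Digraph V) (d : ℕ) : ℕ :=
  sSup {k | ∃ x y, B.tree.Adj x y ∧ _root_.nec G d (B.side x y) = k}

/-! ### Locally checkable problems -/

/-- A set of natural numbers is finite or co-finite. -/
def FinOrCofin (μ : Set ℕ) : Prop := μ.Finite ∨ μᶜ.Finite

open Classical in
/-- The `d`-value of a finite or co-finite set: `0` for the two trivial sets, and otherwise one
more than the smaller of the maxima of `μ` and of its complement (exactly one of which exists). -/
noncomputable def dValue (μ : Set ℕ) : ℕ :=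
  if μ = ∅ ∨ μ = Set.univ then 0
  else if μ.Finite then 1 + sSup μ
  else 1 + sSup μᶜ

/-- `d(σ⁺, σ⁻, ρ⁺, ρ⁻)`. -/
noncomputable def dValue₄ (σp σm ρp ρm : Set ℕ) : ℕ :=
  max (max (dValue σp) (dValue σm)) (max (dValue ρp) (dValue ρm))

/-- `S` is a `(σ⁺, σ⁻, ρ⁺, ρ⁻)`-dominating set of `G`. -/
def Dominates {V : Type*} (G : Digraph V) (σp σm ρp ρm : Set ℕ) (S : Set V) : Prop :=
  (∀ v ∈ S, (outNbr G v ∩ S).ncard ∈ σp ∧ (inNbr G v ∩ S).ncard ∈ σm) ∧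
  (∀ v ∉ S, (outNbr G v ∩ S).ncard ∈ ρp ∧ (inNbr G v ∩ S).ncard ∈ ρm)

/-- Minimization or maximization. -/
inductive Goal where
  | minimize
  | maximize

/-- `a` is at least as good a value as `b`. -/
def Goal.AtLeastAsGood : Goal → ℕ → ℕ → Prop
  | .minimize, a, b => a ≤ b
  | .maximize, a, b => b ≤ a

/-- `S` is a `(σ⁺, σ⁻, ρ⁺, ρ⁻)`-dominating set of `G` of optimum size. -/
def IsOptimum {V : Type*} (goal : Goal) (G : Digraph V) (σp σm ρp ρm : Set ℕ) (S : Set V) : Prop :=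
  Dominates G σp σm ρp ρm S ∧
  ∀ S', Dominates G σp σm ρp ρm S' → goal.AtLeastAsGood S.ncard S'.ncard

/-- All entries of a bi-neighbourhood-constraint matrix are pairs of finite or co-finite sets. -/
def IsConstraintMatrix {q : ℕ} (D : Matrix (Fin q) (Fin q) (Set ℕ × Set ℕ)) : Prop :=
  ∀ i j, FinOrCofin (D i j).1 ∧ FinOrCofin (D i j).2

/-- The `d`-value of a bi-neighbourhood-constraint matrix. -/
noncomputable def matrixDValue {q : ℕ} (D : Matrix (Fin q) (Fin q) (Set ℕ × Set ℕ)) : ℕ :=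
  Finset.univ.sup fun i => Finset.univ.sup fun j => max (dValue (D i j).1) (dValue (D i j).2)

/-- `X` is a `D`-partition of the digraph `G` (parts may be empty). -/
def IsDPartition {V : Type*} {q : ℕ} (G : Digraph V)
    (D : Matrix (Fin q) (Fin q) (Set ℕ × Set ℕ)) (X : Fin q → Set V) : Prop :=
  (∀ v, ∃! i, v ∈ X i) ∧
  ∀ i j, ∀ v ∈ X i,
    (outNbr G v ∩ X j).ncard ∈ (D i j).1 ∧ (inNbr G v ∩ X j).ncard ∈ (D i j).2

/-! ### The machine model: uniform-cost random access machines -/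

/-- A configuration of the memory: registers (of which a program mentions only finitely many) and
an indirectly addressed memory, both holding natural numbers. -/
structure RamState where
  reg : ℕ → ℕ
  mem : ℕ → ℕ

/-- The elementary instructions; subtraction is truncated. There is no multiplication. -/
inductive Instr where
  | const (r c : ℕ)
  | add (r a b : ℕ)
  | sub (r a b : ℕ)
  | load (r a : ℕ)
  | store (a b : ℕ)

/-- The effect of an elementary instruction. -/
def Instr.run : Instr → RamState → RamState
  | .const r c, s => { s with reg := Function.update s.reg r c }
  | .add r a b, s => { s with reg := Function.update s.reg r (s.reg a + s.reg b) }
  | .sub r a b, s => { s with reg := Function.update s.reg r (s.reg a - s.reg b) }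
  | .load r a, s => { s with reg := Function.update s.reg r (s.mem (s.reg a)) }
  | .store a b, s => { s with mem := Function.update s.mem (s.reg a) (s.reg b) }

/-- The tests: comparison of two registers. -/
inductive Test where
  | eq (a b : ℕ)
  | lt (a b : ℕ)

/-- A test succeeds in a state. -/
def Test.Holds : Test → RamState → Prop
  | .eq a b, s => s.reg a = s.reg b
  | .lt a b, s => s.reg a < s.reg b

/-- Programs of the random access machine, in structured form. -/
inductive Prog where
  | instr (i : Instr)
  | seq (P Q : Prog)
  | ite (c : Test) (P Q : Prog)
  | loop (c : Test) (P : Prog)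

/-- `Exec P s t s'`: started in the state `s`, the program `P` halts after exactly `t` steps, in the
state `s'`. Every executed elementary instruction and every evaluated test is one step. -/
inductive Exec : Prog → RamState → ℕ → RamState → Prop where
  | instr (i : Instr) (s : RamState) : Exec (.instr i) s 1 (i.run s)
  | seq {P Q : Prog} {s s' s'' : RamState} {t t' : ℕ} :
      Exec P s t s' → Exec Q s' t' s'' → Exec (.seq P Q) s (t + t') s''
  | iteTrue {c : Test} {P Q : Prog} {s s' : RamState} {t : ℕ} :
      c.Holds s → Exec P s t s' → Exec (.ite c P Q) s (t + 1) s'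
  | iteFalse {c : Test} {P Q : Prog} {s s' : RamState} {t : ℕ} :
      ¬ c.Holds s → Exec Q s t s' → Exec (.ite c P Q) s (t + 1) s'
  | loopDone {c : Test} {P : Prog} {s : RamState} :
      ¬ c.Holds s → Exec (.loop c P) s 1 s
  | loopStep {c : Test} {P : Prog} {s s' s'' : RamState} {t t' : ℕ} :
      c.Holds s → Exec P s t s' → Exec (.loop c P) s' t' s'' →
      Exec (.loop c P) s (t + t' + 1) s''

/-! ### Inputs and outputs -/

open Classical in
/-- The input: the numbers of vertices and of tree nodes, the adjacency matrices of the digraph and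
of the tree, row by row, and the leaf assigned to each vertex. -/
noncomputable def inputList {n m : ℕ} (G : Digraph (Fin n))
    (B : BranchDecomposition (Fin n) (Fin m)) : List ℕ :=
  [n, m] ++
  (List.ofFn fun u : Fin n => List.ofFn fun v : Fin n => if G.Adj u v then 1 else 0).flatten ++
  (List.ofFn fun x : Fin m => List.ofFn fun y : Fin m => if B.tree.Adj x y then 1 else 0).flatten ++
  List.ofFn fun v : Fin n => (B.leaf v : ℕ)

/-- The initial state: the input is in the memory from address `0` on, all else is `0`. -/
noncomputable def initState {n m : ℕ} (G : Digraph (Fin n))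
    (B : BranchDecomposition (Fin n) (Fin m)) : RamState where
  reg _ := 0
  mem a := (inputList G B).getD a 0

open Classical in
/-- The memory reports the set `S` of vertices: a `1` at address `0`, then the indicator vector. -/
def ReportsSet {n : ℕ} (s : RamState) (S : Set (Fin n)) : Prop :=
  s.mem 0 = 1 ∧ ∀ v : Fin n, s.mem (v + 1) = if v ∈ S then 1 else 0

/-- The final state is a correct answer to the optimization problem: it reports a set of optimum
size, or a `0` at address `0` if there is no feasible set at all. -/
def CorrectSubsetOutput {n : ℕ} (goal : Goal) (G : Digraph (Fin n)) (σp σm ρp ρm : Set ℕ)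
    (s : RamState) : Prop :=
  (∃ S, IsOptimum goal G σp σm ρp ρm S ∧ ReportsSet s S) ∨
  ((¬ ∃ S, Dominates G σp σm ρp ρm S) ∧ s.mem 0 = 0)

/-- The final state is a correct answer to the existence problem: a `1` or a `0` at address `0`
according to whether there is a `D`-partition. -/
def CorrectPartitionOutput {n q : ℕ} (G : Digraph (Fin n))
    (D : Matrix (Fin q) (Fin q) (Set ℕ × Set ℕ)) (s : RamState) : Prop :=
  ((∃ X, IsDPartition G D X) ∧ s.mem 0 = 1) ∨ ((¬ ∃ X, IsDPartition G D X) ∧ s.mem 0 = 0)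

/-!
The algorithm is dynamic programming over the cuts of the branch decomposition, without a root. Both
families of problems ask for a colouring of the vertices in which every vertex `u` sees, among its out-
and among its in-neighbours, an acceptable number of vertices of certain colours; since the sets of
acceptable numbers are finite or co-finite, only the numbers capped at `d` matter (`mem_iff_min_mem`).
A side `A` of a cut is represented by *signatures* (`Problem.sig`): the capped counts that a colouring of
`A` contributes to the vertices outside `A`. With `k` counted colours the number of signatures is at most
the `k`-th power of the number of `d`-bi-neighbourhood classes (`sigBound`), where `k = 1` for sets and
`k = q` for partitions. For every directed edge of the tree the algorithm lists the signatures of its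
side `A` (`Spec.classPhase`), and for every pair of a signature `g` of `A` and a signature `z` of the
complement it stores a cheapest colouring of `A` that has the signature `g` and meets the constraints in
`A` if the complement contributes `z` (`Problem.Fits`, `Spec.tablePhase`). If `A` is the disjoint union of
`A₁` and `A₂`, then a colouring of `A` fits `(g, z)` if and only if its restriction to `A₁` fits its own
signature together with the join of `z` and the signature on `A₂`, and conversely (`Problem.good_union`,
`ClassesUpTo.fits_join`). So a table is computed from triples of signatures, in time `O(n)` for each
triple, and this gives the factor `W ^ 3 * n ^ 2` of the running time, where `W` bounds the number of
signatures; listing the signatures takes `O(W ^ 3 * k * n)` steps per edge, by comparing each of the `W ^ 2`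
candidates with the `W` signatures known. Finding the order of the edges takes `O(n ^ 3)` steps.

The algorithm is written in a small language of arrays with a cost semantics (`Comp`). Its programs are
implemented on the random access machine with a constant slowdown (`Implements`); two-dimensional arrays
are laid out by the pairing function, which a table of squares makes computable without multiplication.
The number of array indices grows with the number of signatures found, so that nothing has to be known
about the number of classes in advance. Correctness and cost are proved for the array language with
Hoare-style rules (`Spec`).

The three forms of the bounds follow (`time_bounds`) from the estimate `nec ≤ n ^ (d * w)`
(`BranchDecomposition.nec_le_pow`): every subset of `A` has the same capped counts as one of size at most
`d` times the size of an induced matching, because the elements of a minimal such subset are essential for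
vertices outside with at most `d` neighbours in it, and a minimal set of such vertices has private
neighbours (`exists_representative`). The degenerate cases are handled apart: for `d = 0` all the
constraints are trivial and the answer is a constant (`exists_const_program`); and if all the edges of the
digraph are loops, then the number of classes may be `1`, and a cubic time would be too much, but every
vertex can be coloured on its own (`exists_partition_iff_of_loops`). Any other edge yields two classes
(`BranchDecomposition.two_le_nec`), which makes `n ^ 3` and the number `q` of colours small enough.
-/

/-! ### A small array language and its implementation on the random access machine -/

/-- The names of the two-dimensional arrays used by the algorithm: the adjacency matrices `adj` of the
digraph and `tre` of the tree, and the vertices `lv` of the leaves; the rows of the signatures (`pu`, `pt`,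
`tr`, `rel`); the constraints `mu`, the offset `cb` of a colour in them, and the weights `wt`; the list of
the directed edges of the tree (`pos`, `ex`, `ey`, `lf`, `pa`, `pb`, `rev`); the range `st`, `en` of the
classes of an edge, their signatures `vec`, the class `cc` of a single colour, and the class `join` of a
union; the table `tab` of the numbers of solutions, their weights `cost`, and the solutions `sol`. One-dimensional
arrays use the row `0`. -/
inductive Arr where
  | adj | tre | lv | pu | pt | tr | rel | mu | cb | wt | pos | ex | ey | lf | pa | pb | rev
  | st | en | vec | cc | join | tab | cost | sol
  deriving DecidableEq

/-- The residue modulo `32` of the addresses of the cells of an array; residue `0` is kept for the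
table of squares. -/
def Arr.code : Arr → ℕ
  | adj => 1 | tre => 2 | lv => 3 | pu => 4 | pt => 5 | tr => 6 | rel => 7 | mu => 8 | cb => 9
  | wt => 10 | pos => 11 | ex => 12 | ey => 13 | lf => 14 | pa => 15 | pb => 16 | rev => 17
  | st => 18 | en => 19 | vec => 20 | cc => 21 | join => 22 | tab => 23 | cost => 24 | sol => 25

lemma Arr.code_pos (b : Arr) : 1 ≤ b.code := by cases b <;> decide

lemma Arr.code_lt (b : Arr) : b.code < 32 := by cases b <;> decide

lemma Arr.code_injective : Function.Injective Arr.code := by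
  intro a b h
  cases a <;> cases b <;> first | rfl | (exact absurd h (by decide))

/-- The memory as the array language sees it: an input-output region of `base` cells, and arrays
whose cells `(i, j)` may be accessed as long as `i, j < lim`. -/
structure Store where
  base : ℕ
  lim : ℕ
  io : ℕ → ℕ
  arr : Arr → ℕ → ℕ → ℕ

/-- Write one array cell. -/
def Store.set (s : Store) (b : Arr) (i j v : ℕ) : Store :=
  { s with arr := fun x y z => if x = b ∧ y = i ∧ z = j then v else s.arr x y z }

/-- Write one cell of the input-output region. -/
def Store.setIo (s : Store) (a v : ℕ) : Store := { s with io := Function.update s.io a v }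

/-- Admit one more index. -/
def Store.grow (s : Store) : Store := { s with lim := s.lim + 1 }

@[simp] lemma Store.set_base (s : Store) (b i j v) : (s.set b i j v).base = s.base := rfl
@[simp] lemma Store.set_lim (s : Store) (b i j v) : (s.set b i j v).lim = s.lim := rfl
@[simp] lemma Store.set_io (s : Store) (b i j v) : (s.set b i j v).io = s.io := rfl
@[simp] lemma Store.setIo_base (s : Store) (a v) : (s.setIo a v).base = s.base := rfl
@[simp] lemma Store.setIo_lim (s : Store) (a v) : (s.setIo a v).lim = s.lim := rfl
@[simp] lemma Store.setIo_arr (s : Store) (a v) : (s.setIo a v).arr = s.arr := rfl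
lemma Store.setIo_io (s : Store) (a v) : (s.setIo a v).io = Function.update s.io a v := rfl
@[simp] lemma Store.grow_base (s : Store) : s.grow.base = s.base := rfl
@[simp] lemma Store.grow_lim (s : Store) : s.grow.lim = s.lim + 1 := rfl
@[simp] lemma Store.grow_io (s : Store) : s.grow.io = s.io := rfl
@[simp] lemma Store.grow_arr (s : Store) : s.grow.arr = s.arr := rfl

lemma Store.set_arr (s : Store) (b i j v b' i' j') :
    (s.set b i j v).arr b' i' j' = if b' = b ∧ i' = i ∧ j' = j then v else s.arr b' i' j' := rfl

@[simp] lemma Store.set_arr_same (s : Store) (b i j v) : (s.set b i j v).arr b i j = v := by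
  simp [Store.set_arr]

lemma Store.set_arr_cell (s : Store) (b i j v i' j') :
    (s.set b i j v).arr b i' j' = if i' = i ∧ j' = j then v else s.arr b i' j' := by
  simp [Store.set_arr]

@[simp] lemma Store.set_arr_ne (s : Store) {b b' : Arr} (h : b' ≠ b) (i j v) :
    (s.set b i j v).arr b' = s.arr b' := by
  funext i' j'; simp [Store.set_arr, h]

/-- Computations of the array language, as relations: `p s a s' c` says that `p`, started in `s`,
can end in `s'` with the value `a` at cost `c`. A computation that accesses an array out of bounds
is related to nothing. -/
def Comp (α : Type) := Store → α → Store → ℕ → Prop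

/-- The costs of consecutive computations add up; `pure` has cost `1`, since its value is copied to a
register. -/
instance : Monad Comp where
  pure a := fun s a' s' c => a' = a ∧ s' = s ∧ c = 1
  bind p g := fun s b s'' c => ∃ a s' c₁ c₂, p s a s' c₁ ∧ g a s' b s'' c₂ ∧ c = c₁ + c₂

namespace Comp

/-- A constant of the program. -/
def const (k : ℕ) : Comp ℕ := fun s a s' c => a = k ∧ s' = s ∧ c = 1
/-- Addition. -/
def add (x y : ℕ) : Comp ℕ := fun s a s' c => a = x + y ∧ s' = s ∧ c = 1
/-- Truncated subtraction. -/
def sub (x y : ℕ) : Comp ℕ := fun s a s' c => a = x - y ∧ s' = s ∧ c = 1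
/-- Read a cell of the input-output region. -/
def ioRd (x : ℕ) : Comp ℕ := fun s a s' c => x < s.base ∧ a = s.io x ∧ s' = s ∧ c = 1
/-- Write a cell of the input-output region. -/
def ioWr (x v : ℕ) : Comp ℕ := fun s a s' c => x < s.base ∧ a = 0 ∧ s' = s.setIo x v ∧ c = 1
/-- Read an array cell. -/
def rd (b : Arr) (i j : ℕ) : Comp ℕ := fun s a s' c =>
  i < s.lim ∧ j < s.lim ∧ a = s.arr b i j ∧ s' = s ∧ c = 1
/-- Write an array cell. -/
def wr (b : Arr) (i j v : ℕ) : Comp ℕ := fun s a s' c =>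
  i < s.lim ∧ j < s.lim ∧ a = 0 ∧ s' = s.set b i j v ∧ c = 1
/-- Admit one more index. -/
def grow : Comp ℕ := fun s a s' c => a = 0 ∧ s' = s.grow ∧ c = 1
/-- Branch on `x < y`. -/
def ifLt (x y : ℕ) (p q : Comp ℕ) : Comp ℕ := fun s a s' c =>
  ∃ t, c = t + 1 ∧ if x < y then p s a s' t else q s a s' t
/-- Branch on `x = y`. -/
def ifEq (x y : ℕ) (p q : Comp ℕ) : Comp ℕ := fun s a s' c =>
  ∃ t, c = t + 1 ∧ if x = y then p s a s' t else q s a s' t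

/-- `r` rounds of a loop with an accumulator, the counter starting at `i`. -/
def loop (body : ℕ → ℕ → Comp ℕ) : ℕ → ℕ → ℕ → Comp ℕ
  | 0, _, acc => fun s a s' c => a = acc ∧ s' = s ∧ c = 1
  | r + 1, i, acc => fun s a s'' c => ∃ a₁ s' c₁ c₂,
      body i acc s a₁ s' c₁ ∧ loop body r (i + 1) a₁ s' a s'' c₂ ∧ c = c₁ + c₂ + 1

/-- The loop `for i < n`, with an accumulator whose initial value is `a₀`. -/
def foldN (n a₀ : ℕ) (body : ℕ → ℕ → Comp ℕ) : Comp ℕ := loop body n 0 a₀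

end Comp

/-! ### Straight-line code -/

/-- A nonempty sequence of instructions as a program. -/
def block : Instr → List Instr → Prog
  | i, [] => .instr i
  | i, j :: is => .seq (.instr i) (block j is)

lemma exec_block (i : Instr) (is : List Instr) (s : RamState) :
    Exec (block i is) s (is.length + 1) (is.foldl (fun s i => i.run s) (i.run s)) := by
  induction is generalizing i s with
  | nil => exact Exec.instr i s
  | cons j is ih =>
    have := Exec.seq (Exec.instr i s) (ih j (i.run s))
    simpa [block, add_comm] using this

/-- The machine state `st` represents the store `s`. Register `0` holds the base of the arrays,
registers `1` and `2` hold `lim` and its square; cell `(i, j)` of an array lies at a position given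
by the pairing function `Nat.pair`, which a table of squares makes computable in constant time. -/
structure Represents (s : Store) (st : RamState) : Prop where
  base : st.reg 0 = s.base
  lim : st.reg 1 = s.lim
  sq : st.reg 2 = s.lim * s.lim
  io : ∀ a < s.base, st.mem a = s.io a
  table : ∀ i < s.lim, st.mem (s.base + 32 * i) = i * i
  cell : ∀ (b : Arr) i j, st.mem (s.base + 32 * Nat.pair i j + b.code) = s.arr b i j

/-- The registers from `8` on hold the values of a stack of `k` local variables; the variable
pushed first is in register `8`. -/
inductive Env (st : RamState) : ℕ → List ℕ → Prop
  | nil : Env st 0 []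
  | cons {k l x} : st.reg (k + 8) = x → Env st k l → Env st (k + 1) (x :: l)

/-- The value `x` is the `i`-th variable of a stack. -/
inductive At : ℕ → List ℕ → ℕ → ℕ → Prop
  | head {k l x} : At (k + 1) (x :: l) x k
  | tail {k l x y i} : At k l x i → At (k + 1) (y :: l) x i

lemma At.reg {k l x i st} (h : At k l x i) (he : Env st k l) : st.reg (i + 8) = x ∧ i < k := by
  induction h with
  | head => cases he with | cons h1 h2 => exact ⟨h1, by omega⟩
  | tail _ ih => cases he with | cons h1 h2 => exact ⟨(ih h2).1, by have := (ih h2).2; omega⟩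

lemma Env.congr {k l st st'} (he : Env st k l) (h : ∀ i < k, st'.reg (i + 8) = st.reg (i + 8)) :
    Env st' k l := by
  induction he with
  | nil => exact .nil
  | cons h1 _ ih =>
    exact .cons ((h _ (by omega)).trans h1) (ih fun i hi => h i (by omega))

/-- The program `P` implements `p` over the stack `l` of `k` variables: it keeps the stack, pushes
the value of `p`, and its running time is at most `40` times the cost of `p`. The two spare steps pay for
moving the value in `bind`. -/
def Implements (P : Prog) (k : ℕ) (l : List ℕ) (p : Comp ℕ) : Prop :=
  ∀ st s a s' c, Represents s st → Env st k l → p s a s' c →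
    ∃ t st', Exec P st t st' ∧ t + 2 ≤ 40 * c ∧ Represents s' st' ∧
      (∀ i < k, st'.reg (i + 8) = st.reg (i + 8)) ∧ st'.reg (k + 8) = a

lemma Represents.of_reg {s st st'} (h : Represents s st) (h0 : st'.reg 0 = st.reg 0) (h1 : st'.reg 1 = st.reg 1)
    (h2 : st'.reg 2 = st.reg 2) (hm : st'.mem = st.mem) : Represents s st' := by
  constructor
  · rw [h0, h.base]
  · rw [h1, h.lim]
  · rw [h2, h.sq]
  · rw [hm]; exact h.io
  · rw [hm]; exact h.table
  · rw [hm]; exact h.cell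

namespace Implements

/-- Move register `j` to register `i`. -/
def move (i j : ℕ) : Prog := block (.const 3 0) [.add i j 3]

lemma exec_move (i j : ℕ) (st : RamState) (hj : j ≠ 3) : ∃ st', Exec (move i j) st 2 st' ∧
    st'.mem = st.mem ∧ st'.reg i = st.reg j ∧ ∀ r, r ≠ i → r ≠ 3 → st'.reg r = st.reg r :=
  ⟨_, exec_block _ _ _, rfl, by simp [Instr.run, hj], fun r h1 h2 => by simp [Instr.run, h1, h2]⟩

lemma bind {P Q k l} {p : Comp ℕ} {g : ℕ → Comp ℕ} (hp : Implements P k l p)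
    (hg : ∀ a, Implements Q (k + 1) (a :: l) (g a)) :
    Implements (.seq P (.seq Q (move (k + 8) (k + 9)))) k l (p >>= g) := by
  rintro st s b s'' c hr he ⟨a, s', c1, c2, h1, h2, rfl⟩
  obtain ⟨t1, st1, e1, ht1, hr1, hk1, ha1⟩ := hp st s a s' c1 hr he h1
  obtain ⟨t2, st2, e2, ht2, hr2, hk2, ha2⟩ := hg a st1 s' b s'' c2 hr1 (.cons ha1 (he.congr hk1)) h2
  obtain ⟨st3, e3, hm3, hv3, hf3⟩ := exec_move (k + 8) (k + 9) st2 (by omega)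
  have h3 : ∀ i, i < k ∨ i = k + 1 → st3.reg (i + 8) = st2.reg (i + 8) := fun i hi =>
    hf3 _ (by omega) (by omega)
  refine ⟨t1 + (t2 + 2), st3, .seq e1 (.seq e2 e3), by omega,
    hr2.of_reg (hf3 _ (by omega) (by omega)) (hf3 _ (by omega) (by omega))
      (hf3 _ (by omega) (by omega)) hm3,
    fun i hi => (h3 i (by omega)).trans ((hk2 i (by omega)).trans (hk1 i hi)), ?_⟩
  rw [hv3, ← ha2]

/-- Straight-line code that neither changes the memory nor the first three registers nor the stack,
and pushes the right value. -/
lemma of_block {k l} {p : Comp ℕ} (i : Instr) (is : List Instr) (hl : is.length ≤ 30)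
    (h : ∀ st s a s' c, Represents s st → Env st k l → p s a s' c → s' = s ∧ 1 ≤ c ∧
      let st' := is.foldl (fun s i => i.run s) (i.run st)
      st'.mem = st.mem ∧ st'.reg (k + 8) = a ∧ ∀ r, r ≠ k + 8 → (r < 3 ∨ 8 ≤ r) → st'.reg r = st.reg r) :
    Implements (block i is) k l p := by
  intro st s a s' c hr he hp
  obtain ⟨rfl, hc, hm, hv, hf⟩ := h st s a s' c hr he hp
  exact ⟨_, _, exec_block _ _ _, by omega, hr.of_reg (hf _ (by omega) (by omega))
    (hf _ (by omega) (by omega)) (hf _ (by omega) (by omega)) hm,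
    fun i hi => hf _ (by omega) (by omega), hv⟩

lemma const {k l} (v : ℕ) : Implements (block (.const (k + 8) v) []) k l (Comp.const v) := by
  refine of_block _ _ (by simp) ?_
  rintro st s a s' c hr he ⟨rfl, rfl, rfl⟩
  refine ⟨rfl, le_rfl, rfl, by simp [Instr.run], fun r h1 h2 => by simp [Instr.run, h1]⟩

lemma pure {k l x i} (hx : At k l x i) : Implements (move (k + 8) (i + 8)) k l (Pure.pure x) := by
  refine of_block _ _ (by simp) ?_
  rintro st s a s' c hr he ⟨rfl, rfl, rfl⟩
  obtain ⟨rfl, hi⟩ := hx.reg he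
  refine ⟨rfl, le_rfl, rfl, by simp [Instr.run], fun r h1 h2 => ?_⟩
  have : r ≠ 3 := by omega
  simp [Instr.run, h1, this]

lemma add {k l x y i j} (hx : At k l x i) (hy : At k l y j) :
    Implements (block (.add (k + 8) (i + 8) (j + 8)) []) k l (Comp.add x y) := by
  refine of_block _ _ (by simp) ?_
  rintro st s a s' c hr he ⟨rfl, rfl, rfl⟩
  obtain ⟨rfl, hi⟩ := hx.reg he
  obtain ⟨rfl, hi⟩ := hy.reg he
  exact ⟨rfl, le_rfl, rfl, by simp [Instr.run], fun r h1 h2 => by simp [Instr.run, h1]⟩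

lemma sub {k l x y i j} (hx : At k l x i) (hy : At k l y j) :
    Implements (block (.sub (k + 8) (i + 8) (j + 8)) []) k l (Comp.sub x y) := by
  refine of_block _ _ (by simp) ?_
  rintro st s a s' c hr he ⟨rfl, rfl, rfl⟩
  obtain ⟨rfl, hi⟩ := hx.reg he
  obtain ⟨rfl, hi⟩ := hy.reg he
  exact ⟨rfl, le_rfl, rfl, by simp [Instr.run], fun r h1 h2 => by simp [Instr.run, h1]⟩

lemma ioRd {k l x i} (hx : At k l x i) :
    Implements (block (.load (k + 8) (i + 8)) []) k l (Comp.ioRd x) := by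
  refine of_block _ _ (by simp) ?_
  rintro st s a s' c hr he ⟨hb, rfl, rfl, rfl⟩
  obtain ⟨rfl, hi⟩ := hx.reg he
  exact ⟨rfl, le_rfl, rfl, by simp [Instr.run, hr.io _ hb],
    fun r h1 h2 => by simp [Instr.run, h1]⟩

lemma ioWr {k l x y i j} (hx : At k l x i) (hy : At k l y j) :
    Implements (block (.store (i + 8) (j + 8)) [.const (k + 8) 0]) k l (Comp.ioWr x y) := by
  rintro st s a s' c hr he ⟨hb, rfl, rfl, rfl⟩
  obtain ⟨rfl, hi⟩ := hx.reg he
  obtain ⟨rfl, hj⟩ := hy.reg he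
  refine ⟨_, _, exec_block _ _ _, by simp, ?_, ?_, by simp [Instr.run]⟩
  · constructor
    · simpa [Instr.run] using hr.base
    · simpa [Instr.run] using hr.lim
    · simpa [Instr.run] using hr.sq
    · intro a ha
      simp only [Store.setIo_base] at ha
      by_cases h : a = st.reg (i + 8)
      · simp [Instr.run, Store.setIo, h]
      · simp [Instr.run, Store.setIo, h, hr.io a ha]
    · intro a ha
      have : s.base + 32 * a ≠ st.reg (i + 8) := by omega
      simpa [Instr.run, Store.setIo, this] using hr.table a ha
    · intro b i' j'
      have : s.base + 32 * Nat.pair i' j' + b.code ≠ st.reg (i + 8) := by omega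
      simpa [Instr.run, Store.setIo, this] using hr.cell b i' j'
  · intro r hr
    have : r ≠ k := by omega
    simp [Instr.run, this]

lemma ifLt {P Q k l x y i j} {p q : Comp ℕ} (hx : At k l x i) (hy : At k l y j)
    (hp : Implements P k l p) (hq : Implements Q k l q) :
    Implements (.ite (.lt (i + 8) (j + 8)) P Q) k l (Comp.ifLt x y p q) := by
  rintro st s a s' c hr he ⟨c', rfl, h⟩
  obtain ⟨rfl, hi⟩ := hx.reg he
  obtain ⟨rfl, hj⟩ := hy.reg he
  split_ifs at h with hc
  · obtain ⟨t, st', e, ht, h'⟩ := hp st s a s' c' hr he h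
    exact ⟨t + 1, st', .iteTrue hc e, by omega, h'⟩
  · obtain ⟨t, st', e, ht, h'⟩ := hq st s a s' c' hr he h
    exact ⟨t + 1, st', .iteFalse hc e, by omega, h'⟩

lemma ifEq {P Q k l x y i j} {p q : Comp ℕ} (hx : At k l x i) (hy : At k l y j)
    (hp : Implements P k l p) (hq : Implements Q k l q) :
    Implements (.ite (.eq (i + 8) (j + 8)) P Q) k l (Comp.ifEq x y p q) := by
  rintro st s a s' c hr he ⟨c', rfl, h⟩
  obtain ⟨rfl, hi⟩ := hx.reg he
  obtain ⟨rfl, hj⟩ := hy.reg he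
  split_ifs at h with hc
  · obtain ⟨t, st', e, ht, h'⟩ := hp st s a s' c' hr he h
    exact ⟨t + 1, st', .iteTrue hc e, by omega, h'⟩
  · obtain ⟨t, st', e, ht, hs⟩ := hq st s a s' c' hr he h
    exact ⟨t + 1, st', .iteFalse hc e, by omega, hs⟩

/-- The counter and the accumulator of a loop are on top of the stack: registers `k + 8` and `k + 9`. -/
lemma loop {P k l n j} {body : ℕ → ℕ → Comp ℕ} (hn : At k l n j)
    (hb : ∀ i acc, Implements P (k + 2) (acc :: i :: l) (body i acc)) (r i acc : ℕ) :
    ∀ st s a s' c, Represents s st → Env st (k + 2) (acc :: i :: l) → i + r = n →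
      Comp.loop body r i acc s a s' c →
      ∃ t st', Exec (.loop (.lt (k + 8) (j + 8)) (.seq P (block (.const 3 0)
          [.add (k + 9) (k + 10) 3, .const 3 1, .add (k + 8) (k + 8) 3]))) st t st' ∧
        t ≤ 40 * (c - 1) + 1 ∧ 1 ≤ c ∧ Represents s' st' ∧
        (∀ i < k, st'.reg (i + 8) = st.reg (i + 8)) ∧ st'.reg (k + 9) = a := by
  induction r generalizing i acc with
  | zero =>
    rintro st s a s' c hr he hi ⟨rfl, rfl, rfl⟩
    obtain _ | ⟨ha, he'⟩ := he
    obtain _ | ⟨hi', he'⟩ := he'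
    obtain ⟨hj, hjk⟩ := hn.reg he'
    refine ⟨1, st, .loopDone ?_, by omega, le_rfl, hr, fun _ _ => rfl, ha⟩
    simp only [Test.Holds]; omega
  | succ r ih =>
    rintro st s a s'' c hr he hi ⟨a1, s', c1, c2, h1, h2, rfl⟩
    have he0 := he
    obtain _ | ⟨ha, he'⟩ := he
    obtain _ | ⟨hi', he'⟩ := he'
    obtain ⟨hj, hjk⟩ := hn.reg he'
    obtain ⟨t1, st1, e1, ht1, hr1, hk1, ha1⟩ := hb i acc st s a1 s' c1 hr he0 h1
    have e2 := exec_block (.const 3 0) [.add (k + 9) (k + 10) 3, .const 3 1, .add (k + 8) (k + 8) 3] st1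
    set st2 := List.foldl (fun s i => Instr.run i s) ((Instr.const 3 0).run st1)
      [.add (k + 9) (k + 10) 3, .const 3 1, .add (k + 8) (k + 8) 3] with hst2
    have hk1k := hk1 k (by omega)
    have f1 : st2.reg (k + 8) = i + 1 := by simp [hst2, Instr.run, hk1k, hi']
    have f2 : st2.reg (k + 9) = a1 := by simp [hst2, Instr.run, ← ha1]
    have f3 : ∀ r, r ≠ 3 → r ≠ k + 8 → r ≠ k + 9 → st2.reg r = st1.reg r := fun r x1 x2 x3 => by
      simp [hst2, Instr.run, x1, x2, x3]
    have hr2 : Represents s' st2 := hr1.of_reg (f3 _ (by omega) (by omega) (by omega))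
      (f3 _ (by omega) (by omega) (by omega)) (f3 _ (by omega) (by omega) (by omega)) rfl
    have he2 : Env st2 (k + 2) (a1 :: (i + 1) :: l) := .cons f2 (.cons f1 (he'.congr fun r hr =>
      (f3 _ (by omega) (by omega) (by omega)).trans (hk1 r (by omega))))
    obtain ⟨t3, st3, e3, ht3, hc3, hr3, hk3, ha3⟩ := ih (i + 1) a1 st2 s' a s'' c2 hr2 he2 (by omega) h2
    refine ⟨_, st3, .loopStep ?_ (.seq e1 e2) e3, ?_, by omega, hr3, fun r hr => ?_, ha3⟩
    · simp only [Test.Holds]; omega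
    · simp only [List.length_cons, List.length_nil]; omega
    · rw [hk3 r hr, f3 _ (by omega) (by omega) (by omega), hk1 r (by omega)]

lemma foldN {P k l n x i j} {body : ℕ → ℕ → Comp ℕ} (hn : At k l n j) (hx : At k l x i)
    (hb : ∀ i acc, Implements P (k + 2) (acc :: i :: l) (body i acc)) :
    Implements (.seq (block (.const 3 0) [.add (k + 9) (i + 8) 3, .const (k + 8) 0])
      (.seq (.loop (.lt (k + 8) (j + 8)) (.seq P (block (.const 3 0)
          [.add (k + 9) (k + 10) 3, .const 3 1, .add (k + 8) (k + 8) 3])))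
        (move (k + 8) (k + 9)))) k l (Comp.foldN n x body) := by
  intro st s a s' c hr he hp
  have e1 := exec_block (.const 3 0) [.add (k + 9) (i + 8) 3, .const (k + 8) 0] st
  set st1 := List.foldl (fun s i => Instr.run i s) ((Instr.const 3 0).run st)
    [.add (k + 9) (i + 8) 3, .const (k + 8) 0] with hst1
  obtain ⟨hxi, _⟩ := hx.reg he
  have f1 : st1.reg (k + 8) = 0 := by simp [hst1, Instr.run]
  have f2 : st1.reg (k + 9) = x := by simp [hst1, Instr.run, hxi]
  have f3 : ∀ r, r ≠ 3 → r ≠ k + 8 → r ≠ k + 9 → st1.reg r = st.reg r := fun r x1 x2 x3 => by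
    simp [hst1, Instr.run, x1, x2, x3]
  have hr1 : Represents s st1 := hr.of_reg (f3 _ (by omega) (by omega) (by omega))
    (f3 _ (by omega) (by omega) (by omega)) (f3 _ (by omega) (by omega) (by omega)) rfl
  have he1 : Env st1 (k + 2) (x :: 0 :: l) := .cons f2 (.cons f1 (he.congr fun r hr =>
    f3 _ (by omega) (by omega) (by omega)))
  obtain ⟨t2, st2, e2, ht2, hc2, hr2, hk2, ha2⟩ :=
    loop hn hb n 0 x st1 s a s' c hr1 he1 (by omega) hp
  obtain ⟨st3, e3, hm3, hv3, hf3⟩ := exec_move (k + 8) (k + 9) st2 (by omega)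
  refine ⟨_, st3, .seq e1 (.seq e2 e3), ?_, hr2.of_reg (hf3 _ (by omega) (by omega))
    (hf3 _ (by omega) (by omega)) (hf3 _ (by omega) (by omega)) hm3, fun r hr => ?_, hv3.trans ha2⟩
  · simp only [List.length_cons, List.length_nil]; omega
  · rw [hf3 _ (by omega) (by omega), hk2 r hr, f3 _ (by omega) (by omega) (by omega)]

/-- The code that puts the address of the cell `(st.reg i, st.reg j)` of the array `b` into
register `3`. It looks up the square of the larger index, which determines `Nat.pair`; the factors `32`
are five doublings. -/
def address (b : Arr) (i j : ℕ) : Prog :=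
  .seq (.ite (.lt i j)
    (block (.add 3 j j) [.add 3 3 3, .add 3 3 3, .add 3 3 3, .add 3 3 3, .add 3 3 0, .load 3 3,
      .add 3 3 i])
    (block (.add 3 i i) [.add 3 3 3, .add 3 3 3, .add 3 3 3, .add 3 3 3, .add 3 3 0, .load 3 3,
      .add 3 3 i, .add 3 3 j]))
    (block (.add 3 3 3) [.add 3 3 3, .add 3 3 3, .add 3 3 3, .add 3 3 3, .add 3 3 0,
      .const 4 b.code, .add 3 3 4])

lemma exec_address (b : Arr) {i j : ℕ} (hi : 8 ≤ i) (hj : 8 ≤ j) {s : Store} {st : RamState}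
    (hr : Represents s st) (hx : st.reg i < s.lim) (hy : st.reg j < s.lim) :
    ∃ t st', Exec (address b i j) st t st' ∧ t ≤ 30 ∧ st'.mem = st.mem ∧
      st'.reg 3 = s.base + 32 * Nat.pair (st.reg i) (st.reg j) + b.code ∧
      ∀ r, (r < 3 ∨ 8 ≤ r) → st'.reg r = st.reg r := by
  have key : ∃ t st1, Exec (.ite (.lt i j)
      (block (.add 3 j j) [.add 3 3 3, .add 3 3 3, .add 3 3 3, .add 3 3 3, .add 3 3 0, .load 3 3,
        .add 3 3 i])
      (block (.add 3 i i) [.add 3 3 3, .add 3 3 3, .add 3 3 3, .add 3 3 3, .add 3 3 0, .load 3 3,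
        .add 3 3 i, .add 3 3 j])) st t st1 ∧ t ≤ 15 ∧ st1.mem = st.mem ∧
      st1.reg 3 = Nat.pair (st.reg i) (st.reg j) ∧
      ∀ r, (r < 3 ∨ 8 ≤ r) → st1.reg r = st.reg r := by
    have hi3 : i ≠ 3 := by omega
    have hj3 : j ≠ 3 := by omega
    by_cases hlt : st.reg i < st.reg j
    · refine ⟨_, _, .iteTrue hlt (exec_block _ _ _), by simp, rfl, ?_, fun r h => ?_⟩
      · have := hr.table _ hy
        rw [show s.base + 32 * st.reg j = st.reg j + st.reg j + (st.reg j + st.reg j) +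
          (st.reg j + st.reg j + (st.reg j + st.reg j)) +
          (st.reg j + st.reg j + (st.reg j + st.reg j) +
          (st.reg j + st.reg j + (st.reg j + st.reg j))) +
          (st.reg j + st.reg j + (st.reg j + st.reg j) +
          (st.reg j + st.reg j + (st.reg j + st.reg j)) +
          (st.reg j + st.reg j + (st.reg j + st.reg j) +
          (st.reg j + st.reg j + (st.reg j + st.reg j)))) + st.reg 0 by rw [hr.base]; ring] at this
        simp [Instr.run, hi3, this, Nat.pair, hlt]
      · have : r ≠ 3 := by omega
        simp [Instr.run, this]
    · refine ⟨_, _, .iteFalse hlt (exec_block _ _ _), by simp, rfl, ?_, fun r h => ?_⟩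
      · have := hr.table _ hx
        rw [show s.base + 32 * st.reg i = st.reg i + st.reg i + (st.reg i + st.reg i) +
          (st.reg i + st.reg i + (st.reg i + st.reg i)) +
          (st.reg i + st.reg i + (st.reg i + st.reg i) +
          (st.reg i + st.reg i + (st.reg i + st.reg i))) +
          (st.reg i + st.reg i + (st.reg i + st.reg i) +
          (st.reg i + st.reg i + (st.reg i + st.reg i)) +
          (st.reg i + st.reg i + (st.reg i + st.reg i) +
          (st.reg i + st.reg i + (st.reg i + st.reg i)))) + st.reg 0 by rw [hr.base]; ring] at this
        simp [Instr.run, hi3, hj3, this, Nat.pair, hlt]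
      · have : r ≠ 3 := by omega
        simp [Instr.run, this]
  obtain ⟨t, st1, e1, ht, hm, hv, hf⟩ := key
  refine ⟨_, _, .seq e1 (exec_block _ _ _), ?_, hm, ?_, fun r h => ?_⟩
  · simp only [List.length_cons, List.length_nil]; omega
  · have := (hf 0 (by omega)).trans hr.base
    simp [Instr.run, this, hv]; ring
  · have h3 : r ≠ 3 := by omega
    have h4 : r ≠ 4 := by omega
    simp [Instr.run, h3, h4, hf r h]

lemma rd {k l x y i j} (b : Arr) (hx : At k l x i) (hy : At k l y j) :
    Implements (.seq (address b (i + 8) (j + 8)) (block (.load (k + 8) 3) [])) k l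
      (Comp.rd b x y) := by
  rintro st s a s' c hr he ⟨h1, h2, rfl, rfl, rfl⟩
  obtain ⟨rfl, hi⟩ := hx.reg he
  obtain ⟨rfl, hj⟩ := hy.reg he
  obtain ⟨t, st1, e1, ht, hm, hv, hf⟩ := exec_address b (by omega) (by omega) hr h1 h2
  have g : ∀ r, r ≠ k + 8 → (r < 3 ∨ 8 ≤ r) → ((Instr.load (k + 8) 3).run st1).reg r = st.reg r :=
    fun r h3 h4 => by simp [Instr.run, h3, hf r h4]
  refine ⟨_, _, .seq e1 (exec_block _ _ _), ?_, hr.of_reg (g _ (by omega) (by omega))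
    (g _ (by omega) (by omega)) (g _ (by omega) (by omega)) hm, fun r hr =>
    g _ (by omega) (by omega), ?_⟩
  · simp only [List.length_nil]; omega
  · simp [Instr.run, hm, hv, hr.cell]

lemma wr {k l x y v i j r} (b : Arr) (hx : At k l x i) (hy : At k l y j) (hv : At k l v r) :
    Implements (.seq (address b (i + 8) (j + 8)) (block (.store 3 (r + 8)) [.const (k + 8) 0])) k l
      (Comp.wr b x y v) := by
  rintro st s a s' c hr he ⟨h1, h2, rfl, rfl, rfl⟩
  obtain ⟨rfl, hi⟩ := hx.reg he
  obtain ⟨rfl, hj⟩ := hy.reg he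
  obtain ⟨rfl, hrk⟩ := hv.reg he
  obtain ⟨t, st1, e1, ht, hm, hv, hf⟩ := exec_address b (i := i + 8) (j := j + 8)
    (by omega) (by omega) hr h1 h2
  refine ⟨_, _, .seq e1 (exec_block _ _ _), ?_, ?_, fun r hr => ?_, by simp [Instr.run]⟩
  · simp only [List.length_cons, List.length_nil]; omega
  · have hb := b.code_pos
    have hb' := b.code_lt
    constructor
    · simpa [Instr.run, hf] using hr.base
    · simpa [Instr.run, hf] using hr.lim
    · simpa [Instr.run, hf] using hr.sq
    · intro a ha
      simp only [Store.set_base] at ha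
      have : a ≠ st1.reg 3 := by omega
      simpa [Instr.run, this, hm] using hr.io a ha
    · intro a ha
      have : s.base + 32 * a ≠ st1.reg 3 := by omega
      simpa [Instr.run, this, hm] using hr.table a ha
    · intro b' i' j'
      have hb1 := b'.code_lt
      by_cases h : s.base + 32 * Nat.pair i' j' + b'.code = st1.reg 3
      · have h5 : b'.code = b.code := by omega
        have h6 : Nat.pair i' j' = Nat.pair (st.reg (i + 8)) (st.reg (j + 8)) := by omega
        obtain ⟨h7, h8⟩ := Nat.pair_eq_pair.1 h6
        have h9 := Arr.code_injective h5
        subst h7 h8 h9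
        simp [Instr.run, h, hf]
      · have h5 : ¬ (b' = b ∧ i' = st.reg (i + 8) ∧ j' = st.reg (j + 8)) := by
          rintro ⟨rfl, rfl, rfl⟩; exact h hv.symm
        rw [Store.set_arr, if_neg h5, ← hr.cell]
        simp [Instr.run, h, hm]
  · have : r ≠ k := by omega
    simp [Instr.run, this, hf]

/-- The next entry of the table of squares comes from `(x + 1) ^ 2 = x ^ 2 + x + x + 1`. -/
lemma grow {k l} : Implements (block (.add 3 1 1) [.add 3 3 3, .add 3 3 3, .add 3 3 3, .add 3 3 3,
      .add 3 3 0, .store 3 2, .const 4 1, .add 2 2 1, .add 2 2 1, .add 2 2 4, .add 1 1 4,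
      .const (k + 8) 0]) k l Comp.grow := by
  rintro st s a s' c hr he ⟨rfl, rfl, rfl⟩
  refine ⟨_, _, exec_block _ _ _, by simp, ?_, fun r hr => ?_, by simp [Instr.run]⟩
  · have hA : st.reg 1 + st.reg 1 + (st.reg 1 + st.reg 1) +
          (st.reg 1 + st.reg 1 + (st.reg 1 + st.reg 1)) +
          (st.reg 1 + st.reg 1 + (st.reg 1 + st.reg 1) +
          (st.reg 1 + st.reg 1 + (st.reg 1 + st.reg 1))) +
          (st.reg 1 + st.reg 1 + (st.reg 1 + st.reg 1) +
          (st.reg 1 + st.reg 1 + (st.reg 1 + st.reg 1)) +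
          (st.reg 1 + st.reg 1 + (st.reg 1 + st.reg 1) +
          (st.reg 1 + st.reg 1 + (st.reg 1 + st.reg 1)))) + st.reg 0 = s.base + 32 * s.lim := by
      rw [hr.base, hr.lim]; ring
    constructor
    · simpa [Instr.run] using hr.base
    · simpa [Instr.run] using hr.lim
    · simp [Instr.run, hr.lim, hr.sq]; ring
    · intro a ha
      simp only [Store.grow_base] at ha
      have : a ≠ s.base + 32 * s.lim := by omega
      simpa [Instr.run, hA, this] using hr.io a ha
    · intro a ha
      simp only [Store.grow_lim, Store.grow_base] at ha ⊢
      by_cases h : a = s.lim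
      · subst h; simp [Instr.run, hA, hr.sq]
      · simpa [Instr.run, hA, h] using hr.table a (by omega)
    · intro b i j
      have hb := b.code_pos
      have hb' := b.code_lt
      have : s.base + 32 * Nat.pair i j + b.code ≠ s.base + 32 * s.lim := by omega
      simpa [Instr.run, hA, this] using hr.cell b i j
  · have : r ≠ k := by omega
    simp [Instr.run, this]

end Implements

/-! ### The algorithm in the array language -/

namespace Comp

open Arr

/-- Store a table of constants. -/
def loadCells (b : Arr) (f : ℕ → ℕ → ℕ) : List (ℕ × ℕ) → Comp ℕ
  | [] => const 0
  | (i, j) :: L => do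
    let x ← const i
    let y ← const j
    let v ← const (f i j)
    let _ ← wr b x y v
    loadCells b f L

/-- Admit `B` more indices. -/
def growBy (B z0 : ℕ) : Comp ℕ :=
  foldN B z0 fun _ acc => do
    let _ ← grow
    pure acc

/-- Copy the adjacency matrices and the list of leaves from the input region to arrays; the entry of
the array `lv` for a leaf of the tree is one more than its vertex. -/
def copyInput (n m z0 one two : ℕ) : Comp ℕ := do
  let p ← foldN n two fun u p => foldN n p fun v p => do
    let a ← ioRd p
    let _ ← wr adj u v a
    add p one
  let p' ← foldN m p fun x p => foldN m p fun y p => do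
    let a ← ioRd p
    let _ ← wr tre x y a
    add p one
  foldN n p' fun v p => do
    let x ← ioRd p
    let v1 ← add v one
    let _ ← wr lv z0 x v1
    add p one

/-- Set up the rows of the signatures: for each tracked colour `j` and each vertex `u` a row that
counts out-neighbours of `u` and a row that counts in-neighbours of `u`. -/
def buildRows (k n z0 one : ℕ) : Comp ℕ :=
  foldN k z0 fun j p => foldN n p fun u p => do
    let p1 ← add p one
    let _ ← wr pu z0 p u
    let _ ← wr pu z0 p1 u
    let _ ← wr tr z0 p j
    let _ ← wr tr z0 p1 j
    let j2 ← add j j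
    let j3 ← add j2 one
    let _ ← wr pt z0 p j2
    let _ ← wr pt z0 p1 j3
    let _ ← foldN n z0 fun v _ => do
      let a ← rd adj u v
      let _ ← wr rel p v a
      let b ← rd adj v u
      wr rel p1 v b
    add p1 one

/-- Count the edges of the tree into `x`, other than from `y`, that are not yet listed; the
positions of the last two listed ones are left at the end of the arrays `pa` and `pb`. -/
def countPending (m z0 one x y l : ℕ) : Comp ℕ :=
  foldN m z0 fun z c => do
    let b ← rd tre x z
    ifEq b z0 (pure c) (ifEq z y (pure c) (do
      let f ← rd pos z x
      ifEq f z0 (add c one) (do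
        let o ← rd pa z0 l
        let _ ← wr pb z0 l o
        let f1 ← sub f one
        let _ ← wr pa z0 l f1
        pure c)))

/-- List the edge from `x` to `y` if it has not been listed and all other edges into `x` have. -/
def tryEdge (m z0 one x y l : ℕ) : Comp ℕ := do
  let a ← rd tre x y
  ifEq a z0 (pure l) (do
    let e ← rd pos x y
    ifEq e z0 (do
      let c ← countPending m z0 one x y l
      ifEq c z0 (do
        let v ← rd lv z0 x
        let _ ← wr lf z0 l v
        let _ ← wr ex z0 l x
        let _ ← wr ey z0 l y
        let l1 ← add l one
        let _ ← wr pos x y l1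
        pure l1) (pure l)) (pure l))

/-- List the directed edges of the tree in a topological order. -/
def listEdges (m z0 one : ℕ) : Comp ℕ :=
  foldN m z0 fun _ l => foldN m l fun x l => foldN m l fun y l => tryEdge m z0 one x y l

/-- For each listed edge, find the position of the reverse edge. -/
def linkReverse (l z0 one : ℕ) : Comp ℕ :=
  foldN l z0 fun i _ => do
    let x ← rd ex z0 i
    let y ← rd ey z0 i
    let f ← rd pos y x
    let f1 ← sub f one
    wr rev z0 i f1

/-- The first phases: everything before the dynamic programming. It returns the number of listed
edges. -/
def prepare (n m k z0 one : ℕ) : Comp ℕ := do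
  let _ ← buildRows k n z0 one
  let l ← listEdges m z0 one
  let _ ← linkReverse l z0 one
  pure l

/-- The entry of the signature of a disjoint union; `d1` is the value `d + 1`, which marks the rows
of the vertices of the set itself. -/
def joinEntry (d d1 a b : ℕ) : Comp ℕ :=
  ifLt d a (pure d1) (ifLt d b (pure d1) (do
    let c ← add a b
    ifLt d c (pure d) (pure c)))

/-- Look for row `h` of `vec` among the rows from `start` on; the result is `h` if it is new. -/
def search (N z0 one start h : ℕ) : Comp ℕ := do
  let len ← sub h start
  foldN len h fun i acc => do
    let g ← add start i
    let eq ← foldN N one fun p e => do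
      let a ← rd vec g p
      let b ← rd vec h p
      ifEq a b (pure e) (pure z0)
    ifEq eq one (pure g) (pure acc)

/-- The new number of classes, given that row `h` was found as class `g`. -/
def bump (one g h : ℕ) : Comp ℕ :=
  ifEq g h (do
    let _ ← grow
    add h one) (pure h)

/-- The classes over a single vertex. -/
def leafClasses (N q d1 z0 one i start v : ℕ) : Comp ℕ :=
  foldN q start fun c h => do
    let _ ← foldN N z0 fun p _ => do
      let u ← rd pu z0 p
      ifEq u v (wr vec h p d1) (do
        let t ← rd tr z0 p
        ifEq t c (do
          let r ← rd rel p v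
          wr vec h p r) (wr vec h p z0))
    let g ← search N z0 one start h
    let _ ← wr cc i c g
    bump one g h

/-- The classes over the union of two sides. -/
def joinClasses (N d d1 z0 one start sa ea sb eb : ℕ) : Comp ℕ := do
  let la ← sub ea sa
  let lb ← sub eb sb
  foldN la start fun i1 h => do
    let g1 ← add sa i1
    foldN lb h fun i2 h => do
      let g2 ← add sb i2
      let _ ← foldN N z0 fun p _ => do
        let a ← rd vec g1 p
        let b ← rd vec g2 p
        let w ← joinEntry d d1 a b
        wr vec h p w
      let g ← search N z0 one start h
      let _ ← wr join g1 g2 g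
      let _ ← wr join g2 g1 g
      bump one g h

/-- The classes over the sides of all listed edges. -/
def classPhase (l N q d d1 z0 one : ℕ) : Comp ℕ :=
  foldN l z0 fun i h => do
    let _ ← wr st z0 i h
    let v1 ← rd lf z0 i
    let hi ← ifEq v1 z0 (do
        let a ← rd pa z0 i
        let b ← rd pb z0 i
        let sa ← rd st z0 a
        let ea ← rd en z0 a
        let sb ← rd st z0 b
        let eb ← rd en z0 b
        joinClasses N d d1 z0 one h sa ea sb eb) (do
        let v ← sub v1 one
        leafClasses N q d1 z0 one i h v)
    let _ ← wr en z0 i hi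
    pure hi

/-- Record a partial solution of cost `w` for the pair `(g, z)` of classes if it is better than the
one known; `s` is the number of the next solution, and `fill u` writes the colour of `u` in it. -/
def improve (n z0 one g z w s : ℕ) (fill : ℕ → Comp ℕ) : Comp ℕ := do
  let t ← rd tab g z
  let better ← ifEq t z0 (pure one) (do
    let o ← rd cost z0 t
    ifLt w o (pure one) (pure z0))
  ifEq better z0 (pure s) (do
    let _ ← foldN n z0 fun u _ => fill u
    let _ ← wr cost z0 s w
    let _ ← wr tab g z s
    let _ ← grow
    add s one)

/-- Combine the solutions at two table entries into one for the pair `(g, z)`. -/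
def joinSolutions (n z0 one s g z g1 z1 g2 z2 : ℕ) : Comp ℕ := do
  let s1 ← rd tab g1 z1
  let s2 ← rd tab g2 z2
  ifEq s1 z0 (pure s) (ifEq s2 z0 (pure s) (do
    let w1 ← rd cost z0 s1
    let w2 ← rd cost z0 s2
    let w ← add w1 w2
    improve n z0 one g z w s fun u => do
      let a ← rd sol s1 u
      let b ← rd sol s2 u
      let c ← add a b
      wr sol s u c))

/-- Whether vertex `v` may have colour `c` if its other neighbours are as in the class `z`. -/
def checkVertex (N d z0 one v c z : ℕ) : Comp ℕ :=
  foldN N one fun p ok => do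
    let u ← rd pu z0 p
    ifEq u v (do
      let x ← rd vec z p
      let t ← rd tr z0 p
      let cnt ← ifEq t c (do
        let r ← rd rel p v
        let y ← add x r
        ifLt d y (pure d) (pure y)) (pure x)
      let τ ← rd pt z0 p
      let j ← rd cb z0 c
      let j' ← add j cnt
      let f ← rd mu τ j'
      ifEq f z0 (pure z0) (pure ok)) (pure ok)

/-- The table for a single vertex. -/
def leafTable (n N q d z0 one i v sz ez s : ℕ) : Comp ℕ := do
  let lz ← sub ez sz
  foldN q s fun c s => do
    let g ← rd cc i c
    let w ← rd wt z0 c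
    foldN lz s fun i3 s => do
      let z ← add sz i3
      let ok ← checkVertex N d z0 one v c z
      ifEq ok z0 (pure s) (improve n z0 one g z w s fun u =>
        ifEq u v (wr sol s u c) (wr sol s u z0))

/-- The table for the union of two sides. -/
def joinTable (n z0 one sa ea sb eb sz ez s : ℕ) : Comp ℕ := do
  let la ← sub ea sa
  let lb ← sub eb sb
  let lz ← sub ez sz
  foldN la s fun i1 s => do
    let g1 ← add sa i1
    foldN lb s fun i2 s => do
      let g2 ← add sb i2
      let g ← rd join g1 g2
      foldN lz s fun i3 s => do
        let z ← add sz i3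
        let z1 ← rd join g2 z
        let z2 ← rd join g1 z
        joinSolutions n z0 one s g z g1 z1 g2 z2

/-- The tables of all listed edges. -/
def tablePhase (l n N q d z0 one : ℕ) : Comp ℕ :=
  foldN l one fun i s => do
    let r ← rd rev z0 i
    let sz ← rd st z0 r
    let ez ← rd en z0 r
    let v1 ← rd lf z0 i
    ifEq v1 z0 (do
        let a ← rd pa z0 i
        let b ← rd pb z0 i
        let sa ← rd st z0 a
        let ea ← rd en z0 a
        let sb ← rd st z0 b
        let eb ← rd en z0 b
        joinTable n z0 one sa ea sb eb sz ez s) (do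
        let v ← sub v1 one
        leafTable n N q d z0 one i v sz ez s)

/-- Combine the tables of the two directions of the first edge; the best solution is recorded at
`(h, h)`, where `h` is not a class. -/
def finalPhase (n z0 one h s : ℕ) : Comp ℕ := do
  let sa ← rd st z0 z0
  let ea ← rd en z0 z0
  let r ← rd rev z0 z0
  let sz ← rd st z0 r
  let ez ← rd en z0 r
  let la ← sub ea sa
  let lz ← sub ez sz
  foldN la s fun i1 s => do
    let g ← add sa i1
    foldN lz s fun i3 s => do
      let z ← add sz i3
      joinSolutions n z0 one s h h g z z g

/-- Report the colour classes of the solution recorded at `(h, h)`, if there is one; the vertices of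
colour `0` are reported by a `1`. -/
def output (n z0 one h : ℕ) : Comp ℕ := do
  let t ← rd tab h h
  ifEq t z0 (ioWr z0 z0) (do
    let _ ← ioWr z0 one
    foldN n z0 fun u _ => do
      let a ← rd sol t u
      let b ← sub one a
      let u1 ← add u one
      ioWr u1 b)

/-- Admit enough indices and read the input. -/
def readInput (extra n m z0 one two N : ℕ) : Comp ℕ := do
  let m2 ← add m m
  let m3 ← add m2 m
  let b1 ← add n m3
  let b2 ← add b1 N
  let e ← const extra
  let b3 ← add b2 e
  let _ ← growBy b3 z0
  copyInput n m z0 one two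

/-- The dynamic programming algorithm. -/
def solve (k q d : ℕ) (MU : ℕ → ℕ → ℕ) (WT : ℕ → ℕ) (n m z0 one N : ℕ) : Comp ℕ := do
  let _ ← loadCells mu MU ((List.range (2 * k)) ×ˢ (List.range (q * (d + 1))))
  let _ ← loadCells cb (fun _ c => c * (d + 1)) ([0] ×ˢ List.range q)
  let _ ← loadCells wt (fun _ c => WT c) ([0] ×ˢ List.range q)
  let kk ← const k
  let qq ← const q
  let dd ← const d
  let d1 ← const (d + 1)
  let l ← prepare n m kk z0 one
  let h ← classPhase l N qq dd d1 z0 one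
  let s ← tablePhase l n N qq dd z0 one
  let _ ← finalPhase n z0 one h s
  output n z0 one h

/-- A `1` if the digraph has an edge other than the loops, and a `0` otherwise. -/
def hasEdge (n z0 one : ℕ) : Comp ℕ :=
  foldN n z0 fun u f => foldN n f fun v f => ifEq u v (pure f) (do
    let a ← rd adj u v
    ifEq a z0 (pure f) (pure one))

/-- The answer in the absence of edges other than loops: a vertex can be coloured if the constant for
the presence or absence of a loop is not `0`. -/
def answerLoops (okNon okLoop n z0 one : ℕ) : Comp ℕ := do
  let a ← foldN n one fun u f => do
    let a ← rd adj u u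
    let t ← ifEq a z0 (const okNon) (const okLoop)
    ifEq t z0 (pure z0) (pure f)
  ioWr z0 a

/-- The program for optimization problems. -/
def optimize (k q d : ℕ) (MU : ℕ → ℕ → ℕ) (WT : ℕ → ℕ) : Comp ℕ := do
  let z0 ← const 0
  let one ← const 1
  let two ← const 2
  let n ← ioRd z0
  let m ← ioRd one
  let kk ← const k
  let N ← foldN kk z0 fun _ acc => do
    let a ← add acc n
    add a n
  let _ ← readInput (q * (d + 1) + 2 * k + q + 10) n m z0 one two N
  solve k q d MU WT n m z0 one N

/-- The program for existence problems. -/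
def decideExists (k q d : ℕ) (MU : ℕ → ℕ → ℕ) (okNon okLoop : ℕ) : Comp ℕ := do
  let z0 ← const 0
  let one ← const 1
  let two ← const 2
  let n ← ioRd z0
  let m ← ioRd one
  let _ ← readInput 10 n m z0 one two z0
  let f ← hasEdge n z0 one
  ifEq f z0 (answerLoops okNon okLoop n z0 one) (do
    let kk ← const k
    let N ← foldN kk z0 fun _ acc => do
      let a ← add acc n
      add a n
    let e ← const (q * (d + 1) + 2 * k + q)
    let b ← add e N
    let _ ← growBy b z0
    solve k q d MU (fun _ => 0) n m z0 one N)

/-- The program that reports all vertices or none. -/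
def reportConst (flag val : ℕ) : Comp ℕ := do
  let z0 ← const 0
  let one ← const 1
  let n ← ioRd z0
  let f ← const flag
  let v ← const val
  let _ ← foldN n z0 fun u _ => do
    let u1 ← add u one
    ioWr u1 v
  ioWr z0 f

end Comp

namespace Implements

lemma exists_loadCells (b : Arr) (f : ℕ → ℕ → ℕ) (L : List (ℕ × ℕ)) (k : ℕ) :
    ∃ P, ∀ l, Implements P k l (Comp.loadCells b f L) := by
  induction L generalizing k with
  | nil => exact ⟨_, fun l => const 0⟩
  | cons a L ih =>
    obtain ⟨P, hP⟩ := ih (k + 4)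
    exact ⟨_, fun l => bind (const _) fun x => bind (const _) fun y => bind (const _) fun v =>
      bind (wr b (.tail (.tail .head)) (.tail .head) .head) fun _ => hP _⟩

/-- A named implementation of `Comp.loadCells`, whose recursion the syntax-directed construction below
cannot follow. -/
lemma loadCells (b : Arr) (f : ℕ → ℕ → ℕ) (L : List (ℕ × ℕ)) (k : ℕ) (l : List ℕ) :
    Implements (exists_loadCells b f L k).choose k l (Comp.loadCells b f L) :=
  (exists_loadCells b f L k).choose_spec l

lemma reportConst (flag val : ℕ) : ∃ P, Implements P 0 [] (Comp.reportConst flag val) := by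
  unfold Comp.reportConst
  -- The rules are directed by the syntax, so that applying them builds the machine program.
  apply Exists.intro
  repeat' first
    | with_reducible exact At.head
    | with_reducible apply At.tail
    | with_reducible exact const _
    | with_reducible apply bind
    | with_reducible apply rd
    | with_reducible apply wr
    | with_reducible apply add
    | with_reducible apply foldN
    | with_reducible apply ifEq
    | with_reducible apply ifLt
    | with_reducible apply sub
    | with_reducible apply pure
    | with_reducible apply ioRd
    | with_reducible apply ioWr
    | with_reducible exact grow
    | with_reducible exact loadCells _ _ _ _ _
    | intro _

lemma optimize (k q d : ℕ) (MU : ℕ → ℕ → ℕ) (WT : ℕ → ℕ) :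
    ∃ P, Implements P 0 [] (Comp.optimize k q d MU WT) := by
  unfold Comp.optimize Comp.solve Comp.readInput Comp.output Comp.finalPhase Comp.tablePhase
    Comp.joinTable Comp.leafTable Comp.checkVertex Comp.joinSolutions Comp.improve Comp.classPhase
    Comp.joinClasses Comp.leafClasses Comp.bump Comp.search Comp.joinEntry Comp.prepare
    Comp.linkReverse Comp.listEdges Comp.tryEdge Comp.countPending Comp.buildRows Comp.copyInput
    Comp.growBy
  apply Exists.intro
  repeat' first
    | with_reducible exact At.head
    | with_reducible apply At.tail
    | with_reducible exact const _
    | with_reducible apply bind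
    | with_reducible apply rd
    | with_reducible apply wr
    | with_reducible apply add
    | with_reducible apply foldN
    | with_reducible apply ifEq
    | with_reducible apply ifLt
    | with_reducible apply sub
    | with_reducible apply pure
    | with_reducible apply ioRd
    | with_reducible apply ioWr
    | with_reducible exact grow
    | with_reducible exact loadCells _ _ _ _ _
    | intro _

lemma decideExists (k q d : ℕ) (MU : ℕ → ℕ → ℕ) (okNon okLoop : ℕ) :
    ∃ P, Implements P 0 [] (Comp.decideExists k q d MU okNon okLoop) := by
  unfold Comp.decideExists Comp.solve Comp.readInput Comp.output Comp.finalPhase Comp.tablePhase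
    Comp.joinTable Comp.leafTable Comp.checkVertex Comp.joinSolutions Comp.improve Comp.classPhase
    Comp.joinClasses Comp.leafClasses Comp.bump Comp.search Comp.joinEntry Comp.prepare
    Comp.linkReverse Comp.listEdges Comp.tryEdge Comp.countPending Comp.buildRows Comp.copyInput
    Comp.growBy Comp.hasEdge Comp.answerLoops
  apply Exists.intro
  repeat' first
    | with_reducible exact At.head
    | with_reducible apply At.tail
    | with_reducible exact const _
    | with_reducible apply bind
    | with_reducible apply rd
    | with_reducible apply wr
    | with_reducible apply add
    | with_reducible apply foldN
    | with_reducible apply ifEq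
    | with_reducible apply ifLt
    | with_reducible apply sub
    | with_reducible apply pure
    | with_reducible apply ioRd
    | with_reducible apply ioWr
    | with_reducible exact grow
    | with_reducible exact loadCells _ _ _ _ _
    | intro _

end Implements

/-! ### Reasoning about the array language -/

/-- Total correctness: `p`, started in `s`, can end with a value, a store and a cost that satisfy
`Q`. -/
def Spec {α : Type} (p : Comp α) (s : Store) (Q : α → Store → ℕ → Prop) : Prop :=
  ∃ a s' c, p s a s' c ∧ Q a s' c

namespace Spec

variable {s : Store} {Q : ℕ → Store → ℕ → Prop}

lemma mono {α : Type} {p : Comp α} {s : Store} {Q Q' : α → Store → ℕ → Prop} (h : Spec p s Q)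
    (hQ : ∀ a s' c, Q a s' c → Q' a s' c) : Spec p s Q' := by
  obtain ⟨a, s', c, h1, h2⟩ := h
  exact ⟨a, s', c, h1, hQ _ _ _ h2⟩

lemma pure_iff (a : ℕ) : Spec (pure a) s Q ↔ Q a s 1 := by
  constructor
  · rintro ⟨_, _, _, ⟨rfl, rfl, rfl⟩, h⟩; exact h
  · intro h; exact ⟨_, _, _, ⟨rfl, rfl, rfl⟩, h⟩

lemma bind_iff {α β : Type} (p : Comp α) (g : α → Comp β) (s : Store) (Q : β → Store → ℕ → Prop) :
    Spec (p >>= g) s Q ↔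
      Spec p s fun a s' c => Spec (g a) s' fun b s'' c' => Q b s'' (c + c') := by
  constructor
  · rintro ⟨b, s'', _, ⟨a, s', c1, c2, h1, h2, rfl⟩, h⟩
    exact ⟨a, s', c1, h1, b, s'', c2, h2, h⟩
  · rintro ⟨a, s', c1, h1, b, s'', c2, h2, h⟩
    exact ⟨b, s'', _, ⟨a, s', c1, c2, h1, h2, rfl⟩, h⟩

lemma const_iff (k : ℕ) : Spec (Comp.const k) s Q ↔ Q k s 1 := by
  constructor
  · rintro ⟨_, _, _, ⟨rfl, rfl, rfl⟩, h⟩; exact h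
  · intro h; exact ⟨_, _, _, ⟨rfl, rfl, rfl⟩, h⟩

lemma add_iff (x y : ℕ) : Spec (Comp.add x y) s Q ↔ Q (x + y) s 1 := by
  constructor
  · rintro ⟨_, _, _, ⟨rfl, rfl, rfl⟩, h⟩; exact h
  · intro h; exact ⟨_, _, _, ⟨rfl, rfl, rfl⟩, h⟩

lemma sub_iff (x y : ℕ) : Spec (Comp.sub x y) s Q ↔ Q (x - y) s 1 := by
  constructor
  · rintro ⟨_, _, _, ⟨rfl, rfl, rfl⟩, h⟩; exact h
  · intro h; exact ⟨_, _, _, ⟨rfl, rfl, rfl⟩, h⟩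

lemma grow_iff : Spec Comp.grow s Q ↔ Q 0 s.grow 1 := by
  constructor
  · rintro ⟨_, _, _, ⟨rfl, rfl, rfl⟩, h⟩; exact h
  · intro h; exact ⟨_, _, _, ⟨rfl, rfl, rfl⟩, h⟩

lemma ioRd_iff (x : ℕ) : Spec (Comp.ioRd x) s Q ↔ x < s.base ∧ Q (s.io x) s 1 := by
  constructor
  · rintro ⟨_, _, _, ⟨h1, rfl, rfl, rfl⟩, h⟩; exact ⟨h1, h⟩
  · rintro ⟨h1, h⟩; exact ⟨_, _, _, ⟨h1, rfl, rfl, rfl⟩, h⟩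

lemma ioWr_iff (x v : ℕ) : Spec (Comp.ioWr x v) s Q ↔ x < s.base ∧ Q 0 (s.setIo x v) 1 := by
  constructor
  · rintro ⟨_, _, _, ⟨h1, rfl, rfl, rfl⟩, h⟩; exact ⟨h1, h⟩
  · rintro ⟨h1, h⟩; exact ⟨_, _, _, ⟨h1, rfl, rfl, rfl⟩, h⟩

lemma rd_iff (b : Arr) (i j : ℕ) :
    Spec (Comp.rd b i j) s Q ↔ i < s.lim ∧ j < s.lim ∧ Q (s.arr b i j) s 1 := by
  constructor
  · rintro ⟨_, _, _, ⟨h1, h2, rfl, rfl, rfl⟩, h⟩; exact ⟨h1, h2, h⟩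
  · rintro ⟨h1, h2, h⟩; exact ⟨_, _, _, ⟨h1, h2, rfl, rfl, rfl⟩, h⟩

lemma wr_iff (b : Arr) (i j v : ℕ) :
    Spec (Comp.wr b i j v) s Q ↔ i < s.lim ∧ j < s.lim ∧ Q 0 (s.set b i j v) 1 := by
  constructor
  · rintro ⟨_, _, _, ⟨h1, h2, rfl, rfl, rfl⟩, h⟩; exact ⟨h1, h2, h⟩
  · rintro ⟨h1, h2, h⟩; exact ⟨_, _, _, ⟨h1, h2, rfl, rfl, rfl⟩, h⟩

lemma ifLt_iff (x y : ℕ) (p q : Comp ℕ) : Spec (Comp.ifLt x y p q) s Q ↔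
    if x < y then Spec p s (fun a s' c => Q a s' (c + 1))
    else Spec q s (fun a s' c => Q a s' (c + 1)) := by
  constructor
  · rintro ⟨a, s', _, ⟨c', rfl, h⟩, hq⟩
    split_ifs at h ⊢ <;> exact ⟨_, _, _, h, hq⟩
  · intro h
    split_ifs at h with hc <;> obtain ⟨a, s', c, h1, h2⟩ := h <;>
      exact ⟨a, s', c + 1, ⟨c, rfl, by simpa [hc] using h1⟩, h2⟩

lemma ifEq_iff (x y : ℕ) (p q : Comp ℕ) : Spec (Comp.ifEq x y p q) s Q ↔
    if x = y then Spec p s (fun a s' c => Q a s' (c + 1))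
    else Spec q s (fun a s' c => Q a s' (c + 1)) := by
  constructor
  · rintro ⟨a, s', _, ⟨c', rfl, h⟩, hq⟩
    split_ifs at h ⊢ <;> exact ⟨_, _, _, h, hq⟩
  · intro h
    split_ifs at h with hc <;> obtain ⟨a, s', c, h1, h2⟩ := h <;>
      exact ⟨a, s', c + 1, ⟨c, rfl, by simpa [hc] using h1⟩, h2⟩

lemma loop_rule {n : ℕ} {body : ℕ → ℕ → Comp ℕ} (I : ℕ → ℕ → Store → ℕ → Prop)
    (hb : ∀ i < n, ∀ acc s C, I i acc s C →
      Spec (body i acc) s fun a s' c => I (i + 1) a s' (C + c + 1)) (r i : ℕ) :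
    ∀ acc s C, i + r = n → I i acc s C →
      Spec (Comp.loop body r i acc) s fun a s' c => I n a s' (C + c - 1) ∧ 1 ≤ c := by
  induction r generalizing i with
  | zero =>
    intro acc s C hi h
    refine ⟨acc, s, 1, ⟨rfl, rfl, rfl⟩, ?_, le_rfl⟩
    simpa [← hi] using h
  | succ r ih =>
    intro acc s C hi h
    obtain ⟨a, s', c, h1, h2⟩ := hb i (by omega) acc s C h
    obtain ⟨a', s'', c', h3, h4, h5⟩ := ih (i + 1) a s' (C + c + 1) (by omega) h2
    refine ⟨a', s'', c + c' + 1, ⟨a, s', c, c', h1, h3, rfl⟩, ?_, by omega⟩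
    rwa [show C + (c + c' + 1) - 1 = C + c + 1 + c' - 1 by omega]

/-- The invariant rule for loops; the invariant may mention the total cost so far. -/
lemma foldN_cost {n a₀ : ℕ} {body : ℕ → ℕ → Comp ℕ} (I : ℕ → ℕ → Store → ℕ → Prop)
    (h0 : I 0 a₀ s 0) (hb : ∀ i < n, ∀ acc s C, I i acc s C →
      Spec (body i acc) s fun a s' c => I (i + 1) a s' (C + c + 1)) :
    Spec (Comp.foldN n a₀ body) s fun a s' c => I n a s' (c - 1) ∧ 1 ≤ c := by
  refine (loop_rule I hb n 0 a₀ s 0 (by omega) h0).mono ?_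
  intro a s' c h
  simpa using h

/-- The invariant rule for loops whose rounds have a common bound on their cost. -/
lemma foldN {n a₀ : ℕ} {body : ℕ → ℕ → Comp ℕ} (I : ℕ → ℕ → Store → Prop) (T : ℕ)
    (h0 : I 0 a₀ s) (hb : ∀ i < n, ∀ acc s, I i acc s →
      Spec (body i acc) s fun a s' c => I (i + 1) a s' ∧ c ≤ T) :
    Spec (Comp.foldN n a₀ body) s fun a s' c => I n a s' ∧ c ≤ n * (T + 1) + 1 := by
  refine (foldN_cost (fun i a s C => I i a s ∧ C ≤ i * (T + 1)) ⟨h0, by simp⟩ ?_).mono ?_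
  · rintro i hi acc s C ⟨h1, h2⟩
    refine (hb i hi acc s h1).mono ?_
    rintro a s' c ⟨h3, h4⟩
    refine ⟨h3, ?_⟩
    rw [Nat.succ_mul]; omega
  · rintro a s' c ⟨⟨h1, h2⟩, h3⟩
    exact ⟨h1, by omega⟩

end Spec

/-- The store `s'` differs from `s` only in the arrays of the list `W` and in the number of
admitted indices. -/
structure Frame (W : List Arr) (s s' : Store) : Prop where
  base : s'.base = s.base
  io : s'.io = s.io
  arr : ∀ b, b ∉ W → s'.arr b = s.arr b

namespace Frame

lemma refl (W : List Arr) (s : Store) : Frame W s s := ⟨rfl, rfl, fun _ _ => rfl⟩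

lemma trans {W s s' s''} (h : Frame W s s') (h' : Frame W s' s'') : Frame W s s'' :=
  ⟨h'.base.trans h.base, h'.io.trans h.io, fun b hb => (h'.arr b hb).trans (h.arr b hb)⟩

lemma mono {W W' s s'} (h : Frame W s s') (hW : ∀ b ∈ W, b ∈ W') : Frame W' s s' :=
  ⟨h.base, h.io, fun b hb => h.arr b fun hb' => hb (hW b hb')⟩

lemma set {W s s'} (h : Frame W s s') {b : Arr} (hb : b ∈ W) (i j v) : Frame W s (s'.set b i j v) :=
  ⟨h.base, h.io, fun b' hb' => by
    rw [Store.set_arr_ne _ (by rintro rfl; exact hb' hb), h.arr b' hb']⟩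

lemma grow {W s s'} (h : Frame W s s') : Frame W s s'.grow := ⟨h.base, h.io, h.arr⟩

end Frame

/-! ### Reading the input -/

namespace Spec

lemma growBy (B : ℕ) (s : Store) : Spec (Comp.growBy B 0) s fun _ s' c =>
    Frame [] s s' ∧ s'.lim = s.lim + B ∧ c ≤ 3 * B + 1 := by
  unfold Comp.growBy
  refine (foldN (fun i _ s' => Frame [] s s' ∧ s'.lim = s.lim + i) 2 ⟨.refl _ _, rfl⟩ ?_).mono ?_
  · rintro i hi acc s' ⟨h1, h2⟩
    simp only [bind_iff, grow_iff, pure_iff]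
    exact ⟨⟨h1.grow, by simp [h2]; ring⟩, by omega⟩
  · rintro _ s' c ⟨⟨h1, h2⟩, h3⟩
    exact ⟨h1, h2, by omega⟩

lemma loadCells (b : Arr) (f : ℕ → ℕ → ℕ) (L : List (ℕ × ℕ)) (s : Store)
    (h : ∀ x ∈ L, x.1 < s.lim ∧ x.2 < s.lim) : Spec (Comp.loadCells b f L) s fun _ s' c =>
      Frame [b] s s' ∧ s'.lim = s.lim ∧ (∀ x ∈ L, s'.arr b x.1 x.2 = f x.1 x.2) ∧
      (∀ i j, (i, j) ∉ L → s'.arr b i j = s.arr b i j) ∧ c ≤ 4 * L.length + 1 := by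
  induction L generalizing s with
  | nil =>
    simp only [Comp.loadCells, const_iff]
    exact ⟨.refl _ _, by simp, by simp, by simp, by simp⟩
  | cons x L ih =>
    obtain ⟨i, j⟩ := x
    simp only [Comp.loadCells, bind_iff, const_iff, wr_iff]
    have h0 := h _ List.mem_cons_self
    refine ⟨h0.1, h0.2, (ih (s.set b i j (f i j)) fun x hx => h x (List.mem_cons_of_mem _ hx)).mono ?_⟩
    rintro _ s' c ⟨h1, h2, h3, h4, h5⟩
    refine ⟨((Frame.refl [b] s).set (by simp) i j _).trans h1, h2, ?_, ?_, ?_⟩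
    · intro x hx
      by_cases hx' : x ∈ L
      · exact h3 x hx'
      · obtain rfl | hx := List.mem_cons.1 hx
        · rw [h4 _ _ hx']; simp
        · exact absurd hx hx'
    · intro i' j' hx
      rw [h4 _ _ fun hh => hx (List.mem_cons_of_mem _ hh), Store.set_arr_cell, if_neg]
      rintro ⟨rfl, rfl⟩; exact hx List.mem_cons_self
    · simp only [List.length_cons]; omega

lemma copyMatrix (b : Arr) (n p₀ : ℕ) (s : Store) (hn : n ≤ s.lim) (hp : p₀ + n * n ≤ s.base) :
    Spec (Comp.foldN n p₀ fun u p => Comp.foldN n p fun v p => do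
      let a ← Comp.ioRd p
      let _ ← Comp.wr b u v a
      Comp.add p 1) s fun p s' c =>
        p = p₀ + n * n ∧ Frame [b] s s' ∧ s'.lim = s.lim ∧
        (∀ u < n, ∀ v < n, s'.arr b u v = s.io (p₀ + u * n + v)) ∧ c ≤ n * (n * 4 + 2) + 1 := by
  refine (foldN (fun u p s' => p = p₀ + u * n ∧ Frame [b] s s' ∧ s'.lim = s.lim ∧
    ∀ u' < u, ∀ v < n, s'.arr b u' v = s.io (p₀ + u' * n + v)) (n * 4 + 1)
    ⟨by simp, .refl _ _, rfl, by simp⟩ ?_).mono ?_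
  · rintro u hu p s1 ⟨rfl, h1, h2, h3⟩
    refine (foldN (fun v p s' => p = p₀ + u * n + v ∧ Frame [b] s s' ∧ s'.lim = s.lim ∧
      (∀ u' < u, ∀ v < n, s'.arr b u' v = s.io (p₀ + u' * n + v)) ∧
      (∀ v' < v, s'.arr b u v' = s.io (p₀ + u * n + v'))) 3
      ⟨by simp, h1, h2, h3, by simp⟩ ?_).mono ?_
    · rintro v hv p s2 ⟨rfl, g1, g2, g3, g4⟩
      have hb : p₀ + u * n + v < s.base := by
        have : (u + 1) * n ≤ n * n := Nat.mul_le_mul_right _ hu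
        rw [Nat.succ_mul] at this; omega
      simp only [bind_iff, ioRd_iff, wr_iff, add_iff]
      refine ⟨by rwa [g1.base], by omega, by omega, ⟨by ring, g1.set (by simp) _ _ _, by simpa, ?_, ?_⟩,
        by omega⟩
      · intro u' hu' v' hv'
        rw [Store.set_arr_cell, if_neg (by omega), g3 u' hu' v' hv']
      · intro v' hv'
        rw [Store.set_arr_cell]
        split_ifs with h
        · rw [g1.io, h.2]
        · exact g4 v' (by omega)
    · rintro p s2 c ⟨⟨rfl, g1, g2, g3, g4⟩, g5⟩
      refine ⟨⟨by ring, g1, g2, ?_⟩, by omega⟩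
      intro u' hu' v hv
      obtain h | rfl := Nat.lt_succ_iff_lt_or_eq.1 hu'
      · exact g3 u' h v hv
      · exact g4 v hv
  · rintro p s1 c ⟨⟨rfl, h1, h2, h3⟩, h4⟩
    exact ⟨rfl, h1, h2, h3, h4⟩

lemma copyInput (n m : ℕ) (s : Store) (hn : n ≤ s.lim) (hm : m ≤ s.lim) (h0 : 0 < s.lim)
    (hb : 2 + n * n + m * m + n ≤ s.base) (lf : ℕ → ℕ)
    (hlf : ∀ v < n, s.io (2 + n * n + m * m + v) = lf v) (hlm : ∀ v < n, lf v < m)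
    (hlv : ∀ x, s.arr .lv 0 x = 0)
    (hinj : ∀ u < n, ∀ v < n, lf u = lf v → u = v) :
    Spec (Comp.copyInput n m 0 1 2) s fun _ s' c =>
      Frame [.adj, .tre, .lv] s s' ∧ s'.lim = s.lim ∧
      (∀ u < n, ∀ v < n, s'.arr .adj u v = s.io (2 + u * n + v)) ∧
      (∀ x < m, ∀ y < m, s'.arr .tre x y = s.io (2 + n * n + x * m + y)) ∧
      (∀ v < n, s'.arr .lv 0 (lf v) = v + 1) ∧
      (∀ x, (∀ v < n, lf v ≠ x) → s'.arr .lv 0 x = 0) ∧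
      c ≤ n * (n * 4 + 2) + m * (m * 4 + 2) + n * 5 + 3 := by
  unfold Comp.copyInput
  rw [bind_iff]
  refine (copyMatrix .adj n 2 s hn (by omega)).mono ?_
  rintro p s1 c1 ⟨rfl, a1, a2, a3, a4⟩
  rw [bind_iff]
  refine (copyMatrix .tre m _ s1 (by omega) (by rw [a1.base]; omega)).mono ?_
  rintro p s2 c2 ⟨rfl, b1, b2, b3, b4⟩
  refine (foldN (fun v p s' => p = 2 + n * n + m * m + v ∧ Frame [.lv] s2 s' ∧ s'.lim = s.lim ∧
    (∀ v' < v, s'.arr .lv 0 (lf v') = v' + 1) ∧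
    (∀ x, (∀ v < n, lf v ≠ x) → s'.arr .lv 0 x = 0)) 4
    ⟨by simp, .refl _ _, by omega, by simp, fun x _ => ?_⟩ ?_).mono ?_
  · rw [b1.arr _ (by decide), a1.arr _ (by decide), hlv]
  · rintro v hv p s3 ⟨rfl, g1, g2, g3, g4⟩
    have hio : s3.io (2 + n * n + m * m + v) = lf v := by rw [g1.io, b1.io, a1.io, hlf v hv]
    have := hlm v hv
    simp only [bind_iff, ioRd_iff, wr_iff, add_iff, hio]
    refine ⟨by rw [g1.base, b1.base, a1.base]; omega, by omega, by omega,
      ⟨by ring, g1.set (by simp) _ _ _, by simpa, ?_, ?_⟩, by omega⟩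
    · intro v' hv'
      rw [Store.set_arr_cell]
      split_ifs with h
      · rw [hinj v' (by omega) v hv h.2]
      · refine g3 v' ?_
        by_contra h'
        exact h ⟨rfl, by rw [show v' = v by omega]⟩
    · intro x hx
      rw [Store.set_arr_cell, if_neg (fun h => hx v hv h.2.symm), g4 x hx]
  · rintro p s3 c3 ⟨⟨rfl, g1, g2, g3, g4⟩, g5⟩
    refine ⟨((a1.mono (by simp)).trans (b1.mono (by simp))).trans (g1.mono (by simp)), g2, ?_, ?_, g3,
      g4, by omega⟩
    · intro u hu v hv
      rw [g1.arr _ (by decide), b1.arr _ (by decide), a3 u hu v hv]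
    · intro u hu v hv
      rw [g1.arr _ (by decide), b3 u hu v hv, a1.io]

/-! ### The rows of the signatures -/

lemma buildRows (k n : ℕ) (s : Store) (E : ℕ → ℕ → ℕ) (hN : 2 * (k * n) ≤ s.lim)
    (hn : n ≤ s.lim) (h0 : 0 < s.lim) (hE : ∀ u < n, ∀ v < n, s.arr .adj u v = E u v) :
    Spec (Comp.buildRows k n 0 1) s fun _ s' c =>
      Frame [.pu, .tr, .pt, .rel] s s' ∧ s'.lim = s.lim ∧
      (∀ j < k, ∀ u < n, ∀ e < 2, s'.arr .pu 0 (2 * (j * n + u) + e) = u ∧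
        s'.arr .tr 0 (2 * (j * n + u) + e) = j ∧ s'.arr .pt 0 (2 * (j * n + u) + e) = 2 * j + e ∧
        ∀ v < n, s'.arr .rel (2 * (j * n + u) + e) v = if e = 0 then E u v else E v u) ∧
      c ≤ k * (n * (n * 5 + 13) + 2) + 1 := by
  unfold Comp.buildRows
  -- the rows below the current one are complete
  let Done (s' : Store) (p : ℕ) : Prop := ∀ j < k, ∀ u < n, ∀ e < 2, 2 * (j * n + u) + e < p →
    s'.arr .pu 0 (2 * (j * n + u) + e) = u ∧ s'.arr .tr 0 (2 * (j * n + u) + e) = j ∧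
    s'.arr .pt 0 (2 * (j * n + u) + e) = 2 * j + e ∧
    ∀ v < n, s'.arr .rel (2 * (j * n + u) + e) v = if e = 0 then E u v else E v u
  refine (foldN (fun j p s' => p = 2 * (j * n) ∧ Frame [.pu, .tr, .pt, .rel] s s' ∧
    s'.lim = s.lim ∧ Done s' p) (n * (n * 5 + 13) + 1) ⟨by simp, .refl _ _, rfl, by simp [Done]⟩ ?_).mono ?_
  · rintro j hj p s1 ⟨rfl, h1, h2, h3⟩
    have hjn : (j + 1) * n ≤ k * n := Nat.mul_le_mul_right _ hj
    rw [Nat.succ_mul] at hjn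
    refine (foldN (fun u p s' => p = 2 * (j * n + u) ∧ Frame [.pu, .tr, .pt, .rel] s s' ∧
      s'.lim = s.lim ∧ Done s' p) (n * 5 + 12) ⟨by simp, h1, h2, h3⟩ ?_).mono ?_
    · rintro u hu p s2 ⟨rfl, g1, g2, g3⟩
      simp only [bind_iff, wr_iff, add_iff, Store.set_lim, g2]
      iterate 6 refine ⟨by omega, by omega, ?_⟩
      set s3 := ((((((s2.set .pu 0 (2 * (j * n + u)) u).set .pu 0 (2 * (j * n + u) + 1) u).set .tr 0
        (2 * (j * n + u)) j).set .tr 0 (2 * (j * n + u) + 1) j).set .pt 0 (2 * (j * n + u))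
        (j + j)).set .pt 0 (2 * (j * n + u) + 1) (j + j + 1)) with hs3
      have f3 : Frame [.pu, .tr, .pt, .rel] s s3 := by
        simp only [hs3]
        iterate 6 refine Frame.set ?_ (by decide) _ _ _
        exact g1
      refine (foldN (fun v _ s' => Frame [.pu, .tr, .pt, .rel] s s' ∧ Frame [.rel] s3 s' ∧
        s'.lim = s.lim ∧
        (∀ p < 2 * (j * n + u), s'.arr .rel p = s3.arr .rel p) ∧
        ∀ v' < v, s'.arr .rel (2 * (j * n + u)) v' = E u v' ∧
          s'.arr .rel (2 * (j * n + u) + 1) v' = E v' u) 4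
          ⟨f3, .refl _ _, by simp [hs3, g2], fun _ _ => rfl, by simp⟩ ?_).mono ?_
      · rintro v hv _ s4 ⟨e0, e1, e2, e3, e4⟩
        simp only [bind_iff, wr_iff, rd_iff, Store.set_lim, e2]
        refine ⟨by omega, by omega, by omega, by omega, by omega, by omega, by omega, by omega,
          ⟨(e0.set (by decide) _ _ _).set (by decide) _ _ _,
          (e1.set (by simp) _ _ _).set (by simp) _ _ _, by simp, ?_, ?_⟩, by omega⟩
        · intro p hp
          funext v'
          rw [Store.set_arr_cell, if_neg (by omega), Store.set_arr_cell, if_neg (by omega), e3 p hp]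
        · intro v' hv'
          have x1 : s4.arr .adj u v = E u v := by rw [e0.arr _ (by decide), hE u hu v hv]
          have x2 : s4.arr .adj v u = E v u := by rw [e0.arr _ (by decide), hE v hv u hu]
          simp only [ne_eq, reduceCtorEq, not_false_eq_true, Store.set_arr_ne, x1, x2]
          simp only [Store.set_arr_cell]
          by_cases h : v' = v
          · subst h; simp
          · simpa [h] using e4 v' (by omega)
      · rintro _ s4 c ⟨⟨e0, e1, e2, e3, e4⟩, e5⟩
        refine ⟨⟨by ring, e0, by omega, ?_⟩, by omega⟩
        intro j' hj' u' hu' e he hlt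
        rw [e1.arr _ (by decide), e1.arr _ (by decide), e1.arr _ (by decide)]
        by_cases hp : 2 * (j' * n + u') + e < 2 * (j * n + u)
        · obtain ⟨i1, i2, i3, i4⟩ := g3 j' hj' u' hu' e he hp
          have z1 : 2 * (j' * n + u') + e ≠ 2 * (j * n + u) := by omega
          have z2 : 2 * (j' * n + u') + e ≠ 2 * (j * n + u) + 1 := by omega
          rw [e3 _ hp]
          simp only [hs3, ne_eq, reduceCtorEq, not_false_eq_true, Store.set_arr_ne, Store.set_arr_cell,
            z1, z2, and_false, if_false]
          exact ⟨i1, i2, i3, i4⟩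
        · have hdiv : j' * n + u' = j * n + u := by omega
          have hju : j' = j ∧ u' = u := by
            have q1 : (j' * n + u') / n = j' := by
              rw [mul_comm, Nat.mul_add_div (by omega), Nat.div_eq_of_lt hu', add_zero]
            have q2 : (j * n + u) / n = j := by
              rw [mul_comm, Nat.mul_add_div (by omega), Nat.div_eq_of_lt hu, add_zero]
            have : j' = j := by rw [← q1, hdiv, q2]
            subst this
            exact ⟨rfl, by omega⟩
          obtain ⟨rfl, rfl⟩ := hju
          obtain rfl | rfl : e = 0 ∨ e = 1 := by omega
          · simp [hs3, Store.set_arr_cell]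
            refine ⟨by ring, fun v hv => (e4 v hv).1⟩
          · simp [hs3]
            refine ⟨by ring, fun v hv => (e4 v hv).2⟩
    · rintro p s2 c ⟨⟨rfl, g1, g2, g3⟩, g4⟩
      have : (j + 1) * n = j * n + n := by ring
      exact ⟨⟨by rw [this], g1, g2, g3⟩, by omega⟩
  · rintro p s1 c ⟨⟨rfl, h1, h2, h3⟩, h4⟩
    refine ⟨h1, h2, fun j hj u hu e he => h3 j hj u hu e he ?_, by omega⟩
    have hjn : (j + 1) * n ≤ k * n := Nat.mul_le_mul_right _ hj
    rw [Nat.succ_mul] at hjn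
    omega

end Spec

/-! ### Listing the edges of the tree -/

open Classical in
/-- What the algorithm needs to know of a branch decomposition, with numbers for the nodes and the
vertices: adjacency in the tree, the array `lv` of leaves (one more than the vertex of a leaf, and
`0` for an internal node), the sides of the cuts, and a size by which the sides are ordered. -/
structure TreeData (n m : ℕ) where
  adj : ℕ → ℕ → Prop
  lv : ℕ → ℕ
  side : ℕ → ℕ → Finset ℕ
  size : ℕ → ℕ → ℕ
  symm : ∀ {x y}, adj x y → adj y x
  lt : ∀ {x y}, adj x y → x < m
  size_pos : ∀ {x y}, adj x y → 0 < size x y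
  size_le : ∀ {x y}, adj x y → size x y ≤ m
  size_lt : ∀ {x y z}, adj x y → adj x z → z ≠ y → size z x < size x y
  degree : ∀ {x y}, adj x y → (lv x ≠ 0 ∧ ∀ z, adj x z → z = y) ∨
    (lv x = 0 ∧ ∃ z z', z ≠ y ∧ z' ≠ y ∧ z ≠ z' ∧ ∀ w, adj x w ↔ w = y ∨ w = z ∨ w = z')
  nonempty : ∃ x y, adj x y
  side_leaf : ∀ {x y}, adj x y → lv x ≠ 0 → lv x - 1 < n ∧ side x y = {lv x - 1}
  side_join : ∀ {x y z z'}, adj x y → adj x z → adj x z' → z ≠ y → z' ≠ y → z ≠ z' →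
    side x y = side z x ∪ side z' x ∧ Disjoint (side z x) (side z' x)
  side_compl : ∀ {x y}, adj x y → side y x = Finset.range n \ side x y
  side_subset : ∀ {x y}, adj x y → side x y ⊆ Finset.range n

namespace TreeData

variable {n m : ℕ} (T : TreeData n m)

lemma lt' {x y} (h : T.adj x y) : y < m := T.lt (T.symm h)

open Classical in
lemma degree_le (x Y : ℕ) : ((Finset.range Y).filter fun y => T.adj x y).card ≤ 3 := by
  by_cases h : ∃ y, T.adj x y
  · obtain ⟨y, hy⟩ := h
    obtain ⟨_, h1⟩ | ⟨_, z, z', _, _, _, h1⟩ := T.degree hy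
    · refine (Finset.card_le_card (t := {y}) fun w hw => ?_).trans (by simp)
      simpa using h1 w (Finset.mem_filter.1 hw).2
    · refine (Finset.card_le_card (t := {y, z, z'}) fun w hw => ?_).trans Finset.card_le_three
      simpa using (h1 w).1 (Finset.mem_filter.1 hw).2
  · push Not at h
    simp [h]

/-- The state of the list of edges: the first `l` entries of the arrays `ex` and `ey` are distinct
edges in topological order, the array `pos` holds their positions plus one, and the arrays `pa` and
`pb` hold the positions of the two edges that an edge with internal tail depends on. -/
structure Listed (s : Store) (l : ℕ) : Prop where
  adj : ∀ i < l, T.adj (s.arr .ex 0 i) (s.arr .ey 0 i)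
  pos : ∀ i < l, s.arr .pos (s.arr .ex 0 i) (s.arr .ey 0 i) = i + 1
  lf : ∀ i < l, s.arr .lf 0 i = T.lv (s.arr .ex 0 i)
  join : ∀ i < l, T.lv (s.arr .ex 0 i) = 0 → s.arr .pa 0 i < i ∧ s.arr .pb 0 i < i ∧
    s.arr .ey 0 (s.arr .pa 0 i) = s.arr .ex 0 i ∧ s.arr .ey 0 (s.arr .pb 0 i) = s.arr .ex 0 i ∧
    s.arr .ex 0 (s.arr .pa 0 i) ≠ s.arr .ey 0 i ∧ s.arr .ex 0 (s.arr .pb 0 i) ≠ s.arr .ey 0 i ∧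
    s.arr .ex 0 (s.arr .pa 0 i) ≠ s.arr .ex 0 (s.arr .pb 0 i)
  of_pos : ∀ x y, s.arr .pos x y ≠ 0 → s.arr .pos x y - 1 < l ∧
    s.arr .ex 0 (s.arr .pos x y - 1) = x ∧ s.arr .ey 0 (s.arr .pos x y - 1) = y

variable {T}

open Classical in
/-- There are at most `3 m` directed edges, since the degrees are at most `3`. -/
lemma Listed.le {s : Store} {l : ℕ} (h : T.Listed s l) : l ≤ 3 * m := by
  have h1 : (Finset.range l).card ≤
      ((Finset.range m).sigma fun x => (Finset.range m).filter fun y => T.adj x y).card := by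
    refine Finset.card_le_card_of_injOn (fun i => ⟨s.arr .ex 0 i, s.arr .ey 0 i⟩) ?_ ?_
    · intro i hi
      have := h.adj i (by simpa using hi)
      simp [T.lt this, T.lt' this, this]
    · intro i hi j hj hij
      simp only [Sigma.mk.injEq, heq_eq_eq] at hij
      have hi := h.pos i (by simpa using hi)
      have hj := h.pos j (by simpa using hj)
      rw [hij.1, hij.2] at hi
      omega
  rw [Finset.card_range, Finset.card_sigma] at h1
  refine h1.trans ((Finset.sum_le_card_nsmul _ _ 3 fun x _ => T.degree_le x m).trans ?_)
  simp [mul_comm]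

end TreeData

namespace Spec

open Classical in
/-- If no edge into `x` is pending, and there are two of them apart from the one from `y`, then `pa` and
`pb` hold the positions of two distinct ones. -/
lemma countPending {n m : ℕ} {T : TreeData n m} {x y l : ℕ} (hx : x < m) (s : Store)
    (hm : m ≤ s.lim) (h0 : 0 < s.lim) (hl : l < s.lim)
    (ht : ∀ x < m, ∀ y < m, s.arr .tre x y = 0 ↔ ¬ T.adj x y) :
    Spec (Comp.countPending m 0 1 x y l) s fun c s' t => Frame [.pa, .pb] s s' ∧ s'.lim = s.lim ∧
      (∀ i, i ≠ l → s'.arr .pa 0 i = s.arr .pa 0 i ∧ s'.arr .pb 0 i = s.arr .pb 0 i) ∧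
      ((∀ z, T.adj x z → z ≠ y → s.arr .pos z x ≠ 0) → c = 0) ∧
      (c = 0 → (∀ z, T.adj x z → z ≠ y → s.arr .pos z x ≠ 0) ∧
        (∀ z z', T.adj x z → T.adj x z' → z ≠ y → z' ≠ y → z ≠ z' →
        ∃ w w', T.adj x w ∧ T.adj x w' ∧ w ≠ y ∧ w' ≠ y ∧ w ≠ w' ∧
          s'.arr .pa 0 l = s.arr .pos w x - 1 ∧ s'.arr .pb 0 l = s.arr .pos w' x - 1)) ∧
      t ≤ m * 14 + 1 := by
  unfold Comp.countPending
  let F (Z : ℕ) := (Finset.range Z).filter fun z => T.adj x z ∧ z ≠ y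
  have hF : ∀ Z, ¬ (T.adj x Z ∧ Z ≠ y) → F (Z + 1) = F Z := fun Z hZ => by
    simp only [F, Finset.range_add_one, Finset.filter_insert, if_neg hZ]
  have hF' : ∀ Z, T.adj x Z ∧ Z ≠ y → F (Z + 1) = insert Z (F Z) := fun Z hZ => by
    simp only [F, Finset.range_add_one, Finset.filter_insert, if_pos hZ]
  have hFn : ∀ Z, Z ∉ F Z := fun Z => by simp [F]
  refine (foldN (fun Z c s' => Frame [.pa, .pb] s s' ∧ s'.lim = s.lim ∧
      (∀ i, i ≠ l → s'.arr .pa 0 i = s.arr .pa 0 i ∧ s'.arr .pb 0 i = s.arr .pb 0 i) ∧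
      ((∀ z ∈ F Z, s.arr .pos z x ≠ 0) → c = 0) ∧
      (c = 0 → (∀ z ∈ F Z, s.arr .pos z x ≠ 0) ∧
        (1 ≤ (F Z).card → ∃ w ∈ F Z, s'.arr .pa 0 l = s.arr .pos w x - 1) ∧
        (2 ≤ (F Z).card → ∃ w ∈ F Z, ∃ w' ∈ F Z, w ≠ w' ∧
          s'.arr .pa 0 l = s.arr .pos w x - 1 ∧ s'.arr .pb 0 l = s.arr .pos w' x - 1))) 13
    ⟨.refl _ _, rfl, fun _ _ => ⟨rfl, rfl⟩, by simp, by simp [F]⟩ ?_).mono ?_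
  · rintro Z hZ c s' ⟨h1, h2, h3, h4, h5⟩
    have e1 : s'.arr .tre = s.arr .tre := h1.arr _ (by decide)
    have e2 : s'.arr .pos = s.arr .pos := h1.arr _ (by decide)
    simp only [bind_iff, rd_iff, e1, e2, h2, ifEq_iff, ht x hx Z hZ]
    refine ⟨by omega, by omega, ?_⟩
    by_cases hadj : T.adj x Z
    swap
    · rw [if_pos hadj, pure_iff, hF Z (fun h => hadj h.1)]
      exact ⟨⟨h1, h2, h3, h4, h5⟩, by omega⟩
    rw [if_neg (not_not.2 hadj)]
    by_cases hy : Z = y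
    · rw [if_pos hy, pure_iff, hF Z (fun h => h.2 hy)]
      exact ⟨⟨h1, h2, h3, h4, h5⟩, by omega⟩
    rw [if_neg hy]
    have hZF := hF' Z ⟨hadj, hy⟩
    refine ⟨by omega, by omega, ?_⟩
    rw [hZF]
    split_ifs with hpos
    · rw [add_iff]
      refine ⟨⟨h1, h2, h3, fun h => absurd hpos (h Z (by simp)), by omega⟩, by omega⟩
    · simp only [wr_iff, sub_iff, pure_iff, h2, Store.set_lim]
      refine ⟨by omega, by omega, by omega, by omega, by omega, by omega,
        ⟨(h1.set (by simp) _ _ _).set (by simp) _ _ _, trivial, ?_, ?_, ?_⟩, by omega⟩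
      · intro i hi
        simpa [Store.set_arr_cell, hi] using h3 i hi
      · intro h
        exact h4 fun z hz => h z (by simp [hz])
      · intro hc
        obtain ⟨g1, g2, g3⟩ := h5 hc
        refine ⟨?_, fun _ => ⟨Z, by simp, by simp⟩, fun hcard => ?_⟩
        · simp only [Finset.mem_insert]
          rintro z (rfl | hz)
          · exact hpos
          · exact g1 z hz
        · rw [Finset.card_insert_of_notMem (hFn Z)] at hcard
          obtain ⟨w, hw, hw'⟩ := g2 (by omega)
          refine ⟨Z, by simp, w, by simp [hw], ?_, by simp, by simp [hw']⟩
          rintro rfl; exact hFn _ hw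
  · rintro c s' t ⟨⟨h1, h2, h3, h4, h5⟩, h6⟩
    have hmem : ∀ z, z ∈ F m ↔ T.adj x z ∧ z ≠ y := fun z => by
      simp only [F, Finset.mem_filter, Finset.mem_range, and_iff_right_iff_imp, and_imp]
      intro h _; exact T.lt' h
    simp only [hmem] at h4 h5
    refine ⟨h1, h2, h3, fun h => h4 fun z hz => h z hz.1 hz.2, fun hc => ?_, by omega⟩
    obtain ⟨g1, g2, g3⟩ := h5 hc
    refine ⟨fun z hz hz' => g1 z ⟨hz, hz'⟩, fun z z' a1 a2 a3 a4 a5 => ?_⟩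
    have : 2 ≤ (F m).card := Finset.one_lt_card.2
      ⟨z, (hmem _).2 ⟨a1, a3⟩, z', (hmem _).2 ⟨a2, a4⟩, a5⟩
    obtain ⟨w, hw, w', hw', b1, b2, b3⟩ := g3 this
    exact ⟨w, w', hw.1, hw'.1, hw.2, hw'.2, b1, b2, b3⟩

open Classical in
/-- The bound on the cost distinguishes the edges from the other pairs: there are `m ^ 2` pairs, but only
linearly many edges. -/
lemma tryEdge {n m : ℕ} {T : TreeData n m} {x y l : ℕ} (hx : x < m) (hy : y < m) (s : Store)
    (h0 : 0 < s.lim) (hm : 3 * m < s.lim)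
    (ht : ∀ x < m, ∀ y < m, s.arr .tre x y = 0 ↔ ¬ T.adj x y) (hv : ∀ x < m, s.arr .lv 0 x = T.lv x)
    (hL : T.Listed s l) :
    Spec (Comp.tryEdge m 0 1 x y l) s fun l' s' t =>
      Frame [.pos, .ex, .ey, .lf, .pa, .pb] s s' ∧ s'.lim = s.lim ∧ T.Listed s' l' ∧
      (∀ x' y', s.arr .pos x' y' ≠ 0 → s'.arr .pos x' y' ≠ 0) ∧
      (T.adj x y → (∀ z, T.adj x z → z ≠ y → s.arr .pos z x ≠ 0) → s'.arr .pos x y ≠ 0) ∧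
      t ≤ 3 + if T.adj x y then m * 14 + 15 else 0 := by
  unfold Comp.tryEdge
  have hl := hL.le
  simp only [bind_iff, rd_iff, ifEq_iff, ht x hx y hy, pure_iff]
  refine ⟨by omega, by omega, ?_⟩
  by_cases hadj : T.adj x y
  swap
  · rw [if_pos hadj]
    exact ⟨.refl _ _, by simp, hL, fun _ _ h => h, fun h => absurd h hadj, by omega⟩
  rw [if_neg (not_not.2 hadj), if_pos hadj]
  refine ⟨by omega, by omega, ?_⟩
  by_cases hpos : s.arr .pos x y = 0
  swap
  · rw [if_neg hpos]
    exact ⟨.refl _ _, by simp, hL, fun _ _ h => h, fun _ _ => hpos, by omega⟩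
  rw [if_pos hpos]
  refine ((countPending (T := T) (y := y) (l := l) hx s (by omega) h0 (by omega) ht).mono ?_)
  rintro c s1 t ⟨a1, a2, a3, a4, a5, a6⟩
  have hS : T.Listed s1 l := by
    have e1 : s1.arr .ex = s.arr .ex := a1.arr _ (by decide)
    have e2 : s1.arr .ey = s.arr .ey := a1.arr _ (by decide)
    have e3 : s1.arr .pos = s.arr .pos := a1.arr _ (by decide)
    have e4 : s1.arr .lf = s.arr .lf := a1.arr _ (by decide)
    constructor
    · simpa only [e1, e2] using hL.adj
    · simpa only [e1, e2, e3] using hL.pos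
    · simpa only [e1, e4] using hL.lf
    · intro i hi hlv
      rw [(a3 i (by omega)).1, (a3 i (by omega)).2]
      simp only [e1, e2] at hlv ⊢
      exact hL.join i hi hlv
    · simpa only [e1, e2, e3] using hL.of_pos
  have e3 : s1.arr .pos = s.arr .pos := a1.arr _ (by decide)
  split_ifs with hc
  swap
  · refine ⟨a1.mono (by decide), a2, hS, fun x' y' h => by rwa [e3], fun _ h => absurd (a4 h) hc, by omega⟩
  obtain ⟨b1, b2⟩ := a5 hc
  simp only [wr_iff, add_iff, Store.set_lim, a2]
  refine ⟨by omega, by omega, by omega, by omega, by omega, by omega, by omega, by omega, by omega,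
    by omega, ?_⟩
  have e5 : s1.arr .lv 0 x = T.lv x := by rw [a1.arr _ (by decide), hv x hx]
  rw [e5]
  refine ⟨?_, trivial, ?_, ?_, ?_, by omega⟩
  · iterate 4 refine Frame.set ?_ (by decide) _ _ _
    exact a1.mono (by decide)
  · have hne : ∀ i < l, ¬ (s1.arr .ex 0 i = x ∧ s1.arr .ey 0 i = y) := by
      rintro i hi ⟨rfl, rfl⟩
      have := hS.pos i hi
      rw [e3] at this
      omega
    constructor
    · intro i hi
      simp only [ne_eq, reduceCtorEq, not_false_eq_true, Store.set_arr_ne, Store.set_arr_cell, true_and]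
      by_cases h : i = l
      · simp [h, hadj]
      · simpa [h] using hS.adj i (by omega)
    · intro i hi
      simp only [ne_eq, reduceCtorEq, not_false_eq_true, Store.set_arr_ne, Store.set_arr_cell, true_and]
      by_cases h : i = l
      · simp [h]
      · simp only [h, if_false]
        rw [if_neg (hne i (by omega))]
        exact hS.pos i (by omega)
    · intro i hi
      simp only [ne_eq, reduceCtorEq, not_false_eq_true, Store.set_arr_ne, Store.set_arr_cell, true_and]
      by_cases h : i = l
      · simp [h]
      · simpa [h] using hS.lf i (by omega)
    · intro i hi
      simp only [ne_eq, reduceCtorEq, not_false_eq_true, Store.set_arr_ne, Store.set_arr_cell, true_and]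
      by_cases h : i = l
      · subst h
        simp only [if_true]
        intro hlv
        obtain ⟨h', _⟩ | ⟨_, z, z', z1, z2, z3, z4⟩ := T.degree hadj
        · exact absurd hlv h'
        obtain ⟨w, w', c1, c2, c3, c4, c5, c6, c7⟩ := b2 z z' ((z4 z).2 (by simp)) ((z4 z').2 (by simp)) z1 z2 z3
        have d1 := hS.of_pos w x (by rw [e3]; exact b1 w c1 c3)
        have d2 := hS.of_pos w' x (by rw [e3]; exact b1 w' c2 c4)
        rw [e3] at d1 d2
        rw [← c6] at d1
        rw [← c7] at d2
        rw [if_neg (by omega), if_neg (by omega), if_neg (by omega), if_neg (by omega), d1.2.1, d1.2.2,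
          d2.2.1, d2.2.2]
        exact ⟨d1.1, d2.1, rfl, rfl, c3, c4, c5⟩
      · simp only [h, if_false]
        intro hlv
        have hj := hS.join i (by omega) hlv
        rw [if_neg (by omega), if_neg (by omega), if_neg (by omega), if_neg (by omega)]
        exact hj
    · intro x' y'
      simp only [ne_eq, reduceCtorEq, not_false_eq_true, Store.set_arr_ne, Store.set_arr_cell, true_and]
      by_cases h : x' = x ∧ y' = y
      · simp [h]
      · simp only [h, if_false]
        intro hp
        have := hS.of_pos x' y' hp
        rw [if_neg (by omega), if_neg (by omega)]
        exact ⟨by omega, this.2⟩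
  · intro x' y' h
    rw [Store.set_arr_cell]
    split_ifs
    · omega
    · simpa [e3] using h
  · intro _ _
    rw [Store.set_arr_cell]; simp

open Classical in
/-- After `r` rounds, all edges whose side has size at most `r` are listed. -/
lemma listEdges {n m : ℕ} {T : TreeData n m} (s : Store) (h0 : 0 < s.lim) (hm : 3 * m < s.lim)
    (ht : ∀ x < m, ∀ y < m, s.arr .tre x y = 0 ↔ ¬ T.adj x y) (hv : ∀ x < m, s.arr .lv 0 x = T.lv x)
    (hpos : ∀ x y, s.arr .pos x y = 0) :
    Spec (Comp.listEdges m 0 1) s fun l s' t =>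
      Frame [.pos, .ex, .ey, .lf, .pa, .pb] s s' ∧ s'.lim = s.lim ∧ T.Listed s' l ∧
      (∀ x y, T.adj x y → s'.arr .pos x y ≠ 0) ∧ t ≤ m * (m * (m * 46 + 47) + 2) + 1 := by
  unfold Comp.listEdges
  have step : ∀ x < m, ∀ y < m, ∀ l s', Frame [.pos, .ex, .ey, .lf, .pa, .pb] s s' → s'.lim = s.lim →
      T.Listed s' l → Spec (Comp.tryEdge m 0 1 x y l) s' fun l' s'' t =>
      Frame [.pos, .ex, .ey, .lf, .pa, .pb] s s'' ∧ s''.lim = s.lim ∧ T.Listed s'' l' ∧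
      (∀ x' y', s'.arr .pos x' y' ≠ 0 → s''.arr .pos x' y' ≠ 0) ∧
      (T.adj x y → (∀ z, T.adj x z → z ≠ y → s'.arr .pos z x ≠ 0) → s''.arr .pos x y ≠ 0) ∧
      t ≤ 3 + if T.adj x y then m * 14 + 15 else 0 := by
    intro x hx y hy l s' a1 a2 a3
    refine (tryEdge (T := T) hx hy s' (by omega) (by omega) ?_ ?_ a3).mono ?_
    · rw [a1.arr _ (by decide)]; exact ht
    · rw [a1.arr _ (by decide)]; exact hv
    · rintro l' s'' t ⟨b1, b2, b3, b4, b5, b6⟩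
      exact ⟨a1.trans b1, b2.trans a2, b3, b4, b5, b6⟩
  refine (foldN (fun r l s' => Frame [.pos, .ex, .ey, .lf, .pa, .pb] s s' ∧ s'.lim = s.lim ∧
    T.Listed s' l ∧ ∀ x y, T.adj x y → T.size x y ≤ r → s'.arr .pos x y ≠ 0) (m * (m * 46 + 47) + 1)
    ⟨.refl _ _, rfl, ⟨by simp, by simp, by simp, by simp, by simp [hpos]⟩, ?_⟩ ?_).mono ?_
  · intro x y h h'
    have := T.size_pos h
    omega
  · rintro r hr l s1 ⟨a1, a2, a3, a4⟩
    refine (foldN (fun X l s' => Frame [.pos, .ex, .ey, .lf, .pa, .pb] s s' ∧ s'.lim = s.lim ∧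
      T.Listed s' l ∧ (∀ x y, T.adj x y → T.size x y ≤ r → s'.arr .pos x y ≠ 0) ∧
      (∀ x y, x < X → T.adj x y → T.size x y ≤ r + 1 → s'.arr .pos x y ≠ 0)) (m * 46 + 46)
      ⟨a1, a2, a3, a4, by simp⟩ ?_).mono ?_
    · rintro X hX l s2 ⟨b1, b2, b3, b4, b5⟩
      refine (foldN_cost (fun Y l s' C => Frame [.pos, .ex, .ey, .lf, .pa, .pb] s s' ∧
        s'.lim = s.lim ∧
        T.Listed s' l ∧ (∀ x y, T.adj x y → T.size x y ≤ r → s'.arr .pos x y ≠ 0) ∧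
        (∀ x y, x < X → T.adj x y → T.size x y ≤ r + 1 → s'.arr .pos x y ≠ 0) ∧
        (∀ y < Y, T.adj X y → T.size X y ≤ r + 1 → s'.arr .pos X y ≠ 0) ∧
        C ≤ Y * 4 + ((Finset.range Y).filter fun y => T.adj X y).card * (m * 14 + 15))
        ⟨b1, b2, b3, b4, b5, by simp, by simp⟩ ?_).mono ?_
      · rintro Y hY l s3 C ⟨c1, c2, c3, c4, c5, c6, c7⟩
        refine (step X hX Y hY l s3 c1 c2 c3).mono ?_
        rintro l' s4 t ⟨d1, d2, d3, d4, d5, d6⟩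
        refine ⟨d1, d2, d3, fun x y h h' => d4 _ _ (c4 x y h h'),
          fun x y hx h h' => d4 _ _ (c5 x y hx h h'), ?_, ?_⟩
        · intro y hy h h'
          obtain hy | rfl := Nat.lt_succ_iff_lt_or_eq.1 hy
          · exact d4 _ _ (c6 y hy h h')
          · refine d5 h fun z hz hne => c4 z X (T.symm hz) ?_
            have := T.size_lt h hz hne
            omega
        · rw [Finset.range_add_one, Finset.filter_insert]
          split_ifs at d6 ⊢ with h
          · rw [Finset.card_insert_of_notMem (by simp), add_one_mul (Finset.card _)]; omega
          · omega
      · rintro l' s3 t ⟨⟨c1, c2, c3, c4, c5, c6, c7⟩, c8⟩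
        refine ⟨⟨c1, c2, c3, c4, ?_⟩, ?_⟩
        · intro x y hx h h'
          obtain hx | rfl := Nat.lt_succ_iff_lt_or_eq.1 hx
          · exact c5 x y hx h h'
          · exact c6 y (T.lt' h) h h'
        · have := Nat.mul_le_mul_right (m * 14 + 15) (T.degree_le X m)
          omega
    · rintro l' s2 t ⟨⟨b1, b2, b3, b4, b5⟩, b6⟩
      exact ⟨⟨b1, b2, b3, fun x y h h' => b5 x y (T.lt h) h h'⟩, by omega⟩
  · rintro l' s1 t ⟨⟨a1, a2, a3, a4⟩, a5⟩
    exact ⟨a1, a2, a3, fun x y h => a4 x y h (T.size_le h), by omega⟩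

lemma linkReverse {n m : ℕ} {T : TreeData n m} (l : ℕ) (s : Store) (h0 : 0 < s.lim) (hm : 3 * m < s.lim)
    (hL : T.Listed s l) (hA : ∀ x y, T.adj x y → s.arr .pos x y ≠ 0) :
    Spec (Comp.linkReverse l 0 1) s fun _ s' t => Frame [.rev] s s' ∧ s'.lim = s.lim ∧
      (∀ i < l, s'.arr .rev 0 i < l ∧ s.arr .ex 0 (s'.arr .rev 0 i) = s.arr .ey 0 i ∧
        s.arr .ey 0 (s'.arr .rev 0 i) = s.arr .ex 0 i) ∧ t ≤ l * 6 + 1 := by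
  have hl := hL.le
  unfold Comp.linkReverse
  refine (foldN (fun i _ s' => Frame [.rev] s s' ∧ s'.lim = s.lim ∧
    ∀ j < i, s'.arr .rev 0 j < l ∧ s.arr .ex 0 (s'.arr .rev 0 j) = s.arr .ey 0 j ∧
        s.arr .ey 0 (s'.arr .rev 0 j) = s.arr .ex 0 j) 5 ⟨.refl _ _, rfl, by simp⟩ ?_).mono ?_
  · rintro i hi _ s1 ⟨a1, a2, a3⟩
    have hadj := hL.adj i hi
    have := T.lt hadj
    have := T.lt' hadj
    have e1 : s1.arr .ex = s.arr .ex := a1.arr _ (by decide)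
    have e2 : s1.arr .ey = s.arr .ey := a1.arr _ (by decide)
    have e3 : s1.arr .pos = s.arr .pos := a1.arr _ (by decide)
    have hp := hL.of_pos _ _ (hA _ _ (T.symm hadj))
    simp only [bind_iff, rd_iff, wr_iff, sub_iff, a2, e1, e2, e3]
    refine ⟨by omega, by omega, by omega, by omega, by omega, by omega, by omega, by omega,
      ⟨a1.set (by simp) _ _ _, by simpa using a2, ?_⟩, by omega⟩
    intro j hj
    simp only [Store.set_arr_cell, true_and]
    by_cases h : j = i
    · subst h; simpa using hp
    · simpa [h] using a3 j (by omega)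
  · rintro _ s1 t ⟨⟨a1, a2, a3⟩, a4⟩
    exact ⟨a1, a2, a3, by omega⟩

end Spec

/-! ### Signatures of colourings -/

/-- A colouring problem as the dynamic programming algorithm sees it. The rows `p < N` stand for the
neighbourhood counts that matter: row `p` belongs to the vertex `pu p` and counts the vertices `v` of
colour `tr p` with `R p v = 1`. A vertex of colour `c` tolerates the count `x` in its row `p` if
`ok c p (min d x)`; the colouring is to minimize the sum of the weights `wt` of the colours. -/
structure Problem where
  n : ℕ
  N : ℕ
  q : ℕ
  d : ℕ
  pu : ℕ → ℕ
  tr : ℕ → ℕ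
  R : ℕ → ℕ → ℕ
  ok : ℕ → ℕ → ℕ → Prop
  wt : ℕ → ℕ
  d_pos : 1 ≤ d
  R_le : ∀ p v, R p v ≤ 1
  pu_lt : ∀ p < N, pu p < n

namespace Problem

variable (I : Problem)

/-- Only colours below `q` are used. All vertices are coloured, also those outside of the set under
consideration. -/
def Valid (col : ℕ → ℕ) : Prop := ∀ v, col v < I.q

/-- The count of row `p`, restricted to the vertices of `A`. -/
def cnt (A : Finset ℕ) (col : ℕ → ℕ) (p : ℕ) : ℕ := ∑ v ∈ A, if col v = I.tr p then I.R p v else 0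

/-- The signature of a colouring of `A`: the counts, capped at `d`, in the rows of the vertices
outside `A`; in the rows of the vertices of `A` there is the mark `d + 1`. -/
def sig (A : Finset ℕ) (col : ℕ → ℕ) (p : ℕ) : ℕ :=
  if I.pu p ∈ A then I.d + 1 else min I.d (I.cnt A col p)

/-- The signature of a disjoint union, entry by entry. -/
def jn (a b : ℕ) : ℕ := if I.d < a then I.d + 1 else if I.d < b then I.d + 1 else min I.d (a + b)

/-- At most `W` signatures of colourings of `A` are pairwise distinct. The signatures come as a sequence,
as in the lists that the algorithm makes. -/
def SigBound (A : Finset ℕ) (W : ℕ) : Prop := ∀ (k : ℕ) (c : ℕ → ℕ → ℕ), (∀ a < k, I.Valid (c a)) →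
  (∀ a b, a < b → b < k → ∃ p < I.N, I.sig A (c a) p ≠ I.sig A (c b) p) → k ≤ W

variable {I}

lemma cnt_congr {A : Finset ℕ} {col col' : ℕ → ℕ} (h : ∀ v ∈ A, col v = col' v) (p : ℕ) :
    I.cnt A col p = I.cnt A col' p :=
  Finset.sum_congr rfl fun v hv => by rw [h v hv]

lemma sig_congr {A : Finset ℕ} {col col' : ℕ → ℕ} (h : ∀ v ∈ A, col v = col' v) (p : ℕ) :
    I.sig A col p = I.sig A col' p := by
  rw [sig, sig, cnt_congr h]

lemma cnt_union {A B : Finset ℕ} (h : Disjoint A B) (col : ℕ → ℕ) (p : ℕ) :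
    I.cnt (A ∪ B) col p = I.cnt A col p + I.cnt B col p := Finset.sum_union h

/-- Capped counts of a union are determined by the capped counts of the parts. -/
lemma sig_union {A B : Finset ℕ} (h : Disjoint A B) (col : ℕ → ℕ) (p : ℕ) :
    I.sig (A ∪ B) col p = I.jn (I.sig A col p) (I.sig B col p) := by
  unfold sig jn
  by_cases hA : I.pu p ∈ A
  · simp [hA]
  by_cases hB : I.pu p ∈ B
  · simp [hA, hB]
  simp only [Finset.mem_union, hA, hB, or_self, if_false, cnt_union h]
  split_ifs <;> omega

lemma jn_comm (a b : ℕ) : I.jn a b = I.jn b a := by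
  unfold jn; split_ifs <;> omega

/-- The colouring that agrees with `col` on `A` and with `col'` elsewhere. -/
def glue (A : Finset ℕ) (col col' : ℕ → ℕ) (v : ℕ) : ℕ := if v ∈ A then col v else col' v

lemma Valid.glue {A : Finset ℕ} {col col' : ℕ → ℕ} (h : I.Valid col) (h' : I.Valid col') :
    I.Valid (glue A col col') := fun v => by
  unfold Problem.glue; split_ifs <;> simp [h v, h' v]

lemma sig_glue_left {A : Finset ℕ} {col col' : ℕ → ℕ} (p : ℕ) :
    I.sig A (glue A col col') p = I.sig A col p :=
  sig_congr (fun v hv => by simp [glue, hv]) p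

lemma sig_glue_right {A B : Finset ℕ} (h : Disjoint A B) {col col' : ℕ → ℕ} (p : ℕ) :
    I.sig B (glue A col col') p = I.sig B col' p :=
  sig_congr (fun v hv => by simp [glue, Finset.disjoint_right.1 h hv]) p

lemma sig_singleton {v : ℕ} (col : ℕ → ℕ) (p : ℕ) : I.sig {v} col p =
    if I.pu p = v then I.d + 1 else if I.tr p = col v then I.R p v else 0 := by
  have h1 := I.R_le p v
  have h2 := I.d_pos
  simp only [sig, cnt, Finset.mem_singleton, Finset.sum_singleton, eq_comm (a := col v)]
  split_ifs <;> omega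

end Problem

/-! ### Plans -/

/-- A decomposition of a set of `n` vertices in the form in which the dynamic programming uses it:
the sides of the cuts, in a topological order. Entry `i` is the side of a leaf (`lf i` is one more
than its vertex) or the disjoint union of the entries `pa i` and `pb i`; entry `rev i` is the other
side of the same cut. The fields `cross_pa` and `cross_pb` express that the three edges at an internal
node play symmetric roles: the complement of one of the two parts is the union of the other part and of
the complement of the whole. -/
structure Plan (n L : ℕ) where
  side : ℕ → Finset ℕ
  lf : ℕ → ℕ
  pa : ℕ → ℕ
  pb : ℕ → ℕ
  rev : ℕ → ℕ
  pos : 0 < L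
  subset : ∀ i < L, side i ⊆ Finset.range n
  rev_lt : ∀ i < L, rev i < L
  rev_rev : ∀ i < L, rev (rev i) = i
  side_rev : ∀ i < L, side (rev i) = Finset.range n \ side i
  leaf : ∀ i < L, lf i ≠ 0 → lf i - 1 < n ∧ side i = {lf i - 1}
  pa_lt : ∀ i < L, lf i = 0 → pa i < i
  pb_lt : ∀ i < L, lf i = 0 → pb i < i
  ne : ∀ i < L, lf i = 0 → pa i ≠ pb i
  union : ∀ i < L, lf i = 0 → side i = side (pa i) ∪ side (pb i)
  disjoint : ∀ i < L, lf i = 0 → Disjoint (side (pa i)) (side (pb i))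
  cross_pa : ∀ i < L, lf i = 0 → lf (rev (pa i)) = 0 ∧
    (pa (rev (pa i)) = pb i ∧ pb (rev (pa i)) = rev i ∨ pa (rev (pa i)) = rev i ∧ pb (rev (pa i)) = pb i)
  cross_pb : ∀ i < L, lf i = 0 → lf (rev (pb i)) = 0 ∧
    (pa (rev (pb i)) = pa i ∧ pb (rev (pb i)) = rev i ∨ pa (rev (pb i)) = rev i ∧ pb (rev (pb i)) = pa i)

namespace Plan

variable {n L : ℕ} (P : Plan n L)

/-- Two entries determine the union that they enter. -/
lemma eq_of_pair {i j : ℕ} (hi : i < L) (hj : j < L) (h0 : P.lf i = 0) (h0' : P.lf j = 0)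
    (h : P.pa i = P.pa j ∧ P.pb i = P.pb j ∨ P.pa i = P.pb j ∧ P.pb i = P.pa j) : i = j := by
  have key : P.rev i = P.rev j := by
    obtain ⟨h1, h2⟩ | ⟨h1, h2⟩ := h
    · have a := (P.cross_pa i hi h0).2
      have b := (P.cross_pa j hj h0').2
      rw [h1, h2] at a
      omega
    · have a := (P.cross_pa i hi h0).2
      have b := (P.cross_pb j hj h0').2
      rw [h1, h2] at a
      omega
  rw [← P.rev_rev i hi, key, P.rev_rev j hj]

end Plan

/-- The list of edges that the algorithm computes, as a plan. -/
def TreeData.Listed.plan {n m : ℕ} {T : TreeData n m} {s : Store} {l : ℕ} (h : T.Listed s l)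
    (hA : ∀ x y, T.adj x y → s.arr .pos x y ≠ 0) (rev : ℕ → ℕ)
    (hr : ∀ i < l, rev i < l ∧ s.arr .ex 0 (rev i) = s.arr .ey 0 i ∧
      s.arr .ey 0 (rev i) = s.arr .ex 0 i) : Plan n l :=
  have inj : ∀ i < l, ∀ j < l, s.arr .ex 0 i = s.arr .ex 0 j → s.arr .ey 0 i = s.arr .ey 0 j → i = j := by
    intro i hi j hj h1 h2
    have a := h.pos i hi
    have b := h.pos j hj
    rw [h1, h2] at a
    omega
  have deg : ∀ i < l, s.arr .lf 0 i = 0 → ∀ w, T.adj (s.arr .ex 0 i) w ↔ w = s.arr .ey 0 i ∨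
      w = s.arr .ex 0 (s.arr .pa 0 i) ∨ w = s.arr .ex 0 (s.arr .pb 0 i) := by
    intro i hi h0 w
    have h0' := h0
    rw [h.lf i hi] at h0
    obtain ⟨a, b, c, d, e, f, g⟩ := h.join i hi h0
    obtain ⟨h', _⟩ | ⟨_, z, z', _, _, _, h5⟩ := T.degree (h.adj i hi)
    · exact absurd h0 h'
    · have x1 := h.adj _ (a.trans hi)
      have x2 := h.adj _ (b.trans hi)
      rw [c] at x1
      rw [d] at x2
      have x3 := (h5 _).1 (T.symm x1)
      have x4 := (h5 _).1 (T.symm x2)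
      rw [h5 w]
      omega
  -- the cross conditions, for an edge `a` into the tail of `i`, the other one being `b`
  have cross : ∀ i < l, ∀ a < l, ∀ b < l, s.arr .lf 0 i = 0 → s.arr .ey 0 a = s.arr .ex 0 i →
      s.arr .ey 0 b = s.arr .ex 0 i → s.arr .ex 0 a ≠ s.arr .ey 0 i → s.arr .ex 0 b ≠ s.arr .ey 0 i →
      s.arr .ex 0 a ≠ s.arr .ex 0 b → s.arr .lf 0 (rev a) = 0 ∧
      (s.arr .pa 0 (rev a) = b ∧ s.arr .pb 0 (rev a) = rev i ∨
        s.arr .pa 0 (rev a) = rev i ∧ s.arr .pb 0 (rev a) = b) := by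
    intro i hi a ha b hb h0 e1 e2 e3 e4 e5
    obtain ⟨ra, rx, ry⟩ := hr a ha
    obtain ⟨ri, rix, riy⟩ := hr i hi
    have hl : s.arr .lf 0 (rev a) = 0 := by
      rw [h.lf _ ra, rx, e1, ← h.lf i hi, h0]
    refine ⟨hl, ?_⟩
    obtain ⟨j1, j2, j3, j4, j5, j6, j7⟩ := h.join _ ra ((h.lf _ ra).symm.trans hl)
    rw [rx, e1] at j3 j4
    rw [ry] at j5 j6
    -- the two tails are the neighbours of the common node other than the tail of `a`
    have hw : ∀ w, T.adj (s.arr .ex 0 i) w → w = s.arr .ey 0 i ∨ w = s.arr .ex 0 a ∨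
        w = s.arr .ex 0 b := by
      have xa := h.adj a ha
      have xb := h.adj b hb
      rw [e1] at xa
      rw [e2] at xb
      have := (deg i hi h0 _).1 (T.symm xa)
      have := (deg i hi h0 _).1 (T.symm xb)
      intro w hw
      have := (deg i hi h0 w).1 hw
      omega
    have y1 := h.adj _ (j1.trans ra)
    have y2 := h.adj _ (j2.trans ra)
    rw [j3] at y1
    rw [j4] at y2
    have y1 := hw _ (T.symm y1)
    have y2 := hw _ (T.symm y2)
    obtain ⟨z1, z2⟩ | ⟨z1, z2⟩ : (s.arr .ex 0 (s.arr .pa 0 (rev a)) = s.arr .ex 0 b ∧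
        s.arr .ex 0 (s.arr .pb 0 (rev a)) = s.arr .ey 0 i) ∨
        (s.arr .ex 0 (s.arr .pa 0 (rev a)) = s.arr .ey 0 i ∧
        s.arr .ex 0 (s.arr .pb 0 (rev a)) = s.arr .ex 0 b) := by omega
    · exact .inl ⟨inj _ (j1.trans ra) _ hb z1 (by rw [j3, e2]),
        inj _ (j2.trans ra) _ ri (by rw [z2, rix]) (by rw [j4, riy])⟩
    · exact .inr ⟨inj _ (j1.trans ra) _ ri (by rw [z1, rix]) (by rw [j3, riy]),
        inj _ (j2.trans ra) _ hb z2 (by rw [j4, e2])⟩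
  { side := fun i => T.side (s.arr .ex 0 i) (s.arr .ey 0 i)
    lf := s.arr .lf 0
    pa := s.arr .pa 0
    pb := s.arr .pb 0
    rev := rev
    pos := by
      obtain ⟨x, y, hxy⟩ := T.nonempty
      have := h.of_pos x y (hA x y hxy)
      omega
    subset := fun i hi => T.side_subset (h.adj i hi)
    rev_lt := fun i hi => (hr i hi).1
    rev_rev := fun i hi => by
      obtain ⟨a, b, c⟩ := hr i hi
      obtain ⟨a', b', c'⟩ := hr _ a
      exact inj _ a' _ hi (by rw [b', c]) (by rw [c', b])
    side_rev := fun i hi => by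
      obtain ⟨a, b, c⟩ := hr i hi
      rw [b, c]; exact T.side_compl (h.adj i hi)
    leaf := fun i hi h0 => by
      rw [h.lf i hi] at h0 ⊢
      exact T.side_leaf (h.adj i hi) h0
    pa_lt := fun i hi h0 => (h.join i hi ((h.lf i hi).symm.trans h0)).1
    pb_lt := fun i hi h0 => (h.join i hi ((h.lf i hi).symm.trans h0)).2.1
    ne := fun i hi h0 he => (h.join i hi ((h.lf i hi).symm.trans h0)).2.2.2.2.2.2 (by rw [he])
    union := fun i hi h0 => by
      obtain ⟨a, b, c, d, e, f, g⟩ := h.join i hi ((h.lf i hi).symm.trans h0)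
      have x1 := h.adj _ (a.trans hi)
      have x2 := h.adj _ (b.trans hi)
      rw [c] at x1 ⊢
      rw [d] at x2 ⊢
      exact (T.side_join (h.adj i hi) (T.symm x1) (T.symm x2) e f g).1
    disjoint := fun i hi h0 => by
      obtain ⟨a, b, c, d, e, f, g⟩ := h.join i hi ((h.lf i hi).symm.trans h0)
      have x1 := h.adj _ (a.trans hi)
      have x2 := h.adj _ (b.trans hi)
      rw [c] at x1 ⊢
      rw [d] at x2 ⊢
      exact (T.side_join (h.adj i hi) (T.symm x1) (T.symm x2) e f g).2
    cross_pa := fun i hi h0 => by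
      obtain ⟨a, b, c, d, e, f, g⟩ := h.join i hi ((h.lf i hi).symm.trans h0)
      exact cross i hi _ (a.trans hi) _ (b.trans hi) h0 c d e f g
    cross_pb := fun i hi h0 => by
      obtain ⟨a, b, c, d, e, f, g⟩ := h.join i hi ((h.lf i hi).symm.trans h0)
      exact cross i hi _ (b.trans hi) _ (a.trans hi) h0 d c f e g.symm }

/-! ### The class lists -/

lemma Store.set_set_arr (s : Store) (b : Arr) (x y g x' y' : ℕ) :
    ((s.set b x y g).set b y x g).arr b x' y' =
      if x' = x ∧ y' = y ∨ x' = y ∧ y' = x then g else s.arr b x' y' := by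
  simp only [Store.set_arr_cell]
  split_ifs <;> tauto

/-- The rows `lo ≤ g < hi` of the array `vec` hold distinct signatures of colourings of `A`. -/
structure Cls (I : Problem) (s : Store) (A : Finset ℕ) (lo hi : ℕ) : Prop where
  le : lo ≤ hi
  sound : ∀ g, lo ≤ g → g < hi → ∃ col, I.Valid col ∧ ∀ p < I.N, s.arr .vec g p = I.sig A col p
  distinct : ∀ g g', lo ≤ g → g < g' → g' < hi → ∃ p < I.N, s.arr .vec g p ≠ s.arr .vec g' p

namespace Cls

variable {I : Problem} {s s' : Store} {A : Finset ℕ} {lo hi W : ℕ}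

lemma empty (I : Problem) (s : Store) (A : Finset ℕ) (lo : ℕ) : Cls I s A lo lo :=
  ⟨le_rfl, fun g h h' => absurd h (by omega), fun g g' h h' h'' => absurd h (by omega)⟩

lemma card_le (h : Cls I s A lo hi) (hW : I.SigBound A W) : hi - lo ≤ W := by
  classical
  have := h.sound
  choose! col hv hc using this
  refine hW (hi - lo) (fun a => col (lo + a)) (fun a ha => hv _ (by omega) (by omega)) ?_
  intro a b hab hb
  obtain ⟨p, hp, hne⟩ := h.distinct (lo + a) (lo + b) (by omega) (by omega) (by omega)
  refine ⟨p, hp, ?_⟩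
  rwa [← hc _ (by omega) (by omega) p hp, ← hc _ (by omega) (by omega) p hp]

lemma congr (h : Cls I s A lo hi) (hv : ∀ g < hi, s'.arr .vec g = s.arr .vec g) :
    Cls I s' A lo hi := by
  refine ⟨h.le, fun g h1 h2 => ?_, fun g g' h1 h2 h3 => ?_⟩
  · rw [hv g h2]; exact h.sound g h1 h2
  · rw [hv g (by omega), hv g' h3]; exact h.distinct g g' h1 h2 h3

/-- Adding the candidate row `hi` if the search found no equal row. -/
lemma insert (h : Cls I s A lo hi) {g : ℕ} (hg : g ≤ hi) {col : ℕ → ℕ}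
    (hcol : I.Valid col) (hrow : ∀ p < I.N, s.arr .vec hi p = I.sig A col p)
    (hnew : g = hi → ∀ g', lo ≤ g' → g' < hi → ∃ p < I.N, s.arr .vec g' p ≠ s.arr .vec hi p) :
    Cls I s A lo (if g = hi then hi + 1 else hi) ∧ g < (if g = hi then hi + 1 else hi) := by
  split_ifs with hh
  · refine ⟨⟨h.le.trans (by omega), fun g' h1 h2 => ?_, fun g' g'' h1 h2 h3 => ?_⟩, by omega⟩
    · by_cases hh' : g' = hi
      · subst hh'; exact ⟨col, hcol, hrow⟩
      · exact h.sound g' h1 (by omega)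
    · by_cases hh' : g'' = hi
      · subst hh'; exact hnew hh g' h1 h2
      · exact h.distinct g' g'' h1 h2 (by omega)
  · exact ⟨h, by omega⟩

end Cls

/-- The arrays that describe the rows of the signatures are set up. -/
structure HasRows (I : Problem) (s : Store) : Prop where
  pu : ∀ p < I.N, s.arr .pu 0 p = I.pu p
  tr : ∀ p < I.N, s.arr .tr 0 p = I.tr p
  rel : ∀ p < I.N, ∀ v < I.n, s.arr .rel p v = I.R p v

lemma HasRows.frame {I : Problem} {s s' : Store} {W : List Arr} (h : HasRows I s) (hf : Frame W s s')
    (h1 : Arr.pu ∉ W) (h2 : Arr.tr ∉ W) (h3 : Arr.rel ∉ W) : HasRows I s' := by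
  constructor
  · rw [hf.arr _ h1]; exact h.pu
  · rw [hf.arr _ h2]; exact h.tr
  · rw [hf.arr _ h3]; exact h.rel

/-- The arrays that describe the plan are set up. -/
structure HasPlan {n L : ℕ} (P : Plan n L) (s : Store) : Prop where
  lf : ∀ i < L, s.arr .lf 0 i = P.lf i
  pa : ∀ i < L, s.arr .pa 0 i = P.pa i
  pb : ∀ i < L, s.arr .pb 0 i = P.pb i
  rev : ∀ i < L, s.arr .rev 0 i = P.rev i

lemma HasPlan.frame {n L : ℕ} {P : Plan n L} {s s' : Store} {W : List Arr} (h : HasPlan P s)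
    (hf : Frame W s s') (h1 : Arr.lf ∉ W) (h2 : Arr.pa ∉ W) (h3 : Arr.pb ∉ W) (h4 : Arr.rev ∉ W) :
    HasPlan P s' := by
  constructor
  · rw [hf.arr _ h1]; exact h.lf
  · rw [hf.arr _ h2]; exact h.pa
  · rw [hf.arr _ h3]; exact h.pb
  · rw [hf.arr _ h4]; exact h.rev

namespace Spec

/-- The search returns a row equal to row `h`, and `h` itself only if there is no other. -/
lemma search {N start h : ℕ} (s : Store) (hh : h < s.lim) (hN : N ≤ s.lim) (hs : start ≤ h) :
    Spec (Comp.search N 0 1 start h) s fun g s' c => s' = s ∧ start ≤ g ∧ g ≤ h ∧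
      (∀ p < N, s.arr .vec g p = s.arr .vec h p) ∧
      (g = h → ∀ g', start ≤ g' → g' < h → ∃ p < N, s.arr .vec g' p ≠ s.arr .vec h p) ∧
      c ≤ (h - start) * (N * 5 + 5) + 2 := by
  unfold Comp.search
  simp only [bind_iff, sub_iff]
  refine (foldN (fun i acc s' => s' = s ∧ (acc = h ∧
      (∀ g', start ≤ g' → g' < start + i → ∃ p < N, s.arr .vec g' p ≠ s.arr .vec h p) ∨
      start ≤ acc ∧ acc < h ∧ ∀ p < N, s.arr .vec acc p = s.arr .vec h p)) (N * 5 + 4)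
      ⟨rfl, .inl ⟨rfl, by omega⟩⟩ ?_).mono ?_
  · rintro i hi acc _ ⟨rfl, hacc⟩
    rename_i s
    simp only [bind_iff, add_iff]
    refine (foldN (fun p e s' => s' = s ∧
      (e = 1 ↔ ∀ p' < p, s.arr .vec (start + i) p' = s.arr .vec h p')) 4 ⟨rfl, by simp⟩ ?_).mono ?_
    · rintro p hp e _ ⟨rfl, he⟩
      rename_i s
      simp only [bind_iff, rd_iff, ifEq_iff, pure_iff]
      refine ⟨by omega, by omega, by omega, by omega, ?_⟩
      split_ifs with heq
      · refine ⟨⟨trivial, he.trans ⟨fun h' p' hp' => ?_, fun h' p' hp' => h' p' (by omega)⟩⟩, by omega⟩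
        obtain hp' | rfl := Nat.lt_succ_iff_lt_or_eq.1 hp'
        · exact h' p' hp'
        · exact heq
      · refine ⟨⟨trivial, by simp, fun h' => absurd (h' p (by omega)) heq⟩, by omega⟩
    · rintro e _ c ⟨⟨rfl, he⟩, hc⟩
      rename_i s
      simp only [ifEq_iff, pure_iff, he]
      split_ifs with heq
      · exact ⟨⟨trivial, .inr ⟨by omega, by omega, heq⟩⟩, by omega⟩
      · refine ⟨⟨trivial, hacc.imp_left fun ⟨h1, h2⟩ => ⟨h1, fun g' h3 h4 => ?_⟩⟩, by omega⟩
        by_cases h5 : g' = start + i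
        · subst h5
          push Not at heq
          exact heq
        · exact h2 g' h3 (by omega)
  · rintro g _ c ⟨⟨rfl, hg⟩, hc⟩
    change c ≤ (h - start) * (N * 5 + 5) + 1 at hc
    refine ⟨rfl, ?_⟩
    obtain ⟨rfl, h2⟩ | ⟨h1, h2, h3⟩ := hg
    · exact ⟨hs, le_rfl, fun _ _ => rfl, fun _ g' h3 h4 => h2 g' h3 (by omega), by omega⟩
    · exact ⟨h1, h2.le, h3, fun h4 => by omega, by omega⟩

lemma bump {g h : ℕ} {s : Store} : Spec (Comp.bump 1 g h) s fun h' s' c =>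
    h' = (if g = h then h + 1 else h) ∧ s' = (if g = h then s.grow else s) ∧ c ≤ 3 := by
  unfold Comp.bump
  simp only [ifEq_iff, bind_iff, grow_iff, add_iff, pure_iff]
  split_ifs <;> simp

lemma joinEntry (I : Problem) (a b : ℕ) (s : Store) :
    Spec (Comp.joinEntry I.d (I.d + 1) a b) s fun w s' c => s' = s ∧ w = I.jn a b ∧ c ≤ 5 := by
  unfold Comp.joinEntry Problem.jn
  simp only [ifLt_iff, bind_iff, add_iff, pure_iff]
  split_ifs
  · simp
  · simp
  · simp; omega
  · simp; omega

/-- The loop that fills row `h` of an array. -/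
lemma fillRow {b : Arr} {N h T : ℕ} {body : ℕ → Comp ℕ} (s : Store) (f : ℕ → ℕ)
    (hb : ∀ p < N, ∀ s', Frame [b] s s' → s'.lim = s.lim → (∀ g, g ≠ h → s'.arr b g = s.arr b g) →
      Spec (body p) s' fun _ s'' c => s'' = s'.set b h p (f p) ∧ c ≤ T) :
    Spec (Comp.foldN N 0 fun p _ => body p) s fun _ s' c => Frame [b] s s' ∧ s'.lim = s.lim ∧
      (∀ g, g ≠ h → s'.arr b g = s.arr b g) ∧ (∀ p < N, s'.arr b h p = f p) ∧
      c ≤ N * (T + 1) + 1 := by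
  refine (foldN (fun p _ s' => Frame [b] s s' ∧ s'.lim = s.lim ∧
    (∀ g, g ≠ h → s'.arr b g = s.arr b g) ∧ ∀ p' < p, s'.arr b h p' = f p') T
    ⟨.refl _ _, rfl, fun _ _ => rfl, by simp⟩ ?_).mono ?_
  · rintro p hp _ s1 ⟨h1, h2, h3, h4⟩
    refine (hb p hp s1 h1 h2 h3).mono ?_
    rintro _ s2 c ⟨rfl, hc⟩
    refine ⟨⟨h1.set (by simp) _ _ _, by simpa using h2, fun g hg => ?_, fun p' hp' => ?_⟩, hc⟩
    · funext p'
      simp [Store.set_arr_cell, hg, h3]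
    · rw [Store.set_arr_cell]
      split_ifs with h5
      · rw [h5.2]
      · exact h4 p' (by omega)
  · rintro _ s1 c ⟨⟨h1, h2, h3, h4⟩, h5⟩
    exact ⟨h1, h2, h3, h4, h5⟩

lemma leafClasses {I : Problem} {i start v B W : ℕ} (s : Store) (hlim : start + B ≤ s.lim)
    (hN : I.N ≤ B) (hn : I.n ≤ B) (hq : I.q ≤ B) (hi : i < B) (hv : v < I.n) (hr : HasRows I s)
    (hW : I.SigBound {v} W) :
    Spec (Comp.leafClasses I.N I.q (I.d + 1) 0 1 i start v) s fun h s' c =>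
      start ≤ h ∧ Frame [.vec, .cc] s s' ∧ s'.lim + start = s.lim + h ∧
      (∀ g < start, s'.arr .vec g = s.arr .vec g) ∧ (∀ j, j ≠ i → s'.arr .cc j = s.arr .cc j) ∧
      Cls I s' {v} start h ∧ (∀ c < I.q, start ≤ s'.arr .cc i c ∧ s'.arr .cc i c < h ∧
        ∀ p < I.N, s'.arr .vec (s'.arr .cc i c) p = I.sig {v} (fun _ => c) p) ∧
      c ≤ I.q * (I.N * 7 + W * (I.N * 5 + 5) + 8) + 1 := by
  unfold Comp.leafClasses
  refine (foldN (fun c h s' => start ≤ h ∧ Frame [.vec, .cc] s s' ∧ s'.lim + start = s.lim + h ∧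
      (∀ g < start, s'.arr .vec g = s.arr .vec g) ∧ (∀ j, j ≠ i → s'.arr .cc j = s.arr .cc j) ∧
      Cls I s' {v} start h ∧ (∀ c' < c, start ≤ s'.arr .cc i c' ∧ s'.arr .cc i c' < h ∧
        ∀ p < I.N, s'.arr .vec (s'.arr .cc i c') p = I.sig {v} (fun _ => c') p))
      (I.N * 7 + W * (I.N * 5 + 5) + 7)
      ⟨le_rfl, .refl _ _, rfl, fun _ _ => rfl, fun _ _ => rfl, .empty _ _ _ _, by simp⟩ ?_).mono ?_
  · rintro c hc h s1 ⟨a1, a2, a3, a4, a5, a6, a7⟩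
    have hcard := a6.card_le hW
    rw [bind_iff]
    refine (fillRow (b := .vec) (T := 6) (h := h) s1 (fun p => I.sig {v} (fun _ => c) p) ?_).mono ?_
    · intro p hp s2 b1 b2 b3
      have hr2 : HasRows I s2 := (hr.frame a2 (by decide) (by decide) (by decide)).frame b1
        (by decide) (by decide) (by decide)
      simp only [bind_iff, rd_iff, wr_iff, ifEq_iff, hr2.pu p hp, hr2.tr p hp, hr2.rel p hp v hv,
        Problem.sig_singleton]
      refine ⟨by omega, by omega, ?_⟩
      split_ifs
      · exact ⟨by omega, by omega, rfl, by omega⟩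
      · exact ⟨by omega, by omega, by omega, by omega, by omega, by omega, rfl, by omega⟩
      · exact ⟨by omega, by omega, by omega, by omega, rfl, by omega⟩
    · rintro _ s2 t1 ⟨b1, b2, b3, b4, b5⟩
      rw [bind_iff]
      refine (search s2 (by omega) (by omega) a1).mono ?_
      rintro g _ t2 ⟨rfl, c1, c2, c3, c4, c5⟩
      rename_i s2
      obtain ⟨d1, d2⟩ := (a6.congr (s' := s2) fun g hg => b3 g (by omega)).insert c2
        (col := fun _ => c) (fun _ => hc) b4 c4
      simp only [bind_iff, wr_iff]
      refine ⟨by omega, by omega, bump.mono ?_⟩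
      rintro h' s3 t3 ⟨e1, e2, e3⟩
      rw [← e1] at d1 d2
      have harr : s3.arr = (s2.set .cc i c g).arr := by rw [e2]; split_ifs <;> rfl
      have hlim3 : s3.lim + h = s2.lim + h' := by
        rw [e2, e1]; split_ifs
        · simp; omega
        · simp
      have hf3 : Frame [.vec, .cc] s s3 := by
        have := ((a2.trans (b1.mono (by simp))).set (b := .cc) (by simp) i c g)
        rw [e2]; split_ifs
        · exact this.grow
        · exact this
      have hvec : s3.arr .vec = s2.arr .vec := by rw [harr, Store.set_arr_ne _ (by decide)]
      refine ⟨⟨by omega, hf3, by omega, fun g' hg' => by rw [hvec, b3 g' (by omega), a4 g' hg'],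
        fun j hj => ?_, d1.congr fun _ _ => by rw [hvec], ?_⟩, ?_⟩
      · funext c'
        rw [harr, Store.set_arr_cell, if_neg (by tauto), b1.arr _ (by decide), a5 j hj]
      · intro c' hc'
        rw [harr, Store.set_arr_cell, ← harr, hvec]
        split_ifs with h6
        · obtain ⟨_, rfl⟩ := h6
          exact ⟨c1, d2, fun p hp => by rw [c3 p hp, b4 p hp]⟩
        · obtain ⟨x1, x2, x3⟩ := a7 c' (by omega)
          rw [b1.arr .cc (by decide)]
          refine ⟨x1, by split_ifs at e1 <;> omega, fun p hp => ?_⟩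
          rw [b3 _ (by omega), x3 p hp]
      · have := Nat.mul_le_mul_right (I.N * 5 + 5) hcard
        omega
  · rintro h s' t ⟨⟨a1, a2, a3, a4, a5, a6, a7⟩, a8⟩
    exact ⟨a1, a2, a3, a4, a5, a6, a7, a8⟩

/-- Every pair of a class of `A₁` and a class of `A₂` is assigned a class of `A₁ ∪ A₂`. The invariant `J D`
of the proof says this for the pairs in `D`. -/
lemma joinClasses {I : Problem} {start sa ea sb eb B W : ℕ} {A₁ A₂ : Finset ℕ} (s : Store)
    (hlim : start + B ≤ s.lim) (hN : I.N ≤ B) (hB : 0 < B) (hA : Disjoint A₁ A₂)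
    (h1 : Cls I s A₁ sa ea) (h2 : Cls I s A₂ sb eb) (hea : ea ≤ start) (heb : eb ≤ start)
    (hab : ea ≤ sb ∨ eb ≤ sa) (hW₁ : ea - sa ≤ W) (hW₂ : eb - sb ≤ W) (hW : I.SigBound (A₁ ∪ A₂) W) :
    Spec (Comp.joinClasses I.N I.d (I.d + 1) 0 1 start sa ea sb eb) s fun h s' c =>
      start ≤ h ∧ Frame [.vec, .join] s s' ∧ s'.lim + start = s.lim + h ∧
      (∀ g < start, s'.arr .vec g = s.arr .vec g) ∧
      (∀ x y, ¬ (sa ≤ x ∧ x < ea ∧ sb ≤ y ∧ y < eb) → ¬ (sa ≤ y ∧ y < ea ∧ sb ≤ x ∧ x < eb) →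
        s'.arr .join x y = s.arr .join x y) ∧
      Cls I s' (A₁ ∪ A₂) start h ∧
      (∀ x y, sa ≤ x → x < ea → sb ≤ y → y < eb → s'.arr .join y x = s'.arr .join x y ∧
        start ≤ s'.arr .join x y ∧ s'.arr .join x y < h ∧
        ∀ p < I.N, s'.arr .vec (s'.arr .join x y) p = I.jn (s.arr .vec x p) (s.arr .vec y p)) ∧
      c ≤ W * (W * (I.N * 9 + W * (I.N * 5 + 5) + 10) + 3) + 3 := by
  let J (D : ℕ → ℕ → Prop) (h : ℕ) (s' : Store) : Prop := start ≤ h ∧ Frame [.vec, .join] s s' ∧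
      s'.lim + start = s.lim + h ∧
      (∀ g < start, s'.arr .vec g = s.arr .vec g) ∧
      (∀ x y, ¬ (sa ≤ x ∧ x < ea ∧ sb ≤ y ∧ y < eb) → ¬ (sa ≤ y ∧ y < ea ∧ sb ≤ x ∧ x < eb) →
        s'.arr .join x y = s.arr .join x y) ∧
      Cls I s' (A₁ ∪ A₂) start h ∧
      (∀ x y, sa ≤ x → x < ea → sb ≤ y → y < eb → D x y → s'.arr .join y x = s'.arr .join x y ∧
        start ≤ s'.arr .join x y ∧ s'.arr .join x y < h ∧
        ∀ p < I.N, s'.arr .vec (s'.arr .join x y) p = I.jn (s.arr .vec x p) (s.arr .vec y p))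
  have Jmono : ∀ {D D' : ℕ → ℕ → Prop} {h s'}, J D h s' →
      (∀ x y, sa ≤ x → x < ea → sb ≤ y → y < eb → D' x y → D x y) → J D' h s' := by
    rintro D D' h s' ⟨a1, a2, a3, a4, a5, a6, a7⟩ hD
    exact ⟨a1, a2, a3, a4, a5, a6, fun x y x1 x2 y1 y2 hd => a7 x y x1 x2 y1 y2 (hD x y x1 x2 y1 y2 hd)⟩
  unfold Comp.joinClasses
  simp only [bind_iff, sub_iff]
  refine (foldN (fun i1 h s' => J (fun x _ => x < sa + i1) h s')
    (W * (I.N * 9 + W * (I.N * 5 + 5) + 10) + 2)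
    ⟨le_rfl, .refl _ _, rfl, fun _ _ => rfl, fun _ _ _ _ => rfl, .empty _ _ _ _,
      fun x y x1 _ _ _ hd => absurd hd (by omega)⟩ ?_).mono ?_
  · intro i1 hi1 h s1 hJ
    simp only [bind_iff, add_iff]
    refine (foldN (fun i2 h s' => J (fun x y => x < sa + i1 ∨ x = sa + i1 ∧ y < sb + i2) h s')
      (I.N * 9 + W * (I.N * 5 + 5) + 9) (Jmono hJ fun x y _ _ y1 _ hd => by omega) ?_).mono ?_
    · rintro i2 hi2 h s1 ⟨a1, a2, a3, a4, a5, a6, a7⟩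
      have hcard := a6.card_le hW
      simp only [bind_iff, add_iff]
      generalize hx : sa + i1 = x at a7 ⊢
      generalize hy : sb + i2 = y at a7 ⊢
      obtain ⟨col₁, hc1, hr1⟩ := h1.sound x (by omega) (by omega)
      obtain ⟨col₂, hc2, hr2⟩ := h2.sound y (by omega) (by omega)
      refine (fillRow (b := .vec) (T := 8) (h := h) s1 (fun p => I.jn (s.arr .vec x p) (s.arr .vec y p)) ?_).mono ?_
      · intro p hp s2 b1 b2 b3
        simp only [bind_iff, rd_iff]
        have e1 : s2.arr .vec x = s.arr .vec x := by rw [b3 x (by omega), a4 x (by omega)]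
        have e2 : s2.arr .vec y = s.arr .vec y := by rw [b3 y (by omega), a4 y (by omega)]
        refine ⟨by omega, by omega, by omega, by omega, (joinEntry I _ _ s2).mono ?_⟩
        rintro w _ t ⟨rfl, rfl, ht⟩
        rename_i s2
        simp only [wr_iff, e1, e2]
        exact ⟨by omega, by omega, trivial, by omega⟩
      · rintro _ s2 t1 ⟨b1, b2, b3, b4, b5⟩
        refine (search s2 (by omega) (by omega) a1).mono ?_
        rintro g _ t2 ⟨rfl, c1, c2, c3, c4, c5⟩
        rename_i s2
        have hrow : ∀ p < I.N, s2.arr .vec h p = I.sig (A₁ ∪ A₂) (Problem.glue A₁ col₁ col₂) p := by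
          intro p hp
          rw [b4 p hp, hr1 p hp, hr2 p hp, Problem.sig_union hA, Problem.sig_glue_left,
            Problem.sig_glue_right hA]
        obtain ⟨d1, d2⟩ := (a6.congr (s' := s2) fun g hg => b3 g (by omega)).insert c2
          (hc1.glue hc2) hrow c4
        simp only [wr_iff, Store.set_lim]
        refine ⟨by omega, by omega, by omega, by omega, bump.mono ?_⟩
        rintro h' s3 t3 ⟨e1, e2, e3⟩
        rw [← e1] at d1 d2
        have harr : s3.arr = ((s2.set .join x y g).set .join y x g).arr := by
          rw [e2]; split_ifs <;> rfl
        have hlim3 : s3.lim + h = s2.lim + h' := by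
          rw [e2, e1]; split_ifs
          · simp; omega
          · simp
        have hf3 : Frame [.vec, .join] s s3 := by
          have := ((a2.trans (b1.mono (by simp))).set (b := .join) (by simp) x y g).set
            (b := .join) (by simp) y x g
          rw [e2]; split_ifs
          · exact this.grow
          · exact this
        have hvec : s3.arr .vec = s2.arr .vec := by
          rw [harr, Store.set_arr_ne _ (by decide), Store.set_arr_ne _ (by decide)]
        have hj : ∀ x' y', s3.arr .join x' y' = if x' = x ∧ y' = y ∨ x' = y ∧ y' = x then g else
            s1.arr .join x' y' := by
          intro x' y'
          rw [harr, Store.set_set_arr, b1.arr .join (by decide)]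
        have hhh : h ≤ h' := by split_ifs at e1 <;> omega
        have k1 : start ≤ h' := a1.trans hhh
        have k2 : s3.lim + start = s.lim + h' := by omega
        have k3 : ∀ g < start, s3.arr .vec g = s.arr .vec g := fun g' hg' => by
          rw [hvec, b3 g' (by omega), a4 g' hg']
        have k4 : Cls I s3 (A₁ ∪ A₂) start h' := d1.congr fun _ _ => by rw [hvec]
        refine ⟨⟨k1, hf3, k2, k3, fun x' y' n1 n2 => ?_, k4, ?_⟩, ?_⟩
        · rw [hj, if_neg (by omega), a5 x' y' n1 n2]
        · intro x' y' x1 x2 y1 y2 hD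
          rw [hj x' y', hj y' x', hvec]
          by_cases hxy : x' = x ∧ y' = y
          · rw [if_pos (by omega), if_pos (by omega), hxy.1, hxy.2]
            exact ⟨rfl, c1, d2, fun p hp => by rw [c3 p hp, b4 p hp]⟩
          · rw [if_neg (by omega), if_neg (by omega)]
            obtain ⟨z1, z2, z3, z4⟩ := a7 x' y' x1 x2 y1 y2 (by omega)
            exact ⟨z1, z2, by omega, fun p hp => by rw [b3 _ (by omega), z4 p hp]⟩
        · have := Nat.mul_le_mul_right (I.N * 5 + 5) hcard
          omega
    · rintro h s2 t ⟨hJ', ht⟩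
      refine ⟨Jmono hJ' fun x y _ _ _ _ hd => by omega, ?_⟩
      change t ≤ (eb - sb) * (I.N * 9 + W * (I.N * 5 + 5) + 10) + 1 at ht
      have := Nat.mul_le_mul_right (I.N * 9 + W * (I.N * 5 + 5) + 10) hW₂
      omega
  · rintro h s1 t ⟨⟨a1, a2, a3, a4, a5, a6, a7⟩, ht⟩
    refine ⟨a1, a2, a3, a4, a5, a6, fun x y x1 x2 y1 y2 => a7 x y x1 x2 y1 y2 (by omega), ?_⟩
    change t ≤ (ea - sa) * (W * (I.N * 9 + W * (I.N * 5 + 5) + 10) + 3) + 1 at ht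
    have := Nat.mul_le_mul_right (W * (I.N * 9 + W * (I.N * 5 + 5) + 10) + 3) hW₁
    omega

end Spec

/-- The class lists of the entries below `i` of a plan are complete, and all classes are below `h`. -/
structure ClassesUpTo (I : Problem) {L : ℕ} (P : Plan I.n L) (s : Store) (i h : ℕ) : Prop where
  le : ∀ j < i, s.arr .en 0 j ≤ h
  order : ∀ j j', j < j' → j' < i → s.arr .en 0 j ≤ s.arr .st 0 j'
  cls : ∀ j < i, Cls I s (P.side j) (s.arr .st 0 j) (s.arr .en 0 j)
  complete : ∀ j < i, ∀ col, I.Valid col → ∃ g, s.arr .st 0 j ≤ g ∧ g < s.arr .en 0 j ∧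
    ∀ p < I.N, s.arr .vec g p = I.sig (P.side j) col p
  leaf : ∀ j < i, P.lf j ≠ 0 → ∀ c < I.q, s.arr .st 0 j ≤ s.arr .cc j c ∧
    s.arr .cc j c < s.arr .en 0 j ∧
    ∀ p < I.N, s.arr .vec (s.arr .cc j c) p = I.sig (P.side j) (fun _ => c) p
  join : ∀ j < i, P.lf j = 0 → ∀ x y, s.arr .st 0 (P.pa j) ≤ x → x < s.arr .en 0 (P.pa j) →
    s.arr .st 0 (P.pb j) ≤ y → y < s.arr .en 0 (P.pb j) → s.arr .join y x = s.arr .join x y ∧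
    s.arr .st 0 j ≤ s.arr .join x y ∧ s.arr .join x y < s.arr .en 0 j ∧
    ∀ p < I.N, s.arr .vec (s.arr .join x y) p = I.jn (s.arr .vec x p) (s.arr .vec y p)

namespace ClassesUpTo

variable {I : Problem} {L : ℕ} {P : Plan I.n L} {s s' : Store} {i h h' : ℕ}

/-- The class lists of different entries are disjoint. -/
lemma unique (H : ClassesUpTo I P s i h) {j j' g : ℕ} (hj : j < i) (hj' : j' < i)
    (h1 : s.arr .st 0 j ≤ g) (h2 : g < s.arr .en 0 j) (h3 : s.arr .st 0 j' ≤ g)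
    (h4 : g < s.arr .en 0 j') : j = j' := by
  by_contra hne
  obtain hlt | hlt : j < j' ∨ j' < j := by omega
  · have := H.order j j' hlt hj'; omega
  · have := H.order j' j hlt hj; omega

lemma congr (H : ClassesUpTo I P s i h) (hi : i ≤ L) (hst : ∀ j < i, s'.arr .st 0 j = s.arr .st 0 j)
    (hen : ∀ j < i, s'.arr .en 0 j = s.arr .en 0 j) (hvec : ∀ g < h, s'.arr .vec g = s.arr .vec g)
    (hcc : ∀ j < i, s'.arr .cc j = s.arr .cc j)
    (hjoin : ∀ j < i, P.lf j = 0 → ∀ x y, s.arr .st 0 (P.pa j) ≤ x → x < s.arr .en 0 (P.pa j) →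
      s.arr .st 0 (P.pb j) ≤ y → y < s.arr .en 0 (P.pb j) →
      s'.arr .join x y = s.arr .join x y ∧ s'.arr .join y x = s.arr .join y x) :
    ClassesUpTo I P s' i h := by
  constructor
  · intro j hj
    rw [hen j hj]; exact H.le j hj
  · intro j j' hjj hj'
    rw [hen j (by omega), hst j' hj']; exact H.order j j' hjj hj'
  · intro j hj
    rw [hst j hj, hen j hj]
    exact (H.cls j hj).congr fun g hg => hvec g (hg.trans_le (H.le j hj))
  · intro j hj col hcol
    obtain ⟨g, h1, h2, h3⟩ := H.complete j hj col hcol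
    refine ⟨g, by rwa [hst j hj], by rwa [hen j hj], ?_⟩
    rwa [hvec g (h2.trans_le (H.le j hj))]
  · intro j hj hl c hc
    obtain ⟨h1, h2, h3⟩ := H.leaf j hj hl c hc
    rw [hst j hj, hen j hj, hcc j hj, hvec _ (h2.trans_le (H.le j hj))]
    exact ⟨h1, h2, h3⟩
  · intro j hj hl x y
    have ha := P.pa_lt j (by omega) hl
    have hb := P.pb_lt j (by omega) hl
    rw [hst j hj, hen j hj, hst _ (ha.trans hj), hen _ (ha.trans hj), hst _ (hb.trans hj),
      hen _ (hb.trans hj)]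
    intro x1 x2 y1 y2
    obtain ⟨h1, h2, h3, h4⟩ := H.join j hj hl x y x1 x2 y1 y2
    obtain ⟨k1, k2⟩ := hjoin j hj hl x y x1 x2 y1 y2
    rw [k1, k2, hvec _ (h3.trans_le (H.le j hj)), hvec x (x2.trans_le (H.le _ (ha.trans hj))),
      hvec y (y2.trans_le (H.le _ (hb.trans hj)))]
    exact ⟨h1, h2, h3, h4⟩

/-- Extension by one entry. -/
lemma succ (H : ClassesUpTo I P s i h) (hst : s.arr .st 0 i = h) (hen : s.arr .en 0 i = h')
    (hc : Cls I s (P.side i) h h')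
    (hcomplete : ∀ col, I.Valid col → ∃ g, h ≤ g ∧ g < h' ∧
      ∀ p < I.N, s.arr .vec g p = I.sig (P.side i) col p)
    (hleaf : P.lf i ≠ 0 → ∀ c < I.q, h ≤ s.arr .cc i c ∧ s.arr .cc i c < h' ∧
      ∀ p < I.N, s.arr .vec (s.arr .cc i c) p = I.sig (P.side i) (fun _ => c) p)
    (hjoin : P.lf i = 0 → ∀ x y, s.arr .st 0 (P.pa i) ≤ x → x < s.arr .en 0 (P.pa i) →
      s.arr .st 0 (P.pb i) ≤ y → y < s.arr .en 0 (P.pb i) → s.arr .join y x = s.arr .join x y ∧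
      h ≤ s.arr .join x y ∧ s.arr .join x y < h' ∧
      ∀ p < I.N, s.arr .vec (s.arr .join x y) p = I.jn (s.arr .vec x p) (s.arr .vec y p)) :
    ClassesUpTo I P s (i + 1) h' := by
  have hh := hc.le
  constructor
  · intro j hj
    obtain hj | rfl := Nat.lt_succ_iff_lt_or_eq.1 hj
    · exact (H.le j hj).trans hh
    · exact hen.le
  · intro j j' hjj hj'
    obtain hj' | rfl := Nat.lt_succ_iff_lt_or_eq.1 hj'
    · exact H.order j j' hjj hj'
    · rw [hst]; exact H.le j hjj
  · intro j hj
    obtain hj | rfl := Nat.lt_succ_iff_lt_or_eq.1 hj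
    · exact H.cls j hj
    · rwa [hst, hen]
  · intro j hj
    obtain hj | rfl := Nat.lt_succ_iff_lt_or_eq.1 hj
    · exact H.complete j hj
    · rwa [hst, hen]
  · intro j hj
    obtain hj | rfl := Nat.lt_succ_iff_lt_or_eq.1 hj
    · exact H.leaf j hj
    · rwa [hst, hen]
  · intro j hj
    obtain hj | rfl := Nat.lt_succ_iff_lt_or_eq.1 hj
    · exact H.join j hj
    · rwa [hst, hen]

lemma card_le (H : ClassesUpTo I P s i h) {W : ℕ} (hi : i ≤ L)
    (hW : ∀ i < L, I.SigBound (P.side i) W) {j : ℕ} (hj : j < i) :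
    s.arr .en 0 j - s.arr .st 0 j ≤ W :=
  (H.cls j hj).card_le (hW j (by omega))

end ClassesUpTo

namespace Spec

/-- Each of the `h` classes found is a new index, since a class is the number of a row of `vec`. -/
lemma classPhase {I : Problem} {L B W : ℕ} {P : Plan I.n L} (s : Store) (hlim : B ≤ s.lim)
    (hN : I.N ≤ B) (hn : I.n ≤ B) (hq : I.q ≤ B) (hL : L ≤ B) (hr : HasRows I s) (hP : HasPlan P s)
    (hW : ∀ i < L, I.SigBound (P.side i) W) :
    Spec (Comp.classPhase L I.N I.q I.d (I.d + 1) 0 1) s fun h s' c =>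
      Frame [.st, .en, .vec, .cc, .join] s s' ∧ s'.lim = s.lim + h ∧ ClassesUpTo I P s' L h ∧
      c ≤ L * (W * (W * (I.N * 9 + W * (I.N * 5 + 5) + 10) + 3) +
        I.q * (I.N * 7 + W * (I.N * 5 + 5) + 8) + 20) + 1 := by
  have hLpos := P.pos
  unfold Comp.classPhase
  refine (foldN (fun i h s' => Frame [.st, .en, .vec, .cc, .join] s s' ∧ s'.lim = s.lim + h ∧
    ClassesUpTo I P s' i h) (W * (W * (I.N * 9 + W * (I.N * 5 + 5) + 10) + 3) +
        I.q * (I.N * 7 + W * (I.N * 5 + 5) + 8) + 19)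
    ⟨.refl _ _, rfl, ⟨by simp, by simp, by simp, by simp, by simp, by simp⟩⟩ ?_).mono ?_
  · rintro i hi h s1 ⟨a1, a2, a3⟩
    have hP1 := hP.frame a1 (by decide) (by decide) (by decide) (by decide)
    simp only [bind_iff, wr_iff, rd_iff, Store.set_lim]
    refine ⟨by omega, by omega, by omega, by omega, ?_⟩
    rw [Store.set_arr_ne _ (by decide), hP1.lf i hi, ifEq_iff]
    set s2 := s1.set .st 0 i h with hs2
    have f2 : Frame [.st, .en, .vec, .cc, .join] s s2 := a1.set (by simp) _ _ _
    have hlim2 : s2.lim = s.lim + h := a2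
    have hst2 : s2.arr .st 0 i = h := by simp [hs2]
    have u2 : ClassesUpTo I P s2 i h := by
      refine a3.congr hi.le (fun j hj => ?_) (fun j hj => ?_) (fun g hg => ?_) (fun j hj => ?_)
        (fun j hj _ x y _ _ _ _ => ⟨?_, ?_⟩)
      · rw [hs2, Store.set_arr_cell, if_neg (by omega)]
      all_goals rw [hs2, Store.set_arr_ne _ (by decide)]
    have hP2 := hP.frame f2 (by decide) (by decide) (by decide) (by decide)
    have hr2 := hr.frame f2 (by decide) (by decide) (by decide)
    by_cases hl : P.lf i = 0
    · rw [if_pos hl]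
      have ha := P.pa_lt i hi hl
      have hb := P.pb_lt i hi hl
      simp only [bind_iff, rd_iff, hP2.pa i hi, hP2.pb i hi]
      iterate 6 refine ⟨by omega, by omega, ?_⟩
      refine (joinClasses (B := B) (W := W) s2 (by omega) hN (by omega) (P.disjoint i hi hl)
        (u2.cls _ ha) (u2.cls _ hb) (u2.le _ ha) (u2.le _ hb) ?_ (u2.card_le hi.le hW ha)
        (u2.card_le hi.le hW hb) (by rw [← P.union i hi hl]; exact hW i hi)).mono ?_
      · have := P.ne i hi hl
        obtain hlt | hlt : P.pa i < P.pb i ∨ P.pb i < P.pa i := by omega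
        · exact .inl (u2.order _ _ hlt hb)
        · exact .inr (u2.order _ _ hlt ha)
      · rintro h' s3 t ⟨b1, b2, b3, b4, b5, b6, b7, b8⟩
        simp only [pure_iff]
        have e1 : s3.arr .st = s2.arr .st := b2.arr _ (by decide)
        have e2 : s3.arr .en = s2.arr .en := b2.arr _ (by decide)
        have e3 : s3.arr .cc = s2.arr .cc := b2.arr _ (by decide)
        set s4 := s3.set .en 0 i h' with hs4
        have e5 : s4.arr .st = s2.arr .st := by rw [hs4, Store.set_arr_ne _ (by decide), e1]
        have e6 : ∀ j < i, s4.arr .en 0 j = s2.arr .en 0 j := fun j hj => by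
          rw [hs4, Store.set_arr_cell, if_neg (by omega), e2]
        have e7 : s4.arr .vec = s3.arr .vec := by rw [hs4, Store.set_arr_ne _ (by decide)]
        have e8 : s4.arr .join = s3.arr .join := by rw [hs4, Store.set_arr_ne _ (by decide)]
        have u4 : ClassesUpTo I P s4 i h := by
          refine u2.congr hi.le (fun j hj => by rw [e5]) e6 (fun g hg => ?_) (fun j hj => ?_) ?_
          · rw [e7, b4 g hg]
          · rw [hs4, Store.set_arr_ne _ (by decide), e3]
          · intro j hj hl' x y x1 x2 y1 y2
            have ha' := P.pa_lt j (by omega) hl'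
            have hb' := P.pb_lt j (by omega) hl'
            have n1 : ¬ (s2.arr .st 0 (P.pa i) ≤ x ∧ x < s2.arr .en 0 (P.pa i) ∧
                s2.arr .st 0 (P.pb i) ≤ y ∧ y < s2.arr .en 0 (P.pb i)) := fun ⟨z1, z2, z3, z4⟩ => by
              have q1 := u2.unique (by omega) ha x1 x2 z1 z2
              have q2 := u2.unique (by omega) hb y1 y2 z3 z4
              have := P.eq_of_pair (by omega) hi hl' hl (.inl ⟨q1, q2⟩)
              omega
            have n2 : ¬ (s2.arr .st 0 (P.pa i) ≤ y ∧ y < s2.arr .en 0 (P.pa i) ∧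
                s2.arr .st 0 (P.pb i) ≤ x ∧ x < s2.arr .en 0 (P.pb i)) := fun ⟨z1, z2, z3, z4⟩ => by
              have q1 := u2.unique (by omega) ha y1 y2 z1 z2
              have q2 := u2.unique (by omega) hb x1 x2 z3 z4
              have := P.eq_of_pair (by omega) hi hl' hl (.inr ⟨q2, q1⟩)
              omega
            rw [e8]
            exact ⟨b5 x y n1 n2, b5 y x n2 n1⟩
        have c4 : Cls I s4 (P.side i) h h' := by
          rw [P.union i hi hl]; exact b6.congr fun _ _ => by rw [e7]
        refine ⟨by omega, by omega, ⟨⟨?_, ?_, ?_⟩, by omega⟩⟩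
        · exact (f2.trans (b2.mono (by simp))).set (by simp) _ _ _
        · simp only [hs4, Store.set_lim]; omega
        · refine u4.succ (by rw [e5, hst2]) (by simp [hs4]) c4 ?_ (fun h => absurd hl h) ?_
          · intro col hcol
            obtain ⟨x, x1, x2, x3⟩ := u2.complete _ ha col hcol
            obtain ⟨y, y1, y2, y3⟩ := u2.complete _ hb col hcol
            obtain ⟨z1, z2, z3, z4⟩ := b7 x y x1 x2 y1 y2
            refine ⟨_, z2, z3, fun p hp => ?_⟩
            rw [e7, z4 p hp, x3 p hp, y3 p hp, P.union i hi hl,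
              Problem.sig_union (P.disjoint i hi hl)]
          · intro _ x y
            rw [e5, e6 _ ha, e6 _ hb, e7, e8]
            intro x1 x2 y1 y2
            obtain ⟨z1, z2, z3, z4⟩ := b7 x y x1 x2 y1 y2
            have hx : x < h := x2.trans_le (u2.le _ ha)
            have hy : y < h := y2.trans_le (u2.le _ hb)
            exact ⟨z1, z2, z3, fun p hp => by rw [z4 p hp, b4 x hx, b4 y hy]⟩
    · rw [if_neg hl]
      obtain ⟨hv, hside⟩ := P.leaf i hi hl
      simp only [bind_iff, sub_iff]
      refine (leafClasses (B := B) (W := W) s2 (by omega) hN hn hq (by omega) hv hr2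
        (by rw [← hside]; exact hW i hi)).mono ?_
      rintro h' s3 t ⟨b1, b2, b3, b4, b5, b6, b7, b8⟩
      simp only [pure_iff]
      have e1 : s3.arr .st = s2.arr .st := b2.arr _ (by decide)
      have e2 : s3.arr .en = s2.arr .en := b2.arr _ (by decide)
      have e3 : s3.arr .join = s2.arr .join := b2.arr _ (by decide)
      set s4 := s3.set .en 0 i h' with hs4
      have e5 : s4.arr .st = s2.arr .st := by rw [hs4, Store.set_arr_ne _ (by decide), e1]
      have e6 : ∀ j < i, s4.arr .en 0 j = s2.arr .en 0 j := fun j hj => by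
        rw [hs4, Store.set_arr_cell, if_neg (by omega), e2]
      have e7 : s4.arr .vec = s3.arr .vec := by rw [hs4, Store.set_arr_ne _ (by decide)]
      have e8 : s4.arr .cc = s3.arr .cc := by rw [hs4, Store.set_arr_ne _ (by decide)]
      have u4 : ClassesUpTo I P s4 i h := by
        refine u2.congr hi.le (fun j hj => by rw [e5]) e6 (fun g hg => ?_) (fun j hj => ?_)
          (fun j hj _ x y _ _ _ _ => ⟨?_, ?_⟩)
        · rw [e7, b4 g hg]
        · rw [e8, b5 j (by omega)]
        all_goals rw [hs4, Store.set_arr_ne _ (by decide), e3]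
      have c4 : Cls I s4 (P.side i) h h' := by
        rw [hside]; exact b6.congr fun _ _ => by rw [e7]
      refine ⟨by omega, by omega, ⟨⟨?_, ?_, ?_⟩, by omega⟩⟩
      · exact (f2.trans (b2.mono (by simp))).set (by simp) _ _ _
      · simp only [hs4, Store.set_lim]; omega
      · refine u4.succ (by rw [e5, hst2]) (by simp [hs4]) c4 ?_ ?_ (fun h => absurd h hl)
        · intro col hcol
          obtain ⟨z1, z2, z3⟩ := b7 (col (P.lf i - 1)) (hcol _)
          refine ⟨_, z1, z2, fun p hp => ?_⟩
          rw [e7, z3 p hp, hside]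
          exact Problem.sig_congr (fun v hv => by rw [Finset.mem_singleton.1 hv]) p
        · intro _ c hc
          rw [e7, e8, hside]; exact b7 c hc
  · rintro h s1 t ⟨⟨a1, a2, a3⟩, a4⟩
    exact ⟨a1, a2, a3, a4⟩

end Spec

/-! ### Partial solutions -/

namespace Problem

variable (I : Problem)

/-- The constraints at the vertices of `A` hold for `col` if the counts in their rows that come from
outside `A` are as in `z`. -/
def Good (A : Finset ℕ) (col z : ℕ → ℕ) : Prop :=
  ∀ p < I.N, I.pu p ∈ A → I.ok (col (I.pu p)) p (min I.d (I.cnt A col p + z p))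

/-- The total weight of the colours on `A`. -/
def weight (A : Finset ℕ) (col : ℕ → ℕ) : ℕ := ∑ v ∈ A, I.wt (col v)

variable {I}

lemma weight_congr {A : Finset ℕ} {col col' : ℕ → ℕ} (h : ∀ v ∈ A, col v = col' v) :
    I.weight A col = I.weight A col' :=
  Finset.sum_congr rfl fun v hv => by rw [h v hv]

lemma weight_union {A B : Finset ℕ} (h : Disjoint A B) (col : ℕ → ℕ) :
    I.weight (A ∪ B) col = I.weight A col + I.weight B col := Finset.sum_union h

lemma Good.congr {A : Finset ℕ} {col col' z z' : ℕ → ℕ} (h : I.Good A col z)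
    (hc : ∀ v ∈ A, col v = col' v) (hz : ∀ p < I.N, z p = z' p) : I.Good A col' z' := by
  intro p hp hA
  rw [← hc _ hA, ← cnt_congr hc, ← hz p hp]
  exact h p hp hA

/-- The step of the dynamic programming: the constraints at the vertices of `A` see what `B` and the
outside contribute together, and the join of the two signatures records this, and conversely. -/
lemma good_union {A B : Finset ℕ} (h : Disjoint A B) (col z : ℕ → ℕ)
    (hz : ∀ p < I.N, I.pu p ∈ A ∪ B → z p ≤ I.d) :
    I.Good (A ∪ B) col z ↔ I.Good A col (fun p => I.jn (I.sig B col p) (z p)) ∧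
      I.Good B col (fun p => I.jn (I.sig A col p) (z p)) := by
  have key : ∀ {A B : Finset ℕ}, Disjoint A B → ∀ p, I.pu p ∈ A → z p ≤ I.d →
      min I.d (I.cnt A col p + I.jn (I.sig B col p) (z p)) =
        min I.d (I.cnt A col p + I.cnt B col p + z p) := by
    intro A B h p hp hz
    rw [sig, if_neg (Finset.disjoint_left.1 h hp), jn, if_neg (by omega), if_neg (by omega)]
    omega
  constructor
  · intro hg
    refine ⟨fun p hp hA => ?_, fun p hp hB => ?_⟩
    · have := hg p hp (Finset.mem_union_left _ hA)
      rwa [key h p hA (hz p hp (Finset.mem_union_left _ hA)), ← cnt_union h]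
    · have := hg p hp (Finset.mem_union_right _ hB)
      rwa [key h.symm p hB (hz p hp (Finset.mem_union_right _ hB)), add_comm (I.cnt B col p),
        ← cnt_union h]
  · rintro ⟨h1, h2⟩ p hp hAB
    rw [cnt_union h]
    obtain hA | hB := Finset.mem_union.1 hAB
    · rw [← key h p hA (hz p hp hAB)]; exact h1 p hp hA
    · rw [add_comm (I.cnt A col p), ← key h.symm p hB (hz p hp hAB)]; exact h2 p hp hB

/-- The colouring `col` of `A` counts for the table entry `(g, z)`: its signature is in row `g`, and
its constraints hold if the vertices outside contribute as in row `z`. -/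
def Fits (s : Store) (A : Finset ℕ) (g z : ℕ) (col : ℕ → ℕ) : Prop :=
  (∀ p < I.N, s.arr .vec g p = I.sig A col p) ∧ I.Good A col (s.arr .vec z)

end Problem

/-- The tables that describe the constraints and weights are set up. -/
structure HasTables (I : Problem) (s : Store) (B : ℕ) : Prop where
  pt : ∀ p < I.N, s.arr .pt 0 p < B
  cb : ∀ c < I.q, ∀ x ≤ I.d, s.arr .cb 0 c + x < B
  mu : ∀ p < I.N, ∀ c < I.q, ∀ x ≤ I.d,
    s.arr .mu (s.arr .pt 0 p) (s.arr .cb 0 c + x) ≠ 0 ↔ I.ok c p x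
  wt : ∀ c < I.q, s.arr .wt 0 c = I.wt c

lemma HasTables.frame {I : Problem} {s s' : Store} {B : ℕ} {W : List Arr} (h : HasTables I s B)
    (hf : Frame W s s') (h1 : Arr.pt ∉ W) (h2 : Arr.cb ∉ W) (h3 : Arr.mu ∉ W) (h4 : Arr.wt ∉ W) :
    HasTables I s' B := by
  constructor
  · rw [hf.arr _ h1]; exact h.pt
  · rw [hf.arr _ h2]; exact h.cb
  · rw [hf.arr _ h1, hf.arr _ h2, hf.arr _ h3]; exact h.mu
  · rw [hf.arr _ h4]; exact h.wt

/-- The stage of filling the rows `lo ≤ g < hi` of the table, from the store `s₀` with `S₀` as the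
next solution on. The entries are realized by colourings of `A` that satisfy `Ok`, and are at least as
good as all candidates `(g, z, w)` in `C`, where `w` is a weight. -/
structure TabInv (I : Problem) (s₀ : Store) (S₀ lo hi : ℕ) (A : Finset ℕ)
    (Ok : ℕ → ℕ → (ℕ → ℕ) → Prop) (C : ℕ → ℕ → ℕ → Prop) (S : ℕ) (s : Store) : Prop where
  le : S₀ ≤ S
  frame : Frame [.tab, .cost, .sol] s₀ s
  lim : s.lim + S₀ = s₀.lim + S
  old_cost : ∀ t < S₀, s.arr .cost 0 t = s₀.arr .cost 0 t
  old_sol : ∀ t < S₀, s.arr .sol t = s₀.arr .sol t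
  other : ∀ g, ¬ (lo ≤ g ∧ g < hi) → s.arr .tab g = s₀.arr .tab g
  sound : ∀ g z, lo ≤ g → g < hi → s.arr .tab g z ≠ 0 → s.arr .tab g z < S ∧
    ∃ col, I.Valid col ∧ Ok g z col ∧
      (∀ u < I.n, s.arr .sol (s.arr .tab g z) u = if u ∈ A then col u else 0) ∧
      s.arr .cost 0 (s.arr .tab g z) = I.weight A col
  complete : ∀ g z w, C g z w → lo ≤ g ∧ g < hi ∧ s.arr .tab g z ≠ 0 ∧
    s.arr .cost 0 (s.arr .tab g z) ≤ w

namespace TabInv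

variable {I : Problem} {s₀ s : Store} {S₀ S lo hi : ℕ} {A : Finset ℕ}
  {Ok : ℕ → ℕ → (ℕ → ℕ) → Prop} {C C' : ℕ → ℕ → ℕ → Prop}

lemma init (h : ∀ g z, lo ≤ g → g < hi → s₀.arr .tab g z = 0) :
    TabInv I s₀ S₀ lo hi A Ok (fun _ _ _ => False) S₀ s₀ :=
  ⟨le_rfl, .refl _ _, rfl, fun _ _ => rfl, fun _ _ => rfl, fun _ _ => rfl,
    fun g z h1 h2 h3 => absurd (h g z h1 h2) h3, fun _ _ _ h => h.elim⟩

lemma mono (H : TabInv I s₀ S₀ lo hi A Ok C S s) (h : ∀ g z w, C' g z w → C g z w) :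
    TabInv I s₀ S₀ lo hi A Ok C' S s :=
  { H with complete := fun g z w hc => H.complete g z w (h g z w hc) }

end TabInv

namespace Spec

/-- The candidate `(g, z, w)` is taken into account: either it is recorded, or a solution at least as good
is known already. -/
lemma improve {I : Problem} {s₀ s : Store} {S₀ S lo hi g z w T : ℕ} {A : Finset ℕ}
    {Ok : ℕ → ℕ → (ℕ → ℕ) → Prop} {C : ℕ → ℕ → ℕ → Prop} {fill : ℕ → Comp ℕ} {col : ℕ → ℕ}
    (H : TabInv I s₀ S₀ lo hi A Ok C S s) (hlim : S₀ < s₀.lim)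
    (hS₀ : 0 < S₀) (hlo : lo ≤ g)
    (hhi : g < hi) (hg : g < s₀.lim) (hz : z < s₀.lim) (hcol : I.Valid col) (hok : Ok g z col)
    (hw : w = I.weight A col)
    (hfill : ∀ u < I.n, ∀ s₁, Frame [.sol] s s₁ → s₁.lim = s.lim →
      (∀ t, t ≠ S → s₁.arr .sol t = s.arr .sol t) → Spec (fill u) s₁ fun _ s₂ c =>
        s₂ = s₁.set .sol S u (if u ∈ A then col u else 0) ∧ c ≤ T) :
    Spec (Comp.improve I.n 0 1 g z w S fill) s fun S' s' c =>
      TabInv I s₀ S₀ lo hi A Ok (fun g' z' w' => C g' z' w' ∨ g' = g ∧ z' = z ∧ w' = w) S' s' ∧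
      c ≤ I.n * (T + 1) + 12 := by
  have h1 := H.le
  have h2 := H.lim
  have hsound := H.sound g z hlo hhi
  -- the case in which the candidate is recorded as solution `S`
  have record : (s.arr .tab g z ≠ 0 → w < s.arr .cost 0 (s.arr .tab g z)) → Spec (do
      let _ ← Comp.foldN I.n 0 fun u _ => fill u
      let _ ← Comp.wr .cost 0 S w
      let _ ← Comp.wr .tab g z S
      let _ ← Comp.grow
      Comp.add S 1) s fun S' s' c =>
      TabInv I s₀ S₀ lo hi A Ok (fun g' z' w' => C g' z' w' ∨ g' = g ∧ z' = z ∧ w' = w) S' s' ∧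
      c ≤ I.n * (T + 1) + 5 := by
    intro hbetter
    simp only [bind_iff]
    refine (fillRow (b := .sol) (h := S) s (fun u => if u ∈ A then col u else 0) hfill).mono ?_
    rintro _ s₁ c ⟨a1, a2, a3, a4, a5⟩
    simp only [wr_iff, grow_iff, add_iff, Store.set_lim]
    refine ⟨by omega, by omega, by omega, by omega, ?_, by omega⟩
    have t1 : (((s₁.set .cost 0 S w).set .tab g z S).grow).arr =
      ((s₁.set .cost 0 S w).set .tab g z S).arr := rfl
    have etab : ∀ g' z', (((s₁.set .cost 0 S w).set .tab g z S).grow).arr .tab g' z' =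
        if g' = g ∧ z' = z then S else s.arr .tab g' z' := by
      intro g' z'
      rw [t1, Store.set_arr_cell, Store.set_arr_ne _ (by decide), a1.arr .tab (by decide)]
    have ecost : ∀ t, (((s₁.set .cost 0 S w).set .tab g z S).grow).arr .cost 0 t =
        if t = S then w else s.arr .cost 0 t := by
      intro t
      rw [t1, Store.set_arr_ne _ (by decide), Store.set_arr_cell, a1.arr .cost (by decide)]
      simp
    have esol : (((s₁.set .cost 0 S w).set .tab g z S).grow).arr .sol = s₁.arr .sol := by
      rw [t1, Store.set_arr_ne _ (by decide), Store.set_arr_ne _ (by decide)]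
    constructor
    · omega
    · exact (((H.frame.trans (a1.mono (by simp))).set (by simp) _ _ _).set (by simp) _ _ _).grow
    · simp only [Store.grow_lim, Store.set_lim]; omega
    · intro t ht
      rw [ecost, if_neg (by omega), H.old_cost t ht]
    · intro t ht
      rw [esol, a3 t (by omega), H.old_sol t ht]
    · intro g' hg'
      funext z'
      rw [etab, if_neg (by rintro ⟨rfl, rfl⟩; exact hg' ⟨hlo, hhi⟩), H.other g' hg']
    · intro g' z' h3 h4
      rw [etab]
      split_ifs with h5
      · intro _
        obtain ⟨rfl, rfl⟩ := h5
        refine ⟨by omega, col, hcol, hok, fun u hu => ?_, ?_⟩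
        · rw [esol, a4 u hu]
        · rw [ecost, if_pos rfl, hw]
      · intro h6
        obtain ⟨b1, col', b2, b3, b4, b5⟩ := H.sound g' z' h3 h4 h6
        refine ⟨by omega, col', b2, b3, fun u hu => ?_, ?_⟩
        · rw [esol, a3 _ (by omega), b4 u hu]
        · rw [ecost, if_neg (by omega), b5]
    · rintro g' z' w' (hc | ⟨rfl, rfl, rfl⟩)
      · obtain ⟨b1, b2, b3, b4⟩ := H.complete g' z' w' hc
        refine ⟨b1, b2, ?_⟩
        rw [etab]
        split_ifs with h5
        · obtain ⟨rfl, rfl⟩ := h5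
          rw [ecost, if_pos rfl]
          exact ⟨by omega, (hbetter b3).le.trans b4⟩
        · have := (H.sound g' z' b1 b2 b3).1
          rw [ecost, if_neg (by omega)]
          exact ⟨b3, b4⟩
      · refine ⟨hlo, hhi, ?_⟩
        rw [etab, if_pos ⟨rfl, rfl⟩, ecost, if_pos rfl]
        exact ⟨by omega, le_rfl⟩
  unfold Comp.improve
  rw [bind_iff, rd_iff]
  refine ⟨by omega, by omega, ?_⟩
  rw [bind_iff, ifEq_iff]
  split_ifs with h0
  · rw [pure_iff, ifEq_iff, if_neg (by omega)]
    refine (record fun h => absurd h0 h).mono ?_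
    rintro S' s' c ⟨c1, c2⟩
    exact ⟨c1, by omega⟩
  · obtain ⟨b1, col', b2, b3, b4, b5⟩ := hsound h0
    rw [bind_iff, rd_iff]
    refine ⟨by omega, by omega, ?_⟩
    rw [ifLt_iff]
    split_ifs with h3
    · rw [pure_iff, ifEq_iff, if_neg (by omega)]
      refine (record fun _ => h3).mono ?_
      rintro S' s' c ⟨c1, c2⟩
      exact ⟨c1, by omega⟩
    · rw [pure_iff, ifEq_iff, if_pos rfl, pure_iff]
      refine ⟨{ H with complete := ?_ }, by omega⟩
      rintro g' z' w' (hc | ⟨rfl, rfl, rfl⟩)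
      · exact H.complete g' z' w' hc
      · exact ⟨hlo, hhi, h0, by omega⟩

/-- A solution is stored with the colour `0` at the vertices outside of its set, so that the solution for a
disjoint union is the sum of the two solutions. -/
lemma joinSolutions {I : Problem} {s₀ s : Store} {S₀ S lo hi g z g₁ z₁ g₂ z₂ : ℕ}
    {A₁ A₂ : Finset ℕ} {Ok : ℕ → ℕ → (ℕ → ℕ) → Prop} {C : ℕ → ℕ → ℕ → Prop}
    {Ok₁ Ok₂ : (ℕ → ℕ) → Prop}
    (H : TabInv I s₀ S₀ lo hi (A₁ ∪ A₂) Ok C S s) (hA : Disjoint A₁ A₂) (hn : I.n ≤ s₀.lim)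
    (hlim : S₀ < s₀.lim) (hS₀ : 0 < S₀) (hlo : lo ≤ g) (hhi : g < hi) (hg : g < s₀.lim)
    (hz : z < s₀.lim) (hg₁ : g₁ < s₀.lim) (hz₁ : z₁ < s₀.lim) (hg₂ : g₂ < s₀.lim)
    (hz₂ : z₂ < s₀.lim) (hn₁ : ¬ (lo ≤ g₁ ∧ g₁ < hi)) (hn₂ : ¬ (lo ≤ g₂ ∧ g₂ < hi))
    (h₁ : s₀.arr .tab g₁ z₁ ≠ 0 → s₀.arr .tab g₁ z₁ < S₀ ∧ ∃ col, I.Valid col ∧ Ok₁ col ∧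
      (∀ u < I.n, s₀.arr .sol (s₀.arr .tab g₁ z₁) u = if u ∈ A₁ then col u else 0) ∧
      s₀.arr .cost 0 (s₀.arr .tab g₁ z₁) = I.weight A₁ col)
    (h₂ : s₀.arr .tab g₂ z₂ ≠ 0 → s₀.arr .tab g₂ z₂ < S₀ ∧ ∃ col, I.Valid col ∧ Ok₂ col ∧
      (∀ u < I.n, s₀.arr .sol (s₀.arr .tab g₂ z₂) u = if u ∈ A₂ then col u else 0) ∧
      s₀.arr .cost 0 (s₀.arr .tab g₂ z₂) = I.weight A₂ col)
    (hok : ∀ col₁ col₂, Ok₁ col₁ → Ok₂ col₂ → Ok g z (Problem.glue A₁ col₁ col₂)) :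
    Spec (Comp.joinSolutions I.n 0 1 S g z g₁ z₁ g₂ z₂) s fun S' s' c =>
      TabInv I s₀ S₀ lo hi (A₁ ∪ A₂) Ok (fun g' z' w' => C g' z' w' ∨ g' = g ∧ z' = z ∧
        s₀.arr .tab g₁ z₁ ≠ 0 ∧ s₀.arr .tab g₂ z₂ ≠ 0 ∧
        w' = s₀.arr .cost 0 (s₀.arr .tab g₁ z₁) + s₀.arr .cost 0 (s₀.arr .tab g₂ z₂)) S' s' ∧
      c ≤ I.n * 5 + 19 := by
  have hle := H.le
  have hl := H.lim
  unfold Comp.joinSolutions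
  simp only [bind_iff, rd_iff, H.other _ hn₁, H.other _ hn₂]
  refine ⟨by omega, by omega, by omega, by omega, ?_⟩
  rw [ifEq_iff]
  split_ifs with h3
  · rw [pure_iff]
    refine ⟨H.mono ?_, by omega⟩
    rintro g' z' w' (hc | ⟨_, _, hh, _⟩)
    · exact hc
    · exact absurd h3 hh
  rw [ifEq_iff]
  split_ifs with h4
  · rw [pure_iff]
    refine ⟨H.mono ?_, by omega⟩
    rintro g' z' w' (hc | ⟨_, _, _, hh, _⟩)
    · exact hc
    · exact absurd h4 hh
  obtain ⟨b1, col₁, b2, b3, b4, b5⟩ := h₁ h3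
  obtain ⟨d1, col₂, d2, d3, d4, d5⟩ := h₂ h4
  simp only [bind_iff, rd_iff, add_iff]
  refine ⟨by omega, by omega, by omega, by omega, ?_⟩
  rw [H.old_cost _ b1, H.old_cost _ d1]
  refine (improve (T := 4) (col := Problem.glue A₁ col₁ col₂) H hlim hS₀ hlo hhi hg hz
    (b2.glue d2) (hok _ _ b3 d3) ?_ ?_).mono ?_
  · rw [b5, d5, Problem.weight_union hA]
    refine congrArg₂ _ (Problem.weight_congr fun v hv => ?_) (Problem.weight_congr fun v hv => ?_)
    · rw [Problem.glue, if_pos hv]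
    · rw [Problem.glue, if_neg (Finset.disjoint_right.1 hA hv)]
  · intro u hu s₁ e1 e2 e3
    simp only [bind_iff, rd_iff, add_iff, wr_iff]
    refine ⟨by omega, by omega, by omega, by omega, by omega, by omega, ?_, by omega⟩
    rw [e3 _ (by omega), e3 _ (by omega), H.old_sol _ b1, H.old_sol _ d1, b4 u hu, d4 u hu]
    congr 1
    simp only [Finset.mem_union, Problem.glue]
    by_cases u1 : u ∈ A₁
    · simp [u1, Finset.disjoint_left.1 hA u1]
    · simp [u1]
  · rintro S' s' c ⟨f1, f2⟩
    exact ⟨f1.mono fun g' z' w' => Or.imp_right fun ⟨q1, q2, _, _, q3⟩ => ⟨q1, q2, q3⟩, by omega⟩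

lemma checkVertex {I : Problem} {s : Store} {v c z B : ℕ} (hN : I.N ≤ s.lim) (hB : B ≤ s.lim)
    (hn : I.n ≤ s.lim) (hq : I.q ≤ s.lim) (hz : z < s.lim) (hv : v < I.n) (hc : c < I.q)
    (hr : HasRows I s) (ht : HasTables I s B)
    (hzd : ∀ p < I.N, I.pu p = v → s.arr .vec z p ≤ I.d) :
    Spec (Comp.checkVertex I.N I.d 0 1 v c z) s fun b s' t => s' = s ∧
      (b ≠ 0 ↔ I.Good {v} (fun _ => c) (s.arr .vec z)) ∧ t ≤ I.N * 16 + 1 := by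
  unfold Comp.checkVertex
  refine (foldN (fun p b s' => s' = s ∧ (b ≠ 0 ↔ ∀ p' < p, I.pu p' ∈ ({v} : Finset ℕ) →
    I.ok c p' (min I.d (I.cnt {v} (fun _ => c) p' + s.arr .vec z p')))) 15 ⟨rfl, by simp⟩ ?_).mono ?_
  · rintro p hp b _ ⟨rfl, hb⟩
    rename_i s
    simp only [bind_iff, rd_iff, hr.pu p hp]
    refine ⟨by omega, by omega, ?_⟩
    have hstep : ∀ b', (b' ≠ 0 ↔ b ≠ 0 ∧ (I.pu p = v →
        I.ok c p (min I.d (I.cnt {v} (fun _ => c) p + s.arr .vec z p)))) →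
        (b' ≠ 0 ↔ ∀ p' < p + 1, I.pu p' ∈ ({v} : Finset ℕ) →
          I.ok c p' (min I.d (I.cnt {v} (fun _ => c) p' + s.arr .vec z p'))) := by
      intro b' hb'
      rw [hb', hb]
      constructor
      · rintro ⟨h1, h2⟩ p' hp' hpu
        obtain h | rfl := Nat.lt_succ_iff_lt_or_eq.1 hp'
        · exact h1 p' h hpu
        · exact h2 (Finset.mem_singleton.1 hpu)
      · intro h
        exact ⟨fun p' hp' => h p' (by omega), fun h' => h p (by omega) (Finset.mem_singleton.2 h')⟩
    by_cases hpu : I.pu p = v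
    · rw [ifEq_iff, if_pos hpu]
      have hx := hzd p hp hpu
      simp only [bind_iff, rd_iff, hr.tr p hp]
      refine ⟨by omega, by omega, by omega, by omega, ?_⟩
      have hcnt : I.cnt {v} (fun _ => c) p = if I.tr p = c then I.R p v else 0 := by
        simp only [Problem.cnt, Finset.sum_singleton, eq_comm]
      -- the count that is looked up is the capped total count
      have hlook : Spec (Comp.ifEq (I.tr p) c (do
          let r ← Comp.rd .rel p v
          let y ← Comp.add (s.arr .vec z p) r
          Comp.ifLt I.d y (pure I.d) (pure y)) (pure (s.arr .vec z p))) s fun x s' t => s' = s ∧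
            x = min I.d (I.cnt {v} (fun _ => c) p + s.arr .vec z p) ∧ t ≤ 5 := by
        rw [hcnt, ifEq_iff]
        split_ifs
        · simp only [bind_iff, rd_iff, add_iff, ifLt_iff, pure_iff, hr.rel p hp v hv]
          refine ⟨by omega, by omega, ?_⟩
          split_ifs
          · exact ⟨trivial, by omega, by omega⟩
          · exact ⟨trivial, by omega, by omega⟩
        · rw [pure_iff]
          exact ⟨rfl, by omega, by omega⟩
      refine hlook.mono ?_
      rintro x _ t ⟨rfl, rfl, hx'⟩
      rename_i s
      have hle : min I.d (I.cnt {v} (fun _ => c) p + s.arr .vec z p) ≤ I.d := min_le_left _ _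
      have h1 := ht.pt p hp
      have h2 := ht.cb c hc _ hle
      simp only [add_iff, ifEq_iff, pure_iff]
      refine ⟨by omega, by omega, by omega, by omega, by omega, by omega, ?_⟩
      have hmu := ht.mu p hp c hc _ hle
      split_ifs with h0
      · refine ⟨⟨trivial, hstep 0 ?_⟩, by omega⟩
        have : ¬ I.ok c p (min I.d (I.cnt {v} (fun _ => c) p + s.arr .vec z p)) :=
          fun h => hmu.2 h h0
        simp [hpu, this]
      · refine ⟨⟨trivial, hstep b ?_⟩, by omega⟩
        simp [hpu, hmu.1 h0]
    · rw [ifEq_iff, if_neg hpu, pure_iff]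
      exact ⟨⟨rfl, hstep b (by simp [hpu])⟩, by omega⟩
  · rintro b _ t ⟨⟨rfl, hb⟩, ht'⟩
    refine ⟨rfl, hb.trans ?_, ht'⟩
    unfold Problem.Good
    exact Iff.rfl

end Spec

/-! ### The tables -/

lemma Problem.Fits.congr_store {I : Problem} {s s' : Store} (h : s'.arr .vec = s.arr .vec)
    (A : Finset ℕ) (g z : ℕ) : I.Fits s' A g z = I.Fits s A g z := by
  unfold Fits; rw [h]

/-- The tables of the entries below `i` of a plan are complete, and all solutions are below `S`. -/
structure TablesUpTo (I : Problem) {L : ℕ} (P : Plan I.n L) (s : Store) (i S : ℕ) : Prop where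
  sound : ∀ j < i, ∀ g z, s.arr .st 0 j ≤ g → g < s.arr .en 0 j → s.arr .tab g z ≠ 0 →
    s.arr .tab g z < S ∧ ∃ col, I.Valid col ∧ I.Fits s (P.side j) g z col ∧
      (∀ u < I.n, s.arr .sol (s.arr .tab g z) u = if u ∈ P.side j then col u else 0) ∧
      s.arr .cost 0 (s.arr .tab g z) = I.weight (P.side j) col
  complete : ∀ j < i, ∀ g z, s.arr .st 0 j ≤ g → g < s.arr .en 0 j →
    s.arr .st 0 (P.rev j) ≤ z → z < s.arr .en 0 (P.rev j) → ∀ col, I.Valid col →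
    I.Fits s (P.side j) g z col → s.arr .tab g z ≠ 0 ∧
      s.arr .cost 0 (s.arr .tab g z) ≤ I.weight (P.side j) col
  zero : ∀ g z, (∀ j < i, ¬ (s.arr .st 0 j ≤ g ∧ g < s.arr .en 0 j)) → s.arr .tab g z = 0

namespace TablesUpTo

variable {I : Problem} {L : ℕ} {P : Plan I.n L} {s s' : Store} {i h S S' : ℕ}

/-- Extension by one entry. -/
lemma succ (H : ClassesUpTo I P s L h) (K : TablesUpTo I P s i S) (hi : i < L)
    {C : ℕ → ℕ → ℕ → Prop}
    (T : TabInv I s S (s.arr .st 0 i) (s.arr .en 0 i) (P.side i) (I.Fits s (P.side i)) C S' s')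
    (hC : ∀ g z, s.arr .st 0 i ≤ g → g < s.arr .en 0 i → s.arr .st 0 (P.rev i) ≤ z →
      z < s.arr .en 0 (P.rev i) → ∀ col, I.Valid col → I.Fits s (P.side i) g z col →
      ∃ w ≤ I.weight (P.side i) col, C g z w) : TablesUpTo I P s' (i + 1) S' := by
  have e1 : s'.arr .st = s.arr .st := T.frame.arr _ (by decide)
  have e2 : s'.arr .en = s.arr .en := T.frame.arr _ (by decide)
  have e3 : s'.arr .vec = s.arr .vec := T.frame.arr _ (by decide)
  have old : ∀ j < i, ∀ g, s.arr .st 0 j ≤ g → g < s.arr .en 0 j →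
      s'.arr .tab g = s.arr .tab g := by
    intro j hj g h1 h2
    refine T.other g fun h => ?_
    have := H.unique (by omega) hi h1 h2 h.1 h.2
    omega
  constructor
  · intro j hj g z
    rw [e1, e2, Problem.Fits.congr_store e3]
    intro h1 h2
    obtain hj | rfl := Nat.lt_succ_iff_lt_or_eq.1 hj
    · rw [old j hj g h1 h2]
      intro h3
      obtain ⟨b1, col, b2, b3, b4, b5⟩ := K.sound j hj g z h1 h2 h3
      rw [T.old_cost _ b1, T.old_sol _ b1]
      exact ⟨b1.trans_le T.le, col, b2, b3, b4, b5⟩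
    · exact T.sound g z h1 h2
  · intro j hj g z
    rw [e1, e2, Problem.Fits.congr_store e3]
    intro h1 h2 h3 h4 col hcol hf
    obtain hj | rfl := Nat.lt_succ_iff_lt_or_eq.1 hj
    · rw [old j hj g h1 h2]
      obtain ⟨b1, b2⟩ := K.complete j hj g z h1 h2 h3 h4 col hcol hf
      rw [T.old_cost _ (K.sound j hj g z h1 h2 b1).1]
      exact ⟨b1, b2⟩
    · obtain ⟨w, hw, hc⟩ := hC g z h1 h2 h3 h4 col hcol hf
      obtain ⟨_, _, b1, b2⟩ := T.complete g z w hc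
      exact ⟨b1, b2.trans hw⟩
  · intro g z
    rw [e1, e2]
    intro h1
    rw [T.other g (h1 i (by omega))]
    exact K.zero g z fun j hj => h1 j (by omega)

end TablesUpTo

namespace ClassesUpTo

variable {I : Problem} {L : ℕ} {P : Plan I.n L} {s : Store} {i h : ℕ}

/-- In the rows of the vertices of a side, the classes of the other side have no marks. -/
lemma row_le (H : ClassesUpTo I P s L h) (hi : i < L) {z : ℕ} (h1 : s.arr .st 0 (P.rev i) ≤ z)
    (h2 : z < s.arr .en 0 (P.rev i)) {p : ℕ} (hp : p < I.N) (hpu : I.pu p ∈ P.side i) :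
    s.arr .vec z p ≤ I.d := by
  obtain ⟨col, _, hrow⟩ := (H.cls _ (P.rev_lt i hi)).sound z h1 h2
  rw [hrow p hp, Problem.sig, if_neg]
  · exact min_le_left _ _
  · rw [P.side_rev i hi]; simp [hpu]

/-- The join of a class over `pb i` with one over `rev i` is one over `rev (pa i)`. -/
lemma join_pa (H : ClassesUpTo I P s L h) (hi : i < L) (hl : P.lf i = 0) {y z : ℕ}
    (y1 : s.arr .st 0 (P.pb i) ≤ y) (y2 : y < s.arr .en 0 (P.pb i))
    (z1 : s.arr .st 0 (P.rev i) ≤ z) (z2 : z < s.arr .en 0 (P.rev i)) :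
    s.arr .st 0 (P.rev (P.pa i)) ≤ s.arr .join y z ∧
    s.arr .join y z < s.arr .en 0 (P.rev (P.pa i)) ∧
    ∀ p < I.N, s.arr .vec (s.arr .join y z) p = I.jn (s.arr .vec y p) (s.arr .vec z p) := by
  have ha := (P.pa_lt i hi hl).trans hi
  obtain ⟨c1, ⟨c2, c3⟩ | ⟨c2, c3⟩⟩ := P.cross_pa i hi hl
  · obtain ⟨_, h2⟩ := H.join _ (P.rev_lt _ ha) c1 y z (by rwa [c2]) (by rwa [c2]) (by rwa [c3])
      (by rwa [c3])
    exact h2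
  · obtain ⟨h1, h2, h3, h4⟩ := H.join _ (P.rev_lt _ ha) c1 z y (by rwa [c2]) (by rwa [c2])
      (by rwa [c3]) (by rwa [c3])
    rw [h1]
    exact ⟨h2, h3, fun p hp => by rw [h4 p hp, Problem.jn_comm]⟩

/-- The join of a class over `pa i` with one over `rev i` is one over `rev (pb i)`. -/
lemma join_pb (H : ClassesUpTo I P s L h) (hi : i < L) (hl : P.lf i = 0) {x z : ℕ}
    (x1 : s.arr .st 0 (P.pa i) ≤ x) (x2 : x < s.arr .en 0 (P.pa i))
    (z1 : s.arr .st 0 (P.rev i) ≤ z) (z2 : z < s.arr .en 0 (P.rev i)) :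
    s.arr .st 0 (P.rev (P.pb i)) ≤ s.arr .join x z ∧
    s.arr .join x z < s.arr .en 0 (P.rev (P.pb i)) ∧
    ∀ p < I.N, s.arr .vec (s.arr .join x z) p = I.jn (s.arr .vec x p) (s.arr .vec z p) := by
  have hb := (P.pb_lt i hi hl).trans hi
  obtain ⟨c1, ⟨c2, c3⟩ | ⟨c2, c3⟩⟩ := P.cross_pb i hi hl
  · obtain ⟨_, h2⟩ := H.join _ (P.rev_lt _ hb) c1 x z (by rwa [c2]) (by rwa [c2]) (by rwa [c3])
      (by rwa [c3])
    exact h2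
  · obtain ⟨h1, h2, h3, h4⟩ := H.join _ (P.rev_lt _ hb) c1 z x (by rwa [c2]) (by rwa [c2])
      (by rwa [c3]) (by rwa [c3])
    rw [h1]
    exact ⟨h2, h3, fun p hp => by rw [h4 p hp, Problem.jn_comm]⟩

/-- A colouring of a union counts for an entry if and only if its two restrictions count for the two
entries that are combined into it. -/
lemma fits_join (H : ClassesUpTo I P s L h) (hi : i < L) (hl : P.lf i = 0) {x y z : ℕ}
    {col : ℕ → ℕ} (x1 : s.arr .st 0 (P.pa i) ≤ x) (x2 : x < s.arr .en 0 (P.pa i))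
    (y1 : s.arr .st 0 (P.pb i) ≤ y) (y2 : y < s.arr .en 0 (P.pb i))
    (z1 : s.arr .st 0 (P.rev i) ≤ z) (z2 : z < s.arr .en 0 (P.rev i))
    (hx : ∀ p < I.N, s.arr .vec x p = I.sig (P.side (P.pa i)) col p)
    (hy : ∀ p < I.N, s.arr .vec y p = I.sig (P.side (P.pb i)) col p) :
    I.Fits s (P.side i) (s.arr .join x y) z col ↔
      I.Fits s (P.side (P.pa i)) x (s.arr .join y z) col ∧
      I.Fits s (P.side (P.pb i)) y (s.arr .join x z) col := by
  obtain ⟨_, _, _, hxy⟩ := H.join i hi hl x y x1 x2 y1 y2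
  obtain ⟨_, _, hyz⟩ := H.join_pa hi hl y1 y2 z1 z2
  obtain ⟨_, _, hxz⟩ := H.join_pb hi hl x1 x2 z1 z2
  have hd := P.disjoint i hi hl
  have hg := Problem.good_union hd col (s.arr .vec z) fun p hp hpu =>
    H.row_le hi z1 z2 hp (by rwa [P.union i hi hl])
  rw [← P.union i hi hl] at hg
  constructor
  · rintro ⟨_, h2⟩
    obtain ⟨h3, h4⟩ := hg.1 h2
    exact ⟨⟨hx, h3.congr (fun _ _ => rfl) fun p hp => by rw [hyz p hp, hy p hp]⟩,
      ⟨hy, h4.congr (fun _ _ => rfl) fun p hp => by rw [hxz p hp, hx p hp]⟩⟩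
  · rintro ⟨⟨_, h3⟩, ⟨_, h4⟩⟩
    refine ⟨fun p hp => ?_, hg.2 ⟨?_, ?_⟩⟩
    · rw [hxy p hp, hx p hp, hy p hp, P.union i hi hl, Problem.sig_union hd]
    · exact h3.congr (fun _ _ => rfl) fun p hp => by rw [hyz p hp, hy p hp]
    · exact h4.congr (fun _ _ => rfl) fun p hp => by rw [hxz p hp, hx p hp]

/-- Two classes of an entry with equal rows are equal. -/
lemma eq_of_row (H : ClassesUpTo I P s L h) (hi : i < L) {g g' : ℕ}
    (h1 : s.arr .st 0 i ≤ g) (h2 : g < s.arr .en 0 i) (h1' : s.arr .st 0 i ≤ g')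
    (h2' : g' < s.arr .en 0 i) (h : ∀ p < I.N, s.arr .vec g p = s.arr .vec g' p) : g = g' := by
  by_contra hne
  obtain hlt | hlt : g < g' ∨ g' < g := by omega
  · obtain ⟨p, hp, hh⟩ := (H.cls i hi).distinct g g' h1 hlt h2'
    exact hh (h p hp)
  · obtain ⟨p, hp, hh⟩ := (H.cls i hi).distinct g' g h1' hlt h2
    exact hh (h p hp).symm

end ClassesUpTo

lemma Problem.Fits.congr {I : Problem} {s : Store} {A : Finset ℕ} {g z : ℕ} {col col' : ℕ → ℕ}
    (hf : I.Fits s A g z col) (h : ∀ v ∈ A, col v = col' v) : I.Fits s A g z col' :=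
  ⟨fun p hp => (hf.1 p hp).trans (sig_congr h p), hf.2.congr h fun _ _ => rfl⟩

namespace Spec

variable {I : Problem} {L B W : ℕ} {P : Plan I.n L}

lemma joinTable {s : Store} {i h S : ℕ} (H : ClassesUpTo I P s L h) (K : TablesUpTo I P s i S)
    (hi : i < L) (hl : P.lf i = 0) (hn : I.n ≤ s.lim) (hh : h ≤ s.lim) (hS : S < s.lim) (hS0 : 0 < S)
    (hW : ∀ i < L, I.SigBound (P.side i) W) :
    Spec (Comp.joinTable I.n 0 1 (s.arr .st 0 (P.pa i)) (s.arr .en 0 (P.pa i))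
      (s.arr .st 0 (P.pb i)) (s.arr .en 0 (P.pb i)) (s.arr .st 0 (P.rev i)) (s.arr .en 0 (P.rev i)) S)
      s fun S' s' c => TablesUpTo I P s' (i + 1) S' ∧ Frame [.tab, .cost, .sol] s s' ∧ S ≤ S' ∧
      s'.lim + S = s.lim + S' ∧ c ≤ W * (W * (W * (I.n * 5 + 23) + 4) + 3) + 4 := by
  have ha := P.pa_lt i hi hl
  have hb := P.pb_lt i hi hl
  have hr := P.rev_lt i hi
  have hla := H.le _ (ha.trans hi)
  have hlb := H.le _ (hb.trans hi)
  have hlr := H.le _ hr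
  have hli := H.le i hi
  have hWa := H.card_le le_rfl hW (ha.trans hi)
  have hWb := H.card_le le_rfl hW (hb.trans hi)
  have hWr := H.card_le le_rfl hW hr
  have hside := P.union i hi hl
  have hdisj := P.disjoint i hi hl
  generalize h_ea : s.arr .en 0 (P.pa i) = ea at *
  generalize h_sa : s.arr .st 0 (P.pa i) = sa at *
  generalize h_eb : s.arr .en 0 (P.pb i) = eb at *
  generalize h_sb : s.arr .st 0 (P.pb i) = sb at *
  generalize h_er : s.arr .en 0 (P.rev i) = er at *
  generalize h_sr : s.arr .st 0 (P.rev i) = sr at *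
  -- the candidates that come from the triples in `D`
  let C (D : ℕ → ℕ → ℕ → Prop) (g z w : ℕ) : Prop := ∃ x y, sa ≤ x ∧ x < ea ∧ sb ≤ y ∧ y < eb ∧
    sr ≤ z ∧ z < er ∧ D x y z ∧ g = s.arr .join x y ∧ s.arr .tab x (s.arr .join y z) ≠ 0 ∧
    s.arr .tab y (s.arr .join x z) ≠ 0 ∧ w = s.arr .cost 0 (s.arr .tab x (s.arr .join y z)) +
      s.arr .cost 0 (s.arr .tab y (s.arr .join x z))
  let J (D : ℕ → ℕ → ℕ → Prop) (S' : ℕ) (s' : Store) : Prop :=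
    TabInv I s S (s.arr .st 0 i) (s.arr .en 0 i) (P.side i) (I.Fits s (P.side i)) (C D) S' s'
  have Jmono : ∀ {D D' : ℕ → ℕ → ℕ → Prop} {S' s'}, J D S' s' →
      (∀ x y z, sa ≤ x → x < ea → sb ≤ y → y < eb → sr ≤ z → z < er → D' x y z → D x y z) →
      J D' S' s' := by
    intro D D' S' s' hJ hD
    refine hJ.mono ?_
    rintro g z w ⟨x, y, a1, a2, a3, a4, a5, a6, a7, a8⟩
    exact ⟨x, y, a1, a2, a3, a4, a5, a6, hD x y z a1 a2 a3 a4 a5 a6 a7, a8⟩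
  unfold Comp.joinTable
  simp only [bind_iff, sub_iff]
  refine (foldN (fun i1 S' s' => J (fun x _ _ => x < sa + i1) S' s')
    (W * (W * (I.n * 5 + 23) + 4) + 2) ?_ ?_).mono ?_
  · have hinit : TabInv I s S (s.arr .st 0 i) (s.arr .en 0 i) (P.side i) (I.Fits s (P.side i))
        (fun _ _ _ => False) S s := .init fun g z h1 h2 => K.zero g z fun j hj hh => by
      have := H.unique (by omega) hi hh.1 hh.2 h1 h2
      omega
    refine hinit.mono ?_
    rintro g z w ⟨x, y, a1, a2, a3, a4, a5, a6, a7, a8⟩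
    omega
  · intro i1 hi1 S1 s1 J1
    simp only [bind_iff, add_iff]
    refine (foldN (fun i2 S' s' => J (fun x y _ => x < sa + i1 ∨ x = sa + i1 ∧ y < sb + i2) S' s')
      (W * (I.n * 5 + 23) + 3) (Jmono J1 fun x y z _ _ y1 _ _ _ hd => by omega) ?_).mono ?_
    · intro i2 hi2 S2 s2 J2
      have g1 := J2.lim
      have g2 := J2.le
      simp only [bind_iff, add_iff, rd_iff]
      rw [J2.frame.arr .join (by decide)]
      refine ⟨by omega, by omega, ?_⟩
      generalize hx : sa + i1 = x at *
      generalize hy : sb + i2 = y at *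
      have x1 : sa ≤ x := by omega
      have x2 : x < ea := by omega
      have y1 : sb ≤ y := by omega
      have y2 : y < eb := by omega
      obtain ⟨j1, j2, j3, j4⟩ := H.join i hi hl x y (by omega) (by omega) (by omega) (by omega)
      refine (foldN (fun i3 S' s' => J (fun x' y' z' => (x' < x ∨ x' = x ∧ y' < y) ∨
        x' = x ∧ y' = y ∧ z' < sr + i3) S' s') (I.n * 5 + 22)
        (Jmono J2 fun x y z _ _ _ _ z1 _ hd => by omega) ?_).mono ?_
      · intro i3 hi3 S3 s3 J3
        have g3 := J3.lim
        have g4 := J3.le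
        simp only [bind_iff, add_iff, rd_iff]
        rw [J3.frame.arr .join (by decide)]
        refine ⟨by omega, by omega, by omega, by omega, ?_⟩
        generalize hz : sr + i3 = z at *
        have z1 : sr ≤ z := by omega
        have z2 : z < er := by omega
        obtain ⟨k1, k2, k3⟩ := H.join_pa hi hl (y := y) (z := z) (by omega) (by omega) (by omega)
          (by omega)
        obtain ⟨l1, l2, l3⟩ := H.join_pb hi hl (x := x) (z := z) (by omega) (by omega) (by omega)
          (by omega)
        have hja := H.le _ (P.rev_lt _ (ha.trans hi))
        have hjb := H.le _ (P.rev_lt _ (hb.trans hi))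
        have J3' := J3
        simp only [J] at J3'
        rw [hside] at J3'
        refine (joinSolutions J3' hdisj hn hS hS0 j2 j3 (by omega) (by omega) (by omega) (by omega)
          (by omega) (by omega) (fun hh => ?_) (fun hh => ?_)
          (K.sound _ ha x _ (by omega) (by omega)) (K.sound _ hb y _ (by omega) (by omega))
          ?_).mono ?_
        · have := H.unique hi (ha.trans hi) hh.1 hh.2 (by omega) (by omega)
          omega
        · have := H.unique hi (hb.trans hi) hh.1 hh.2 (by omega) (by omega)
          omega
        · intro col₁ col₂ f1 f2
          have f1' : I.Fits s (P.side (P.pa i)) x (s.arr .join y z)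
              (Problem.glue (P.side (P.pa i)) col₁ col₂) :=
            f1.congr fun v hv => by rw [Problem.glue, if_pos hv]
          have f2' : I.Fits s (P.side (P.pb i)) y (s.arr .join x z)
              (Problem.glue (P.side (P.pa i)) col₁ col₂) :=
            f2.congr fun v hv => by rw [Problem.glue, if_neg (Finset.disjoint_right.1 hdisj hv)]
          rw [← hside]
          exact (H.fits_join hi hl (by omega) (by omega) (by omega) (by omega) (by omega) (by omega)
            f1'.1 f2'.1).2 ⟨f1', f2'⟩
        · rintro S' s' c ⟨T, hc⟩
          rw [← hside] at T
          refine ⟨T.mono ?_, by omega⟩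
          rintro g' z' w' ⟨x', y', a1, a2, a3, a4, a5, a6, a7, a8, a9, a10, a11⟩
          by_cases hh : x' = x ∧ y' = y ∧ z' = z
          · obtain ⟨rfl, rfl, rfl⟩ := hh
            exact .inr ⟨a8, rfl, a9, a10, a11⟩
          · exact .inl ⟨x', y', a1, a2, a3, a4, a5, a6, by omega, a8, a9, a10, a11⟩
      · rintro S3 s3 c ⟨J3, hc⟩
        refine ⟨Jmono J3 fun x' y' z' _ _ _ _ _ _ hd => by omega, ?_⟩
        change c ≤ (er - sr) * (I.n * 5 + 23) + 1 at hc
        have := Nat.mul_le_mul_right (I.n * 5 + 23) hWr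
        omega
    · rintro S2 s2 c ⟨J2, hc⟩
      refine ⟨Jmono J2 fun x' y' z' _ _ _ _ _ _ hd => by omega, ?_⟩
      change c ≤ (eb - sb) * (W * (I.n * 5 + 23) + 4) + 1 at hc
      have := Nat.mul_le_mul_right (W * (I.n * 5 + 23) + 4) hWb
      omega
  · rintro S1 s1 c ⟨J1, hc⟩
    change c ≤ (ea - sa) * (W * (W * (I.n * 5 + 23) + 4) + 3) + 1 at hc
    have := Nat.mul_le_mul_right (W * (W * (I.n * 5 + 23) + 4) + 3) hWa
    refine ⟨K.succ H hi J1 ?_, J1.frame, J1.le, J1.lim, by omega⟩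
    intro g z g1 g2 z1 z2 col hcol hf
    obtain ⟨x, x1, x2, hx⟩ := H.complete _ (ha.trans hi) col hcol
    obtain ⟨y, y1, y2, hy⟩ := H.complete _ (hb.trans hi) col hcol
    obtain ⟨j1, j2, j3, j4⟩ := H.join i hi hl x y x1 x2 y1 y2
    have hg : g = s.arr .join x y := by
      refine H.eq_of_row hi g1 g2 j2 j3 fun p hp => ?_
      rw [hf.1 p hp, j4 p hp, hx p hp, hy p hp, hside, Problem.sig_union hdisj]
    subst hg
    obtain ⟨f1, f2⟩ := (H.fits_join hi hl x1 x2 y1 y2 z1 z2 hx hy).1 hf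
    obtain ⟨k1, k2, k3⟩ := H.join_pa hi hl y1 y2 z1 z2
    obtain ⟨l1, l2, l3⟩ := H.join_pb hi hl x1 x2 z1 z2
    obtain ⟨c1, c2⟩ := K.complete _ ha x _ x1 x2 k1 k2 col hcol f1
    obtain ⟨d1, d2⟩ := K.complete _ hb y _ y1 y2 l1 l2 col hcol f2
    refine ⟨_, ?_, x, y, by omega, by omega, by omega, by omega, by omega, by omega, by omega, rfl,
      c1, d1, rfl⟩
    rw [hside, Problem.weight_union hdisj]
    omega

lemma leafTable {s : Store} {i h S : ℕ} (H : ClassesUpTo I P s L h) (K : TablesUpTo I P s i S)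
    (hi : i < L) (hl : P.lf i ≠ 0) (hn : I.n ≤ s.lim) (hN : I.N ≤ s.lim) (hq : I.q ≤ s.lim)
    (hL : L ≤ s.lim) (hB : B ≤ s.lim) (hh : h ≤ s.lim) (hS : S < s.lim) (hS0 : 0 < S)
    (hr : HasRows I s) (ht : HasTables I s B) (hW : ∀ i < L, I.SigBound (P.side i) W) :
    Spec (Comp.leafTable I.n I.N I.q I.d 0 1 i (P.lf i - 1)
      (s.arr .st 0 (P.rev i)) (s.arr .en 0 (P.rev i)) S)
      s fun S' s' c => TablesUpTo I P s' (i + 1) S' ∧ Frame [.tab, .cost, .sol] s s' ∧ S ≤ S' ∧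
      s'.lim + S = s.lim + S' ∧ c ≤ I.q * (W * (I.N * 16 + I.n * 3 + 16) + 4) + 2 := by
  have hrev := P.rev_lt i hi
  have hlr := H.le _ hrev
  have hli := H.le i hi
  have hWr := H.card_le le_rfl hW hrev
  obtain ⟨hv, hside⟩ := P.leaf i hi hl
  generalize P.lf i - 1 = v at *
  generalize h_er : s.arr .en 0 (P.rev i) = er at *
  generalize h_sr : s.arr .st 0 (P.rev i) = sr at *
  -- the candidates that come from the pairs in `D`
  let C (D : ℕ → ℕ → Prop) (g z w : ℕ) : Prop := ∃ c, c < I.q ∧ sr ≤ z ∧ z < er ∧ D c z ∧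
    g = s.arr .cc i c ∧ I.Good {v} (fun _ => c) (s.arr .vec z) ∧ w = I.wt c
  let J (D : ℕ → ℕ → Prop) (S' : ℕ) (s' : Store) : Prop :=
    TabInv I s S (s.arr .st 0 i) (s.arr .en 0 i) (P.side i) (I.Fits s (P.side i)) (C D) S' s'
  have Jmono : ∀ {D D' : ℕ → ℕ → Prop} {S' s'}, J D S' s' →
      (∀ c z, sr ≤ z → z < er → D' c z → D c z) → J D' S' s' := by
    intro D D' S' s' hJ hD
    refine hJ.mono ?_
    rintro g z w ⟨c, a1, a2, a3, a4, a5⟩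
    exact ⟨c, a1, a2, a3, hD c z a2 a3 a4, a5⟩
  unfold Comp.leafTable
  simp only [bind_iff, sub_iff]
  refine (foldN (fun c S' s' => J (fun c' _ => c' < c) S' s')
    (W * (I.N * 16 + I.n * 3 + 16) + 3) ?_ ?_).mono ?_
  · have hinit : TabInv I s S (s.arr .st 0 i) (s.arr .en 0 i) (P.side i) (I.Fits s (P.side i))
        (fun _ _ _ => False) S s := .init fun g z h1 h2 => K.zero g z fun j hj hh => by
      have := H.unique (by omega) hi hh.1 hh.2 h1 h2
      omega
    refine hinit.mono ?_
    rintro g z w ⟨c, a1, a2, a3, a4, a5⟩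
    omega
  · intro c hc S1 s1 J1
    have g1 := J1.lim
    have g2 := J1.le
    obtain ⟨c1, c2, c3⟩ := H.leaf i hi hl c hc
    simp only [bind_iff, rd_iff]
    rw [J1.frame.arr .cc (by decide), J1.frame.arr .wt (by decide), ht.wt c hc]
    refine ⟨by omega, by omega, by omega, by omega, ?_⟩
    refine (foldN (fun i3 S' s' => J (fun c' z' => c' < c ∨ c' = c ∧ z' < sr + i3) S' s')
      (I.N * 16 + I.n * 3 + 15) (Jmono J1 fun c' z' _ _ hd => by omega) ?_).mono ?_
    · intro i3 hi3 S2 s2 J2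
      have g3 := J2.lim
      have g4 := J2.le
      simp only [bind_iff, add_iff]
      generalize hz : sr + i3 = z at *
      have hvec := J2.frame.arr .vec (by decide)
      refine (checkVertex (B := B) (s := s2) (by omega) (by omega) (by omega) (by omega) (by omega) hv hc
        (hr.frame J2.frame (by decide) (by decide) (by decide))
        (ht.frame J2.frame (by decide) (by decide) (by decide) (by decide)) ?_).mono ?_
      · intro p hp hpu
        rw [hvec]
        exact H.row_le hi (by omega) (by omega) hp (by rw [hside]; simp [hpu])
      · rintro b _ t ⟨rfl, hb, ht'⟩
        rename_i s2
        rw [hvec] at hb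
        rw [ifEq_iff]
        split_ifs with h0
        · rw [pure_iff]
          refine ⟨J2.mono ?_, by omega⟩
          rintro g' z' w' ⟨c', a1, a2, a3, a4, a5, a6, a7⟩
          refine ⟨c', a1, a2, a3, ?_, a5, a6, a7⟩
          have : ¬ (c' = c ∧ z' = z) := by
            rintro ⟨rfl, rfl⟩; exact (hb.2 a6) h0
          omega
        · refine (improve (T := 2) (col := fun _ => c) J2 hS hS0 c1 c2 (by omega) (by omega)
            (fun _ => hc) ⟨c3, by rw [hside]; exact hb.1 h0⟩ (by simp [Problem.weight, hside])
            ?_).mono ?_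
          · intro u hu s₁ e1 e2 e3
            simp only [ifEq_iff, wr_iff, hside, Finset.mem_singleton]
            split_ifs
            · exact ⟨by omega, by omega, rfl, by omega⟩
            · exact ⟨by omega, by omega, rfl, by omega⟩
          · rintro S' s' t' ⟨T, ht''⟩
            refine ⟨T.mono ?_, by omega⟩
            rintro g' z' w' ⟨c', a1, a2, a3, a4, a5, a6, a7⟩
            by_cases hh : c' = c ∧ z' = z
            · obtain ⟨rfl, rfl⟩ := hh
              exact .inr ⟨a5, rfl, a7⟩
            · exact .inl ⟨c', a1, a2, a3, by omega, a5, a6, a7⟩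
    · rintro S2 s2 t ⟨J2, hc'⟩
      refine ⟨Jmono J2 fun c' z' _ _ hd => by omega, ?_⟩
      change t ≤ (er - sr) * (I.N * 16 + I.n * 3 + 16) + 1 at hc'
      have := Nat.mul_le_mul_right (I.N * 16 + I.n * 3 + 16) hWr
      omega
  · rintro S1 s1 t ⟨J1, hc'⟩
    change t ≤ I.q * (W * (I.N * 16 + I.n * 3 + 16) + 4) + 1 at hc'
    refine ⟨K.succ H hi J1 ?_, J1.frame, J1.le, J1.lim, by omega⟩
    intro g z g1 g2 z1 z2 col hcol hf
    obtain ⟨c1, c2, c3⟩ := H.leaf i hi hl (col v) (hcol v)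
    have hcc : ∀ u ∈ P.side i, col u = (fun _ => col v) u := fun u hu => by
      rw [hside, Finset.mem_singleton] at hu; rw [hu]
    refine ⟨I.wt (col v), by simp [Problem.weight, hside], col v, hcol v, by omega, by omega,
      hcol v, ?_, ?_, rfl⟩
    · refine H.eq_of_row hi g1 g2 c1 c2 fun p hp => ?_
      rw [hf.1 p hp, c3 p hp, Problem.sig_congr hcc]
    · have := hf.2.congr hcc fun _ _ => rfl
      rwa [hside] at this

lemma tablePhase {h : ℕ} (s : Store) (H : ClassesUpTo I P s L h) (hlim : B + h ≤ s.lim)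
    (hB2 : 2 ≤ B) (hN : I.N ≤ B) (hn : I.n ≤ B) (hq : I.q ≤ B) (hL : L ≤ B) (hr : HasRows I s)
    (ht : HasTables I s B) (hP : HasPlan P s) (hW : ∀ i < L, I.SigBound (P.side i) W)
    (hz : ∀ g z, s.arr .tab g z = 0) :
    Spec (Comp.tablePhase L I.n I.N I.q I.d 0 1) s fun S s' c =>
      TablesUpTo I P s' L S ∧ Frame [.tab, .cost, .sol] s s' ∧ 1 ≤ S ∧ s'.lim + 1 = s.lim + S ∧
      c ≤ L * (W * (W * (W * (I.n * 5 + 23) + 4) + 3) +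
        I.q * (W * (I.N * 16 + I.n * 3 + 16) + 4) + 20) + 1 := by
  unfold Comp.tablePhase
  refine (foldN (fun i S s' => TablesUpTo I P s' i S ∧ Frame [.tab, .cost, .sol] s s' ∧ 1 ≤ S ∧
      s'.lim + 1 = s.lim + S) (W * (W * (W * (I.n * 5 + 23) + 4) + 3) +
        I.q * (W * (I.N * 16 + I.n * 3 + 16) + 4) + 19)
    ⟨⟨by simp, by simp, fun g z _ => hz g z⟩, .refl _ _, le_rfl, rfl⟩ ?_).mono ?_
  · rintro i hi S s1 ⟨K, a1, a2, a3⟩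
    have hP1 := hP.frame a1 (by decide) (by decide) (by decide) (by decide)
    have hr1 := hr.frame a1 (by decide) (by decide) (by decide)
    have ht1 := ht.frame a1 (by decide) (by decide) (by decide) (by decide)
    have hrev := P.rev_lt i hi
    have H1 : ClassesUpTo I P s1 L h := H.congr le_rfl
      (fun j _ => by rw [a1.arr _ (by decide)]) (fun j _ => by rw [a1.arr _ (by decide)])
      (fun j _ => by rw [a1.arr _ (by decide)]) (fun j _ => by rw [a1.arr _ (by decide)])
      (fun j _ _ x y _ _ _ _ => by rw [a1.arr _ (by decide)]; exact ⟨rfl, rfl⟩)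
    simp only [bind_iff, rd_iff, hP1.rev i hi, hP1.lf i hi]
    iterate 4 refine ⟨by omega, by omega, ?_⟩
    rw [ifEq_iff]
    by_cases hl : P.lf i = 0
    · rw [if_pos hl]
      have ha := P.pa_lt i hi hl
      have hb := P.pb_lt i hi hl
      simp only [bind_iff, rd_iff, hP1.pa i hi, hP1.pb i hi]
      iterate 6 refine ⟨by omega, by omega, ?_⟩
      refine (joinTable H1 K hi hl (by omega) (by omega) (by omega) (by omega) hW).mono ?_
      rintro S' s' c ⟨b1, b2, b3, b4, b5⟩
      exact ⟨⟨b1, a1.trans b2, by omega, by omega⟩, by omega⟩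
    · rw [if_neg hl]
      simp only [bind_iff, sub_iff]
      refine (leafTable (B := B) H1 K hi hl (by omega) (by omega) (by omega) (by omega) (by omega)
        (by omega) (by omega) (by omega) hr1 ht1 hW).mono ?_
      rintro S' s' c ⟨b1, b2, b3, b4, b5⟩
      exact ⟨⟨b1, a1.trans b2, by omega, by omega⟩, by omega⟩
  · rintro S s' c ⟨⟨b1, b2, b3, b4⟩, b5⟩
    exact ⟨b1, b2, b3, b4, b5⟩

end Spec

/-! ### The solution -/

namespace Spec

variable {I : Problem} {L B W : ℕ} {P : Plan I.n L}

/-- The optimum over all colourings that satisfy the constraints, as it is left in the table. -/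
structure _root_.Optimum (I : Problem) (s : Store) (h S : ℕ) : Prop where
  sound : s.arr .tab h h ≠ 0 → s.arr .tab h h < S ∧ ∃ col, I.Valid col ∧
    I.Good (Finset.range I.n) col 0 ∧ (∀ u < I.n, s.arr .sol (s.arr .tab h h) u = col u) ∧
    ∀ col', I.Valid col' → I.Good (Finset.range I.n) col' 0 →
      I.weight (Finset.range I.n) col ≤ I.weight (Finset.range I.n) col'
  complete : (∃ col, I.Valid col ∧ I.Good (Finset.range I.n) col 0) → s.arr .tab h h ≠ 0

lemma finalPhase {h S : ℕ} (s : Store) (H : ClassesUpTo I P s L h) (K : TablesUpTo I P s L S)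
    (hP : HasPlan P s) (hn : I.n ≤ s.lim) (hL : L ≤ s.lim) (hh : h < s.lim) (hS : S < s.lim)
    (hS0 : 0 < S) (hW : ∀ i < L, I.SigBound (P.side i) W) :
    Spec (Comp.finalPhase I.n 0 1 h S) s fun S' s' c => Optimum I s' h S' ∧
      Frame [.tab, .cost, .sol] s s' ∧ s'.lim + S = s.lim + S' ∧
      c ≤ W * (W * (I.n * 5 + 21) + 3) + 8 := by
  have h0 := P.pos
  have hr0 := P.rev_lt 0 h0
  have hrr := P.rev_rev 0 h0
  have hWa := H.card_le le_rfl hW h0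
  have hWr := H.card_le le_rfl hW hr0
  have hla := H.le _ h0
  have hlr := H.le _ hr0
  have hsub := P.subset 0 h0
  have hdisj : Disjoint (P.side 0) (P.side (P.rev 0)) := by
    rw [P.side_rev 0 h0]; exact Finset.disjoint_sdiff
  have hunion : P.side 0 ∪ P.side (P.rev 0) = Finset.range I.n := by
    rw [P.side_rev 0 h0]; exact Finset.union_sdiff_of_subset hsub
  unfold Comp.finalPhase
  simp only [bind_iff, rd_iff, sub_iff, hP.rev 0 h0]
  iterate 5 refine ⟨by omega, by omega, ?_⟩
  -- a colouring of all vertices is good if its restrictions fit the two entries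
  have key : ∀ {x z : ℕ} {col : ℕ → ℕ}, (∀ p < I.N, s.arr .vec x p = I.sig (P.side 0) col p) →
      (∀ p < I.N, s.arr .vec z p = I.sig (P.side (P.rev 0)) col p) →
      (I.Good (Finset.range I.n) col 0 ↔ I.Fits s (P.side 0) x z col ∧
        I.Fits s (P.side (P.rev 0)) z x col) := by
    intro x z col hx hz
    have hjn : ∀ A p, I.jn (I.sig A col p) 0 = I.sig A col p := by
      intro A p
      unfold Problem.jn Problem.sig
      split_ifs <;> omega
    rw [← hunion, Problem.good_union hdisj col 0 (fun _ _ _ => Nat.zero_le _)]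
    simp only [Pi.zero_apply, hjn]
    constructor
    · rintro ⟨h1, h2⟩
      exact ⟨⟨hx, h1.congr (fun _ _ => rfl) fun p hp => (hz p hp).symm⟩,
        ⟨hz, h2.congr (fun _ _ => rfl) fun p hp => (hx p hp).symm⟩⟩
    · rintro ⟨⟨_, h1⟩, ⟨_, h2⟩⟩
      exact ⟨h1.congr (fun _ _ => rfl) hz, h2.congr (fun _ _ => rfl) hx⟩
  generalize h_ea : s.arr .en 0 0 = ea at *
  generalize h_sa : s.arr .st 0 0 = sa at *
  generalize h_er : s.arr .en 0 (P.rev 0) = er at *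
  generalize h_sr : s.arr .st 0 (P.rev 0) = sr at *
  -- the candidates that come from the pairs in `D`
  let C (D : ℕ → ℕ → Prop) (g z w : ℕ) : Prop := g = h ∧ z = h ∧ ∃ x y, sa ≤ x ∧ x < ea ∧
    sr ≤ y ∧ y < er ∧ D x y ∧ s.arr .tab x y ≠ 0 ∧ s.arr .tab y x ≠ 0 ∧
    w = s.arr .cost 0 (s.arr .tab x y) + s.arr .cost 0 (s.arr .tab y x)
  let J (D : ℕ → ℕ → Prop) (S' : ℕ) (s' : Store) : Prop :=
    TabInv I s S h (h + 1) (Finset.range I.n) (fun _ _ col => I.Good (Finset.range I.n) col 0)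
      (C D) S' s'
  have Jmono : ∀ {D D' : ℕ → ℕ → Prop} {S' s'}, J D S' s' →
      (∀ x y, sa ≤ x → x < ea → sr ≤ y → y < er → D' x y → D x y) → J D' S' s' := by
    intro D D' S' s' hJ hD
    refine hJ.mono ?_
    rintro g z w ⟨b1, b2, x, y, a1, a2, a3, a4, a5, a6⟩
    exact ⟨b1, b2, x, y, a1, a2, a3, a4, hD x y a1 a2 a3 a4 a5, a6⟩
  refine (foldN (fun i1 S' s' => J (fun x _ => x < sa + i1) S' s')
    (W * (I.n * 5 + 21) + 2) ?_ ?_).mono ?_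
  · have hinit : TabInv I s S h (h + 1) (Finset.range I.n)
        (fun _ _ col => I.Good (Finset.range I.n) col 0)
        (fun _ _ _ => False) S s := .init fun g z h1 h2 => K.zero g z fun j hj hh => by
      have := H.le j hj
      omega
    refine hinit.mono ?_
    rintro g z w ⟨b1, b2, x, y, a1, a2, a3, a4, a5, a6⟩
    omega
  · intro i1 hi1 S1 s1 J1
    simp only [bind_iff, add_iff]
    generalize hx : sa + i1 = x at *
    refine (foldN (fun i3 S' s' => J (fun x' y' => x' < x ∨ x' = x ∧ y' < sr + i3) S' s')
      (I.n * 5 + 20) (Jmono J1 fun x y _ _ _ _ hd => by omega) ?_).mono ?_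
    · intro i3 hi3 S2 s2 J2
      simp only [bind_iff, add_iff]
      generalize hy : sr + i3 = y at *
      have J2' := J2
      simp only [J] at J2'
      rw [← hunion] at J2'
      refine (joinSolutions J2' hdisj hn hS hS0 le_rfl (by omega) hh hh (by omega) (by omega)
        (by omega) (by omega) (by omega) (by omega) (K.sound 0 h0 x y (by omega) (by omega))
        (K.sound _ hr0 y x (by omega) (by omega)) ?_).mono ?_
      · intro col₁ col₂ f1 f2
        have f1' : I.Fits s (P.side 0) x y (Problem.glue (P.side 0) col₁ col₂) :=
          f1.congr fun v hv => by rw [Problem.glue, if_pos hv]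
        have f2' : I.Fits s (P.side (P.rev 0)) y x (Problem.glue (P.side 0) col₁ col₂) :=
          f2.congr fun v hv => by rw [Problem.glue, if_neg (Finset.disjoint_right.1 hdisj hv)]
        rw [hunion]
        exact (key f1'.1 f2'.1).2 ⟨f1', f2'⟩
      · rintro S' s' c ⟨T, hc⟩
        rw [hunion] at T
        refine ⟨T.mono ?_, by omega⟩
        rintro g' z' w' ⟨b1, b2, x', y', a1, a2, a3, a4, a5, a6⟩
        by_cases hxy : x' = x ∧ y' = y
        · obtain ⟨rfl, rfl⟩ := hxy
          exact .inr ⟨b1, b2, a6⟩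
        · exact .inl ⟨b1, b2, x', y', a1, a2, a3, a4, by omega, a6⟩
    · rintro S2 s2 c ⟨J2, hc⟩
      refine ⟨Jmono J2 fun x' y' _ _ _ _ hd => by omega, ?_⟩
      change c ≤ (er - sr) * (I.n * 5 + 21) + 1 at hc
      have := Nat.mul_le_mul_right (I.n * 5 + 21) hWr
      omega
  · rintro S1 s1 c ⟨J1, hc⟩
    change c ≤ (ea - sa) * (W * (I.n * 5 + 21) + 3) + 1 at hc
    have := Nat.mul_le_mul_right (W * (I.n * 5 + 21) + 3) hWa
    -- every good colouring is met by a candidate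
    have hopt : ∀ col, I.Valid col → I.Good (Finset.range I.n) col 0 → s1.arr .tab h h ≠ 0 ∧
        s1.arr .cost 0 (s1.arr .tab h h) ≤ I.weight (Finset.range I.n) col := by
      intro col hcol hg
      obtain ⟨x, x1, x2, hx⟩ := H.complete 0 h0 col hcol
      obtain ⟨y, y1, y2, hy⟩ := H.complete _ hr0 col hcol
      obtain ⟨f1, f2⟩ := (key hx hy).1 hg
      obtain ⟨c1, c2⟩ := K.complete 0 h0 x y x1 x2 y1 y2 col hcol f1
      obtain ⟨d1, d2⟩ := K.complete _ hr0 y x y1 y2 (by rwa [hrr]) (by rwa [hrr]) col hcol f2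
      obtain ⟨_, _, e1, e2⟩ := J1.complete h h _ ⟨rfl, rfl, x, y, by omega, by omega, by omega,
        by omega, by omega, c1, d1, rfl⟩
      refine ⟨e1, e2.trans ?_⟩
      rw [← hunion, Problem.weight_union hdisj]
      omega
    refine ⟨⟨fun ht => ?_, fun ⟨col, h1, h2⟩ => (hopt col h1 h2).1⟩, J1.frame, J1.lim, by omega⟩
    obtain ⟨c1, col, c2, c3, c4, c5⟩ := J1.sound h h le_rfl (by omega) ht
    refine ⟨c1, col, c2, c3, fun u hu => ?_, fun col' h1 h2 => ?_⟩
    · rw [c4 u hu, if_pos (Finset.mem_range.2 hu)]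
    · rw [← c5]; exact (hopt col' h1 h2).2

lemma output {n h : ℕ} (s : Store) (hb : n < s.base) (hh : h < s.lim) (hn : n ≤ s.lim)
    (ht : s.arr .tab h h < s.lim) : Spec (Comp.output n 0 1 h) s fun _ s' c =>
      (s.arr .tab h h = 0 → s'.io 0 = 0) ∧
      (s.arr .tab h h ≠ 0 → s'.io 0 = 1 ∧
        ∀ u < n, s'.io (u + 1) = 1 - s.arr .sol (s.arr .tab h h) u) ∧
      s'.base = s.base ∧ c ≤ n * 5 + 4 := by
  unfold Comp.output
  simp only [bind_iff, rd_iff]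
  refine ⟨by omega, by omega, ?_⟩
  rw [ifEq_iff]
  split_ifs with h0
  · rw [ioWr_iff]
    refine ⟨by omega, fun _ => ?_, fun h => absurd h0 h, rfl, by omega⟩
    simp [Store.setIo_io]
  · simp only [bind_iff, ioWr_iff]
    refine ⟨by omega, ?_⟩
    refine (foldN (s := s.setIo 0 1) (fun u _ s' => s'.base = s.base ∧ s'.lim = s.lim ∧ s'.arr = s.arr ∧ s'.io 0 = 1 ∧
      ∀ u' < u, s'.io (u' + 1) = 1 - s.arr .sol (s.arr .tab h h) u') 4
      ⟨rfl, rfl, rfl, by simp [Store.setIo_io], by simp⟩ ?_).mono ?_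
    · rintro u hu _ s1 ⟨a1, a2, a3, a4, a5⟩
      simp only [bind_iff, rd_iff, sub_iff, add_iff, ioWr_iff, a3]
      refine ⟨by omega, by omega, by omega, ⟨a1, a2, a3, ?_, fun u' hu' => ?_⟩, by omega⟩
      · rw [Store.setIo_io, Function.update_of_ne (by omega), a4]
      · rw [Store.setIo_io]
        obtain h | rfl := Nat.lt_succ_iff_lt_or_eq.1 hu'
        · rw [Function.update_of_ne (by omega), a5 u' h]
        · rw [Function.update_self]
    · rintro _ s1 c ⟨⟨a1, a2, a3, a4, a5⟩, hc⟩
      exact ⟨fun h => absurd h h0, fun _ => ⟨a4, a5⟩, a1, by omega⟩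

end Spec

/-! ### The dynamic programming algorithm as a whole -/

open Classical in
/-- The problem to colour a digraph on `n` vertices with `q` colours. For each of the first `k` colours
there are two rows per vertex, which count the out-neighbours (for `e = 0`) and the in-neighbours (for
`e = 1`) of this colour `j`; `con (2 * j + e) c x` says whether a vertex of colour `c` tolerates `x` of
them. -/
noncomputable def mkProblem (n k q d : ℕ) (hd : 1 ≤ d) (Adj : ℕ → ℕ → Prop)
    (con : ℕ → ℕ → ℕ → Prop) (wt : ℕ → ℕ) : Problem where
  n := n
  N := 2 * (k * n)
  q := q
  d := d
  pu p := p / 2 % n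
  tr p := p / 2 / n
  R p v := if p % 2 = 0 then if Adj (p / 2 % n) v then 1 else 0 else if Adj v (p / 2 % n) then 1 else 0
  ok c p x := con (2 * (p / 2 / n) + p % 2) c x
  wt := wt
  d_pos := hd
  R_le p v := by split_ifs <;> simp
  pu_lt p hp := Nat.mod_lt _ (Nat.pos_of_ne_zero fun h => by simp [h] at hp)

/-- Every row is the one of a colour, a vertex and a direction. -/
lemma exists_row {n k p : ℕ} (hp : p < 2 * (k * n)) : ∃ j < k, ∃ u < n, ∃ e < 2,
    p = 2 * (j * n + u) + e ∧ p / 2 / n = j ∧ p / 2 % n = u ∧ p % 2 = e := by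
  have hn : 0 < n := Nat.pos_of_ne_zero fun h => by simp [h] at hp
  have h1 := Nat.div_add_mod' (p / 2) n
  have h2 := Nat.div_add_mod p 2
  refine ⟨p / 2 / n, ?_, p / 2 % n, Nat.mod_lt _ hn, p % 2, Nat.mod_lt _ (by omega), by omega, rfl,
    rfl, rfl⟩
  rw [Nat.div_lt_iff_lt_mul hn]
  omega

lemma row_div {n j u e : ℕ} (hu : u < n) (he : e < 2) : (2 * (j * n + u) + e) / 2 / n = j ∧
    (2 * (j * n + u) + e) / 2 % n = u ∧ (2 * (j * n + u) + e) % 2 = e := by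
  have h : (2 * (j * n + u) + e) / 2 = j * n + u := by omega
  refine ⟨?_, ?_, by omega⟩
  · rw [h, Nat.mul_comm, Nat.mul_add_div (by omega), Nat.div_eq_of_lt hu, add_zero]
  · rw [h, Nat.mul_comm, Nat.mul_add_mod, Nat.mod_eq_of_lt hu]

open Classical in
/-- The table that encodes the constraints `con`. -/
noncomputable def constraintTable (d : ℕ) (con : ℕ → ℕ → ℕ → Prop) (τ j : ℕ) : ℕ :=
  if con τ (j / (d + 1)) (j % (d + 1)) then 1 else 0

/-- The answer in the input-output region: the indicator of the colour `0` in an optimum colouring. -/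
def Answers (I : Problem) (s : Store) : Prop :=
  (s.io 0 = 0 ∧ ¬ ∃ col, I.Valid col ∧ I.Good (Finset.range I.n) col 0) ∨
  (s.io 0 = 1 ∧ ∃ col, I.Valid col ∧ I.Good (Finset.range I.n) col 0 ∧
    (∀ u < I.n, s.io (u + 1) = 1 - col u) ∧
    ∀ c, I.Valid c → I.Good (Finset.range I.n) c 0 →
      I.weight (Finset.range I.n) col ≤ I.weight (Finset.range I.n) c)

/-- A bound on the cost of the dynamic programming algorithm, for a list of `l` cuts. -/
def solveCost (n m k q d W N l : ℕ) : ℕ :=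
  8 * (k * (q * (d + 1))) + 8 * q + (k * (n * (n * 5 + 13) + 2) + m * (m * (m * 46 + 47) + 2) + l * 6) +
  l * (W * (W * (N * 9 + W * (N * 5 + 5) + 10) + 3) + q * (N * 7 + W * (N * 5 + 5) + 8) + 20) +
  l * (W * (W * (W * (n * 5 + 23) + 4) + 3) + q * (W * (N * 16 + n * 3 + 16) + 4) + 20) +
  (W * (W * (n * 5 + 21) + 3)) + n * 5 + 40

open Classical in
/-- The phases together; the last assumption bounds the number of signatures on each side. -/
lemma Spec.solve {n m k q d W : ℕ} (hd : 1 ≤ d) (Adj : ℕ → ℕ → Prop) (con : ℕ → ℕ → ℕ → Prop)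
    (wt : ℕ → ℕ) (T : TreeData n m) (s : Store)
    (hlim : 2 * (k * n) + n + 3 * m + q * (d + 1) + 2 * k + q + 10 ≤ s.lim) (hbase : n < s.base)
    (hadj : ∀ u < n, ∀ v < n, s.arr .adj u v = if Adj u v then 1 else 0)
    (htre : ∀ x < m, ∀ y < m, s.arr .tre x y = 0 ↔ ¬ T.adj x y)
    (hlv : ∀ x < m, s.arr .lv 0 x = T.lv x)
    (hzero : ∀ b, b ∉ [Arr.adj, .tre, .lv] → ∀ i j, s.arr b i j = 0)
    (hW : ∀ x y, T.adj x y → (mkProblem n k q d hd Adj con wt).SigBound (T.side x y) W) :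
    Spec (Comp.solve k q d (constraintTable d con) wt n m 0 1 (2 * (k * n))) s fun _ s' c =>
      Answers (mkProblem n k q d hd Adj con wt) s' ∧ s'.base = s.base ∧
      ∃ l ≤ 3 * m, c ≤ solveCost n m k q d W (2 * (k * n)) l := by
  set I := mkProblem n k q d hd Adj con wt with hI
  unfold Comp.solve
  rw [bind_iff]
  refine (loadCells .mu _ _ s ?_).mono ?_
  · rintro ⟨i, j⟩ hx
    simp at hx
    constructor <;> dsimp only <;> omega
  rintro _ s1 c1 ⟨a1, a2, a3, -, a5⟩
  rw [bind_iff]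
  refine (loadCells .cb _ _ s1 ?_).mono ?_
  · rintro ⟨i, j⟩ hx
    simp at hx
    constructor <;> dsimp only <;> omega
  rintro _ s2 c2 ⟨b1, b2, b3, -, b5⟩
  rw [bind_iff]
  refine (loadCells .wt _ _ s2 ?_).mono ?_
  · rintro ⟨i, j⟩ hx
    simp at hx
    constructor <;> dsimp only <;> omega
  rintro _ s3 c3 ⟨d1, d2, d3, -, d5⟩
  have f3 : Frame [.mu, .cb, .wt] s s3 := ((a1.mono (by simp)).trans (b1.mono (by simp))).trans
    (d1.mono (by simp))
  have hmu3 : ∀ τ < 2 * k, ∀ j < q * (d + 1), s3.arr .mu τ j = constraintTable d con τ j := by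
    intro τ hτ j hj
    rw [d1.arr _ (by decide), b1.arr _ (by decide)]
    exact a3 (τ, j) (by simp [hτ, hj])
  have hcb3 : ∀ c < q, s3.arr .cb 0 c = c * (d + 1) := by
    intro c hc
    rw [d1.arr _ (by decide)]
    exact b3 (0, c) (by simp [hc])
  have hwt3 : ∀ c < q, s3.arr .wt 0 c = wt c := by
    intro c hc
    exact d3 (0, c) (by simp [hc])
  simp only [bind_iff, const_iff, Comp.prepare, pure_iff]
  refine (buildRows k n s3 (fun u v => if Adj u v then 1 else 0) (by omega) (by omega) (by omega) ?_).mono ?_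
  · intro u hu v hv
    rw [f3.arr _ (by decide), hadj u hu v hv]
  rintro _ s4 c4 ⟨e1, e2, e3, e4⟩
  have f4 : Frame [.mu, .cb, .wt, .pu, .tr, .pt, .rel] s s4 :=
    (f3.mono (by simp)).trans (e1.mono (by simp))
  refine (listEdges (T := T) s4 (by omega) (by omega) ?_ ?_ ?_).mono ?_
  · rw [f4.arr _ (by decide)]; exact htre
  · rw [f4.arr _ (by decide)]; exact hlv
  · rw [f4.arr _ (by decide)]; exact hzero _ (by decide)
  rintro l s5 c5 ⟨g1, g2, g3, g4, g5⟩
  have hl := g3.le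
  refine (linkReverse l s5 (by omega) (by omega) g3 g4).mono ?_
  rintro _ s6 c6 ⟨i1, i2, i3, i4⟩
  set P : Plan n l := g3.plan g4 (s6.arr .rev 0) i3 with hPdef
  have f46 : Frame [.pos, .ex, .ey, .lf, .pa, .pb, .rev] s4 s6 :=
    (g1.mono (by simp)).trans (i1.mono (by simp))
  have f6 : Frame [.mu, .cb, .wt, .pu, .tr, .pt, .rel, .pos, .ex, .ey, .lf, .pa, .pb, .rev] s s6 :=
    (f4.mono (by simp)).trans (f46.mono (by simp))
  have hP6 : HasPlan (n := I.n) P s6 := by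
    constructor
    · rw [i1.arr _ (by decide)]; exact fun _ _ => rfl
    · rw [i1.arr _ (by decide)]; exact fun _ _ => rfl
    · rw [i1.arr _ (by decide)]; exact fun _ _ => rfl
    · exact fun _ _ => rfl
  have hr6 : HasRows I s6 := by
    constructor
    · intro p hp
      obtain ⟨j, hj, u, hu, e, he, rfl, q1, q2, q3⟩ := exists_row hp
      rw [f46.arr _ (by decide), (e3 j hj u hu e he).1]
      exact q2.symm
    · intro p hp
      obtain ⟨j, hj, u, hu, e, he, rfl, q1, q2, q3⟩ := exists_row hp
      rw [f46.arr _ (by decide), (e3 j hj u hu e he).2.1]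
      exact q1.symm
    · intro p hp v hv
      obtain ⟨j, hj, u, hu, e, he, rfl, q1, q2, q3⟩ := exists_row hp
      rw [f46.arr _ (by decide), (e3 j hj u hu e he).2.2.2 v hv]
      simp only [hI, mkProblem, q2, q3]
  have ht6 : HasTables I s6 (q * (d + 1) + 2 * k) := by
    have hx : ∀ c < q, ∀ x ≤ d, c * (d + 1) + x < q * (d + 1) := by
      intro c hc x hx
      have : (c + 1) * (d + 1) ≤ q * (d + 1) := Nat.mul_le_mul_right _ hc
      rw [Nat.succ_mul] at this; omega
    have hpt : ∀ j < k, ∀ u < n, ∀ e < 2, s6.arr .pt 0 (2 * (j * n + u) + e) = 2 * j + e := by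
      intro j hj u hu e he
      rw [f46.arr _ (by decide), (e3 j hj u hu e he).2.2.1]
    have hcb : s6.arr .cb = s3.arr .cb := by rw [f46.arr _ (by decide), e1.arr _ (by decide)]
    have hmu : s6.arr .mu = s3.arr .mu := by rw [f46.arr _ (by decide), e1.arr _ (by decide)]
    constructor
    · intro p hp
      obtain ⟨j, hj, u, hu, e, he, rfl, q1, q2, q3⟩ := exists_row hp
      rw [hpt j hj u hu e he]; omega
    · intro c hc x hxd
      rw [hcb, hcb3 c hc]
      have := hx c hc x hxd
      omega
    · intro p hp c hc x hxd
      obtain ⟨j, hj, u, hu, e, he, rfl, q1, q2, q3⟩ := exists_row hp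
      have hxd' : x ≤ d := hxd
      rw [hpt j hj u hu e he, hcb, hcb3 c hc, hmu, hmu3 _ (by omega) _ (hx c hc x hxd),
        constraintTable, Nat.mul_comm c, Nat.mul_add_div (by omega), Nat.mul_add_mod,
        Nat.div_eq_of_lt (by omega), Nat.mod_eq_of_lt (by omega)]
      simp only [hI, mkProblem, q1, q3]
      simp
    · rw [f46.arr _ (by decide), e1.arr _ (by decide)]; exact hwt3
  have hWP : ∀ i < l, I.SigBound (P.side i) W := fun i hi => hW _ _ (g3.adj i hi)
  have hIn : I.n = n := rfl
  have hIN : I.N = 2 * (k * n) := rfl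
  have hIq : I.q = q := rfl
  refine (classPhase (I := I) (P := P) (B := 2 * (k * n) + n + 3 * m + q * (d + 1) + 2 * k + q + 10)
    s6 (by omega) (by omega) (by omega) (by omega) (by omega) hr6 hP6 hWP).mono ?_
  rintro h s7 c7 ⟨k1, k2, k3, k4⟩
  have f7 : Frame [.mu, .cb, .wt, .pu, .tr, .pt, .rel, .pos, .ex, .ey, .lf, .pa, .pb, .rev, .st, .en,
    .vec, .cc, .join] s s7 := (f6.mono (by simp)).trans (k1.mono (by simp))
  have hP7 := hP6.frame k1 (by decide) (by decide) (by decide) (by decide)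
  refine (tablePhase (I := I) (P := P) (B := 2 * (k * n) + n + 3 * m + q * (d + 1) + 2 * k + q + 10)
    s7 k3 (by omega) (by omega) (by omega) (by omega) (by omega) (by omega)
    (hr6.frame k1 (by decide) (by decide) (by decide))
    ?_ hP7 hWP ?_).mono ?_
  · obtain ⟨t1, t2, t3, t4⟩ := ht6.frame k1 (by decide) (by decide) (by decide) (by decide)
    exact ⟨fun p hp => (t1 p hp).trans_le (by omega),
      fun c hc x hx => (t2 c hc x hx).trans_le (by omega), t3, t4⟩
  · rw [f7.arr _ (by decide)]; exact hzero _ (by decide)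
  rintro S s8 c8 ⟨l1, l2, l3, l4, l5⟩
  have k3' : ClassesUpTo I P s8 l h := k3.congr le_rfl
      (fun j _ => by rw [l2.arr _ (by decide)]) (fun j _ => by rw [l2.arr _ (by decide)])
      (fun j _ => by rw [l2.arr _ (by decide)]) (fun j _ => by rw [l2.arr _ (by decide)])
      (fun j _ _ x y _ _ _ _ => by rw [l2.arr _ (by decide)]; exact ⟨rfl, rfl⟩)
  refine (finalPhase (I := I) (P := P) s8 k3' l1
    (hP7.frame l2 (by decide) (by decide) (by decide) (by decide))
    (by omega) (by omega) (by omega) (by omega) (by omega) hWP).mono ?_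
  rintro S' s9 c9 ⟨m1, m2, m3, m4⟩
  have hb9 : s9.base = s.base := by rw [m2.base, l2.base, f7.base]
  refine (output s9 (by omega) (by omega) (by omega) ?_).mono ?_
  · by_cases h0 : s9.arr .tab h h = 0
    · omega
    · have := (m1.sound h0).1
      omega
  rintro _ s10 c10 ⟨n1, n2, n3, n4⟩
  refine ⟨?_, by omega, l, hl, ?_⟩
  · by_cases h0 : s9.arr .tab h h = 0
    · exact .inl ⟨n1 h0, fun hh => m1.complete hh h0⟩
    · obtain ⟨_, col, o1, o2, o3, o4⟩ := m1.sound h0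
      exact .inr ⟨(n2 h0).1, col, o1, o2, fun u hu => by rw [(n2 h0).2 u hu, o3 u hu], o4⟩
  · have z1 : (List.range (2 * k) ×ˢ List.range (q * (d + 1))).length = 2 * (k * (q * (d + 1))) := by
      rw [List.length_product, List.length_range, List.length_range, mul_assoc]
    have z2 : ([0] ×ˢ List.range q).length = q := by
      rw [List.length_product, List.length_range, List.length_singleton, one_mul]
    rw [z1] at a5
    rw [z2] at b5 d5
    rw [hIN, hIq] at k4 l5
    rw [hIn] at l5 m4
    simp only [solveCost]
    omega

/-! ### The running time in the array language -/

/-- With `N = 2 k n` rows, `l = O(n)` edges and `q = O(W ^ 2)` colours, every term of `solveCost` is bounded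
by a multiple of `W ^ 3 * k * n ^ 2` or of `n ^ 3`. -/
lemma solveCost_le {n m k q d W l : ℕ} (hn : 1 ≤ n) (hk : 1 ≤ k) (hW : 1 ≤ W) (hm : m ≤ 2 * n)
    (hl : l ≤ 3 * m) (hq : q ≤ 2 * W ^ 2) :
    solveCost n m k q d W (2 * (k * n)) l ≤ (16 * d + 4000) * (W ^ 3 * k * n ^ 2 + n ^ 3) := by
  have hl' : l ≤ 6 * n := by omega
  have key : ∀ a ≤ 3, ∀ b ≤ 1, ∀ c ≤ 2, W ^ a * k ^ b * n ^ c ≤ W ^ 3 * k * n ^ 2 := by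
    intro a ha b hb c hc
    have h1 := Nat.pow_le_pow_right hW ha
    have h2 := Nat.pow_le_pow_right hk hb
    have h3 := Nat.pow_le_pow_right hn hc
    rw [pow_one] at h2
    exact Nat.mul_le_mul (Nat.mul_le_mul h1 h2) h3
  have hn3 : n ≤ n ^ 3 := by
    simpa using Nat.pow_le_pow_right hn (show 1 ≤ 3 by omega)
  have hn23 : n ^ 2 ≤ n ^ 3 := Nat.pow_le_pow_right hn (by omega)
  have hd := Nat.mul_le_mul_left d (key 2 (by omega) 1 (by omega) 0 (by omega))
  calc solveCost n m k q d W (2 * (k * n)) l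
      ≤ solveCost n (2 * n) k (2 * W ^ 2) d W (2 * (k * n)) (6 * n) := by
        unfold solveCost; gcongr
    _ ≤ _ := by
      unfold solveCost
      linarith [key 0 (by omega) 0 (by omega) 0 (by omega), key 0 (by omega) 0 (by omega) 1 (by omega),
        key 0 (by omega) 0 (by omega) 2 (by omega), key 0 (by omega) 1 (by omega) 0 (by omega),
        key 0 (by omega) 1 (by omega) 1 (by omega), key 0 (by omega) 1 (by omega) 2 (by omega),
        key 1 (by omega) 0 (by omega) 0 (by omega), key 1 (by omega) 0 (by omega) 1 (by omega),
        key 1 (by omega) 0 (by omega) 2 (by omega), key 1 (by omega) 1 (by omega) 0 (by omega),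
        key 1 (by omega) 1 (by omega) 1 (by omega), key 1 (by omega) 1 (by omega) 2 (by omega),
        key 2 (by omega) 0 (by omega) 0 (by omega), key 2 (by omega) 0 (by omega) 1 (by omega),
        key 2 (by omega) 0 (by omega) 2 (by omega), key 2 (by omega) 1 (by omega) 0 (by omega),
        key 2 (by omega) 1 (by omega) 1 (by omega), key 2 (by omega) 1 (by omega) 2 (by omega),
        key 3 (by omega) 0 (by omega) 0 (by omega), key 3 (by omega) 0 (by omega) 1 (by omega),
        key 3 (by omega) 0 (by omega) 2 (by omega), key 3 (by omega) 1 (by omega) 0 (by omega),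
        key 3 (by omega) 1 (by omega) 1 (by omega), Nat.zero_le (d * n ^ 3)]

open Classical in
/-- The store that holds the input: `n`, `m`, the two adjacency matrices and the list of leaves. -/
structure InputStore {n m : ℕ} (Adj : ℕ → ℕ → Prop) (T : TreeData n m) (s : Store) : Prop where
  base : 2 + n * n + m * m + n ≤ s.base
  lim : s.lim = 0
  arr : ∀ b i j, s.arr b i j = 0
  n_eq : s.io 0 = n
  m_eq : s.io 1 = m
  adj : ∀ u < n, ∀ v < n, s.io (2 + u * n + v) = if Adj u v then 1 else 0
  tre : ∀ x < m, ∀ y < m, s.io (2 + n * n + x * m + y) = 0 ↔ ¬ T.adj x y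
  leaf : ∃ lf : ℕ → ℕ, (∀ v < n, s.io (2 + n * n + m * m + v) = lf v) ∧ (∀ v < n, lf v < m) ∧
    (∀ u < n, ∀ v < n, lf u = lf v → u = v) ∧ (∀ v < n, T.lv (lf v) = v + 1) ∧
    ∀ x, (∀ v < n, lf v ≠ x) → T.lv x = 0

/-- The store after the input has been read. -/
structure InputRead {n m : ℕ} (Adj : ℕ → ℕ → Prop) (T : TreeData n m) (s s' : Store) : Prop where
  frame : Frame [.adj, .tre, .lv] s s'
  adj : ∀ u < n, ∀ v < n, s'.arr .adj u v = s.io (2 + u * n + v)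
  tre : ∀ x < m, ∀ y < m, s'.arr .tre x y = 0 ↔ ¬ T.adj x y
  lv : ∀ x < m, s'.arr .lv 0 x = T.lv x

namespace Spec

variable {n m : ℕ} {Adj : ℕ → ℕ → Prop} {T : TreeData n m}

lemma readInput {s : Store} (h : InputStore Adj T s) {extra : ℕ} (he : 1 ≤ extra) (N : ℕ) :
    Spec (Comp.readInput extra n m 0 1 2 N) s fun _ s' c => InputRead Adj T s s' ∧
      s'.lim = n + 3 * m + N + extra ∧
      c ≤ n * (n * 4 + 2) + m * (m * 4 + 2) + n * 5 + 3 * (n + 3 * m + N + extra) + 10 := by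
  obtain ⟨lf, h1, h2, h3, h4, h5⟩ := h.leaf
  unfold Comp.readInput
  simp only [bind_iff, add_iff, const_iff]
  refine (growBy _ s).mono ?_
  rintro _ s1 c1 ⟨a1, a2, a3⟩
  rw [h.lim] at a2
  refine (copyInput n m s1 (by omega) (by omega) (by omega) (by rw [a1.base]; exact h.base) lf ?_ h2 ?_
    h3).mono ?_
  · rw [a1.io]; exact h1
  · intro x; rw [a1.arr _ (by simp)]; exact h.arr _ _ _
  rintro _ s2 c2 ⟨b1, b2, b3, b4, b5, b6, b7⟩
  rw [a1.io] at b3 b4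
  refine ⟨⟨(a1.mono (by simp)).trans b1, b3, fun x hx y hy => ?_, fun x hx => ?_⟩, by omega, by omega⟩
  · rw [b4 x hx y hy]; exact h.tre x hx y hy
  · by_cases hh : ∃ v < n, lf v = x
    · obtain ⟨v, hv, rfl⟩ := hh
      rw [b5 v hv, h4 v hv]
    · push Not at hh
      rw [b6 x hh, h5 x hh]

/-- The number of rows is computed by additions. -/
lemma countRows (k n : ℕ) (s : Store) : Spec (Comp.foldN k 0 fun _ acc => do
    let a ← Comp.add acc n
    Comp.add a n) s fun N s' c => N = 2 * (k * n) ∧ s' = s ∧ c ≤ 3 * k + 1 := by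
  refine (foldN (fun i acc s' => acc = 2 * (i * n) ∧ s' = s) 2 ⟨by simp, rfl⟩ ?_).mono ?_
  · rintro i hi acc _ ⟨rfl, rfl⟩
    simp only [bind_iff, add_iff]
    exact ⟨⟨by ring, trivial⟩, by omega⟩
  · rintro N s' c ⟨⟨rfl, rfl⟩, hc⟩
    exact ⟨rfl, rfl, by omega⟩

lemma optimize {k q d W : ℕ} (hd : 1 ≤ d) (con : ℕ → ℕ → ℕ → Prop) (wt : ℕ → ℕ) {s : Store}
    (h : InputStore Adj T s) (hn : 1 ≤ n) (hk : 1 ≤ k) (hW : 1 ≤ W) (hm : m ≤ 2 * n)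
    (hq : q ≤ 2 * W ^ 2)
    (hB : ∀ x y, T.adj x y → (mkProblem n k q d hd Adj con wt).SigBound (T.side x y) W) :
    Spec (Comp.optimize k q d (constraintTable d con) wt) s fun _ s' c =>
      Answers (mkProblem n k q d hd Adj con wt) s' ∧ s'.base = s.base ∧
      c ≤ (22 * d + 4200) * (W ^ 3 * k * n ^ 2 + n ^ 3) := by
  have hbase := h.base
  unfold Comp.optimize
  simp only [bind_iff, const_iff, ioRd_iff, h.n_eq, h.m_eq]
  refine ⟨by omega, by omega, (countRows k n s).mono ?_⟩
  rintro _ _ c1 ⟨rfl, rfl, a1⟩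
  rename_i s
  refine (readInput h (by omega) _).mono ?_
  rintro _ s2 c2 ⟨b1, b2, b3⟩
  refine (Spec.solve hd Adj con wt T s2 (by omega) (by rw [b1.frame.base]; omega) ?_ b1.tre b1.lv ?_
    hB).mono ?_
  · intro u hu v hv
    rw [b1.adj u hu v hv, h.adj u hu v hv]
  · intro b hb i j
    rw [b1.frame.arr b hb]; exact h.arr b i j
  rintro _ s3 c3 ⟨d1, d2, l, d3, d4⟩
  refine ⟨d1, d2.trans b1.frame.base, ?_⟩
  have key := solveCost_le (d := d) hn hk hW hm d3 hq
  have hX : ∀ a ≤ 3, ∀ b ≤ 1, ∀ c ≤ 2, W ^ a * k ^ b * n ^ c ≤ W ^ 3 * k * n ^ 2 := by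
    intro a ha b hb c hc
    have h1 := Nat.pow_le_pow_right hW ha
    have h2 := Nat.pow_le_pow_right hk hb
    have h3 := Nat.pow_le_pow_right hn hc
    rw [pow_one] at h2
    exact Nat.mul_le_mul (Nat.mul_le_mul h1 h2) h3
  have hqd : q * (d + 1) ≤ 2 * W ^ 2 * (d + 1) := Nat.mul_le_mul_right _ hq
  have hdd := Nat.mul_le_mul_left d (hX 2 (by omega) 0 (by omega) 0 (by omega))
  have hmm : m * (m * 4 + 2) ≤ 2 * n * (2 * n * 4 + 2) := by gcongr
  linarith [hX 0 (by omega) 0 (by omega) 0 (by omega), hX 0 (by omega) 0 (by omega) 1 (by omega),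
    hX 0 (by omega) 0 (by omega) 2 (by omega), hX 0 (by omega) 1 (by omega) 0 (by omega),
    hX 0 (by omega) 1 (by omega) 1 (by omega), hX 2 (by omega) 0 (by omega) 0 (by omega),
    Nat.zero_le (d * n ^ 3), Nat.zero_le (n ^ 3)]

lemma hasEdge {s : Store} (hn : n ≤ s.lim) : Spec (Comp.hasEdge n 0 1) s fun f s' c => s' = s ∧
    (f = 0 ↔ ∀ u < n, ∀ v < n, u ≠ v → s.arr .adj u v = 0) ∧ c ≤ n * (n * 5 + 2) + 1 := by
  unfold Comp.hasEdge
  refine (foldN (fun u f s' => s' = s ∧ (f = 0 ↔ ∀ u' < u, ∀ v < n, u' ≠ v → s.arr .adj u' v = 0))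
    (n * 5 + 1) ⟨rfl, by simp⟩ ?_).mono ?_
  · rintro u hu f _ ⟨rfl, hf⟩
    rename_i s
    refine (foldN (fun v f s' => s' = s ∧ (f = 0 ↔ (∀ u' < u, ∀ v < n, u' ≠ v → s.arr .adj u' v = 0) ∧
      ∀ v' < v, u ≠ v' → s.arr .adj u v' = 0)) 4 ⟨rfl, by simpa using hf⟩ ?_).mono ?_
    · rintro v hv f' _ ⟨rfl, hf'⟩
      rename_i s
      have step : (∀ v' < v + 1, u ≠ v' → s.arr .adj u v' = 0) ↔
          (∀ v' < v, u ≠ v' → s.arr .adj u v' = 0) ∧ (u ≠ v → s.arr .adj u v = 0) := by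
        constructor
        · exact fun h => ⟨fun v' hv' => h v' (by omega), h v (by omega)⟩
        · rintro ⟨h1, h2⟩ v' hv'
          obtain h | rfl := Nat.lt_succ_iff_lt_or_eq.1 hv'
          · exact h1 v' h
          · exact h2
      rw [ifEq_iff, step]
      split_ifs with huv
      · rw [pure_iff]
        exact ⟨⟨rfl, by simp [hf', huv]⟩, by omega⟩
      · simp only [bind_iff, rd_iff, ifEq_iff, pure_iff]
        refine ⟨by omega, by omega, ?_⟩
        split_ifs with h0
        · exact ⟨⟨trivial, by simp [hf', h0]⟩, by omega⟩
        · exact ⟨⟨trivial, by simp [huv, h0]⟩, by omega⟩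
    · rintro f' _ c ⟨⟨rfl, hf'⟩, hc⟩
      refine ⟨⟨rfl, hf'.trans ⟨?_, ?_⟩⟩, by omega⟩
      · rintro ⟨h1, h2⟩ u' hu'
        obtain h | rfl := Nat.lt_succ_iff_lt_or_eq.1 hu'
        · exact h1 u' h
        · exact h2
      · exact fun h => ⟨fun u' hu' => h u' (by omega), h u (by omega)⟩
  · rintro f _ c ⟨⟨rfl, hf⟩, hc⟩
    exact ⟨rfl, hf, by omega⟩

lemma answerLoops {s : Store} (okNon okLoop : ℕ) (hn : n ≤ s.lim) (hb : 0 < s.base) :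
    Spec (Comp.answerLoops okNon okLoop n 0 1) s fun _ s' c => s'.base = s.base ∧
      s'.io 0 ≤ 1 ∧ (s'.io 0 ≠ 0 ↔ ∀ u < n, (if s.arr .adj u u = 0 then okNon else okLoop) ≠ 0) ∧
      c ≤ n * 6 + 2 := by
  unfold Comp.answerLoops
  rw [bind_iff]
  refine (foldN (fun u f s' => s' = s ∧ f ≤ 1 ∧
    (f ≠ 0 ↔ ∀ u' < u, (if s.arr .adj u' u' = 0 then okNon else okLoop) ≠ 0)) 5
    ⟨rfl, le_rfl, by simp⟩ ?_).mono ?_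
  · rintro u hu f _ ⟨rfl, hf1, hf⟩
    rename_i s
    simp only [bind_iff, rd_iff]
    refine ⟨by omega, by omega, ?_⟩
    have hloop : Spec (Comp.ifEq (s.arr .adj u u) 0 (Comp.const okNon) (Comp.const okLoop)) s
        fun t s' c => t = (if s.arr .adj u u = 0 then okNon else okLoop) ∧ s' = s ∧ c ≤ 2 := by
      rw [ifEq_iff]
      split_ifs
      · rw [const_iff]; exact ⟨rfl, rfl, by omega⟩
      · rw [const_iff]; exact ⟨rfl, rfl, by omega⟩
    refine hloop.mono ?_
    rintro t _ c ⟨ht, rfl, hc⟩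
    rename_i s
    have step : (∀ u' < u + 1, (if s.arr .adj u' u' = 0 then okNon else okLoop) ≠ 0) ↔
        f ≠ 0 ∧ t ≠ 0 := by
      rw [hf, ht]
      constructor
      · exact fun h => ⟨fun u' hu' => h u' (by omega), h u (by omega)⟩
      · rintro ⟨h1, h2⟩ u' hu'
        obtain h | rfl := Nat.lt_succ_iff_lt_or_eq.1 hu'
        · exact h1 u' h
        · exact h2
    rw [ifEq_iff, step]
    split_ifs with h0
    · rw [pure_iff]
      exact ⟨⟨rfl, by omega, by simp [h0]⟩, by omega⟩
    · rw [pure_iff]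
      exact ⟨⟨rfl, hf1, by simp [h0]⟩, by omega⟩
  · rintro f _ c ⟨⟨rfl, hf1, hf⟩, hc⟩
    rename_i s
    rw [ioWr_iff]
    refine ⟨hb, rfl, ?_, ?_, by omega⟩
    · simpa [Store.setIo_io] using hf1
    · simpa [Store.setIo_io] using hf

/-- A digraph without edges other than loops is treated apart, within a time that depends on `n` only. The
bound on `q` is needed only if there is another edge. -/
lemma decideExists {k q d W : ℕ} (hd : 1 ≤ d) (con : ℕ → ℕ → ℕ → Prop) (okNon okLoop : ℕ)
    {s : Store} (h : InputStore Adj T s) (hn : 1 ≤ n) (hk : 1 ≤ k) (hW : 1 ≤ W) (hm : m ≤ 2 * n)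
    (hq : (∃ u < n, ∃ v < n, u ≠ v ∧ Adj u v) → q ≤ 2 * W ^ 2)
    (hB : ∀ x y, T.adj x y → (mkProblem n k q d hd Adj con fun _ => 0).SigBound (T.side x y) W) :
    Spec (Comp.decideExists k q d (constraintTable d con) okNon okLoop) s fun _ s' c =>
      ((¬ ∃ u < n, ∃ v < n, u ≠ v ∧ Adj u v) → s'.io 0 ≤ 1 ∧
        (s'.io 0 ≠ 0 ↔ ∀ u < n, (Adj u u → okLoop ≠ 0) ∧ (¬ Adj u u → okNon ≠ 0)) ∧
        c ≤ 200 * n ^ 2) ∧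
      ((∃ u < n, ∃ v < n, u ≠ v ∧ Adj u v) →
        Answers (mkProblem n k q d hd Adj con fun _ => 0) s') ∧
      s'.base = s.base ∧ c ≤ (22 * d + 4300) * (W ^ 3 * k * n ^ 2 + n ^ 3) := by
  classical
  have hbase := h.base
  have hX : ∀ a ≤ 3, ∀ b ≤ 1, ∀ c ≤ 2, W ^ a * k ^ b * n ^ c ≤ W ^ 3 * k * n ^ 2 := by
    intro a ha b hb c hc
    have h1 := Nat.pow_le_pow_right hW ha
    have h2 := Nat.pow_le_pow_right hk hb
    have h3 := Nat.pow_le_pow_right hn hc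
    rw [pow_one] at h2
    exact Nat.mul_le_mul (Nat.mul_le_mul h1 h2) h3
  have hmm : m * (m * 4 + 2) ≤ 2 * n * (2 * n * 4 + 2) := by gcongr
  unfold Comp.decideExists
  simp only [bind_iff, const_iff, ioRd_iff, h.n_eq, h.m_eq]
  refine ⟨by omega, by omega, (readInput h (by omega) _).mono ?_⟩
  rintro _ s2 c2 ⟨b1, b2, b3⟩
  refine (hasEdge (by omega)).mono ?_
  rintro f _ c3 ⟨rfl, e1, e2⟩
  rename_i s2
  have hadj : ∀ u < n, ∀ v < n, s2.arr .adj u v = if Adj u v then 1 else 0 := by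
    intro u hu v hv
    rw [b1.adj u hu v hv, h.adj u hu v hv]
  have e1' : f = 0 ↔ ¬ ∃ u < n, ∃ v < n, u ≠ v ∧ Adj u v := by
    rw [e1]
    push Not
    refine forall₄_congr fun u hu v hv => ?_
    rw [hadj u hu v hv]
    simp
  rw [ifEq_iff]
  split_ifs with h0
  · have hne := e1'.1 h0
    refine (answerLoops okNon okLoop (by omega) (by rw [b1.frame.base]; omega)).mono ?_
    rintro _ s3 c4 ⟨d1, d2, d3, d4⟩
    refine ⟨fun _ => ⟨d2, d3.trans ?_, ?_⟩, fun hh => absurd hh hne, by rw [d1, b1.frame.base], ?_⟩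
    · refine forall₂_congr fun u hu => ?_
      rw [hadj u hu u hu]
      by_cases hl : Adj u u <;> simp [hl]
    · nlinarith
    · linarith [hX 0 (by omega) 0 (by omega) 0 (by omega), hX 0 (by omega) 0 (by omega) 1 (by omega),
        hX 0 (by omega) 0 (by omega) 2 (by omega), Nat.zero_le (d * n ^ 3), Nat.zero_le (n ^ 3),
        Nat.zero_le (d * (W ^ 3 * k * n ^ 2))]
  · have hne : ∃ u < n, ∃ v < n, u ≠ v ∧ Adj u v := by
      by_contra hh; exact h0 (e1'.2 hh)
    simp only [bind_iff, const_iff, add_iff]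
    refine (countRows k n s2).mono ?_
    rintro _ _ c4 ⟨rfl, rfl, a1⟩
    rename_i s2
    refine (growBy _ s2).mono ?_
    rintro _ s3 c5 ⟨g1, g2, g3⟩
    refine (Spec.solve hd Adj con _ T s3 (by omega) (by rw [g1.base, b1.frame.base]; omega) ?_ ?_ ?_ ?_
      hB).mono ?_
    · intro u hu v hv
      rw [g1.arr _ (by simp), hadj u hu v hv]
    · rw [g1.arr _ (by simp)]; exact b1.tre
    · rw [g1.arr _ (by simp)]; exact b1.lv
    · intro b hb i j
      rw [g1.arr _ (by simp), b1.frame.arr b hb]; exact h.arr b i j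
    rintro _ s4 c6 ⟨d1, d2, l, d3, d4⟩
    refine ⟨fun hh => absurd hne hh, fun _ => d1, by rw [d2, g1.base, b1.frame.base], ?_⟩
    have key := solveCost_le (d := d) hn hk hW hm d3 (hq hne)
    have hq' := hq hne
    have hqd : q * (d + 1) ≤ 2 * W ^ 2 * (d + 1) := Nat.mul_le_mul_right _ hq'
    have hdd := Nat.mul_le_mul_left d (hX 2 (by omega) 0 (by omega) 0 (by omega))
    linarith [hX 0 (by omega) 0 (by omega) 0 (by omega), hX 0 (by omega) 0 (by omega) 1 (by omega),
      hX 0 (by omega) 0 (by omega) 2 (by omega), hX 0 (by omega) 1 (by omega) 0 (by omega),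
      hX 0 (by omega) 1 (by omega) 1 (by omega), hX 2 (by omega) 0 (by omega) 0 (by omega),
    Nat.zero_le (d * n ^ 3), Nat.zero_le (n ^ 3)]

lemma reportConst (flag val : ℕ) {s : Store} (hn : s.io 0 = n) (hb : n < s.base) :
    Spec (Comp.reportConst flag val) s fun _ s' c => s'.base = s.base ∧ s'.io 0 = flag ∧
      (∀ u < n, s'.io (u + 1) = val) ∧ c ≤ n * 3 + 7 := by
  unfold Comp.reportConst
  simp only [bind_iff, const_iff, ioRd_iff, hn]
  refine ⟨by omega, ?_⟩
  refine (foldN (s := s) (fun u _ s' => s'.base = s.base ∧ ∀ u' < u, s'.io (u' + 1) = val) 2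
    ⟨rfl, by simp⟩ ?_).mono ?_
  · rintro u hu _ s1 ⟨a1, a2⟩
    simp only [bind_iff, add_iff, ioWr_iff]
    refine ⟨by omega, ⟨a1, fun u' hu' => ?_⟩, by omega⟩
    rw [Store.setIo_io]
    obtain h | rfl := Nat.lt_succ_iff_lt_or_eq.1 hu'
    · rw [Function.update_of_ne (by omega), a2 u' h]
    · rw [Function.update_self]
  · rintro _ s1 c ⟨⟨a1, a2⟩, hc⟩
    rw [ioWr_iff]
    refine ⟨by omega, a1, by simp [Store.setIo_io], fun u hu => ?_, by omega⟩
    rw [Store.setIo_io, Function.update_of_ne (by omega), a2 u hu]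

end Spec

/-! ### The sides of the cuts of a tree -/

namespace SimpleGraph

variable {N : Type*} {T : SimpleGraph N}

/-- The nodes in the component of `x` after the deletion of the edge `xy`. -/
def nodeSide (T : SimpleGraph N) (x y : N) : Set N := {w | (T.deleteEdges {s(x, y)}).Reachable x w}

lemma self_mem_nodeSide (x y : N) : x ∈ T.nodeSide x y := Reachable.refl x

lemma not_mem_nodeSide (hT : T.IsAcyclic) {x y : N} (h : T.Adj x y) : y ∉ T.nodeSide x y := by
  have := isAcyclic_iff_forall_adj_isBridge.1 hT h
  rw [isBridge_iff] at this
  exact this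

lemma nodeSide_disjoint (hT : T.IsAcyclic) {x y w : N} (h : T.Adj x y) (h1 : w ∈ T.nodeSide x y)
    (h2 : w ∈ T.nodeSide y x) : False := by
  refine not_mem_nodeSide hT h (Reachable.trans h1 ?_)
  have h3 := Reachable.symm h2
  rwa [Sym2.eq_swap] at h3

/-- A walk from `z` that avoids `x` stays on the side of `z`. -/
lemma mem_nodeSide_of_walk {x z w : N} (p : T.Walk z w) (hp : x ∉ p.support) :
    w ∈ T.nodeSide z x := by
  refine ⟨p.toDeleteEdge _ fun he => hp ?_⟩
  exact p.snd_mem_support_of_mem_edges he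

/-- The path from `x` to a node on the side of `z` starts with the edge from `x` to `z`. -/
lemma exists_path_of_mem_nodeSide (hT : T.IsAcyclic) {x z w : N} (h : T.Adj x z)
    (hw : w ∈ T.nodeSide z x) : ∃ p : T.Walk z w, (Walk.cons h p).IsPath := by
  classical
  obtain ⟨q⟩ := hw
  have hle : T.deleteEdges {s(z, x)} ≤ T := deleteEdges_le _
  refine ⟨(q.toPath : (T.deleteEdges {s(z, x)}).Walk z w).mapLe hle, ?_⟩
  rw [Walk.cons_isPath_iff]
  refine ⟨(Walk.isPath_mapLe hle).2 q.toPath.2, fun hx => ?_⟩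
  rw [Walk.support_mapLe_eq_support] at hx
  exact not_mem_nodeSide hT h.symm ⟨q.toPath.1.takeUntil x hx⟩

lemma nodeSide_unique (hT : T.IsAcyclic) {x z z' w : N} (h : T.Adj x z) (h' : T.Adj x z')
    (hw : w ∈ T.nodeSide z x) (hw' : w ∈ T.nodeSide z' x) : z = z' := by
  obtain ⟨p, hp⟩ := exists_path_of_mem_nodeSide hT h hw
  obtain ⟨p', hp'⟩ := exists_path_of_mem_nodeSide hT h' hw'
  have := (hT.subsingleton_path x w).elim ⟨_, hp⟩ ⟨_, hp'⟩
  have := congrArg (fun p : T.Path x w => p.1.snd) this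
  simpa using this

lemma exists_nodeSide (hT : T.IsTree) {x w : N} (h : w ≠ x) : ∃ z, T.Adj x z ∧ w ∈ T.nodeSide z x := by
  classical
  obtain ⟨q⟩ := hT.1.preconnected x w
  obtain ⟨p, hp⟩ := q.toPath
  cases p with
  | nil => exact absurd rfl h
  | cons hxz p =>
    rw [Walk.cons_isPath_iff] at hp
    exact ⟨_, hxz, mem_nodeSide_of_walk p hp.2⟩

/-- The component of `x` consists of `x` and of the components on the other edges at `x`. -/
lemma mem_nodeSide_iff (hT : T.IsTree) {x y w : N} (h : T.Adj x y) :
    w ∈ T.nodeSide x y ↔ w = x ∨ ∃ z, T.Adj x z ∧ z ≠ y ∧ w ∈ T.nodeSide z x := by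
  constructor
  · intro hw
    by_cases hx : w = x
    · exact .inl hx
    · obtain ⟨z, hz, hz'⟩ := exists_nodeSide hT hx
      exact .inr ⟨z, hz, fun hzy => nodeSide_disjoint hT.2 h hw (hzy ▸ hz'), hz'⟩
  · rintro (rfl | ⟨z, hz, hzy, hw⟩)
    · exact self_mem_nodeSide _ _
    · obtain ⟨p, hp⟩ := exists_path_of_mem_nodeSide hT.2 hz hw
      refine ⟨(Walk.cons hz p).toDeleteEdge _ fun he => ?_⟩
      rw [Walk.edges_cons, List.mem_cons] at he
      obtain he | he := he
      · exact hzy (by simpa using (Sym2.congr_right.1 he).symm)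
      · exact (Walk.cons_isPath_iff _ _).1 hp |>.2 (p.fst_mem_support_of_mem_edges he)

lemma mem_nodeSide_compl (hT : T.IsTree) {x y w : N} (h : T.Adj x y) :
    w ∈ T.nodeSide y x ↔ w ∉ T.nodeSide x y := by
  constructor
  · exact fun h1 h2 => nodeSide_disjoint hT.2 h h2 h1
  · intro hw
    have hx : w ≠ x := fun hx => hw (hx ▸ self_mem_nodeSide _ _)
    obtain ⟨z, hz, hz'⟩ := exists_nodeSide hT hx
    by_cases hzy : z = y
    · exact hzy ▸ hz'
    · exact absurd ((mem_nodeSide_iff hT h).2 (.inr ⟨z, hz, hzy, hz'⟩)) hw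

end SimpleGraph

namespace BranchDecomposition

variable {V N : Type*} (B : BranchDecomposition V N)

lemma mem_side {x y : N} {v : V} : v ∈ B.side x y ↔ B.leaf v ∈ B.tree.nodeSide x y := Iff.rfl

lemma isLeaf_leaf (v : V) : IsLeaf B.tree (B.leaf v) := by
  have : B.leaf v ∈ {x | IsLeaf B.tree x} := B.leaf_range ▸ Set.mem_range_self v
  exact this

lemma exists_leaf {x : N} (h : IsLeaf B.tree x) : ∃ v, B.leaf v = x := by
  have : x ∈ Set.range B.leaf := B.leaf_range ▸ h
  exact this

lemma unique_nbr {x y : N} (h : IsLeaf B.tree x) (hy : B.tree.Adj x y) {z : N} (hz : B.tree.Adj x z) :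
    z = y := by
  obtain ⟨a, ha⟩ := Set.ncard_eq_one.1 h
  have h1 : z ∈ B.tree.neighborSet x := hz
  have h2 : y ∈ B.tree.neighborSet x := hy
  rw [ha] at h1 h2
  rw [h1, h2]

lemma two_nbrs {x y : N} (h : ¬ IsLeaf B.tree x) (hy : B.tree.Adj x y) : ∃ z z', z ≠ y ∧ z' ≠ y ∧
    z ≠ z' ∧ ∀ w, B.tree.Adj x w ↔ w = y ∨ w = z ∨ w = z' := by
  obtain ⟨a, b, c, hab, hac, hbc, habc⟩ := Set.ncard_eq_three.1 (B.subcubic x h)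
  have key : ∀ w, B.tree.Adj x w ↔ w = a ∨ w = b ∨ w = c := fun w => by
    have : w ∈ B.tree.neighborSet x ↔ w ∈ ({a, b, c} : Set N) := by rw [habc]
    simpa using this
  obtain rfl | rfl | rfl := (key y).1 hy
  · exact ⟨b, c, hab.symm, hac.symm, hbc, key⟩
  · exact ⟨a, c, hab, hbc.symm, hac, fun w => by rw [key]; tauto⟩
  · exact ⟨a, b, hac, hbc, hab, fun w => by rw [key]; tauto⟩

lemma exists_adj : ∃ x y, B.tree.Adj x y := by
  obtain ⟨x, y, hxy⟩ := B.nontrivial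
  obtain ⟨z, hz, _⟩ := SimpleGraph.exists_nodeSide B.isTree hxy.symm
  exact ⟨x, z, hz⟩

lemma side_compl {x y : N} (h : B.tree.Adj x y) : B.side y x = (B.side x y)ᶜ := by
  ext v
  exact SimpleGraph.mem_nodeSide_compl B.isTree h

/-- The side of a leaf. -/
lemma side_leaf {v : V} {y : N} (h : B.tree.Adj (B.leaf v) y) : B.side (B.leaf v) y = {v} := by
  ext u
  rw [mem_side, SimpleGraph.mem_nodeSide_iff B.isTree h]
  constructor
  · rintro (hu | ⟨z, hz, hzy, _⟩)
    · exact B.leaf_injective hu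
    · exact absurd (B.unique_nbr (B.isLeaf_leaf v) h hz) hzy
  · rintro rfl; exact .inl rfl

lemma mem_side_join {x y z z' : N} (h : B.tree.Adj x y) (hz : B.tree.Adj x z) (hz' : B.tree.Adj x z')
    (h1 : z ≠ y) (h2 : z' ≠ y) (h3 : z ≠ z') {v : V} :
    v ∈ B.side x y ↔ v ∈ B.side z x ∨ v ∈ B.side z' x := by
  have hx : ¬ IsLeaf B.tree x := fun hl => h1 (B.unique_nbr hl h hz)
  obtain ⟨a, b, ha, hb, hab, key⟩ := B.two_nbrs hx h
  rw [mem_side, SimpleGraph.mem_nodeSide_iff B.isTree h]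
  constructor
  · rintro (hv | ⟨w, hw, hwy, hv⟩)
    · exact absurd (hv ▸ B.isLeaf_leaf v) hx
    · have c1 := (key w).1 hw
      have c2 := (key z).1 hz
      have c3 := (key z').1 hz'
      have : w = z ∨ w = z' := by grind
      obtain rfl | rfl := this
      · exact .inl hv
      · exact .inr hv
  · rintro (hv | hv)
    · exact .inr ⟨z, hz, h1, hv⟩
    · exact .inr ⟨z', hz', h2, hv⟩

/-- A subcubic tree with `n` leaves has `2 n - 2` nodes. -/
lemma card_nodes {n m : ℕ} (B : BranchDecomposition (Fin n) (Fin m)) : m + 2 = 2 * n ∧ 2 ≤ n := by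
  classical
  have hm : 1 < m := by
    have := B.nontrivial
    simpa using Fintype.one_lt_card_iff_nontrivial.2 this
  have h1 := B.tree.sum_degrees_eq_twice_card_edges
  have h2 := B.isTree.card_edgeFinset
  have h3 : ∀ x, B.tree.degree x = (B.tree.neighborSet x).ncard := fun x => by
    rw [Set.ncard_eq_toFinset_card', ← SimpleGraph.neighborFinset_def,
      SimpleGraph.card_neighborFinset_eq_degree]
  have h4 : ∀ x, B.tree.degree x = if x ∈ Finset.univ.image B.leaf then 1 else 3 := by
    intro x
    rw [h3]
    split_ifs with hx
    · obtain ⟨v, -, rfl⟩ := Finset.mem_image.1 hx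
      exact B.isLeaf_leaf v
    · refine B.subcubic x fun hl => hx ?_
      obtain ⟨v, rfl⟩ := B.exists_leaf hl
      exact Finset.mem_image_of_mem _ (Finset.mem_univ v)
  have h5 : (Finset.univ.filter fun x => x ∈ Finset.univ.image B.leaf).card = n := by
    rw [Finset.filter_mem_eq_inter, Finset.univ_inter, Finset.card_image_of_injective _ B.leaf_injective]
    simp
  have h6 := Finset.card_filter_add_card_filter_not (s := (Finset.univ : Finset (Fin m)))
    (fun x => x ∈ Finset.univ.image B.leaf)
  simp only [h4, Finset.sum_ite, Finset.sum_const, smul_eq_mul] at h1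
  simp only [Finset.card_univ, Fintype.card_fin] at h2 h6
  omega

end BranchDecomposition

open Classical in
/-- The decomposition in terms of numbers. -/
noncomputable def BranchDecomposition.treeData {n m : ℕ} (B : BranchDecomposition (Fin n) (Fin m)) :
    TreeData n m where
  adj x y := ∃ (hx : x < m) (hy : y < m), B.tree.Adj ⟨x, hx⟩ ⟨y, hy⟩
  lv x := if h : ∃ v, (B.leaf v : ℕ) = x then h.choose + 1 else 0
  side x y := if h : x < m ∧ y < m then
    (Finset.univ.filter fun v => v ∈ B.side ⟨x, h.1⟩ ⟨y, h.2⟩).map Fin.valEmbedding else ∅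
  size x y := if h : x < m ∧ y < m then (B.tree.nodeSide ⟨x, h.1⟩ ⟨y, h.2⟩).ncard else 0
  symm := by
    rintro x y ⟨hx, hy, h⟩
    exact ⟨hy, hx, h.symm⟩
  lt := by
    rintro x y ⟨hx, hy, h⟩
    exact hx
  size_pos := by
    rintro x y ⟨hx, hy, h⟩
    rw [dif_pos ⟨hx, hy⟩, Set.ncard_pos]
    exact ⟨_, SimpleGraph.self_mem_nodeSide _ _⟩
  size_le := by
    rintro x y ⟨hx, hy, h⟩
    rw [dif_pos ⟨hx, hy⟩]
    refine (Set.ncard_le_ncard (Set.subset_univ _)).trans ?_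
    simp [Set.ncard_univ]
  size_lt := by
    rintro x y z ⟨hx, hy, h⟩ ⟨_, hz, h'⟩ hne
    rw [dif_pos ⟨hz, hx⟩, dif_pos ⟨hx, hy⟩]
    refine Set.ncard_lt_ncard ⟨fun w hw => ?_, fun hh => ?_⟩
    · exact (SimpleGraph.mem_nodeSide_iff B.isTree h).2 (.inr ⟨_, h', by simpa using hne, hw⟩)
    · exact SimpleGraph.not_mem_nodeSide B.isTree.2 h'.symm (hh (SimpleGraph.self_mem_nodeSide _ _))
  degree := by
    rintro x y ⟨hx, hy, h⟩
    by_cases hl : IsLeaf B.tree ⟨x, hx⟩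
    · left
      obtain ⟨v, hv⟩ := B.exists_leaf hl
      rw [dif_pos ⟨v, by rw [hv]⟩]
      refine ⟨by simp, ?_⟩
      rintro z ⟨_, hz, h'⟩
      simpa using B.unique_nbr hl h h'
    · right
      constructor
      · rw [dif_neg]
        rintro ⟨v, hv⟩
        refine hl ?_
        have : B.leaf v = ⟨x, hx⟩ := Fin.ext hv
        exact this ▸ B.isLeaf_leaf v
      · obtain ⟨z, z', h1, h2, h3, key⟩ := B.two_nbrs hl h
        refine ⟨z, z', fun hh => h1 (Fin.ext hh), fun hh => h2 (Fin.ext hh), fun hh => h3 (Fin.ext hh),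
          fun w => ?_⟩
        constructor
        · rintro ⟨_, hw, h'⟩
          simpa [Fin.ext_iff] using (key _).1 h'
        · intro hw
          have hwm : w < m := by omega
          exact ⟨hx, hwm, (key ⟨w, hwm⟩).2 (by simpa [Fin.ext_iff] using hw)⟩
  nonempty := by
    obtain ⟨x, y, h⟩ := B.exists_adj
    exact ⟨x, y, x.2, y.2, h⟩
  side_leaf := by
    rintro x y ⟨hx, hy, h⟩ hl
    split_ifs at hl with hv
    · have hv' : B.leaf hv.choose = ⟨x, hx⟩ := Fin.ext hv.choose_spec
      rw [dif_pos hv, dif_pos ⟨hx, hy⟩]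
      refine ⟨by simp, ?_⟩
      have h' := h
      rw [← hv'] at h'
      have := B.side_leaf h'
      rw [hv'] at this
      ext u
      simp [this, eq_comm]
    · exact absurd rfl hl
  side_join := by
    rintro x y z z' ⟨hx, hy, h⟩ ⟨_, hz, h'⟩ ⟨_, hz', h''⟩ h1 h2 h3
    rw [dif_pos ⟨hx, hy⟩, dif_pos ⟨hz, hx⟩, dif_pos ⟨hz', hx⟩, ← Finset.map_union, ← Finset.filter_or,
      Finset.disjoint_map]
    constructor
    · congr 1
      refine Finset.filter_congr fun v _ => ?_
      exact B.mem_side_join h h' h'' (by simpa using h1) (by simpa using h2) (by simpa using h3)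
    · rw [Finset.disjoint_filter]
      intro v _ hv hv'
      exact h3 (by simpa using SimpleGraph.nodeSide_unique B.isTree.2 h' h'' hv hv')
  side_compl := by
    rintro x y ⟨hx, hy, h⟩
    rw [dif_pos ⟨hy, hx⟩, dif_pos ⟨hx, hy⟩]
    ext u
    simp only [B.side_compl h, Finset.mem_map, Finset.mem_filter, Finset.mem_univ, true_and,
      Finset.mem_sdiff, Finset.mem_range, Set.mem_compl_iff, Fin.valEmbedding_apply]
    constructor
    · rintro ⟨v, hv, rfl⟩
      refine ⟨v.2, ?_⟩
      rintro ⟨v', hv', hvv⟩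
      exact hv (Fin.ext hvv ▸ hv')
    · rintro ⟨hu, h1⟩
      exact ⟨⟨u, hu⟩, fun hh => h1 ⟨_, hh, rfl⟩, rfl⟩
  side_subset := by
    rintro x y ⟨hx, hy, h⟩ u hu
    rw [dif_pos ⟨hx, hy⟩] at hu
    obtain ⟨v, -, rfl⟩ := Finset.mem_map.1 hu
    simp

/-! ### The machine program -/

/-- Computes the base of the arrays, `(n + m + 2) ^ 2`, which exceeds the addresses of the input. -/
def prologue : Prog :=
  .seq (block (.const 3 0) [.load 4 3, .const 3 1, .load 5 3, .add 4 4 5, .const 3 2, .add 4 4 3,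
    .const 3 1, .const 5 0])
  (.loop (.lt 5 4) (block (.add 0 0 4) [.add 5 5 3]))

lemma exec_addLoop (r : ℕ) : ∀ (st : RamState), st.reg 3 = 1 → st.reg 5 + r = st.reg 4 →
    ∃ st', Exec (.loop (.lt 5 4) (block (.add 0 0 4) [.add 5 5 3])) st (3 * r + 1) st' ∧
      st'.reg 0 = st.reg 0 + r * st.reg 4 ∧ st'.mem = st.mem ∧ st'.reg 1 = st.reg 1 ∧
      st'.reg 2 = st.reg 2 := by
  induction r with
  | zero =>
    intro st h3 h5
    exact ⟨st, .loopDone (by simp only [Test.Holds]; omega), by simp, rfl, rfl, rfl⟩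
  | succ r ih =>
    intro st h3 h5
    have hb := exec_block (.add 0 0 4) [.add 5 5 3] st
    obtain ⟨st', h1, h2, h4, h6, h7⟩ := ih
      ((Instr.add 5 5 3).run ((Instr.add 0 0 4).run st)) (by simp [Instr.run, h3])
      (by simp [Instr.run, h3]; omega)
    refine ⟨st', ?_, ?_, h4, h6, h7⟩
    · have := Exec.loopStep (c := .lt 5 4) (by simp only [Test.Holds]; omega) hb h1
      convert this using 1
      simp
      ring
    · rw [h2]
      simp [Instr.run]
      ring

lemma exec_prologue (st : RamState) (h0 : ∀ i, st.reg i = 0) :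
    ∃ st', Exec prologue st (3 * (st.mem 0 + st.mem 1 + 2) + 10) st' ∧
      st'.reg 0 = (st.mem 0 + st.mem 1 + 2) * (st.mem 0 + st.mem 1 + 2) ∧ st'.mem = st.mem ∧
      st'.reg 1 = 0 ∧ st'.reg 2 = 0 := by
  have hb := exec_block (.const 3 0) [.load 4 3, .const 3 1, .load 5 3, .add 4 4 5, .const 3 2,
    .add 4 4 3, .const 3 1, .const 5 0] st
  simp only [List.length_cons, List.length_nil, List.foldl_cons, List.foldl_nil] at hb
  generalize hst : Instr.run (.const 5 0) _ = st1 at hb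
  have r4 : st1.reg 4 = st.mem 0 + st.mem 1 + 2 := by
    rw [← hst]; simp [Instr.run]
  have r3 : st1.reg 3 = 1 := by rw [← hst]; simp [Instr.run]
  have r5 : st1.reg 5 = 0 := by rw [← hst]; simp [Instr.run]
  have rm : st1.mem = st.mem := by rw [← hst]; rfl
  have r0 : st1.reg 0 = 0 ∧ st1.reg 1 = 0 ∧ st1.reg 2 = 0 := by
    rw [← hst]; simp [Instr.run, h0]
  obtain ⟨st2, h1, h2, h3, h4, h5⟩ := exec_addLoop (st.mem 0 + st.mem 1 + 2) st1 r3 (by omega)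
  refine ⟨st2, ?_, by rw [h2, r0.1, r4]; simp, by rw [h3, rm], by rw [h4, r0.2.1], by rw [h5, r0.2.2]⟩
  rw [show 3 * (st.mem 0 + st.mem 1 + 2) + 10 = 9 + (3 * (st.mem 0 + st.mem 1 + 2) + 1) by omega]
  exact Exec.seq hb h1

section Input

variable {n m : ℕ} (G : Digraph (Fin n)) (B : BranchDecomposition (Fin n) (Fin m))

/-- Adjacency in terms of numbers. -/
def natAdj (G : Digraph (Fin n)) (u v : ℕ) : Prop := ∃ (hu : u < n) (hv : v < n), G.Adj ⟨u, hu⟩ ⟨v, hv⟩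

/-- The store that the input represents: no array index is admitted yet. -/
noncomputable def inputStore : Store where
  base := (n + m + 2) * (n + m + 2)
  lim := 0
  io a := (inputList G B).getD a 0
  arr _ _ _ := 0

lemma flatten_ofFn {a b : ℕ} (f : Fin a → Fin b → ℕ) :
    (List.ofFn fun u => List.ofFn fun v => f u v).flatten =
      List.ofFn fun i : Fin (a * b) => f i.divNat i.modNat := by
  rw [List.ofFn_mul]
  congr 1
  congr 1
  funext u
  congr 1
  funext v
  congr 1
  · ext
    simp [Fin.divNat, Nat.mul_add_div, Nat.mul_comm u.1, v.pos, Nat.div_eq_of_lt v.2]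
  · ext
    simp [Fin.modNat, Nat.mul_comm u.1, Nat.mod_eq_of_lt v.2]

/-- The entries of a matrix that is given row by row. -/
lemma getD_flatten {a b : ℕ} (f : Fin a → Fin b → ℕ) (l : List ℕ) {i j : ℕ} (hi : i < a) (hj : j < b) :
    ((List.ofFn fun u => List.ofFn fun v => f u v).flatten ++ l).getD (i * b + j) 0 =
      f ⟨i, hi⟩ ⟨j, hj⟩ := by
  have hlt : i * b + j < a * b := by
    have : (i + 1) * b ≤ a * b := Nat.mul_le_mul_right _ hi
    rw [Nat.succ_mul] at this; omega
  rw [flatten_ofFn, List.getD_append _ _ _ _ (by simpa using hlt), List.getD_eq_getElem _ _ (by simpa using hlt),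
    List.getElem_ofFn]
  congr 1
  · ext
    simp [Fin.divNat, Nat.mul_comm i, Nat.mul_add_div (show 0 < b by omega), Nat.div_eq_of_lt hj]
  · ext
    simp [Fin.modNat, Nat.mul_comm i, Nat.mod_eq_of_lt hj]

lemma length_flatten_ofFn {a b : ℕ} (f : Fin a → Fin b → ℕ) :
    (List.ofFn fun u => List.ofFn fun v => f u v).flatten.length = a * b := by
  rw [flatten_ofFn, List.length_ofFn]

lemma inputStore_spec : InputStore (natAdj G) B.treeData (inputStore G B) := by
  classical
  have hlen1 := fun f : Fin n → Fin n → ℕ => length_flatten_ofFn f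
  have hlen2 := fun f : Fin m → Fin m → ℕ => length_flatten_ofFn f
  constructor
  · simp only [inputStore]; nlinarith
  · rfl
  · intros; rfl
  · simp [inputStore, inputList]
  · simp [inputStore, inputList]
  · intro u hu v hv
    simp only [inputStore, inputList, List.append_assoc]
    rw [List.getD_append_right _ _ _ _ (by simp; omega)]
    rw [show 2 + u * n + v - [n, m].length = u * n + v by simp; omega, getD_flatten _ _ hu hv]
    simp [natAdj, hu, hv]
  · intro x hx y hy
    simp only [inputStore, inputList, List.append_assoc]
    rw [List.getD_append_right _ _ _ _ (by simp; omega),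
      List.getD_append_right _ _ _ _ (by rw [hlen1]; simp; omega), hlen1]
    rw [show 2 + n * n + x * m + y - [n, m].length - n * n = x * m + y by simp; omega,
      getD_flatten _ _ hx hy]
    simp [BranchDecomposition.treeData, hx, hy]
  · refine ⟨fun v => if h : v < n then B.leaf ⟨v, h⟩ else 0, ?_, ?_, ?_, ?_, ?_⟩
    · intro v hv
      simp only [inputStore, inputList, List.append_assoc]
      rw [List.getD_append_right _ _ _ _ (by simp; omega),
        List.getD_append_right _ _ _ _ (by rw [hlen1]; simp; omega), hlen1,
        List.getD_append_right _ _ _ _ (by rw [hlen2]; simp; omega), hlen2]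
      rw [show 2 + n * n + m * m + v - [n, m].length - n * n - m * m = v by simp; omega,
        List.getD_eq_getElem _ _ (by simpa using hv), List.getElem_ofFn, dif_pos hv]
    · intro v hv
      simp only [dif_pos hv]; exact (B.leaf _).2
    · intro u hu v hv h
      simp only [dif_pos hu, dif_pos hv] at h
      simpa using B.leaf_injective (Fin.ext h)
    · intro v hv
      have h : ∃ u, (B.leaf u : ℕ) = (B.leaf ⟨v, hv⟩ : ℕ) := ⟨_, rfl⟩
      simp only [BranchDecomposition.treeData, dif_pos hv]
      rw [dif_pos h]
      have := B.leaf_injective (Fin.ext h.choose_spec)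
      rw [this]
    · intro x hx
      simp only [BranchDecomposition.treeData]
      rw [dif_neg]
      rintro ⟨v, hv⟩
      exact hx v v.2 (by simp only [dif_pos v.2]; exact hv)

/-- A program of the array language that meets its specification gives rise to a terminating run of the
machine program, within a constant multiple of its cost. -/
lemma exists_exec {P : Prog} {p : Comp ℕ} (hP : Implements P 0 [] p) {Q : ℕ → Store → ℕ → Prop}
    (hQ : Spec p (inputStore G B) Q) : ∃ t st a s c, Exec (.seq prologue P) (initState G B) t st ∧
      Q a s c ∧ Represents s st ∧ t ≤ 40 * c + 3 * (n + m + 2) + 10 := by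
  obtain ⟨a, s, c, h1, h2⟩ := hQ
  have hS := inputStore_spec G B
  have hn : (initState G B).mem 0 = n := hS.n_eq
  have hm : (initState G B).mem 1 = m := hS.m_eq
  obtain ⟨st1, e1, e2, e3, e4, e5⟩ := exec_prologue (initState G B) fun _ => rfl
  rw [hn, hm] at e1 e2
  have hrep : Represents (inputStore G B) st1 := by
    constructor
    · exact e2
    · exact e4
    · exact e5
    · intro x _; rw [e3]; rfl
    · intro i hi; exact absurd hi (Nat.not_lt_zero i)
    · intro b i j
      rw [e3]
      simp only [initState, inputStore]
      refine List.getD_eq_default _ _ ?_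
      have : (inputList G B).length ≤ (n + m + 2) * (n + m + 2) := by
        simp only [inputList, List.length_append, length_flatten_ofFn, List.length_ofFn,
          List.length_cons, List.length_nil]
        nlinarith
      omega
  obtain ⟨t, st2, f1, f2, f3, -, -⟩ := hP st1 _ a s c hrep .nil h1
  exact ⟨_, st2, a, s, c, .seq e1 f1, h2, f3, by omega⟩

end Input

/-! ### Bounds on the numbers of equivalence classes -/

section Matching

variable {V : Type*} [Finite V]

lemma card_le_inducedMatchingNumber {H : Digraph V} {M : Set (V × V)} (h : IsInducedMatching H M) :
    M.ncard ≤ inducedMatchingNumber H :=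
  le_csSup ⟨(Set.univ : Set (V × V)).ncard, by
    rintro _ ⟨M, -, rfl⟩
    exact Set.ncard_le_ncard (Set.subset_univ M)⟩ ⟨M, h, rfl⟩

open Classical in
/-- A set `X` has a subset with the same capped counts whose size is at most `d` times the size of a
set `U` with private neighbours: in a minimal subset every element is an essential neighbour of a vertex
with at most `d` neighbours, and a minimal set of vertices that between them see the whole subset has
private neighbours. -/
lemma exists_representative (d : ℕ) (R : V → V → Prop) (A X : Set V) (hX : X ⊆ A) :
    ∃ X' ⊆ X, (∀ u ∉ A, min d ({a | R a u} ∩ X').ncard = min d ({a | R a u} ∩ X).ncard) ∧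
      ∃ (U : Set V) (p : V → V), (∀ u ∈ U, u ∉ A ∧ p u ∈ A ∧ R (p u) u ∧ ∀ u' ∈ U, R (p u) u' → u' = u) ∧
        X'.ncard ≤ d * U.ncard := by
  have := Fintype.ofFinite V
  -- a subset of minimal size
  obtain ⟨X', ⟨hX', heq⟩, hmin⟩ := exists_minimal_of_wellFoundedLT (fun Y : Set V => Y ⊆ X ∧
    ∀ u ∉ A, min d ({a | R a u} ∩ Y).ncard = min d ({a | R a u} ∩ X).ncard) ⟨X, subset_rfl, fun _ _ => rfl⟩
  refine ⟨X', hX', heq, ?_⟩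
  have hess : ∀ x ∈ X', ∃ u ∉ A, R x u ∧ ({a | R a u} ∩ X').ncard ≤ d := by
    intro x hx
    by_contra hcon
    push Not at hcon
    have hle := hmin (y := X' \ {x}) ⟨Set.sdiff_subset.trans hX', fun u hu => ?_⟩ Set.sdiff_subset hx
    · exact hle.2 rfl
    · rw [← heq u hu]
      by_cases hR : R x u
      · have h1 := hcon u hu hR
        have h2 : {a | R a u} ∩ (X' \ {x}) = ({a | R a u} ∩ X') \ {x} := by
          ext; simp; tauto
        rw [h2, Set.ncard_sdiff_singleton_of_mem (show x ∈ {a | R a u} ∩ X' from ⟨hR, hx⟩)]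
        omega
      · congr 2
        ext a
        simp only [Set.mem_inter_iff, Set.mem_ofPred_eq, Set.mem_sdiff, Set.mem_singleton_iff]
        constructor
        · tauto
        · rintro ⟨h1, h2⟩
          exact ⟨h1, h2, fun h => hR (h ▸ h1)⟩
  -- a minimal cover
  obtain ⟨U, ⟨hU, hcov⟩, hUmin⟩ := exists_minimal_of_wellFoundedLT (fun U : Set V =>
    (∀ u ∈ U, u ∉ A ∧ ({a | R a u} ∩ X').ncard ≤ d) ∧ ∀ x ∈ X', ∃ u ∈ U, R x u)
    ⟨{u | u ∉ A ∧ ({a | R a u} ∩ X').ncard ≤ d}, fun u hu => hu, fun x hx => by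
      obtain ⟨u, h1, h2, h3⟩ := hess x hx
      exact ⟨u, ⟨h1, h3⟩, h2⟩⟩
  have hpriv : ∀ u ∈ U, ∃ x ∈ X', R x u ∧ ∀ u' ∈ U, R x u' → u' = u := by
    intro u hu
    by_contra hcon
    push Not at hcon
    have hle := hUmin (y := U \ {u}) ⟨fun v hv => hU v hv.1, fun x hx => ?_⟩ Set.sdiff_subset hu
    · exact hle.2 rfl
    · obtain ⟨v, hv, hxv⟩ := hcov x hx
      by_cases hvu : v = u
      · obtain ⟨u', h1, h2, h3⟩ := hcon x hx (hvu ▸ hxv)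
        exact ⟨u', ⟨h1, h3⟩, h2⟩
      · exact ⟨v, ⟨hv, hvu⟩, hxv⟩
  choose! p hp using hpriv
  refine ⟨U, p, fun u hu => ⟨(hU u hu).1, hX (hX' (hp u hu).1), (hp u hu).2⟩, ?_⟩
  have hsub : X'.toFinset ⊆ U.toFinset.biUnion fun u => ({a | R a u} ∩ X').toFinset := by
    intro x hx
    obtain ⟨u, hu, hxu⟩ := hcov x (by simpa using hx)
    simp only [Finset.mem_biUnion, Set.mem_toFinset]
    exact ⟨u, hu, hxu, by simpa using hx⟩
  calc X'.ncard = X'.toFinset.card := Set.ncard_eq_toFinset_card' _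
    _ ≤ _ := Finset.card_le_card hsub
    _ ≤ U.toFinset.card * d := Finset.card_biUnion_le_card_mul _ _ _ fun u hu => by
        rw [← Set.ncard_eq_toFinset_card']; exact (hU u (by simpa using hu)).2
    _ = d * U.ncard := by rw [Set.ncard_eq_toFinset_card' U, mul_comm]

/-- A set of at most `s` elements of `A` is the range of a partial enumeration by `Fin s`. -/
lemma ncard_small_subsets (A : Set V) (s : ℕ) :
    {X : Set V | X ⊆ A ∧ X.ncard ≤ s}.ncard ≤ (A.ncard + 1) ^ s := by
  let φ : (Fin s → Option A) → Set V := fun g => {v | ∃ i, ∃ h : v ∈ A, g i = some ⟨v, h⟩}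
  have hsub : {X : Set V | X ⊆ A ∧ X.ncard ≤ s} ⊆ Set.range φ := by
    rintro X ⟨hX, hc⟩
    have e : X ≃ Fin X.ncard := Finite.equivFin X
    refine ⟨fun i => if h : i < X.ncard then some ⟨(e.symm ⟨i, h⟩ : V), hX (e.symm ⟨i, h⟩).2⟩ else none, ?_⟩
    ext v
    simp only [φ, Set.mem_ofPred_eq]
    constructor
    · rintro ⟨i, hv, hi⟩
      split_ifs at hi with h
      · simp only [Option.some.injEq, Subtype.mk.injEq] at hi
        rw [← hi]; exact (e.symm _).2
    · intro hv
      refine ⟨⟨e ⟨v, hv⟩, (e ⟨v, hv⟩).2.trans_le hc⟩, hX hv, ?_⟩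
      simp
  refine (Set.ncard_le_ncard hsub (Set.toFinite _)).trans ?_
  rw [← Set.image_univ]
  refine (Set.ncard_image_le (Set.toFinite _)).trans ?_
  rw [Set.ncard_univ, Nat.card_fun, Nat.card_fin, Finite.card_option]
  rfl

/-- The number of distinct families of capped counts is at most the number of representatives. -/
lemma ncard_counts_le (d : ℕ) (R : V → V → Prop) (A : Set V) (s : ℕ)
    (hs : ∀ (U : Set V) (p : V → V), (∀ u ∈ U, u ∉ A ∧ p u ∈ A ∧ R (p u) u ∧
      ∀ u' ∈ U, R (p u) u' → u' = u) → U.ncard ≤ s) :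
    (Set.range fun (X : {X : Set V // X ⊆ A}) (u : {u // u ∉ A}) =>
      min d ({a | R a u} ∩ X.1).ncard).ncard ≤ (A.ncard + 1) ^ (d * s) := by
  refine le_trans (Set.ncard_le_ncard ?_ (Set.toFinite _)) ((Set.ncard_image_le
    (f := fun X (u : {u // u ∉ A}) => min d ({a | R a u} ∩ X).ncard) (Set.toFinite _)).trans
    (ncard_small_subsets A (d * s)))
  rintro _ ⟨⟨X, hX⟩, rfl⟩
  obtain ⟨X', h1, h2, U, p, h3, h4⟩ := exists_representative d R A X hX
  refine ⟨X', ⟨h1.trans hX, h4.trans (Nat.mul_le_mul_left _ (hs U p h3))⟩, ?_⟩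
  funext u
  exact h2 u u.2

/-- Vertices outside `A` with private in-neighbours in `A` are the heads of an induced matching. -/
lemma ncard_le_mim_left (G : Digraph V) (A U : Set V) (p : V → V)
    (h : ∀ u ∈ U, u ∉ A ∧ p u ∈ A ∧ G.Adj (p u) u ∧ ∀ u' ∈ U, G.Adj (p u) u' → u' = u) :
    U.ncard ≤ inducedMatchingNumber (edgesFromTo G A Aᶜ) := by
  have hinj : Function.Injective fun u => (p u, u) := fun u u' huu => congrArg Prod.snd huu
  rw [← Set.ncard_image_of_injective U hinj]
  refine card_le_inducedMatchingNumber ⟨?_, ?_, ?_⟩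
  · rintro _ ⟨u, hu, rfl⟩
    exact ⟨(h u hu).2.1, (h u hu).1, (h u hu).2.2.1⟩
  · rintro _ ⟨u, hu, rfl⟩ _ ⟨u', hu', rfl⟩ hne hm
    obtain ⟨a1, a2, a3, a4⟩ := h u hu
    obtain ⟨b1, b2, b3, b4⟩ := h u' hu'
    simp only [Meets] at hm
    obtain h1 | h1 | h1 | h1 := hm
    · have := a4 u' hu' (h1 ▸ b3)
      exact hne (by rw [this])
    · exact b1 (h1 ▸ a2)
    · exact a1 (h1 ▸ b2)
    · exact hne (by rw [h1])
  · rintro ⟨x, y⟩ ⟨hx, hy, hxy⟩ _ ⟨u, hu, rfl⟩ _ ⟨u', hu', rfl⟩ hne ⟨hm, hm'⟩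
    obtain ⟨a1, a2, a3, a4⟩ := h u hu
    obtain ⟨b1, b2, b3, b4⟩ := h u' hu'
    simp only [Meets] at hm hm' hx hy hxy
    have key : ∀ v ∈ U, x = p v ∨ x = v ∨ y = p v ∨ y = v → x = p v ∨ y = v := by
      rintro v hv (h1 | h1 | h1 | h1)
      · exact .inl h1
      · exact absurd (h1 ▸ hx) (h v hv).1
      · exact absurd (h1 ▸ (h v hv).2.1) hy
      · exact .inr h1
    obtain h1 | h1 := key u hu hm <;> obtain h2 | h2 := key u' hu' hm'
    · exact hne (by rw [a4 u' hu' (by rw [← h1, h2]; exact b3)])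
    · exact hne (by rw [a4 u' hu' (by rw [← h1, ← h2]; exact hxy)])
    · exact hne (by rw [b4 u hu (by rw [← h1, ← h2]; exact hxy)])
    · exact hne (by rw [← h1, ← h2])

/-- Vertices outside `A` with private out-neighbours in `A` are the tails of an induced matching. -/
lemma ncard_le_mim_right (G : Digraph V) (A U : Set V) (p : V → V)
    (h : ∀ u ∈ U, u ∉ A ∧ p u ∈ A ∧ G.Adj u (p u) ∧ ∀ u' ∈ U, G.Adj u' (p u) → u' = u) :
    U.ncard ≤ inducedMatchingNumber (edgesFromTo G Aᶜ A) := by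
  have hinj : Function.Injective fun u => (u, p u) := fun u u' huu => congrArg Prod.fst huu
  rw [← Set.ncard_image_of_injective U hinj]
  refine card_le_inducedMatchingNumber ⟨?_, ?_, ?_⟩
  · rintro _ ⟨u, hu, rfl⟩
    exact ⟨(h u hu).1, (h u hu).2.1, (h u hu).2.2.1⟩
  · rintro _ ⟨u, hu, rfl⟩ _ ⟨u', hu', rfl⟩ hne hm
    obtain ⟨a1, a2, a3, a4⟩ := h u hu
    obtain ⟨b1, b2, b3, b4⟩ := h u' hu'
    simp only [Meets] at hm
    obtain h1 | h1 | h1 | h1 := hm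
    · exact hne (by rw [h1])
    · exact a1 (h1 ▸ b2)
    · exact b1 (h1 ▸ a2)
    · have := a4 u' hu' (h1 ▸ b3)
      exact hne (by rw [this])
  · rintro ⟨y, x⟩ ⟨hy, hx, hxy⟩ _ ⟨u, hu, rfl⟩ _ ⟨u', hu', rfl⟩ hne ⟨hm, hm'⟩
    obtain ⟨a1, a2, a3, a4⟩ := h u hu
    obtain ⟨b1, b2, b3, b4⟩ := h u' hu'
    simp only [Meets] at hm hm' hx hy hxy
    have key : ∀ v ∈ U, y = v ∨ y = p v ∨ x = v ∨ x = p v → x = p v ∨ y = v := by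
      rintro v hv (h1 | h1 | h1 | h1)
      · exact .inr h1
      · exact absurd (h1 ▸ (h v hv).2.1) hy
      · exact absurd (h1 ▸ hx) (h v hv).1
      · exact .inl h1
    obtain h1 | h1 := key u hu hm <;> obtain h2 | h2 := key u' hu' hm'
    · exact hne (by rw [a4 u' hu' (by rw [← h1, h2]; exact b3)])
    · exact hne (by rw [a4 u' hu' (by rw [← h1, ← h2]; exact hxy)])
    · exact hne (by rw [b4 u hu (by rw [← h1, ← h2]; exact hxy)])
    · exact hne (by rw [← h1, ← h2])

/-- A class is determined by its two families of capped counts. -/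
lemma nec_le (G : Digraph V) (d : ℕ) (A : Set V) :
    nec G d A ≤ (A.ncard + 1) ^ (d * bimim G A) := by
  let f : {X : Set V // X ⊆ A} → {u // u ∉ A} → ℕ := fun X u => min d (inNbr G u ∩ X.1).ncard
  let g : {X : Set V // X ⊆ A} → {u // u ∉ A} → ℕ := fun X u => min d (outNbr G u ∩ X.1).ncard
  have hf : (Set.range f).ncard ≤ (A.ncard + 1) ^ (d * inducedMatchingNumber (edgesFromTo G A Aᶜ)) :=
    ncard_counts_le d G.Adj A _ fun U p h => ncard_le_mim_left G A U p h
  have hg : (Set.range g).ncard ≤ (A.ncard + 1) ^ (d * inducedMatchingNumber (edgesFromTo G Aᶜ A)) :=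
    ncard_counts_le d (fun a b => G.Adj b a) A _ fun U p h => ncard_le_mim_right G A U p h
  let F : Quotient (biNbrEquiv G d A) → Set.range f × Set.range g :=
    Quotient.lift (fun X => (⟨f X, X, rfl⟩, ⟨g X, X, rfl⟩)) fun X Y hXY => by
      refine Prod.ext (Subtype.ext ?_) (Subtype.ext ?_)
      · funext u; exact (hXY u u.2).1
      · funext u; exact (hXY u u.2).2
  have hF : Function.Injective F := by
    intro a b
    refine Quotient.inductionOn₂ a b fun X Y h => Quotient.sound fun u hu => ?_
    have h1 : f X = f Y := congrArg (fun x => x.1.1) h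
    have h2 : g X = g Y := congrArg (fun x => x.2.1) h
    exact ⟨congrFun h1 ⟨u, hu⟩, congrFun h2 ⟨u, hu⟩⟩
  have := Nat.card_le_card_of_injective F hF
  rw [Nat.card_prod] at this
  refine this.trans ?_
  rw [bimim, mul_add, pow_add]
  exact Nat.mul_le_mul hf hg

end Matching

namespace BranchDecomposition

/-- Going away from the edge, one arrives at a leaf. -/
lemma side_nonempty {V N : Type*} [Finite N] (B : BranchDecomposition V N) {x y : N}
    (h : B.tree.Adj x y) : (B.side x y).Nonempty := by
  induction hk : (B.tree.nodeSide x y).ncard using Nat.strong_induction_on generalizing x y with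
  | _ k ih =>
    by_cases hl : IsLeaf B.tree x
    · obtain ⟨v, rfl⟩ := B.exists_leaf hl
      exact ⟨v, SimpleGraph.self_mem_nodeSide _ _⟩
    · obtain ⟨z, z', h1, h2, h3, h4⟩ := B.two_nbrs hl h
      have hz : B.tree.Adj x z := (h4 z).2 (.inr (.inl rfl))
      have hsub : B.tree.nodeSide z x ⊆ B.tree.nodeSide x y := fun w hw =>
        (SimpleGraph.mem_nodeSide_iff B.isTree h).2 (.inr ⟨z, hz, h1, hw⟩)
      obtain ⟨v, hv⟩ := ih _ (hk ▸ Set.ncard_lt_ncard ⟨hsub, fun hh =>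
        SimpleGraph.not_mem_nodeSide B.isTree.2 hz.symm (hh (SimpleGraph.self_mem_nodeSide _ _))⟩)
        hz.symm rfl
      exact ⟨v, hsub hv⟩

variable {n m : ℕ} (G : Digraph (Fin n)) (B : BranchDecomposition (Fin n) (Fin m)) (d : ℕ)

lemma ncard_side_lt {x y : Fin m} (h : B.tree.Adj x y) : (B.side x y).ncard + 1 ≤ n := by
  obtain ⟨v, hv⟩ := B.side_nonempty h.symm
  rw [B.side_compl h] at hv
  have := Set.ncard_lt_ncard (Set.ssubset_univ_iff.2 fun hu : B.side x y = Set.univ => hv (hu ▸ trivial))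
  simpa [Set.ncard_univ] using this

lemma finite_values (f : Set (Fin n) → ℕ) : {k | ∃ x y, B.tree.Adj x y ∧ f (B.side x y) = k}.Finite := by
  refine (Set.finite_range fun p : Fin m × Fin m => f (B.side p.1 p.2)).subset ?_
  rintro _ ⟨x, y, _, rfl⟩
  exact ⟨(x, y), rfl⟩

lemma nec_side_le {x y : Fin m} (h : B.tree.Adj x y) : _root_.nec G d (B.side x y) ≤ B.nec G d :=
  le_csSup (B.finite_values _).bddAbove ⟨x, y, h, rfl⟩

lemma bimim_side_le {x y : Fin m} (h : B.tree.Adj x y) : bimim G (B.side x y) ≤ B.bimimWidth G :=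
  le_csSup (B.finite_values _).bddAbove ⟨x, y, h, rfl⟩

lemma nec_pos : 1 ≤ B.nec G d := by
  obtain ⟨x, y, h⟩ := B.exists_adj
  refine le_trans ?_ (B.nec_side_le G d h)
  have : Nonempty (Quotient (biNbrEquiv G d (B.side x y))) := ⟨⟦⟨∅, Set.empty_subset _⟩⟧⟩
  exact Nat.card_pos

/-- A side of a cut has at most `n - 1` vertices, hence the base `n`. -/
lemma nec_le_pow : B.nec G d ≤ n ^ (d * B.bimimWidth G) := by
  have hn := B.card_nodes.2
  obtain ⟨x, y, h⟩ := B.exists_adj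
  refine csSup_le ⟨_, x, y, h, rfl⟩ ?_
  rintro _ ⟨x, y, h, rfl⟩
  calc _ ≤ _ := nec_le G d (B.side x y)
    _ ≤ n ^ (d * bimim G (B.side x y)) := Nat.pow_le_pow_left (B.ncard_side_lt h) _
    _ ≤ _ := Nat.pow_le_pow_right (by omega) (Nat.mul_le_mul_left _ (B.bimim_side_le G h))

/-- An edge that is not a loop gives rise to two classes at the leaf of its tail. -/
lemma two_le_nec (hd : 1 ≤ d) {u v : Fin n} (hne : u ≠ v) (huv : G.Adj u v) : 2 ≤ B.nec G d := by
  have : Nontrivial (Fin m) := B.nontrivial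
  obtain ⟨y, hy⟩ := exists_ne (B.leaf u)
  obtain ⟨z, hz, -⟩ := SimpleGraph.exists_nodeSide B.isTree hy
  refine le_trans ?_ (B.nec_side_le G d hz)
  have hs := B.side_leaf hz
  have : Nontrivial (Quotient (biNbrEquiv G d (B.side (B.leaf u) z))) := by
    refine ⟨⟦⟨∅, Set.empty_subset _⟩⟧, ⟦⟨{u}, hs.ge⟩⟧, fun h => ?_⟩
    have h1 := (Quotient.exact h v (by rw [hs]; exact fun h => hne h.symm)).1
    have h2 : inNbr G v ∩ {u} = {u} := Set.inter_eq_right.2 (by simpa [inNbr] using huv)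
    simp only [Set.inter_empty, Set.ncard_empty, h2, Set.ncard_singleton] at h1
    omega
  exact Finite.one_lt_card

end BranchDecomposition

/-! ### Equivalence classes and signatures -/

section Signatures

variable {n m : ℕ} (G : Digraph (Fin n)) (B : BranchDecomposition (Fin n) (Fin m))

lemma mem_treeData_side {x y : Fin m} {v : ℕ} :
    v ∈ B.treeData.side x y ↔ ∃ h : v < n, (⟨v, h⟩ : Fin n) ∈ B.side x y := by
  simp only [BranchDecomposition.treeData, x.2, y.2, true_and, dite_true, Finset.mem_map,
    Finset.mem_filter, Finset.mem_univ, Fin.valEmbedding_apply]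
  constructor
  · rintro ⟨v, hv, rfl⟩; exact ⟨v.2, hv⟩
  · rintro ⟨h, hv⟩; exact ⟨_, hv, rfl⟩

/-- The counts of the rows are numbers of neighbours. -/
lemma cnt_eq {k q d : ℕ} (hd : 1 ≤ d) (con : ℕ → ℕ → ℕ → Prop) (wt : ℕ → ℕ) (A : Finset ℕ)
    (S : Set (Fin n)) (hA : ∀ v, v ∈ A ↔ ∃ h : v < n, (⟨v, h⟩ : Fin n) ∈ S) (col : ℕ → ℕ) {j e : ℕ}
    (u : Fin n) (he : e < 2) :
    (mkProblem n k q d hd (natAdj G) con wt).cnt A col (2 * (j * n + u) + e) =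
      ((if e = 0 then outNbr G u else inNbr G u) ∩ {v | v ∈ S ∧ col v = j}).ncard := by
  classical
  obtain ⟨h1, h2, h3⟩ := row_div (j := j) u.2 he
  have hmap : A = (Finset.univ.filter fun v : Fin n => v ∈ S).map Fin.valEmbedding := by
    ext v
    rw [hA]
    simp only [Finset.mem_map, Finset.mem_filter, Finset.mem_univ, true_and, Fin.valEmbedding_apply]
    constructor
    · rintro ⟨h, hv⟩; exact ⟨_, hv, rfl⟩
    · rintro ⟨v, hv, rfl⟩; exact ⟨v.2, hv⟩
  simp only [Problem.cnt, mkProblem, h1, h2, h3]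
  rw [hmap, Finset.sum_map, Set.ncard_eq_toFinset_card']
  simp only [Fin.valEmbedding_apply]
  have hadj : ∀ a b : Fin n, natAdj G a b ↔ G.Adj a b := fun a b => by simp [natAdj]
  simp only [hadj]
  rw [Finset.sum_filter, Finset.card_eq_sum_ones, ← Finset.sum_filter_add_sum_filter_not Finset.univ
    (fun v => v ∈ ((if e = 0 then outNbr G u else inNbr G u) ∩ {v | v ∈ S ∧ col v = j}))]
  rw [Finset.sum_eq_zero (s := Finset.univ.filter fun v => ¬ _), add_zero]
  · refine Finset.sum_congr (by ext; simp) fun v hv => ?_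
    obtain ⟨g1, g2, g3⟩ := Set.mem_toFinset.1 hv
    rw [if_pos g2, if_pos g3]
    split_ifs at g1 ⊢ with he0
    · rfl
    · exact absurd g1 ‹_›
    · rfl
    · exact absurd g1 ‹_›
  · intro v hv
    have := (Finset.mem_filter.1 hv).2
    by_contra hne
    apply this
    split_ifs at hne ⊢ with g1 g2 g3 g4
    all_goals first
      | exact absurd rfl hne
      | exact ⟨by assumption, by assumption, by assumption⟩

/-- Colourings with distinct signatures differ in the class of some colour, among the `k` that are counted. -/
lemma sigBound {k q d : ℕ} (hd : 1 ≤ d) (con : ℕ → ℕ → ℕ → Prop) (wt : ℕ → ℕ) {x y : ℕ}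
    (h : B.treeData.adj x y) :
    (mkProblem n k q d hd (natAdj G) con wt).SigBound (B.treeData.side x y) (B.nec G d ^ k) := by
  obtain ⟨hx, hy, h⟩ := h
  lift x to Fin m using hx
  lift y to Fin m using hy
  intro K c hc hdist
  let X (a : ℕ) (j : ℕ) : {X : Set (Fin n) // X ⊆ B.side x y} :=
    ⟨{v | v ∈ B.side x y ∧ c a v = j}, fun v hv => hv.1⟩
  let F : Fin K → Fin k → Quotient (biNbrEquiv G d (B.side x y)) := fun a j => ⟦X a j⟧
  have hF : ∀ a b : Fin K, a < b → F a ≠ F b := by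
    intro a b hab hFab
    obtain ⟨p, hp, hne⟩ := hdist a b hab b.2
    obtain ⟨j, hj, u, hu, e, he, rfl, q1, q2, q3⟩ := exists_row hp
    refine hne ?_
    have hA := fun v => mem_treeData_side B (x := x) (y := y) (v := v)
    have hpu : (mkProblem n k q d hd (natAdj G) con wt).pu (2 * (j * n + u) + e) = u := q2
    unfold Problem.sig
    rw [hpu]
    split_ifs with hmem
    · rfl
    · have c1 := cnt_eq G (k := k) (q := q) hd con wt _ _ hA (c a) (j := j) ⟨u, hu⟩ he
      have c2 := cnt_eq G (k := k) (q := q) hd con wt _ _ hA (c b) (j := j) ⟨u, hu⟩ he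
      dsimp only at c1 c2
      rw [c1, c2]
      have hrel := Quotient.exact (congrFun hFab ⟨j, hj⟩) ⟨u, hu⟩ fun hh => hmem ((hA u).2 ⟨hu, hh⟩)
      split_ifs
      · exact hrel.2
      · exact hrel.1
  have hinj : Function.Injective F := by
    intro a b hab
    obtain hlt | heq | hlt := lt_trichotomy a b
    · exact absurd hab (hF a b hlt)
    · exact heq
    · exact absurd hab.symm (hF b a hlt)
  have := Nat.card_le_card_of_injective F hinj
  rw [Nat.card_fin, Nat.card_fun, Nat.card_fin] at this
  exact this.trans (Nat.pow_le_pow_left (B.nec_side_le G d h) k)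

end Signatures

/-! ### The `d`-value -/

/-- Beyond its `d`-value, a finite set contains no number and a co-finite set contains all numbers. -/
lemma mem_iff_min_mem {μ : Set ℕ} (h : FinOrCofin μ) {d : ℕ} (hd : dValue μ ≤ d) (x : ℕ) :
    x ∈ μ ↔ min d x ∈ μ := by
  obtain hx | hx := le_or_gt x d
  · rw [min_eq_right hx]
  rw [min_eq_left hx.le]
  unfold dValue at hd
  split_ifs at hd with h1 h2
  · obtain rfl | rfl := h1 <;> simp
  · have key : ∀ y, d ≤ y → y ∉ μ := fun y hy hm => by
      have := le_csSup h2.bddAbove hm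
      omega
    exact iff_of_false (key x hx.le) (key d le_rfl)
  · have h3 := h.resolve_left h2
    have key : ∀ y, d ≤ y → y ∈ μ := fun y hy => by
      by_contra hm
      have := le_csSup h3.bddAbove hm
      omega
    exact iff_of_true (key x hx.le) (key d le_rfl)

lemma eq_of_dValue_eq_zero {μ : Set ℕ} (h : dValue μ = 0) : μ = ∅ ∨ μ = Set.univ := by
  unfold dValue at h
  split_ifs at h with h1
  · exact h1
  all_goals omega

/-! ### Colourings and the locally checkable problems -/

section Colourings

variable {n : ℕ} (G : Digraph (Fin n))

/-- The conditions on the rows of a colouring, in terms of numbers of neighbours. -/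
lemma good_iff {k q d : ℕ} (hd : 1 ≤ d) (con : ℕ → ℕ → ℕ → Prop) (wt : ℕ → ℕ) (col : ℕ → ℕ) :
    (mkProblem n k q d hd (natAdj G) con wt).Good (Finset.range n) col 0 ↔
      ∀ u : Fin n, ∀ j < k, con (2 * j) (col u) (min d (outNbr G u ∩ {v | col v = j}).ncard) ∧
        con (2 * j + 1) (col u) (min d (inNbr G u ∩ {v | col v = j}).ncard) := by
  have hcnt := fun (u : Fin n) (j e : ℕ) (he : e < 2) =>
    cnt_eq G (k := k) (q := q) hd con wt (Finset.range n) Set.univ (by simp) col (j := j) u he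
  simp only [Set.mem_univ, true_and] at hcnt
  have hcell : ∀ (u : Fin n) (j e : ℕ), j < k → e < 2 → 2 * (j * n + u) + e < 2 * (k * n) := by
    intro u j e hj he
    have h1 : (j + 1) * n ≤ k * n := Nat.mul_le_mul_right _ hj
    have h2 := u.2
    rw [Nat.succ_mul] at h1
    omega
  constructor
  · intro h u j hj
    have key : ∀ e < 2, con (2 * j + e) (col u)
        (min d ((if e = 0 then outNbr G u else inNbr G u) ∩ {v | col v = j}).ncard) := by
      intro e he
      obtain ⟨q1, q2, q3⟩ := row_div (j := j) u.2 he
      have := h (2 * (j * n + u) + e) (hcell u j e hj he)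
        (by show _ % _ ∈ _; rw [q2]; exact Finset.mem_range.2 u.2)
      rw [Pi.zero_apply, add_zero, hcnt u j e he] at this
      simp only [mkProblem, q1, q2, q3] at this
      exact this
    exact ⟨key 0 (by omega), key 1 (by omega)⟩
  · intro h p hp _
    obtain ⟨j, hj, u, hu, e, he, rfl, q1, q2, q3⟩ := exists_row hp
    rw [Pi.zero_apply, add_zero, hcnt ⟨u, hu⟩ j e he]
    simp only [mkProblem, q1, q2, q3]
    obtain rfl | rfl : e = 0 ∨ e = 1 := by omega
    · exact (h ⟨u, hu⟩ j hj).1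
    · exact (h ⟨u, hu⟩ j hj).2

/-- The constraints of a `(σ⁺, σ⁻, ρ⁺, ρ⁻)`-set: the set is the colour `0`, its complement the colour
`1`, and only the neighbours of colour `0` are counted. -/
def setConstraint (σp σm ρp ρm : Set ℕ) (τ c x : ℕ) : Prop :=
  x ∈ if c = 0 then (if τ = 0 then σp else σm) else (if τ = 0 then ρp else ρm)

lemma good_setConstraint {σp σm ρp ρm : Set ℕ} {d : ℕ} (hd : 1 ≤ d)
    (hσp : ∀ x, x ∈ σp ↔ min d x ∈ σp) (hσm : ∀ x, x ∈ σm ↔ min d x ∈ σm)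
    (hρp : ∀ x, x ∈ ρp ↔ min d x ∈ ρp) (hρm : ∀ x, x ∈ ρm ↔ min d x ∈ ρm) (wt : ℕ → ℕ) (col : ℕ → ℕ) :
    (mkProblem n 1 2 d hd (natAdj G) (setConstraint σp σm ρp ρm) wt).Good (Finset.range n) col 0 ↔
      Dominates G σp σm ρp ρm {v | col v = 0} := by
  rw [good_iff]
  simp only [Nat.lt_one_iff, forall_eq, setConstraint, mul_zero, zero_add, one_ne_zero, if_true, if_false]
  constructor
  · refine fun h => ⟨fun v hv => ?_, fun v hv => ?_⟩
    · have := h v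
      rw [if_pos (show col v = 0 from hv), if_pos (show col v = 0 from hv)] at this
      exact ⟨(hσp _).2 this.1, (hσm _).2 this.2⟩
    · have := h v
      rw [if_neg (show ¬ col v = 0 from hv), if_neg (show ¬ col v = 0 from hv)] at this
      exact ⟨(hρp _).2 this.1, (hρm _).2 this.2⟩
  · rintro ⟨h1, h2⟩ v
    by_cases hv : col v = 0
    · rw [if_pos hv, if_pos hv]
      exact ⟨(hσp _).1 (h1 v hv).1, (hσm _).1 (h1 v hv).2⟩
    · rw [if_neg hv, if_neg hv]
      exact ⟨(hρp _).1 (h2 v hv).1, (hρm _).1 (h2 v hv).2⟩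

/-- The weights of the two colours, so that a colouring of minimum weight is optimum. -/
def Goal.colourWeight : Goal → ℕ → ℕ
  | .minimize, c => if c = 0 then 1 else 0
  | .maximize, c => if c = 0 then 0 else 1

lemma atLeastAsGood_of_weight_le (goal : Goal) {k q d : ℕ} (hd : 1 ≤ d) (Adj : ℕ → ℕ → Prop)
    (con : ℕ → ℕ → ℕ → Prop) (col col' : ℕ → ℕ)
    (h : (mkProblem n k q d hd Adj con goal.colourWeight).weight (Finset.range n) col ≤
      (mkProblem n k q d hd Adj con goal.colourWeight).weight (Finset.range n) col') :
    goal.AtLeastAsGood {v : Fin n | col v = 0}.ncard {v : Fin n | col' v = 0}.ncard := by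
  have hcard : ∀ c : ℕ → ℕ, {v : Fin n | c v = 0}.ncard = ∑ v : Fin n, if c v = 0 then 1 else 0 := by
    intro c
    rw [Set.ncard_eq_toFinset_card', Finset.card_eq_sum_ones, Finset.sum_ite, Finset.sum_const_zero, add_zero]
    exact Finset.sum_congr (by ext; simp) fun _ _ => rfl
  have hcompl : ∀ c : ℕ → ℕ, (∑ v : Fin n, if c v = 0 then 1 else 0) +
      (∑ v : Fin n, if c v = 0 then 0 else 1) = n := by
    intro c
    rw [← Finset.sum_add_distrib]
    refine (Finset.sum_congr rfl fun v _ => ?_).trans (by simp : (∑ _v : Fin n, 1) = n)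
    split_ifs <;> rfl
  simp only [Problem.weight, mkProblem, Finset.sum_range] at h
  rw [hcard, hcard]
  cases goal
  · exact h
  · have h1 := hcompl col
    have h2 := hcompl col'
    simp only [Goal.colourWeight] at h
    simp only [Goal.AtLeastAsGood]
    omega

open Classical in
/-- The colouring that belongs to a set. -/
noncomputable def indicatorColouring (S : Set (Fin n)) (v : ℕ) : ℕ := if ∃ h : v < n, (⟨v, h⟩ : Fin n) ∈ S then 0 else 1

lemma indicatorColouring_lt (S : Set (Fin n)) (v : ℕ) : indicatorColouring S v < 2 := by
  unfold indicatorColouring; split_ifs <;> omega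

lemma indicatorColouring_eq_zero (S : Set (Fin n)) : {v : Fin n | indicatorColouring S v = 0} = S := by
  ext v
  simp [indicatorColouring]

/-- The constraints of a `D`-partition. -/
def partitionConstraint {q : ℕ} (D : Matrix (Fin q) (Fin q) (Set ℕ × Set ℕ)) (τ c x : ℕ) : Prop :=
  ∀ (hc : c < q) (hj : τ / 2 < q), x ∈ if τ % 2 = 0 then (D ⟨c, hc⟩ ⟨τ / 2, hj⟩).1 else (D ⟨c, hc⟩ ⟨τ / 2, hj⟩).2

lemma exists_good_partitionConstraint {q d : ℕ} (hd : 1 ≤ d) (hq : 1 ≤ q)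
    {D : Matrix (Fin q) (Fin q) (Set ℕ × Set ℕ)}
    (h₁ : ∀ i j x, x ∈ (D i j).1 ↔ min d x ∈ (D i j).1) (h₂ : ∀ i j x, x ∈ (D i j).2 ↔ min d x ∈ (D i j).2)
    (wt : ℕ → ℕ) :
    (∃ col, (mkProblem n q q d hd (natAdj G) (partitionConstraint D) wt).Valid col ∧
      (mkProblem n q q d hd (natAdj G) (partitionConstraint D) wt).Good (Finset.range n) col 0) ↔
      ∃ X, IsDPartition G D X := by
  simp only [good_iff, partitionConstraint]
  constructor
  · rintro ⟨col, hcol, h⟩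
    refine ⟨fun i => {v | col v = i}, fun v => ⟨⟨col v, hcol v⟩, rfl, fun i hi => Fin.ext hi.symm⟩, ?_⟩
    rintro i j v (hv : col v = i)
    obtain ⟨g1, g2⟩ := h v j j.2
    have e1 := g1 (hcol v) (by omega)
    have e2 := g2 (hcol v) (by omega)
    simp only [hv, show 2 * (j : ℕ) / 2 = j by omega, show (2 * (j : ℕ) + 1) / 2 = j by omega,
      show 2 * (j : ℕ) % 2 = 0 by omega, show (2 * (j : ℕ) + 1) % 2 = 1 by omega, if_true, one_ne_zero,
      if_false] at e1 e2
    exact ⟨(h₁ _ _ _).2 e1, (h₂ _ _ _).2 e2⟩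
  · rintro ⟨X, hX, hD⟩
    choose f hf hf' using hX
    have hmem : ∀ v i, v ∈ X i ↔ f v = i := fun v i => ⟨fun h => (hf' v i h).symm, fun h => h ▸ hf v⟩
    let col : ℕ → ℕ := fun v => if h : v < n then f ⟨v, h⟩ else 0
    have hcolv : ∀ v : Fin n, col v = f v := fun v => by simp [col]
    have hset : ∀ j (hj : j < q), {v : Fin n | col v = j} = X ⟨j, hj⟩ := by
      intro j hj
      ext v
      rw [hmem, Set.mem_ofPred_eq, hcolv, Fin.ext_iff]
    refine ⟨col, fun v => ?_, fun u j hj => ?_⟩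
    · show col v < q
      simp only [col]; split_ifs
      · exact (f _).2
      · exact hq
    · rw [hset j hj, hcolv u]
      obtain ⟨g1, g2⟩ := hD (f u) ⟨j, hj⟩ u (hf u)
      refine ⟨fun _ hj' => ?_, fun _ hj' => ?_⟩
      · simp only [show 2 * j / 2 = j by omega, show 2 * j % 2 = 0 by omega, if_true]
        exact (h₁ _ _ _).1 g1
      · simp only [show (2 * j + 1) / 2 = j by omega, show (2 * j + 1) % 2 = 1 by omega, one_ne_zero, if_false]
        exact (h₂ _ _ _).1 g2

open Classical in
/-- In a digraph whose edges are loops, every vertex can be treated on its own. -/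
lemma exists_partition_iff_of_loops {q : ℕ} (D : Matrix (Fin q) (Fin q) (Set ℕ × Set ℕ))
    (hG : ∀ u v, G.Adj u v → u = v) : (∃ X, IsDPartition G D X) ↔ ∀ u, ∃ i, ∀ j,
      (if G.Adj u u ∧ i = j then 1 else 0) ∈ (D i j).1 ∧ (if G.Adj u u ∧ i = j then 1 else 0) ∈ (D i j).2 := by
  have hout : ∀ u (X : Set (Fin n)), (outNbr G u ∩ X).ncard = if G.Adj u u ∧ u ∈ X then 1 else 0 := by
    intro u X
    split_ifs with h
    · rw [Set.ncard_eq_one]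
      refine ⟨u, Set.ext fun v => ⟨fun hv => (hG u v hv.1).symm, ?_⟩⟩
      rintro rfl
      exact h
    · rw [Set.ncard_eq_zero]
      refine Set.eq_empty_of_forall_notMem fun v hv => h ?_
      obtain rfl := hG u v hv.1
      exact hv
  have hin : ∀ u (X : Set (Fin n)), (inNbr G u ∩ X).ncard = if G.Adj u u ∧ u ∈ X then 1 else 0 := by
    intro u X
    rw [← hout]
    congr 2
    ext v
    exact ⟨fun h => by obtain rfl := hG v u h; exact h, fun h => by obtain rfl := hG u v h; exact h⟩
  simp only [IsDPartition, hout, hin]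
  constructor
  · rintro ⟨X, hX, h⟩ u
    obtain ⟨i, hi, hi'⟩ := hX u
    refine ⟨i, fun j => ?_⟩
    have hj : u ∈ X j ↔ i = j := ⟨fun hj => (hi' j hj).symm, fun hj => hj ▸ hi⟩
    have := h i j u hi
    simpa only [hj] using this
  · intro h
    choose f hf using h
    refine ⟨fun i => {v | f v = i}, fun v => ⟨f v, rfl, fun i hi => hi.symm⟩, ?_⟩
    rintro i j v rfl
    convert hf v j <;> exact Iff.rfl

end Colourings

/-! ### Running times and the theorem -/

/-- The three forms of the time bound. -/
lemma time_bounds {n W k d w : ℕ} (hn : 2 ≤ n) (hW : 1 ≤ W) (hk : 1 ≤ k) (hWw : W ≤ n ^ (d * w)) :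
    (W ^ k) ^ 3 * k * n ^ 2 + n ^ 3 ≤ 2 * (W ^ (3 * k) * k * n ^ 3 * Nat.log 2 n) ∧
    (n ≤ W → (W ^ k) ^ 3 * k * n ^ 2 + n ^ 3 ≤ 2 * (W ^ (3 * k) * k * n ^ 2)) ∧
    (1 ≤ d * w → (W ^ k) ^ 3 * k * n ^ 2 + n ^ 3 ≤ 2 * (k * n ^ (3 * k * d * w + 2))) := by
  have hlog : 1 ≤ Nat.log 2 n := Nat.log_pos (by omega) hn
  have hpow : (W ^ k) ^ 3 = W ^ (3 * k) := by rw [← pow_mul, mul_comm]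
  have hWk : 1 ≤ W ^ (3 * k) := Nat.one_le_pow _ _ hW
  have h23 : n ^ 2 ≤ n ^ 3 := Nat.pow_le_pow_right (by omega) (by omega)
  rw [hpow]
  refine ⟨?_, fun h => ?_, fun h => ?_⟩
  · have h1 : W ^ (3 * k) * k * n ^ 2 ≤ W ^ (3 * k) * k * n ^ 3 * Nat.log 2 n :=
      (Nat.mul_le_mul_left _ h23).trans (Nat.le_mul_of_pos_right _ hlog)
    have h2 : n ^ 3 ≤ W ^ (3 * k) * k * n ^ 3 * Nat.log 2 n :=
      (Nat.le_mul_of_pos_left _ (Nat.mul_pos hWk hk)).trans (Nat.le_mul_of_pos_right _ hlog)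
    omega
  · have h1 : W ≤ W ^ (3 * k) * k := by
      calc W = W ^ 1 * 1 := by ring
        _ ≤ _ := Nat.mul_le_mul (Nat.pow_le_pow_right hW (by omega)) hk
    have h2 : n ^ 3 ≤ W ^ (3 * k) * k * n ^ 2 := by
      rw [pow_succ' n 2]
      exact Nat.mul_le_mul_right _ (h.trans h1)
    omega
  · have h1 : W ^ (3 * k) * k * n ^ 2 ≤ k * n ^ (3 * k * d * w + 2) := by
      calc W ^ (3 * k) * k * n ^ 2 ≤ (n ^ (d * w)) ^ (3 * k) * k * n ^ 2 := by gcongr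
        _ = _ := by rw [← pow_mul, pow_add]; ring_nf
    have h2 : n ^ 3 ≤ k * n ^ (3 * k * d * w + 2) := by
      refine (Nat.pow_le_pow_right (by omega) ?_).trans (Nat.le_mul_of_pos_left _ hk)
      have : 1 * 1 ≤ 3 * k * (d * w) := Nat.mul_le_mul (by omega) h
      rw [← mul_assoc] at this
      omega
    omega

/-- A quadratic running time is within all three bounds. -/
lemma sq_time_bounds {n W k : ℕ} (e : ℕ) (hn : 2 ≤ n) (hW : 1 ≤ W) (hk : 1 ≤ k) :
    n ^ 2 ≤ W ^ (3 * k) * k * n ^ 3 * Nat.log 2 n ∧ n ^ 2 ≤ W ^ (3 * k) * k * n ^ 2 ∧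
      n ^ 2 ≤ k * n ^ (e + 2) := by
  have hlog : 1 ≤ Nat.log 2 n := Nat.log_pos (by omega) hn
  have hWk : 1 ≤ W ^ (3 * k) := Nat.one_le_pow _ _ hW
  have h23 : n ^ 2 ≤ n ^ 3 := Nat.pow_le_pow_right (by omega) (by omega)
  refine ⟨(h23.trans (Nat.le_mul_of_pos_left _ (Nat.mul_pos hWk hk))).trans (Nat.le_mul_of_pos_right _ hlog),
    Nat.le_mul_of_pos_left _ (Nat.mul_pos hWk hk),
    (Nat.pow_le_pow_right (by omega) (by omega)).trans (Nat.le_mul_of_pos_left _ hk)⟩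

/-- If all four sets are trivial, then the empty or the full set is optimum, or there is no solution. -/
lemma exists_trivial_answer (goal : Goal) {σp σm ρp ρm : Set ℕ} (h₁ : σp = ∅ ∨ σp = Set.univ)
    (h₂ : σm = ∅ ∨ σm = Set.univ) (h₃ : ρp = ∅ ∨ ρp = Set.univ) (h₄ : ρm = ∅ ∨ ρm = Set.univ) :
    ∃ flag val : ℕ, ∀ {n : ℕ} (G : Digraph (Fin n)) (s : RamState), 1 ≤ n → s.mem 0 = flag →
      (∀ v < n, s.mem (v + 1) = val) → CorrectSubsetOutput goal G σp σm ρp ρm s := by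
  have htriv : ∀ {μ : Set ℕ}, (μ = ∅ ∨ μ = Set.univ) → ∀ x y, x ∈ μ → y ∈ μ := by
    rintro μ (rfl | rfl) x y hx
    · exact absurd hx (Set.notMem_empty _)
    · trivial
  have hdom : ∀ {n : ℕ} (G : Digraph (Fin n)) (S : Set (Fin n)), Dominates G σp σm ρp ρm S ↔
      (S.Nonempty → 0 ∈ σp ∧ 0 ∈ σm) ∧ (Sᶜ.Nonempty → 0 ∈ ρp ∧ 0 ∈ ρm) := by
    intro n G S
    constructor
    · rintro ⟨a, b⟩
      exact ⟨fun ⟨v, hv⟩ => ⟨htriv h₁ _ _ (a v hv).1, htriv h₂ _ _ (a v hv).2⟩,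
        fun ⟨v, hv⟩ => ⟨htriv h₃ _ _ (b v hv).1, htriv h₄ _ _ (b v hv).2⟩⟩
    · rintro ⟨a, b⟩
      exact ⟨fun v hv => ⟨htriv h₁ _ _ (a ⟨v, hv⟩).1, htriv h₂ _ _ (a ⟨v, hv⟩).2⟩,
        fun v hv => ⟨htriv h₃ _ _ (b ⟨v, hv⟩).1, htriv h₄ _ _ (b ⟨v, hv⟩).2⟩⟩
  have hempty : ∀ {n : ℕ} (G : Digraph (Fin n)) (s : RamState), s.mem 0 = 1 →
      (∀ v < n, s.mem (v + 1) = 0) → IsOptimum goal G σp σm ρp ρm ∅ →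
      CorrectSubsetOutput goal G σp σm ρp ρm s := fun G s h0 h1 h => .inl ⟨∅, h, h0, fun v => by
    rw [h1 v v.2, if_neg (Set.notMem_empty _)]⟩
  have hfull : ∀ {n : ℕ} (G : Digraph (Fin n)) (s : RamState), s.mem 0 = 1 →
      (∀ v < n, s.mem (v + 1) = 1) → IsOptimum goal G σp σm ρp ρm Set.univ →
      CorrectSubsetOutput goal G σp σm ρp ρm s := fun G s h0 h1 h => .inl ⟨Set.univ, h, h0, fun v => by
    rw [h1 v v.2, if_pos (Set.mem_univ _)]⟩
  have hcard : ∀ {n : ℕ} (S : Set (Fin n)), S.ncard ≤ (Set.univ : Set (Fin n)).ncard :=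
    fun S => Set.ncard_le_ncard (Set.subset_univ S)
  have onlyEmpty : ¬ (0 ∈ σp ∧ 0 ∈ σm) → ∀ {n : ℕ} (G : Digraph (Fin n)) (S : Set (Fin n)),
      Dominates G σp σm ρp ρm S → S = ∅ := fun h _ G S hS =>
    Set.not_nonempty_iff_eq_empty.1 fun hne => h (((hdom G S).1 hS).1 hne)
  have onlyFull : ¬ (0 ∈ ρp ∧ 0 ∈ ρm) → ∀ {n : ℕ} (G : Digraph (Fin n)) (S : Set (Fin n)),
      Dominates G σp σm ρp ρm S → S = Set.univ := fun h _ G S hS =>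
    Set.compl_empty_iff.1 (Set.not_nonempty_iff_eq_empty.1 fun hne => h (((hdom G S).1 hS).2 hne))
  have self : ∀ a, goal.AtLeastAsGood a a := fun a => by cases goal <;> exact le_rfl
  by_cases hσ : 0 ∈ σp ∧ 0 ∈ σm <;> by_cases hρ : 0 ∈ ρp ∧ 0 ∈ ρm
  · cases goal
    · exact ⟨1, 0, fun G s _ h0 h1 => hempty G s h0 h1 ⟨(hdom G _).2 ⟨fun _ => hσ, fun _ => hρ⟩,
        fun S _ => by simp [Goal.AtLeastAsGood]⟩⟩
    · exact ⟨1, 1, fun G s _ h0 h1 => hfull G s h0 h1 ⟨(hdom G _).2 ⟨fun _ => hσ, fun _ => hρ⟩,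
        fun S _ => hcard S⟩⟩
  · exact ⟨1, 1, fun G s _ h0 h1 => hfull G s h0 h1 ⟨(hdom G _).2 ⟨fun _ => hσ, fun h => by simp at h⟩,
      fun S hS => by rw [onlyFull hρ G S hS]; exact self _⟩⟩
  · exact ⟨1, 0, fun G s _ h0 h1 => hempty G s h0 h1 ⟨(hdom G _).2 ⟨fun h => by simp at h, fun _ => hρ⟩,
      fun S hS => by rw [onlyEmpty hσ G S hS]; exact self _⟩⟩
  · refine ⟨0, 0, fun G s hn h0 _ => .inr ⟨?_, h0⟩⟩
    rintro ⟨S, hS⟩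
    have : (⟨0, hn⟩ : Fin _) ∈ (∅ : Set _) := by
      rw [← onlyEmpty hσ G S hS, onlyFull hρ G S hS]; trivial
    exact this

/-- If all the sets are trivial, then a single colour can be used for all vertices. -/
lemma exists_partition_iff_of_trivial {q : ℕ} {D : Matrix (Fin q) (Fin q) (Set ℕ × Set ℕ)}
    (h₁ : ∀ i j, (D i j).1 = ∅ ∨ (D i j).1 = Set.univ) (h₂ : ∀ i j, (D i j).2 = ∅ ∨ (D i j).2 = Set.univ)
    {n : ℕ} (hn : 1 ≤ n) (G : Digraph (Fin n)) :
    (∃ X, IsDPartition G D X) ↔ ∃ i, ∀ j, (D i j).1 = Set.univ ∧ (D i j).2 = Set.univ := by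
  constructor
  · rintro ⟨X, hX, h⟩
    obtain ⟨i, hi, -⟩ := hX ⟨0, hn⟩
    refine ⟨i, fun j => ?_⟩
    obtain ⟨a, b⟩ := h i j _ hi
    exact ⟨(h₁ i j).resolve_left fun h => by simp [h] at a, (h₂ i j).resolve_left fun h => by simp [h] at b⟩
  · rintro ⟨i, hi⟩
    refine ⟨fun i' => {_v | i' = i}, fun v => ⟨i, rfl, fun _ h => h⟩, ?_⟩
    rintro i' j v rfl
    rw [(hi j).1, (hi j).2]
    exact ⟨trivial, trivial⟩

lemma dValue_le_matrixDValue {q : ℕ} (D : Matrix (Fin q) (Fin q) (Set ℕ × Set ℕ)) (i j : Fin q) :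
    dValue (D i j).1 ≤ matrixDValue D ∧ dValue (D i j).2 ≤ matrixDValue D := by
  have h : max (dValue (D i j).1) (dValue (D i j).2) ≤ matrixDValue D :=
    (Finset.le_sup (f := fun j => max (dValue (D i j).1) (dValue (D i j).2)) (Finset.mem_univ j)).trans
      (Finset.le_sup (f := fun i => Finset.univ.sup fun j => max (dValue (D i j).1) (dValue (D i j).2))
        (Finset.mem_univ i))
  exact ⟨(le_max_left _ _).trans h, (le_max_right _ _).trans h⟩

/-- A program that writes a fixed answer. -/
lemma exists_const_program (flag val : ℕ) : ∃ P : Prog, ∀ (n m : ℕ) (G : Digraph (Fin n))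
    (B : BranchDecomposition (Fin n) (Fin m)), ∃ t s, Exec P (initState G B) t s ∧ s.mem 0 = flag ∧
      (∀ v < n, s.mem (v + 1) = val) ∧ t ≤ 500 * n ^ 2 := by
  obtain ⟨P, hP⟩ := Implements.reportConst flag val
  refine ⟨.seq prologue P, fun n m G B => ?_⟩
  obtain ⟨hm, hn⟩ := B.card_nodes
  have hS := inputStore_spec G B
  have hbase := hS.base
  have hnn : n ≤ n * n := Nat.le_mul_of_pos_left _ (by omega)
  obtain ⟨t, st, a, s, c, h1, ⟨h2, h3, h4, h5⟩, h6, h7⟩ := exists_exec G B hP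
    (Spec.reportConst flag val hS.n_eq (by omega))
  refine ⟨t, st, h1, (h6.io 0 (by omega)).trans h3, fun v hv => (h6.io _ (by omega)).trans (h4 v hv), ?_⟩
  rw [pow_two]
  nlinarith

/-- Optimum `(σ⁺, σ⁻, ρ⁺, ρ⁻)`-sets, with two colours of which one is counted. -/
lemma subset_optimization (goal : Goal) {σp σm ρp ρm : Set ℕ} (hσp : FinOrCofin σp)
    (hσm : FinOrCofin σm) (hρp : FinOrCofin ρp) (hρm : FinOrCofin ρm) {d : ℕ}
    (hd : d = dValue₄ σp σm ρp ρm) : ∃ (P : Prog) (C : ℕ), ∀ (n m : ℕ) (G : Digraph (Fin n))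
        (B : BranchDecomposition (Fin n) (Fin m)),
        ∃ (t : ℕ) (s : RamState), Exec P (initState G B) t s ∧
          CorrectSubsetOutput goal G σp σm ρp ρm s ∧
          t ≤ C * (B.nec G d ^ 3 * n ^ 3 * Nat.log 2 n) ∧
          (n ≤ B.nec G d → t ≤ C * (B.nec G d ^ 3 * n ^ 2)) ∧
          (1 ≤ B.bimimWidth G → t ≤ C * n ^ (3 * d * B.bimimWidth G + 2)) := by
  have d1 : dValue σp ≤ d := hd ▸ (le_max_left _ _).trans (le_max_left _ _)
  have d2 : dValue σm ≤ d := hd ▸ (le_max_right _ _).trans (le_max_left _ _)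
  have d3 : dValue ρp ≤ d := hd ▸ (le_max_left _ _).trans (le_max_right _ _)
  have d4 : dValue ρm ≤ d := hd ▸ (le_max_right _ _).trans (le_max_right _ _)
  clear hd
  obtain rfl | hd := Nat.eq_zero_or_pos d
  · obtain ⟨flag, val, h⟩ := exists_trivial_answer goal (eq_of_dValue_eq_zero (Nat.le_zero.1 d1))
      (eq_of_dValue_eq_zero (Nat.le_zero.1 d2)) (eq_of_dValue_eq_zero (Nat.le_zero.1 d3))
      (eq_of_dValue_eq_zero (Nat.le_zero.1 d4))
    obtain ⟨P, hP⟩ := exists_const_program flag val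
    refine ⟨P, 500, fun n m G B => ?_⟩
    obtain ⟨t, s, h1, h2, h3, h4⟩ := hP n m G B
    have hn := B.card_nodes.2
    obtain ⟨b1, b2, b3⟩ := sq_time_bounds (3 * 0 * B.bimimWidth G) hn (B.nec_pos G 0) le_rfl
    simp only [mul_one, one_mul] at b1 b2 b3
    exact ⟨t, s, h1, h G s (by omega) h2 h3, h4.trans (Nat.mul_le_mul_left _ b1),
      fun _ => h4.trans (Nat.mul_le_mul_left _ b2), fun _ => h4.trans (Nat.mul_le_mul_left _ b3)⟩
  · obtain ⟨P, hP⟩ := Implements.optimize 1 2 d (constraintTable d (setConstraint σp σm ρp ρm))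
      goal.colourWeight
    refine ⟨.seq prologue P, 2 * (40 * (22 * d + 4200) + 20), fun n m G B => ?_⟩
    obtain ⟨hm, hn⟩ := B.card_nodes
    have hS := inputStore_spec G B
    have hbase := hS.base
    have hnn : n ≤ n * n := Nat.le_mul_of_pos_left _ (by omega)
    have hW := B.nec_pos G d
    have hW' : 1 ≤ B.nec G d ^ 1 := by rwa [pow_one]
    obtain ⟨t, st, a, s, c, h1, ⟨h2, h3, h4⟩, h5, h6⟩ := exists_exec G B hP
      (Spec.optimize hd (setConstraint σp σm ρp ρm) goal.colourWeight hS (by omega) le_rfl hW' (by omega)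
        (by have := Nat.one_le_pow 2 _ hW'; omega) fun x y h => sigBound G B hd _ _ h)
    have hgood := good_setConstraint G hd (mem_iff_min_mem hσp d1) (mem_iff_min_mem hσm d2)
      (mem_iff_min_mem hρp d3) (mem_iff_min_mem hρm d4) goal.colourWeight
    have hex : ∀ S, Dominates G σp σm ρp ρm S → ∃ col : ℕ → ℕ, (∀ v, col v < 2) ∧ {v : Fin n | col v = 0} = S :=
      fun S _ => ⟨indicatorColouring S, indicatorColouring_lt S, indicatorColouring_eq_zero S⟩
    refine ⟨t, st, h1, ?_, ?_⟩
    · obtain ⟨e1, e2⟩ | ⟨e1, col, e2, e3, e4, e5⟩ := h2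
      · refine .inr ⟨?_, (h5.io 0 (by omega)).trans e1⟩
        rintro ⟨S, hS⟩
        obtain ⟨col, hc, rfl⟩ := hex S hS
        exact e2 ⟨col, hc, (hgood col).2 hS⟩
      · refine .inl ⟨{v | col v = 0}, ⟨(hgood col).1 e3, fun S hS => ?_⟩, (h5.io 0 (by omega)).trans e1,
          fun v => ?_⟩
        · obtain ⟨col', hc, rfl⟩ := hex S hS
          exact atLeastAsGood_of_weight_le goal hd _ _ col col' (e5 col' hc ((hgood col').2 hS))
        · have hv := v.2
          rw [h5.io _ (by omega)]
          refine (e4 v v.2).trans ?_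
          have : col v < 2 := e2 v
          split_ifs with h
          · rw [show col v = 0 from h]
          · have : col v ≠ 0 := h
            omega
    · have hX : t ≤ (40 * (22 * d + 4200) + 20) * ((B.nec G d ^ 1) ^ 3 * 1 * n ^ 2 + n ^ 3) := by
        have g1 : n * n ≤ (B.nec G d ^ 1) ^ 3 * 1 * n ^ 2 := by
          rw [← pow_two]; exact Nat.le_mul_of_pos_left _ (by positivity)
        linarith [Nat.zero_le (n ^ 3)]
      obtain ⟨b1, b2, b3⟩ := time_bounds (k := 1) hn hW le_rfl (B.nec_le_pow G d)
      simp only [mul_one, one_mul] at b1 b2 b3 hX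
      have hfin : ∀ Y, (B.nec G d ^ 1) ^ 3 * n ^ 2 + n ^ 3 ≤ 2 * Y →
          t ≤ 2 * (40 * (22 * d + 4200) + 20) * Y := fun Y hY =>
        hX.trans ((Nat.mul_le_mul_left _ hY).trans_eq (by ring))
      exact ⟨hfin _ b1, fun h => hfin _ (b2 h), fun h => hfin _ (b3 (Nat.mul_pos hd h))⟩

/-- Existence of `D`-partitions, with `q` colours that are all counted. The program depends on `D`, but the
constant depends on `d` only: loading the table of constraints takes `O(q ^ 2 * d)` steps, and `q < 2 ^ q`
is at most the bound on the number of signatures unless there is only one class. -/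
lemma partition_existence (d : ℕ) : ∃ C : ℕ, ∀ (q : ℕ) (D : Matrix (Fin q) (Fin q) (Set ℕ × Set ℕ)),
      1 ≤ q → IsConstraintMatrix D → matrixDValue D = d →
      ∃ P : Prog, ∀ (n m : ℕ) (G : Digraph (Fin n))
        (B : BranchDecomposition (Fin n) (Fin m)),
        ∃ (t : ℕ) (s : RamState), Exec P (initState G B) t s ∧
          CorrectPartitionOutput G D s ∧
          t ≤ C * (B.nec G d ^ (3 * q) * q * n ^ 3 * Nat.log 2 n) ∧
          (n ≤ B.nec G d → t ≤ C * (B.nec G d ^ (3 * q) * q * n ^ 2)) ∧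
          t ≤ C * (q * n ^ (3 * q * d * B.bimimWidth G + 2)) := by
  classical
  obtain rfl | hd := Nat.eq_zero_or_pos d
  · refine ⟨500, fun q D hq hD hdD => ?_⟩
    have t1 := fun i j => eq_of_dValue_eq_zero (Nat.le_zero.1 (hdD ▸ (dValue_le_matrixDValue D i j).1))
    have t2 := fun i j => eq_of_dValue_eq_zero (Nat.le_zero.1 (hdD ▸ (dValue_le_matrixDValue D i j).2))
    obtain ⟨P, hP⟩ := exists_const_program
      (if ∃ i, ∀ j, (D i j).1 = Set.univ ∧ (D i j).2 = Set.univ then 1 else 0) 0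
    refine ⟨P, fun n m G B => ?_⟩
    obtain ⟨t, s, h1, h2, -, h4⟩ := hP n m G B
    have hn := B.card_nodes.2
    obtain ⟨b1, b2, b3⟩ := sq_time_bounds (3 * q * 0 * B.bimimWidth G) hn (B.nec_pos G 0) hq
    refine ⟨t, s, h1, ?_, h4.trans (Nat.mul_le_mul_left _ b1),
      fun _ => h4.trans (Nat.mul_le_mul_left _ b2), h4.trans (Nat.mul_le_mul_left _ b3)⟩
    have hiff := exists_partition_iff_of_trivial t1 t2 (by omega : 1 ≤ n) G
    by_cases h : ∃ X, IsDPartition G D X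
    · exact .inl ⟨h, by rw [h2, if_pos (hiff.1 h)]⟩
    · exact .inr ⟨h, by rw [h2, if_neg (mt hiff.2 h)]⟩
  · refine ⟨2 * (40 * (22 * d + 4300) + 20), fun q D hq hD hdD => ?_⟩
    have t1 := fun i j => mem_iff_min_mem (hD i j).1 (hdD ▸ (dValue_le_matrixDValue D i j).1)
    have t2 := fun i j => mem_iff_min_mem (hD i j).2 (hdD ▸ (dValue_le_matrixDValue D i j).2)
    obtain ⟨P, hP⟩ := Implements.decideExists q q d (constraintTable d (partitionConstraint D))
      (if ∃ i, ∀ j, 0 ∈ (D i j).1 ∧ 0 ∈ (D i j).2 then 1 else 0)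
      (if ∃ i, ∀ j, (if i = j then 1 else 0) ∈ (D i j).1 ∧ (if i = j then 1 else 0) ∈ (D i j).2 then 1 else 0)
    refine ⟨.seq prologue P, fun n m G B => ?_⟩
    obtain ⟨hm, hn⟩ := B.card_nodes
    have hS := inputStore_spec G B
    have hbase := hS.base
    have hnn : n ≤ n * n := Nat.le_mul_of_pos_left _ (by omega)
    have hW := B.nec_pos G d
    have hW' : 1 ≤ B.nec G d ^ q := Nat.one_le_pow _ _ hW
    have hedge : (∃ u < n, ∃ v < n, u ≠ v ∧ natAdj G u v) ↔ ∃ u v, u ≠ v ∧ G.Adj u v := by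
      constructor
      · rintro ⟨u, _, v, _, hne, hu, hv, h⟩
        exact ⟨⟨u, hu⟩, ⟨v, hv⟩, by simpa using hne, h⟩
      · rintro ⟨u, v, hne, h⟩
        exact ⟨u, u.2, v, v.2, fun hh => hne (Fin.ext hh), u.2, v.2, h⟩
    obtain ⟨t, st, a, s, c, h1, ⟨h2, h3, h4, h4'⟩, h5, h6⟩ := exists_exec G B hP
      (Spec.decideExists (W := B.nec G d ^ q) hd (partitionConstraint D) _ _ hS (by omega) hq hW' (by omega)
        -- `q < 2 ^ q ≤ nec ^ q`
        (fun he => by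
          obtain ⟨u, v, hne, huv⟩ := hedge.1 he
          have g1 : q < 2 ^ q := Nat.lt_two_pow_self
          have g2 : 2 ^ q ≤ B.nec G d ^ q := Nat.pow_le_pow_left (B.two_le_nec G d hd hne huv) q
          have g3 : B.nec G d ^ q ≤ (B.nec G d ^ q) ^ 2 := Nat.le_self_pow (by omega) _
          omega)
        fun x y h => sigBound G B hd _ _ h)
    rw [hedge] at h2 h3
    have hio : st.mem 0 = s.io 0 := h5.io 0 (by omega)
    by_cases he : ∃ u v, u ≠ v ∧ G.Adj u v
    · refine ⟨t, st, h1, ?_, ?_⟩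
      · have hgood := exists_good_partitionConstraint G hd hq t1 t2 (D := D) fun _ => 0
        obtain ⟨e1, e2⟩ | ⟨e1, col, e2, e3, -⟩ := h3 he
        · exact .inr ⟨fun h => e2 (hgood.2 h), hio.trans e1⟩
        · exact .inl ⟨hgood.1 ⟨col, e2, e3⟩, hio.trans e1⟩
      · have hX : t ≤ (40 * (22 * d + 4300) + 20) * ((B.nec G d ^ q) ^ 3 * q * n ^ 2 + n ^ 3) := by
          have g1 : n * n ≤ (B.nec G d ^ q) ^ 3 * q * n ^ 2 := by
            rw [← pow_two]; exact Nat.le_mul_of_pos_left _ (by positivity)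
          linarith [Nat.zero_le (n ^ 3)]
        obtain ⟨b1, b2, b3⟩ := time_bounds hn hW hq (B.nec_le_pow G d)
        have hfin : ∀ Y, (B.nec G d ^ q) ^ 3 * q * n ^ 2 + n ^ 3 ≤ 2 * Y →
            t ≤ 2 * (40 * (22 * d + 4300) + 20) * Y := fun Y hY =>
          hX.trans ((Nat.mul_le_mul_left _ hY).trans_eq (by ring))
        refine ⟨hfin _ b1, fun h => hfin _ (b2 h), hfin _ (b3 (Nat.pos_of_ne_zero fun h0 => ?_))⟩
        -- `d * w = 0` would imply `nec ≤ 1`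
        obtain ⟨u, v, hne, huv⟩ := he
        have g1 := B.two_le_nec G d hd hne huv
        have g2 := B.nec_le_pow G d
        rw [h0, pow_zero] at g2
        omega
    · obtain ⟨e1, e2, e3⟩ := h2 he
      have hX : t ≤ 2 * (40 * (22 * d + 4300) + 20) * n ^ 2 := by
        rw [pow_two] at e3 ⊢
        nlinarith
      obtain ⟨b1, b2, b3⟩ := sq_time_bounds (3 * q * d * B.bimimWidth G) hn hW hq
      refine ⟨t, st, h1, ?_, hX.trans (Nat.mul_le_mul_left _ b1),
        fun _ => hX.trans (Nat.mul_le_mul_left _ b2), hX.trans (Nat.mul_le_mul_left _ b3)⟩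
      have hloops : ∀ u v, G.Adj u v → u = v := fun u v h => by
        by_contra hne; exact he ⟨u, v, hne, h⟩
      have hiff : (∃ X, IsDPartition G D X) ↔ s.io 0 ≠ 0 := by
        rw [exists_partition_iff_of_loops G D hloops, e2]
        have hadj : ∀ u : Fin n, natAdj G u u ↔ G.Adj u u := fun u => by simp [natAdj]
        constructor
        · intro h u hu
          have hu' := hadj ⟨u, hu⟩
          dsimp only at hu'
          rw [hu']
          have := h ⟨u, hu⟩
          constructor
          · intro hl
            simp only [hl, true_and] at this
            simp [this]
          · intro hl
            simp only [hl, false_and, if_false] at this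
            simp [this]
        · intro h u
          have := h u u.2
          rw [hadj] at this
          by_cases hl : G.Adj u u
          · simp only [hl, true_and]
            by_contra hcon
            exact this.1 hl (if_neg hcon)
          · simp only [hl, false_and, if_false]
            by_contra hcon
            exact this.2 hl (if_neg hcon)
      by_cases h : ∃ X, IsDPartition G D X
      · exact .inl ⟨h, by have := hiff.1 h; omega⟩
      · exact .inr ⟨h, by by_contra h0; exact h (hiff.2 (hio ▸ h0))⟩

theorem theorem1 :
    (∀ (goal : Goal) (σp σm ρp ρm : Set ℕ),
      FinOrCofin σp → FinOrCofin σm → FinOrCofin ρp → FinOrCofin ρm →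
      ∀ d : ℕ, d = dValue₄ σp σm ρp ρm →
      ∃ (P : Prog) (C : ℕ), ∀ (n m : ℕ) (G : Digraph (Fin n))
        (B : BranchDecomposition (Fin n) (Fin m)),
        ∃ (t : ℕ) (s : RamState), Exec P (initState G B) t s ∧
          CorrectSubsetOutput goal G σp σm ρp ρm s ∧
          t ≤ C * (B.nec G d ^ 3 * n ^ 3 * Nat.log 2 n) ∧
          (n ≤ B.nec G d → t ≤ C * (B.nec G d ^ 3 * n ^ 2)) ∧
          (1 ≤ B.bimimWidth G → t ≤ C * n ^ (3 * d * B.bimimWidth G + 2))) ∧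
    (∀ d : ℕ, ∃ C : ℕ, ∀ (q : ℕ) (D : Matrix (Fin q) (Fin q) (Set ℕ × Set ℕ)),
      1 ≤ q → IsConstraintMatrix D → matrixDValue D = d →
      ∃ P : Prog, ∀ (n m : ℕ) (G : Digraph (Fin n))
        (B : BranchDecomposition (Fin n) (Fin m)),
        ∃ (t : ℕ) (s : RamState), Exec P (initState G B) t s ∧
          CorrectPartitionOutput G D s ∧
          t ≤ C * (B.nec G d ^ (3 * q) * q * n ^ 3 * Nat.log 2 n) ∧
          (n ≤ B.nec G d → t ≤ C * (B.nec G d ^ (3 * q) * q * n ^ 2)) ∧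
          t ≤ C * (q * n ^ (3 * q * d * B.bimimWidth G + 2))) := by
  exact ⟨fun goal _ _ _ _ h₁ h₂ h₃ h₄ _ hd => subset_optimization goal h₁ h₂ h₃ h₄ hd, partition_existence⟩
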